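/- Let $M$ be a manifold with a finite triangulation $\mathcal T$ having a single vertex $v$ (simplices may be glued to themselves along faces), which is essential, i.e. no edge loop is null-homotopic relative to its endpoints. Let $p:\tilde M\to M$ be the universal cover, $v_0$ a lift of $v$, and let $G=\pi_1(M)$, acting on $\tilde M$ as the deck group, carry a left-invariant total order. Let $i:G\to\mathbb R$ be a strictly order-preserving map with $i(1)=0$ that induces an action $\rho_i$ of $G$ on $\mathbb R$ by orientation-preserving homeomorphisms, with $\rho_i(g)(i(h))=i(gh)$ and with each $\rho_i(g)$ affine on every interval in the complement of $i(G)$. A defining function for $i$ is a continuous $F:\tilde M\to\mathbb R$ such that (a) $F(v_0)=0$ and $F(gx)=\rho_i(g)(F(x))$ for all $g\in G$, $x\in\tilde M$; (b) $F$ is linear on each edge of the lifted triangulation whose endpoint with the larger value of $F$ is $v_0$; (c) in each lifted simplex of dimension at most $2$ the level sets of $F$ are convex (points or segments, or empty), and in each lifted simplex of any dimension some homeomorphism of the simplex preserving every face carries the level sets of $F$ to the intersections of the simplex with a family of parallel hyperplanes. The singular foliation $\mathcal F(\mathcal T,i)$ of $M$ defined by $F$ has as leaves the images in $M$ of the connected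 components of the level sets of $F$. A foliation $\mathcal F$ arises from $\mathcal G$ by inserting strips if there are pairwise disjoint open subsets of $M\setminus\{v\}$, each homeomorphic to some $L\times(0,1)$ with every $L\times\{s\}$ a leaf of $\mathcal F$, and a continuous surjection $c:M\to M$, homotopic to the identity relative to $v$, such that (1) the equivalence relation $c(x)=c(y)$ is generated by the relation "$x$ and $y$ lie in the closure of one transverse arc $\{q\}\times(0,1)$ of a strip"; and (2) $c(x)$ and $c(y)$ lie on the same leaf of $\mathcal G$ if and only if $x$ and $y$ are equivalent under the equivalence relation generated by lying on the same leaf of $\mathcal F$ and lying in the closure of one transverse arc. Claim. Let $i,i'$ be two such maps (for the same order). Then defining functions exist for $i$ and for $i'$, and for any choice of them the foliations $\mathcal F(\mathcal T,i)$ and $\mathcal F(\mathcal T,i')$ differ by removing and inserting strips $L\times(0,1)$ of parallel leaves: there is a third such map $i_0$ and a defining function for it such that both $\mathcal F(\mathcal T,i)$ and $\mathcal F(\mathcal T,i')$ arise from $\mathcal F(\mathcal T,i_0)$ by inserting strips. -/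

import Mathlib

open Set

universe u w

/-- The standard `n`-simplex, in barycentric coordinates. -/
abbrev Simplex (n : ℕ) : Type := stdSimplex ℝ (Fin (n + 1))

/-- A (finite) triangulation of `M` with a single vertex, given by its characteristic maps.
Simplices may be glued to themselves or to each other along affine identifications of faces. -/
structure OneVertexTriangulation (M : Type u) [TopologicalSpace M] where
  /-- the simplices, of all dimensions -/
  Cell : Type
  finite_cell : Finite Cell
  dim : Cell → ℕ
  /-- the characteristic map of a simplex -/
  char : ∀ c : Cell, C(Simplex (dim c), M)
  /-- `M` is the disjoint union of the open simplices, each of which is embedded. -/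
  existsUnique_open : ∀ m : M, ∃! q : (Σ c : Cell, Simplex (dim c)),
    (∀ j, 0 < q.2 j) ∧ char q.1 q.2 = m
  /-- Every face of a simplex is again one of the simplices, up to relabelling its vertices. -/
  face : ∀ (c : Cell) (s : Finset (Fin (dim c + 1))), s.Nonempty →
    ∃ (c' : Cell) (e : Fin (dim c' + 1) ≃ s), ∀ x : Simplex (dim c'),
      char c' x = char c (stdSimplex.map (fun j => (e j : Fin (dim c + 1))) x)
  existsUnique_vertex : ∃! c : Cell, dim c = 0

namespace OneVertexTriangulation

variable {M : Type u} [TopologicalSpace M]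

/-- `m` is the vertex of the triangulation. -/
def IsVertex (T : OneVertexTriangulation M) (m : M) : Prop :=
  ∃ c : T.Cell, T.dim c = 0 ∧ m ∈ range (T.char c)

/-- The triangulation is essential: no edge loop is null-homotopic relative to its endpoints. -/
def IsEssential (T : OneVertexTriangulation M) : Prop :=
  ∀ c : T.Cell, T.dim c = 1 → ∀ m : M,
    ¬ (T.char c).HomotopicRel (ContinuousMap.const _ m) (range fun j => stdSimplex.vertex j)

end OneVertexTriangulation

/-- The deck group of `p`. For the universal cover `p` of `M` this is `π₁(M)`. -/
def Deck {X : Type w} {M : Type u} [TopologicalSpace X] (p : X → M) : Subgroup (X ≃ₜ X) where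
  carrier := {g | ∀ x, p (g x) = p x}
  mul_mem' := by
    intro a b ha hb x
    rw [Homeomorph.mul_apply, ha, hb]
  one_mem' := fun x => rfl
  inv_mem' := by
    intro a ha x
    have h := ha (a⁻¹ x)
    rw [← h, Homeomorph.inv_apply, Homeomorph.apply_symm_apply]

/-- `ρ` is the action `ρ_i` of `G` on `ℝ` by orientation-preserving homeomorphisms that is induced
by `i : G → ℝ`: it is `g (i h) = i (g h)` on `i(G)`, and it is affine on every complementary
interval of `i(G)`. (Order automorphisms of `ℝ` are the same as orientation-preserving
homeomorphisms.) -/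
structure IsInducedAction {G : Type w} [Group G] (i : G → ℝ) (ρ : G →* (ℝ ≃o ℝ)) : Prop where
  map_orbit : ∀ g h : G, ρ g (i h) = i (g * h)
  affine_compl : ∀ (g : G) (J : Set ℝ), J.OrdConnected → Disjoint J (range i) →
    ∃ m b : ℝ, ∀ t ∈ J, ρ g t = m * t + b

/-- `F : X → ℝ` is a defining function, on the universal cover `p : X → M`, of the singular
foliation determined by the triangulation `T`, the base vertex `v₀` and the action `ρ`. -/
structure IsDefiningFunction {X : Type w} {M : Type u} [TopologicalSpace X] [TopologicalSpace M]
    (T : OneVertexTriangulation M) (p : X → M) (v₀ : X) (ρ : Deck p →* (ℝ ≃o ℝ))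
    (F : X → ℝ) : Prop where
  continuous : Continuous F
  map_base : F v₀ = 0
  /-- In particular `F (g v₀) = ρ g 0`, and `F` on an edge with upper endpoint `g v₀` is
  `x ↦ ρ g (F (g⁻¹ x))`. -/
  map_deck : ∀ (g : Deck p) (x : X), F ((g : X ≃ₜ X) x) = ρ g (F x)
  /-- `F` is linear on every lifted edge whose upper endpoint is `v₀`. -/
  linear_edge : ∀ c : T.Cell, T.dim c = 1 → ∀ τ : C(Simplex (T.dim c), X),
    (∀ x, p (τ x) = T.char c x) →
    ∀ j, τ (stdSimplex.vertex j) = v₀ →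
    (∀ k, k ≠ j → F (τ (stdSimplex.vertex k)) < F v₀) →
    ∀ x, F (τ x) = ∑ k, x k * F (τ (stdSimplex.vertex k))
  /-- In every lifted triangle the level sets are straight: points, segments, or empty. -/
  convex_level : ∀ c : T.Cell, T.dim c ≤ 2 → ∀ τ : C(Simplex (T.dim c), X),
    (∀ x, p (τ x) = T.char c x) →
    ∀ t : ℝ, Convex ℝ ((Subtype.val : Simplex (T.dim c) → Fin (T.dim c + 1) → ℝ) ''
      {x | F (τ x) = t})
  /-- In every lifted simplex the level sets are the linear polytopes cut out by a family of
  parallel hyperplanes, up to a homeomorphism of the simplex that preserves each face. -/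
  polytope_level : ∀ (c : T.Cell) (τ : C(Simplex (T.dim c), X)),
    (∀ x, p (τ x) = T.char c x) →
    ∃ (h : Simplex (T.dim c) ≃ₜ Simplex (T.dim c)) (a : Fin (T.dim c + 1) → ℝ),
      (∀ x j, h x j = 0 ↔ x j = 0) ∧
      ∀ x y, F (τ (h x)) = F (τ (h y)) ↔ ∑ j, a j * x j = ∑ j, a j * y j

/-- The leaves, in `M`, of the singular foliation defined by `F : X → ℝ`: the images of the
connected components of the level sets of `F`. -/
def leaves {X : Type w} {M : Type u} [TopologicalSpace X] (p : X → M) (F : X → ℝ) :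
    Set (Set M) :=
  range fun x : X => p '' connectedComponentIn (F ⁻¹' {F x}) x

/-- A family of pairwise disjoint open strips `L × (0,1)` of parallel leaves in a foliation of
`M`, given by its set `𝓕` of leaves, away from the singular point `v`. -/
structure StripFamily {M : Type u} [TopologicalSpace M] (v : M) (𝓕 : Set (Set M)) where
  ι : Type u
  L : ι → Type u
  top : ∀ k, TopologicalSpace (L k)
  /-- the parametrization of a strip -/
  chart : ∀ k, L k × Ioo (0 : ℝ) 1 → M
  isOpenEmbedding : ∀ k, Topology.IsOpenEmbedding (chart k)
  disjoint : ∀ k l, k ≠ l → Disjoint (range (chart k)) (range (chart l))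
  leaf_mem : ∀ k (s : Ioo (0 : ℝ) 1), (range fun q : L k => chart k (q, s)) ∈ 𝓕
  notMem : ∀ k, v ∉ range (chart k)

/-- `x` and `y` lie on the closure of the same transverse arc `{q} × (0,1)` of a strip. -/
def StripFamily.SameArc {M : Type u} [TopologicalSpace M] {v : M} {𝓕 : Set (Set M)}
    (S : StripFamily v 𝓕) (x y : M) : Prop :=
  ∃ (k : S.ι) (q : S.L k),
    x ∈ closure (range fun s : Ioo (0 : ℝ) 1 => S.chart k (q, s)) ∧
    y ∈ closure (range fun s : Ioo (0 : ℝ) 1 => S.chart k (q, s))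

/-- `x` and `y` lie on the same leaf. -/
def SameLeaf {M : Type u} (𝓕 : Set (Set M)) (x y : M) : Prop :=
  ∃ l ∈ 𝓕, x ∈ l ∧ y ∈ l

/-- `𝓕` arises from `𝓖` by inserting strips of parallel leaves (equivalently, `𝓖` arises from `𝓕`
by removing strips): there are strips in `𝓕` and a map `c` from `M` onto `M`, homotopic to the
identity relative to the singular point `v`, such that `c` collapses the closed transverse arcs of
the strips to points and makes no other identifications, and `𝓖` is the foliation obtained from
`𝓕` by this collapse. -/
def IsStripInsertion {M : Type u} [TopologicalSpace M] (v : M) (𝓖 𝓕 : Set (Set M)) : Prop :=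
  ∃ (S : StripFamily v 𝓕) (c : C(M, M)),
    Function.Surjective c ∧
    c.HomotopicRel (ContinuousMap.id M) {v} ∧
    (∀ x y, c x = c y ↔ Relation.EqvGen S.SameArc x y) ∧
    (∀ x y, SameLeaf 𝓖 (c x) (c y) ↔
      Relation.EqvGen (fun a b => SameLeaf 𝓕 a b ∨ S.SameArc a b) x y)

/-! The choice of `i` only decides how the orbit is spread out on the line, and one choice `j`
leaves no superfluous room: its image is unbounded in both directions, and every open interval
either meets it or lies over a jump of the order, that is, between two consecutive elements. For a
countable order without end points such a `j` comes from Cantor's theorem after rational intervals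
have been glued into the jumps (`exists_isTightRealization`). Monotone maps that send `i g` to `j g`
and are affine over the jumps exist and are unique. This yields the action `tightAction` on the side
of `j`, and a continuous, monotone, equivariant map φ = `extend i j` from the open convex hull of
the orbit of `i` to the line. As `j` depends on the order alone, it serves for both given maps. The
intervals on which φ is constant become the strips.

To bring φ from the line to the universal cover, functions are needed that can be compared.
Essentiality gives the vertices of a lifted simplex distinct labels in the group
(`IsTriangulatedCover.key_injective`), so they are totally ordered, and a Möbius flow slides each
point of the simplex from the lowest to the highest vertex of its carrier. The flow depends only on
the order, and it is compatible with faces and deck transformations. An explicit equation defines a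
height on each simplex (`canonHeight`); these heights fit together to a defining function `canonF`
for any `i`, which proves existence, and they increase strictly along the flow lines
(`ascending_canonHeight`). So the canonical functions of `i` and of `j` increase along the same
curves, and a point `x` can be slid to the point of its curve whose height for `j` is φ of the
height of `x` for `i`. This map, `collapse`, is continuous and equivariant and preserves every
simplex, hence descends to a map of `M` that straight segments deform to the identity relative to
the vertex. Its fibres are made of transverse arcs over intervals on which φ is constant, and
pushing along flow lines gives the union of these arcs its product structure. This proves the claim
for canonical functions (`isStripInsertion_canonF`).

An arbitrary defining function differs from the canonical one for the same `i` by a homeomorphism of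
`M` fixing the vertex, with inverse homotopic to the identity (`exists_homeomorph_of_defining`).
Indeed both are, in each simplex and up to homeomorphisms preserving faces, the linear function with
the same vertex values, and the comparison is extended over the skeleta by an Alexander trick
carried out on all levels at once (`exists_level_extension`). Strips are transported by such
homeomorphisms. -/

/-! ### Sliding points of a simplex towards its lowest and highest vertices -/

/-- The Möbius flow on `[0, 1]`, with time rescaled to `[0, 1]`. -/
noncomputable def slideCoord (α T : ℝ) : ℝ :=
  if T = 0 then 0 else if T = 1 then 1 else (1 - α) * T / ((1 - α) * T + α * (1 - T))

section SlideCoord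

lemma slideCoord_zero (α : ℝ) : slideCoord α 0 = 0 := by simp [slideCoord]

lemma slideCoord_one (α : ℝ) : slideCoord α 1 = 1 := by simp [slideCoord]

lemma slideCoord_den_pos {α T : ℝ} (hα : α ∈ Icc (0 : ℝ) 1) (h0 : 0 < T) (h1 : T < 1) :
    0 < (1 - α) * T + α * (1 - T) := by
  rcases hα.1.eq_or_lt with h | h
  · subst h; simpa using h0
  · have := mul_pos h (sub_pos.2 h1)
    have := mul_nonneg (sub_nonneg.2 hα.2) h0.le
    linarith

lemma slideCoord_den_pos' {α T : ℝ} (hα : α ∈ Ioo (0 : ℝ) 1) (hT : T ∈ Icc (0 : ℝ) 1) :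
    0 < (1 - α) * T + α * (1 - T) := by
  rcases hT.1.eq_or_lt with h | h
  · subst h; simpa using hα.1
  · have := mul_pos (sub_pos.2 hα.2) h
    have := mul_nonneg hα.1.le (sub_nonneg.2 hT.2)
    linarith

lemma slideCoord_eq {α T : ℝ} (hα : α ∈ Ioo (0 : ℝ) 1) :
    slideCoord α T = (1 - α) * T / ((1 - α) * T + α * (1 - T)) := by
  unfold slideCoord
  split_ifs with h0 h1
  · simp [h0]
  · have : (1 - α) ≠ 0 := (sub_pos.2 hα.2).ne'
    simp [h1, this]
  · rfl

/-- The defining quotient with its denominator cleared. In this form it is a closed condition that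
makes sense up to α = 0 and α = 1, where it need not determine the image of `T` any more. -/
lemma slideCoord_rel {α T : ℝ} (hα : α ∈ Icc (0 : ℝ) 1) (hT : T ∈ Icc (0 : ℝ) 1) :
    α * slideCoord α T * (1 - T) = (1 - α) * T * (1 - slideCoord α T) := by
  unfold slideCoord
  split_ifs with h0 h1
  · simp [h0]
  · simp [h1]
  · have := slideCoord_den_pos hα (lt_of_le_of_ne hT.1 (Ne.symm h0)) (lt_of_le_of_ne hT.2 h1)
    field_simp
    ring

lemma slideCoord_mono {α S T : ℝ} (hα : α ∈ Icc (0 : ℝ) 1) (h0 : 0 ≤ S) (hST : S ≤ T)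
    (h1 : T ≤ 1) : slideCoord α S ≤ slideCoord α T := by
  have key : ∀ U ∈ Icc (0 : ℝ) 1, slideCoord α U ∈ Icc (0 : ℝ) 1 := by
    intro U hU
    unfold slideCoord
    split_ifs with h0 h1
    · simp
    · simp
    · have h0' := lt_of_le_of_ne hU.1 (Ne.symm h0)
      have h1' := lt_of_le_of_ne hU.2 h1
      have := slideCoord_den_pos hα h0' h1'
      have h2 := mul_nonneg (sub_nonneg.2 hα.2) h0'.le
      have h3 := mul_nonneg hα.1 (sub_pos.2 h1').le
      refine ⟨div_nonneg h2 this.le, (div_le_one this).2 (by linarith)⟩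
  rcases h0.eq_or_lt with hS | hS
  · rw [← hS, slideCoord_zero]; exact (key T ⟨by linarith, h1⟩).1
  rcases h1.eq_or_lt with hT | hT
  · rw [hT, slideCoord_one]; exact (key S ⟨h0, by linarith⟩).2
  have hS1 : S < 1 := by linarith
  have hT0 : 0 < T := by linarith
  rw [slideCoord, slideCoord, if_neg hS.ne', if_neg hS1.ne, if_neg hT0.ne', if_neg hT.ne,
    div_le_div_iff₀ (slideCoord_den_pos hα hS hS1) (slideCoord_den_pos hα hT0 hT)]
  have := mul_nonneg (mul_nonneg (sub_nonneg.2 hα.2) hα.1) (sub_nonneg.2 hST)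
  nlinarith [this]

/-- Only continuity in α for a fixed `T` holds: at α = 0 the map of `T` jumps at `T = 0`, and at α =
1 it jumps at `T = 1`. -/
lemma slideCoord_continuous {T : ℝ} (hT : T ∈ Icc (0 : ℝ) 1) :
    Continuous fun α : unitInterval => slideCoord α T := by
  unfold slideCoord
  split_ifs with h0 h1
  · fun_prop
  · fun_prop
  · refine Continuous.div (by fun_prop) (by fun_prop) fun α => ?_
    exact (slideCoord_den_pos α.2 (lt_of_le_of_ne hT.1 (Ne.symm h0))
      (lt_of_le_of_ne hT.2 h1)).ne'

lemma slideCoord_unique {α T U : ℝ} (hα : α ∈ Ioo (0 : ℝ) 1) (hT : T ∈ Icc (0 : ℝ) 1)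
    (h : α * U * (1 - T) = (1 - α) * T * (1 - U)) : U = slideCoord α T := by
  have := slideCoord_den_pos' hα hT
  rw [slideCoord_eq hα, eq_div_iff this.ne']
  linarith

lemma slideCoord_at_zero (T : ℝ) : slideCoord 0 T = if T = 0 then 0 else 1 := by
  unfold slideCoord
  split_ifs with h0 h1
  · rfl
  · rfl
  · simp [h0]

lemma slideCoord_at_one (T : ℝ) : slideCoord 1 T = if T = 1 then 1 else 0 := by
  unfold slideCoord
  split_ifs with h0 h1 h1
  · simp_all
  · rfl
  · rfl
  · simp

end SlideCoord

/-! ### The Möbius flow on a simplex, acting on cumulative masses -/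

section Slide

variable {ι : Type*} [Fintype ι] {Γ : Type*} [LinearOrder Γ] (κ : ι → Γ)

/-- The mass of `x` at vertices with key at most that of `j`. -/
noncomputable def cumLe (x : ι → ℝ) (j : ι) : ℝ := ∑ k with κ k ≤ κ j, x k

/-- The mass of `x` at vertices with key less than that of `j`. -/
noncomputable def cumLt (x : ι → ℝ) (j : ι) : ℝ := ∑ k with κ k < κ j, x k

variable {κ}

lemma cumLe_eq_cumLt_add (hκ : Function.Injective κ) (x : ι → ℝ) (j : ι) :
    cumLe κ x j = cumLt κ x j + x j := by
  have : (Finset.univ.filter fun k => κ k ≤ κ j) =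
      Finset.cons j (Finset.univ.filter fun k => κ k < κ j) (by simp) := by
    ext k
    simp [le_iff_eq_or_lt, hκ.eq_iff]
  rw [cumLe, this, Finset.sum_cons, cumLt, add_comm]

lemma cumLe_mem (x : stdSimplex ℝ ι) (j : ι) : cumLe κ x j ∈ Icc (0 : ℝ) 1 :=
  ⟨Finset.sum_nonneg fun k _ => x.2.1 k, by
    rw [← x.2.2]
    exact Finset.sum_le_sum_of_subset_of_nonneg (Finset.subset_univ _) fun k _ _ => x.2.1 k⟩

lemma cumLt_mem (x : stdSimplex ℝ ι) (j : ι) : cumLt κ x j ∈ Icc (0 : ℝ) 1 :=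
  ⟨Finset.sum_nonneg fun k _ => x.2.1 k, by
    rw [← x.2.2]
    exact Finset.sum_le_sum_of_subset_of_nonneg (Finset.subset_univ _) fun k _ _ => x.2.1 k⟩

lemma cumLt_le_cumLe (x : stdSimplex ℝ ι) (j : ι) : cumLt κ x j ≤ cumLe κ x j :=
  Finset.sum_le_sum_of_subset_of_nonneg
    (fun k hk => by simp at hk ⊢; exact hk.le) fun k _ _ => x.2.1 k

/-- In order of increasing key the sum telescopes. For `m = slideCoord α` this shows that the slid
coordinates add up to 1, and that the flow acts on cumulative masses by `slideCoord α`. -/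
lemma sum_telescope (hκ : Function.Injective κ) (m : ℝ → ℝ) (x : ι → ℝ) (s : Finset ι) :
    ∑ j ∈ s, (m (∑ k ∈ s with κ k ≤ κ j, x k) - m (∑ k ∈ s with κ k < κ j, x k)) =
      m (∑ k ∈ s, x k) - m 0 := by
  classical
  induction s using Finset.induction_on_max_value κ with
  | empty => simp
  | insert a s ha hmax ih =>
    have hlt : ∀ k ∈ s, κ k < κ a := fun k hk =>
      lt_of_le_of_ne (hmax k hk) fun h => ha (hκ h ▸ hk)
    rw [Finset.sum_insert ha]
    have h1 : ((insert a s).filter fun k => κ k ≤ κ a) = insert a s := by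
      apply Finset.filter_true_of_mem
      intro k hk
      rcases Finset.mem_insert.1 hk with rfl | hk
      · exact le_rfl
      · exact hmax k hk
    have h2 : ((insert a s).filter fun k => κ k < κ a) = s := by
      ext k
      simp only [Finset.mem_filter, Finset.mem_insert]
      constructor
      · rintro ⟨rfl | h, h'⟩
        · exact absurd h' (lt_irrefl _)
        · exact h
      · exact fun h => ⟨Or.inr h, hlt k h⟩
    have h3 : ∀ j ∈ s, m (∑ k ∈ (insert a s) with κ k ≤ κ j, x k) -
        m (∑ k ∈ (insert a s) with κ k < κ j, x k) =
        m (∑ k ∈ s with κ k ≤ κ j, x k) - m (∑ k ∈ s with κ k < κ j, x k) := by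
      intro j hj
      rw [Finset.filter_insert, if_neg (not_le.2 (hlt j hj)), Finset.filter_insert,
        if_neg (not_lt.2 (hlt j hj).le)]
    rw [Finset.sum_congr rfl h3, ih, h1, h2]
    ring

lemma eq_of_cumLe_eq (hκ : Function.Injective κ) {x y : ι → ℝ}
    (h : ∀ j, cumLe κ x j = cumLe κ y j) : x = y := by
  by_contra hne
  have : (Finset.univ.filter fun j => x j ≠ y j).Nonempty := by
    obtain ⟨j, hj⟩ := Function.ne_iff.1 hne
    exact ⟨j, by simpa using hj⟩
  obtain ⟨j, hj, hmin⟩ := Finset.exists_min_image _ κ this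
  simp only [Finset.mem_filter, Finset.mem_univ, true_and] at hj hmin
  apply hj
  have h1 := h j
  rw [cumLe_eq_cumLt_add hκ, cumLe_eq_cumLt_add hκ] at h1
  have h2 : cumLt κ x j = cumLt κ y j := by
    refine Finset.sum_congr rfl fun k hk => ?_
    by_contra hk'
    exact absurd (hmin k hk') (not_le.2 (by simpa using hk))
  linarith

variable (κ) in
/-- The point of the flow line of `x` at time `α`, from the lowest vertex of the carrier of `x`
(at time `0`) to the highest one (at time `1`). The point `x` itself is at time `1 / 2`. -/
noncomputable def slide (hκ : Function.Injective κ) (α : unitInterval) (x : stdSimplex ℝ ι) :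
    stdSimplex ℝ ι :=
  ⟨fun j => slideCoord α (cumLe κ x j) - slideCoord α (cumLt κ x j),
    fun j => sub_nonneg.2 (slideCoord_mono α.2 (cumLt_mem x j).1 (cumLt_le_cumLe x j)
      (cumLe_mem x j).2), by
    have := sum_telescope hκ (slideCoord α) x Finset.univ
    have h1 : ∑ k, x k = 1 := x.2.2
    rw [h1, slideCoord_zero, slideCoord_one, sub_zero] at this
    exact this⟩

variable {hκ : Function.Injective κ}

lemma slide_apply (α : unitInterval) (x : stdSimplex ℝ ι) (j : ι) :
    slide κ hκ α x j = slideCoord α (cumLe κ x j) - slideCoord α (cumLt κ x j) := rfl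

lemma cumLe_slide (α : unitInterval) (x : stdSimplex ℝ ι) (j : ι) :
    cumLe κ (slide κ hκ α x) j = slideCoord α (cumLe κ x j) := by
  have h := sum_telescope hκ (slideCoord α) x (Finset.univ.filter fun k => κ k ≤ κ j)
  rw [slideCoord_zero, sub_zero] at h
  rw [cumLe, ← cumLe.eq_1 κ x j] at *
  rw [← h]
  refine Finset.sum_congr rfl fun i hi => ?_
  simp only [Finset.mem_filter, Finset.mem_univ, true_and] at hi
  rw [slide_apply, cumLe, cumLt, Finset.filter_filter, Finset.filter_filter]
  congr 3 <;> ext k <;> simp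
  · exact fun h => h.trans hi
  · exact fun h => h.le.trans hi

lemma continuous_slide (x : stdSimplex ℝ ι) : Continuous fun α => slide κ hκ α x :=
  Continuous.subtype_mk (continuous_pi fun j =>
    (slideCoord_continuous (cumLe_mem x j)).sub (slideCoord_continuous (cumLt_mem x j))) _

variable (κ) in
/-- A closed relation containing all pairs of a point and a point of its flow line. -/
def SlideRel (x y : stdSimplex ℝ ι) : Prop :=
  ∃ α : unitInterval, ∀ j,
    (α : ℝ) * cumLe κ y j * (1 - cumLe κ x j) = (1 - α) * cumLe κ x j * (1 - cumLe κ y j)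

lemma slideRel_slide (α : unitInterval) (x : stdSimplex ℝ ι) :
    SlideRel κ x (slide κ hκ α x) :=
  ⟨α, fun j => by rw [cumLe_slide]; exact slideCoord_rel α.2 (cumLe_mem x j)⟩

lemma continuous_cumLe (j : ι) : Continuous fun x : stdSimplex ℝ ι => cumLe κ x j :=
  continuous_finsetSum _ fun k _ => (continuous_apply k).comp continuous_subtype_val

/-- The time parameter is projected away along a compact interval, which keeps the relation closed.
-/
lemma isClosed_slideRel :
    IsClosed {q : stdSimplex ℝ ι × stdSimplex ℝ ι | SlideRel κ q.1 q.2} := by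
  have h : IsClosed {r : unitInterval × (stdSimplex ℝ ι × stdSimplex ℝ ι) | ∀ j,
      (r.1 : ℝ) * cumLe κ r.2.2 j * (1 - cumLe κ r.2.1 j) =
        (1 - r.1) * cumLe κ r.2.1 j * (1 - cumLe κ r.2.2 j)} := by
    rw [ofPred_forall]
    refine isClosed_iInter fun j => ?_
    have h1 : Continuous fun r : unitInterval × (stdSimplex ℝ ι × stdSimplex ℝ ι) =>
      cumLe κ r.2.1 j := (continuous_cumLe j).comp (by fun_prop)
    have h2 : Continuous fun r : unitInterval × (stdSimplex ℝ ι × stdSimplex ℝ ι) =>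
      cumLe κ r.2.2 j := (continuous_cumLe j).comp (by fun_prop)
    exact isClosed_eq (by fun_prop) (by fun_prop)
  convert isClosedMap_snd_of_compactSpace _ h using 1
  ext q
  simp [SlideRel]

lemma eq_slide_of_rel {α : unitInterval} (h0 : 0 < α) (h1 : α < 1) {x y : stdSimplex ℝ ι}
    (h : ∀ j, (α : ℝ) * cumLe κ y j * (1 - cumLe κ x j) =
      (1 - α) * cumLe κ x j * (1 - cumLe κ y j)) : y = slide κ hκ α x := by
  apply Subtype.ext
  refine eq_of_cumLe_eq hκ fun j => ?_
  have := cumLe_slide (hκ := hκ) α x j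
  refine Eq.trans ?_ this.symm
  exact slideCoord_unique ⟨by exact_mod_cast h0, by exact_mod_cast h1⟩ (cumLe_mem x j) (h j)

lemma slide_symm {α : unitInterval} (h0 : 0 < α) (h1 : α < 1) (x : stdSimplex ℝ ι) :
    slide κ hκ (unitInterval.symm α) (slide κ hκ α x) = x := by
  refine (eq_slide_of_rel (unitInterval.lt_symm_comm.1 (by simpa using h1))
    (unitInterval.symm_lt_comm.1 (by simpa using h0)) fun j => ?_).symm
  rw [cumLe_slide, unitInterval.coe_symm_eq]
  have := slideCoord_rel α.2 (cumLe_mem (κ := κ) x j)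
  linarith

lemma slide_half (x : stdSimplex ℝ ι) :
    slide κ hκ ⟨1 / 2, by norm_num, by norm_num⟩ x = x := by
  refine (eq_slide_of_rel ?_ ?_ fun j => ?_).symm
  · exact Subtype.mk_lt_mk.2 (by norm_num)
  · exact Subtype.mk_lt_mk.2 (by norm_num)
  · norm_num

lemma slide_apply_eq_zero {α : unitInterval} {x : stdSimplex ℝ ι} {j : ι} (h : x j = 0) :
    slide κ hκ α x j = 0 := by
  rw [slide_apply, cumLe_eq_cumLt_add hκ, h, add_zero, sub_self]

lemma slide_apply_eq_zero_iff {α : unitInterval} (h0 : 0 < α) (h1 : α < 1)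
    {x : stdSimplex ℝ ι} {j : ι} : slide κ hκ α x j = 0 ↔ x j = 0 := by
  refine ⟨fun h => ?_, slide_apply_eq_zero⟩
  rw [← slide_symm (hκ := hκ) h0 h1 x]
  exact slide_apply_eq_zero h

/-- The formula for the flow in barycentric coordinates. -/
lemma slide_apply_formula {α : unitInterval} (h0 : 0 < α) (h1 : α < 1) (x : stdSimplex ℝ ι)
    (j : ι) : slide κ hκ α x j = (1 - α) * α * x j /
      (((1 - α) * cumLt κ x j + α * (1 - cumLt κ x j)) *
        ((1 - α) * cumLe κ x j + α * (1 - cumLe κ x j))) := by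
  have hα : (α : ℝ) ∈ Ioo (0 : ℝ) 1 := ⟨by exact_mod_cast h0, by exact_mod_cast h1⟩
  have h3 := slideCoord_den_pos' hα (cumLt_mem (κ := κ) x j)
  have h4 := slideCoord_den_pos' hα (cumLe_mem (κ := κ) x j)
  rw [slide_apply, slideCoord_eq hα, slideCoord_eq hα, div_sub_div _ _ h4.ne' h3.ne',
    mul_comm (_ + _) (_ + _)]
  congr 1
  rw [cumLe_eq_cumLt_add hκ]
  ring

/-- Ratios of coordinates increase strictly along flow lines. -/
lemma slide_ratio_lt {α β : unitInterval} (h0 : 0 < α) (hαβ : α < β) (h1 : β < 1)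
    {x : stdSimplex ℝ ι} {j l : ι} (hj : x j ≠ 0) (hl : x l ≠ 0) (hjl : κ j < κ l) :
    slide κ hκ α x l * slide κ hκ β x j < slide κ hκ β x l * slide κ hκ α x j := by
  have hα : (α : ℝ) ∈ Ioo (0 : ℝ) 1 := ⟨by exact_mod_cast h0, by exact_mod_cast hαβ.trans h1⟩
  have hβ : (β : ℝ) ∈ Ioo (0 : ℝ) 1 := ⟨by exact_mod_cast h0.trans hαβ, by exact_mod_cast h1⟩
  have hlt : (α : ℝ) < β := by exact_mod_cast hαβ
  have xj : 0 < x j := lt_of_le_of_ne (x.2.1 j) (Ne.symm hj)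
  have xl : 0 < x l := lt_of_le_of_ne (x.2.1 l) (Ne.symm hl)
  have e1 : cumLe κ x j ≤ cumLt κ x l := by
    refine Finset.sum_le_sum_of_subset_of_nonneg (fun k hk => ?_) fun k _ _ => x.2.1 k
    simp at hk ⊢
    exact hk.trans_lt hjl
  have e2 : cumLt κ x j < cumLt κ x l := by
    have := cumLe_eq_cumLt_add hκ x j; linarith
  have e3 : cumLe κ x j < cumLe κ x l := by
    have := cumLe_eq_cumLt_add hκ x l; linarith
  rw [slide_apply_formula h0 (hαβ.trans h1), slide_apply_formula h0 (hαβ.trans h1),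
    slide_apply_formula (h0.trans hαβ) h1, slide_apply_formula (h0.trans hαβ) h1]
  -- The two sides differ by (β - α)(T - S). In `slide_apply_formula` each coordinate has two such
  -- factors in its denominator, one for the mass strictly below the vertex and one for the mass up
  -- to it, so the claim is a product of two of these inequalities.
  have aux : ∀ {S T : ℝ}, S < T → 
      ((1 - (α : ℝ)) * S + α * (1 - S)) * ((1 - β) * T + β * (1 - T)) <
      ((1 - (β : ℝ)) * S + β * (1 - S)) * ((1 - α) * T + α * (1 - T)) := by
    intro S T h
    have := mul_pos (sub_pos.2 hlt) (sub_pos.2 h)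
    nlinarith [this]
  have p1 := slideCoord_den_pos' hα (cumLt_mem (κ := κ) x j)
  have p2 := slideCoord_den_pos' hα (cumLe_mem (κ := κ) x j)
  have p3 := slideCoord_den_pos' hα (cumLt_mem (κ := κ) x l)
  have p4 := slideCoord_den_pos' hα (cumLe_mem (κ := κ) x l)
  have q1 := slideCoord_den_pos' hβ (cumLt_mem (κ := κ) x j)
  have q2 := slideCoord_den_pos' hβ (cumLe_mem (κ := κ) x j)
  have q3 := slideCoord_den_pos' hβ (cumLt_mem (κ := κ) x l)
  have q4 := slideCoord_den_pos' hβ (cumLe_mem (κ := κ) x l)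
  have a1 := aux e2
  have a2 := aux e3
  set A1 := (1 - (α : ℝ)) * cumLt κ x j + α * (1 - cumLt κ x j)
  set A2 := (1 - (α : ℝ)) * cumLe κ x j + α * (1 - cumLe κ x j)
  set A3 := (1 - (α : ℝ)) * cumLt κ x l + α * (1 - cumLt κ x l)
  set A4 := (1 - (α : ℝ)) * cumLe κ x l + α * (1 - cumLe κ x l)
  set B1 := (1 - (β : ℝ)) * cumLt κ x j + β * (1 - cumLt κ x j)
  set B2 := (1 - (β : ℝ)) * cumLe κ x j + β * (1 - cumLe κ x j)
  set B3 := (1 - (β : ℝ)) * cumLt κ x l + β * (1 - cumLt κ x l)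
  set B4 := (1 - (β : ℝ)) * cumLe κ x l + β * (1 - cumLe κ x l)
  have hm : (A1 * B3) * (A2 * B4) < (B1 * A3) * (B2 * A4) :=
    mul_lt_mul'' a1 a2 (by positivity) (by positivity)
  have hc : 0 < (1 - (α : ℝ)) * α * ((1 - β) * β) * (x j * x l) := by
    have := hα.1; have := sub_pos.2 hα.2; have := hβ.1; have := sub_pos.2 hβ.2
    positivity
  rw [div_mul_div_comm, div_mul_div_comm, div_lt_div_iff₀ (by positivity) (by positivity)]
  have := mul_lt_mul_of_pos_left hm hc
  nlinarith [this]

end Slide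

/-! ### Functions that increase along the flow -/

section SlideMaps

open Filter Topology

variable {ι : Type*} [Fintype ι] [DecidableEq ι] {Γ : Type*} [LinearOrder Γ] {κ : ι → Γ}
  {hκ : Function.Injective κ}

variable (κ) in
/-- `j` is the lowest vertex of the carrier of `x`. -/
def IsLowest (x : stdSimplex ℝ ι) (j : ι) : Prop := x j ≠ 0 ∧ ∀ k, x k ≠ 0 → κ j ≤ κ k

variable (κ) in
/-- `j` is the highest vertex of the carrier of `x`. -/
def IsHighest (x : stdSimplex ℝ ι) (j : ι) : Prop := x j ≠ 0 ∧ ∀ k, x k ≠ 0 → κ k ≤ κ j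

lemma support_nonempty (x : stdSimplex ℝ ι) : (Finset.univ.filter fun j => x j ≠ 0).Nonempty := by
  by_contra h
  rw [Finset.not_nonempty_iff_eq_empty, Finset.filter_eq_empty_iff] at h
  have h1 : ∑ j, x j = 1 := x.2.2
  rw [Finset.sum_eq_zero fun j hj => by simpa using h hj] at h1
  exact zero_ne_one h1

variable (κ) in
lemma exists_isLowest (x : stdSimplex ℝ ι) : ∃ j, IsLowest κ x j := by
  obtain ⟨j, hj, hmin⟩ := Finset.exists_min_image _ κ (support_nonempty x)
  exact ⟨j, by simpa using hj, fun k hk => hmin k (by simpa using hk)⟩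

variable (κ) in
lemma exists_isHighest (x : stdSimplex ℝ ι) : ∃ j, IsHighest κ x j := by
  obtain ⟨j, hj, hmin⟩ := Finset.exists_max_image _ κ (support_nonempty x)
  exact ⟨j, by simpa using hj, fun k hk => hmin k (by simpa using hk)⟩

lemma eq_vertex_of_support {x : stdSimplex ℝ ι} {j : ι} (h : ∀ k, k ≠ j → x k = 0) :
    x = stdSimplex.vertex j := by
  have h1 : ∑ k, x k = 1 := x.2.2
  rw [Finset.sum_eq_single j (fun k _ hk => h k hk) (by simp)] at h1
  apply stdSimplex.ext
  ext k
  by_cases hk : k = j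
  · subst hk; simpa using h1
  · rw [h k hk]; simp [hk]

lemma vertex_apply_ne {j k : ι} (h : k ≠ j) : (stdSimplex.vertex j : stdSimplex ℝ ι) k = 0 := by
  simp [h]

lemma vertex_apply_self (j : ι) : (stdSimplex.vertex j : stdSimplex ℝ ι) j = 1 := by
  simp

/-- At time 0 every positive cumulative mass becomes 1, so all the mass sits at the first vertex
that carries any. -/
lemma slide_zero {x : stdSimplex ℝ ι} {j : ι} (hj : IsLowest κ x j) :
    slide κ hκ 0 x = stdSimplex.vertex j := by
  apply eq_vertex_of_support
  intro k hk
  rw [slide_apply]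
  show slideCoord 0 _ - slideCoord 0 _ = 0
  rw [slideCoord_at_zero, slideCoord_at_zero, cumLe_eq_cumLt_add hκ]
  rcases lt_or_ge (κ j) (κ k) with h | h
  · have h1 : 0 < cumLt κ x k := by
      refine lt_of_lt_of_le (lt_of_le_of_ne (x.2.1 j) (Ne.symm hj.1))
        (Finset.single_le_sum (f := fun k => x k) (fun k _ => x.2.1 k) ?_)
      simpa using h
    have h2 : 0 ≤ x k := x.2.1 k
    rw [if_neg h1.ne', if_neg (by linarith)]
    ring
  · have hlt : κ k < κ j := lt_of_le_of_ne h fun h => hk (hκ h)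
    have h0 : x k = 0 := by
      by_contra h0
      exact absurd (hj.2 k h0) (not_le.2 hlt)
    rw [h0, add_zero, sub_self]

lemma slide_one {x : stdSimplex ℝ ι} {j : ι} (hj : IsHighest κ x j) :
    slide κ hκ 1 x = stdSimplex.vertex j := by
  apply eq_vertex_of_support
  intro k hk
  rw [slide_apply]
  show slideCoord 1 _ - slideCoord 1 _ = 0
  rw [slideCoord_at_one, slideCoord_at_one, cumLe_eq_cumLt_add hκ]
  rcases lt_or_ge (κ k) (κ j) with h | h
  · have h1 : cumLe κ x k + x j ≤ 1 := by
      have h1 : ∑ k, x k = 1 := x.2.2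
      rw [← h1, cumLe, add_comm, ← Finset.sum_cons (a := j) (h := by simpa using h)]
      exact Finset.sum_le_sum_of_subset_of_nonneg (Finset.subset_univ _) fun k _ _ => x.2.1 k
    have h3 := cumLe_eq_cumLt_add hκ x k
    have h2 : 0 ≤ x k := x.2.1 k
    have h4 : 0 < x j := lt_of_le_of_ne (x.2.1 j) (Ne.symm hj.1)
    rw [if_neg (by linarith), if_neg (by linarith), sub_self]
  · have hlt : κ j < κ k := lt_of_le_of_ne h fun h => hk (hκ h).symm
    have h0 : x k = 0 := by
      by_contra h0
      exact absurd (hj.2 k h0) (not_le.2 hlt)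
    rw [h0, add_zero, sub_self]

lemma slide_vertex (α : unitInterval) (j : ι) :
    slide κ hκ α (stdSimplex.vertex j) = stdSimplex.vertex j :=
  eq_vertex_of_support fun _ hk => slide_apply_eq_zero (vertex_apply_ne hk)

lemma slide_ne_vertex {α : unitInterval} (h0 : 0 < α) (h1 : α < 1) {x : stdSimplex ℝ ι}
    (hx : ∀ j, x ≠ stdSimplex.vertex j) (j : ι) : slide κ hκ α x ≠ stdSimplex.vertex j := by
  intro h
  refine hx j (eq_vertex_of_support fun k hk => ?_)
  rw [← slide_apply_eq_zero_iff (hκ := hκ) h0 h1, h]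
  exact vertex_apply_ne hk

lemma isLowest_slide {α : unitInterval} (h0 : 0 < α) (h1 : α < 1) {x : stdSimplex ℝ ι} {j : ι} :
    IsLowest κ (slide κ hκ α x) j ↔ IsLowest κ x j := by
  simp only [IsLowest, ne_eq, slide_apply_eq_zero_iff h0 h1]

lemma isHighest_slide {α : unitInterval} (h0 : 0 < α) (h1 : α < 1) {x : stdSimplex ℝ ι} {j : ι} :
    IsHighest κ (slide κ hκ α x) j ↔ IsHighest κ x j := by
  simp only [IsHighest, ne_eq, slide_apply_eq_zero_iff h0 h1]

lemma exists_slide_eq {f : stdSimplex ℝ ι → ℝ} (hf : Continuous f) {x : stdSimplex ℝ ι} {t : ℝ}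
    (h0 : f (slide κ hκ 0 x) ≤ t) (h1 : t ≤ f (slide κ hκ 1 x)) :
    ∃ α, f (slide κ hκ α x) = t :=
  intermediate_value_univ (0 : unitInterval) 1 (hf.comp (continuous_slide x)) ⟨h0, h1⟩

variable (κ hκ) in
/-- `f` increases strictly along all nonconstant flow lines. -/
def Ascending (f : stdSimplex ℝ ι → ℝ) : Prop :=
  ∀ x, (∀ j, x ≠ stdSimplex.vertex j) → StrictMono fun α => f (slide κ hκ α x)

lemma strictMono_unitInterval {g : unitInterval → ℝ} (hg : Continuous g)
    (h : ∀ α β : unitInterval, 0 < α → α < β → β < 1 → g α < g β) : StrictMono g := by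
  have hle : ∀ α β : unitInterval, 0 < α → α < β → g α < g β := by
    intro α β h0 hαβ
    obtain ⟨γ, h1, h2⟩ := exists_between hαβ
    refine (h α γ h0 h1 (h2.trans_le β.2.2)).trans_le ?_
    have hmem : β ∈ closure (Ioo γ β) := by
      rw [closure_Ioo h2.ne]; exact ⟨h2.le, le_rfl⟩
    refine closure_minimal (s := Ioo γ β) (t := {δ | g γ ≤ g δ}) (fun δ hδ => ?_)
      (isClosed_le continuous_const hg) hmem
    exact (h γ δ (h0.trans h1) hδ.1 (hδ.2.trans_le β.2.2)).le
  intro α β hαβ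
  obtain ⟨γ, h1, h2⟩ := exists_between hαβ
  refine lt_of_le_of_lt ?_ (hle γ β (lt_of_le_of_lt α.2.1 h1) h2)
  have hmem : α ∈ closure (Ioo α γ) := by
    rw [closure_Ioo h1.ne]; exact ⟨le_rfl, h1.le⟩
  refine closure_minimal (s := Ioo α γ) (t := {δ | g δ ≤ g γ}) (fun δ hδ => ?_)
    (isClosed_le hg continuous_const) hmem
  exact (hle δ γ (lt_of_le_of_lt α.2.1 hδ.1) hδ.2).le

lemma ascending_of_interior {f : stdSimplex ℝ ι → ℝ} (hf : Continuous f)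
    (h : ∀ x, (∀ j, x ≠ stdSimplex.vertex j) → ∀ α β : unitInterval, 0 < α → α < β → β < 1 →
      f (slide κ hκ α x) < f (slide κ hκ β x)) : Ascending κ hκ f :=
  fun x hx => strictMono_unitInterval (hf.comp (continuous_slide x)) (h x hx)

namespace Ascending

variable {f : stdSimplex ℝ ι → ℝ}

lemma lowest_lt (hf : Ascending κ hκ f) {x : stdSimplex ℝ ι}
    (hx : ∀ j, x ≠ stdSimplex.vertex j) {j : ι} (hj : IsLowest κ x j) :
    f (stdSimplex.vertex j) < f x := by
  have := hf x hx (show (0 : unitInterval) < ⟨1 / 2, by norm_num, by norm_num⟩ from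
    Subtype.mk_lt_mk.2 (by norm_num))
  simpa only [slide_zero hj, slide_half] using this

lemma lt_highest (hf : Ascending κ hκ f) {x : stdSimplex ℝ ι}
    (hx : ∀ j, x ≠ stdSimplex.vertex j) {j : ι} (hj : IsHighest κ x j) :
    f x < f (stdSimplex.vertex j) := by
  have := hf x hx (show (⟨1 / 2, by norm_num, by norm_num⟩ : unitInterval) < 1 from
    Subtype.mk_lt_mk.2 (by norm_num))
  simpa only [slide_one hj, slide_half] using this

lemma lowest_le (hf : Ascending κ hκ f) {x : stdSimplex ℝ ι} {j : ι} (hj : IsLowest κ x j) :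
    f (stdSimplex.vertex j) ≤ f x := by
  by_cases hx : ∀ j, x ≠ stdSimplex.vertex j
  · exact (hf.lowest_lt hx hj).le
  · push Not at hx
    obtain ⟨k, rfl⟩ := hx
    have : j = k := by
      by_contra h
      exact hj.1 (vertex_apply_ne h)
    rw [this]

lemma le_highest (hf : Ascending κ hκ f) {x : stdSimplex ℝ ι} {j : ι} (hj : IsHighest κ x j) :
    f x ≤ f (stdSimplex.vertex j) := by
  by_cases hx : ∀ j, x ≠ stdSimplex.vertex j
  · exact (hf.lt_highest hx hj).le
  · push Not at hx
    obtain ⟨k, rfl⟩ := hx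
    have : j = k := by
      by_contra h
      exact hj.1 (vertex_apply_ne h)
    rw [this]

lemma vertex_lt (hf : Ascending κ hκ f) {j l : ι} (h : κ j < κ l) :
    f (stdSimplex.vertex j) < f (stdSimplex.vertex l) := by
  have hjl : j ≠ l := by rintro rfl; exact lt_irrefl _ h
  -- The midpoint of the edge, whose flow line runs from one end of the edge to the other.
  let x : stdSimplex ℝ ι := ⟨fun k => (if k = j then 1 / 2 else 0) + if k = l then 1 / 2 else 0,
    fun k => by positivity, by simp [Finset.sum_add_distrib]; norm_num⟩
  have hxk : ∀ k, x k = (if k = j then 1 / 2 else 0) + if k = l then 1 / 2 else 0 := fun k => rfl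
  have hsupp : ∀ k, x k ≠ 0 → k = j ∨ k = l := by
    intro k hk
    by_contra hk'
    push Not at hk'
    exact hk (by rw [hxk, if_neg hk'.1, if_neg hk'.2, add_zero])
  have hj : x j ≠ 0 := by rw [hxk, if_pos rfl, if_neg hjl]; norm_num
  have hl : x l ≠ 0 := by rw [hxk, if_pos rfl, if_neg hjl.symm]; norm_num
  have hx : ∀ k, x ≠ stdSimplex.vertex k := by
    intro k hk
    rw [hk] at hj hl
    have h1 : j = k := by by_contra h; exact hj (vertex_apply_ne h)
    have h2 : l = k := by by_contra h; exact hl (vertex_apply_ne h)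
    exact hjl (h1.trans h2.symm)
  have h1 : IsLowest κ x j := ⟨hj, fun k hk => by
    rcases hsupp k hk with rfl | rfl
    exacts [le_rfl, h.le]⟩
  have h2 : IsHighest κ x l := ⟨hl, fun k hk => by
    rcases hsupp k hk with rfl | rfl
    exacts [h.le, le_rfl]⟩
  exact (hf.lowest_lt hx h1).trans (hf.lt_highest hx h2)

lemma vertex_le (hf : Ascending κ hκ f) {j l : ι} (h : κ j ≤ κ l) :
    f (stdSimplex.vertex j) ≤ f (stdSimplex.vertex l) := by
  rcases h.lt_or_eq with h | h
  · exact (hf.vertex_lt h).le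
  · rw [hκ h]

lemma slide_zero_le (hf : Ascending κ hκ f) (α : unitInterval) (x : stdSimplex ℝ ι) :
    f (slide κ hκ 0 x) ≤ f (slide κ hκ α x) := by
  by_cases hx : ∀ j, x ≠ stdSimplex.vertex j
  · exact (hf x hx).monotone α.2.1
  · push Not at hx
    obtain ⟨k, rfl⟩ := hx
    rw [slide_vertex, slide_vertex]

lemma le_slide_one (hf : Ascending κ hκ f) (α : unitInterval) (x : stdSimplex ℝ ι) :
    f (slide κ hκ α x) ≤ f (slide κ hκ 1 x) := by
  by_cases hx : ∀ j, x ≠ stdSimplex.vertex j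
  · exact (hf x hx).monotone α.2.2
  · push Not at hx
    obtain ⟨k, rfl⟩ := hx
    rw [slide_vertex, slide_vertex]

lemma slide_inj (hf : Ascending κ hκ f) {α β : unitInterval} {x : stdSimplex ℝ ι}
    (h : f (slide κ hκ α x) = f (slide κ hκ β x)) : slide κ hκ α x = slide κ hκ β x := by
  by_cases hx : ∀ j, x ≠ stdSimplex.vertex j
  · rw [(hf x hx).injective h]
  · push Not at hx
    obtain ⟨k, rfl⟩ := hx
    rw [slide_vertex, slide_vertex]

/-- On a limit of flow lines, a point is determined by its height. -/
lemma eq_of_slideRel (hf : Ascending κ hκ f) {x y : stdSimplex ℝ ι} (h : SlideRel κ x y)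
    {β : unitInterval} (hy : f y = f (slide κ hκ β x)) : y = slide κ hκ β x := by
  obtain ⟨α, hα⟩ := h
  -- At α = 0 the relation only says that `y` is supported at or below the lowest vertex of `x`.
  -- Since `y` is also at least as high as that vertex, it must be that vertex. The case α = 1 is
  -- symmetric.
  rcases α.2.1.eq_or_lt with h0 | h0
  · obtain ⟨j, hj⟩ := exists_isLowest κ x
    have hsupp : ∀ k, y k ≠ 0 → κ k ≤ κ j := by
      intro k hk
      by_contra hlt
      push Not at hlt
      have h1 := hα j
      rw [← h0] at h1
      have hpos : 0 < cumLe κ x j := by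
        refine lt_of_lt_of_le (lt_of_le_of_ne (x.2.1 j) (Ne.symm hj.1))
          (Finset.single_le_sum (f := fun k => x k) (fun k _ => x.2.1 k) ?_)
        simp
      have h2 : cumLe κ y j = 1 := by
        have : cumLe κ x j * (1 - cumLe κ y j) = 0 := by linarith
        rcases mul_eq_zero.1 this with h | h <;> linarith
      have h3 : cumLe κ y j + y k ≤ 1 := by
        have h1 : ∑ k, y k = 1 := y.2.2
        rw [← h1, cumLe, add_comm, ← Finset.sum_cons (a := k) (h := by simpa using hlt)]
        exact Finset.sum_le_sum_of_subset_of_nonneg (Finset.subset_univ _) fun k _ _ => y.2.1 k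
      have h4 : 0 < y k := lt_of_le_of_ne (y.2.1 k) (Ne.symm hk)
      linarith
    obtain ⟨l, hl⟩ := exists_isHighest κ y
    have h1 := hf.le_highest hl
    have h2 := hf.vertex_le (hsupp l hl.1)
    have h3 := hf.slide_zero_le β x
    rw [slide_zero hj] at h3
    have hyl : y = stdSimplex.vertex l := by
      by_contra hne
      by_cases hy' : ∀ k, y ≠ stdSimplex.vertex k
      · have := hf.lt_highest hy' hl
        linarith
      · push Not at hy'
        obtain ⟨k, hk⟩ := hy'
        have : l = k := by
          by_contra h
          exact hl.1 (by rw [hk]; exact vertex_apply_ne h)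
        exact hne (this ▸ hk)
    have hlj : l = j := by
      by_contra hne
      have := hf.vertex_lt (lt_of_le_of_ne (hsupp l hl.1) fun h => hne (hκ h))
      linarith
    rw [hyl, hlj, ← slide_zero (hκ := hκ) hj]
    apply hf.slide_inj
    rw [slide_zero hj]
    apply le_antisymm h3
    rw [← hy]; exact h1.trans h2
  rcases α.2.2.eq_or_lt with h1 | h1
  · obtain ⟨j, hj⟩ := exists_isHighest κ x
    have hsupp : ∀ k, y k ≠ 0 → κ j ≤ κ k := by
      intro k hk
      by_contra hlt
      push Not at hlt
      have h2 := hα k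
      rw [h1] at h2
      have hpos : 0 < cumLe κ y k := by
        refine lt_of_lt_of_le (lt_of_le_of_ne (y.2.1 k) (Ne.symm hk))
          (Finset.single_le_sum (f := fun k => y k) (fun k _ => y.2.1 k) ?_)
        simp
      have h2 : cumLe κ x k = 1 := by
        have : cumLe κ y k * (1 - cumLe κ x k) = 0 := by linarith
        rcases mul_eq_zero.1 this with h | h <;> linarith
      have h3 : cumLe κ x k + x j ≤ 1 := by
        have h1 : ∑ k, x k = 1 := x.2.2
        rw [← h1, cumLe, add_comm, ← Finset.sum_cons (a := j) (h := by simpa using hlt)]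
        exact Finset.sum_le_sum_of_subset_of_nonneg (Finset.subset_univ _) fun k _ _ => x.2.1 k
      have h4 : 0 < x j := lt_of_le_of_ne (x.2.1 j) (Ne.symm hj.1)
      linarith
    obtain ⟨l, hl⟩ := exists_isLowest κ y
    have h2 := hf.lowest_le hl
    have h4 := hf.vertex_le (hsupp l hl.1)
    have h3 := hf.le_slide_one β x
    rw [slide_one hj] at h3
    have hyl : y = stdSimplex.vertex l := by
      by_contra hne
      by_cases hy' : ∀ k, y ≠ stdSimplex.vertex k
      · have := hf.lowest_lt hy' hl
        linarith
      · push Not at hy'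
        obtain ⟨k, hk⟩ := hy'
        have : l = k := by
          by_contra h
          exact hl.1 (by rw [hk]; exact vertex_apply_ne h)
        exact hne (this ▸ hk)
    have hlj : l = j := by
      by_contra hne
      have := hf.vertex_lt (lt_of_le_of_ne (hsupp l hl.1) fun h => hne (hκ h).symm)
      linarith
    rw [hyl, hlj, ← slide_one (hκ := hκ) hj]
    apply hf.slide_inj
    rw [slide_one hj]
    refine le_antisymm ?_ h3
    rw [← hy]; exact h4.trans h2
  · have hys : y = slide κ hκ α x := eq_slide_of_rel (by exact_mod_cast h0) (by exact_mod_cast h1) hα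
    rw [hys] at hy ⊢
    exact hf.slide_inj hy

/-- Moving points along flow lines to prescribed heights is continuous. -/
lemma continuousOn_slide {Y : Type*} [TopologicalSpace Y] (hf : Ascending κ hκ f)
    (hfc : Continuous f) {A : Set Y} {x R : Y → stdSimplex ℝ ι} (hx : ContinuousOn x A)
    (hR : ∀ y ∈ A, ∃ α, R y = slide κ hκ α (x y)) (hfR : ContinuousOn (fun y => f (R y)) A) :
    ContinuousOn R A := by
  intro a ha
  rw [ContinuousWithinAt, tendsto_iff_ultrafilter]
  intro U hU
  -- The time parameters of the points `R y` are not controlled and the flow is not jointly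
  -- continuous. Compactness provides a limit of the points themselves, which is then identified by
  -- the closed relation and by its height.
  obtain ⟨z, -, hz⟩ := isCompact_univ.ultrafilter_le_nhds (U.map R) (by simp)
  have hz : Tendsto R U (𝓝 z) := hz
  have hxt : Tendsto x U (𝓝 (x a)) := (hx a ha).mono_left hU
  have hA : ∀ᶠ y in (U : Filter Y), y ∈ A := hU self_mem_nhdsWithin
  have hrel : SlideRel κ (x a) z := by
    refine (isClosed_slideRel (κ := κ)).mem_of_tendsto (hxt.prodMk_nhds hz) ?_
    filter_upwards [hA] with y hy
    obtain ⟨α, hα⟩ := hR y hy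
    show SlideRel κ (x y) (R y)
    rw [hα]
    exact slideRel_slide α _
  have hfz : f z = f (R a) := tendsto_nhds_unique ((hfc.tendsto z).comp hz) ((hfR a ha).mono_left hU)
  obtain ⟨β, hβ⟩ := hR a ha
  rw [hβ] at hfz ⊢
  rw [← hf.eq_of_slideRel hrel hfz]
  exact hz

lemma height_mem {w : stdSimplex ℝ ι → ℝ} (hw : Ascending κ hκ w)
    (hfw : ∀ j, f (stdSimplex.vertex j) = w (stdSimplex.vertex j)) (x : stdSimplex ℝ ι) :
    f (slide κ hκ 0 x) ≤ w x ∧ w x ≤ f (slide κ hκ 1 x) := by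
  obtain ⟨j, hj⟩ := exists_isLowest κ x
  obtain ⟨l, hl⟩ := exists_isHighest κ x
  rw [slide_zero hj, slide_one hl, hfw, hfw]
  exact ⟨hw.lowest_le hj, hw.le_highest hl⟩

lemma interior_of_height {w : stdSimplex ℝ ι → ℝ} (hf : Ascending κ hκ f) (hw : Ascending κ hκ w)
    (hfw : ∀ j, f (stdSimplex.vertex j) = w (stdSimplex.vertex j)) {x : stdSimplex ℝ ι}
    (hx : ∀ j, x ≠ stdSimplex.vertex j) {α : unitInterval} (h : f (slide κ hκ α x) = w x) :
    0 < α ∧ α < 1 := by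
  obtain ⟨j, hj⟩ := exists_isLowest κ x
  obtain ⟨l, hl⟩ := exists_isHighest κ x
  have h0 := hw.lowest_lt hx hj
  have h1 := hw.lt_highest hx hl
  rw [← hfw, ← slide_zero (hκ := hκ) hj, ← h] at h0
  rw [← hfw, ← slide_one (hκ := hκ) hl, ← h] at h1
  exact ⟨(hf x hx).lt_iff_lt.1 h0, (hf x hx).lt_iff_lt.1 h1⟩

/-- Two ascending functions with the same values at the vertices differ by a homeomorphism that
moves points along flow lines. -/
lemma exists_homeomorph {w : stdSimplex ℝ ι → ℝ} (hf : Ascending κ hκ f) (hfc : Continuous f)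
    (hw : Ascending κ hκ w) (hwc : Continuous w)
    (hfw : ∀ j, f (stdSimplex.vertex j) = w (stdSimplex.vertex j)) :
    ∃ h : stdSimplex ℝ ι ≃ₜ stdSimplex ℝ ι, (∀ x, f (h x) = w x) ∧
      ∀ x j, h x j = 0 ↔ x j = 0 := by
  -- With equal vertex values both functions cover the same range of heights on a flow line, so `x`
  -- can be moved along its own line to where `f` takes the value `w x`. Interchanging the two
  -- functions gives the inverse.
  have e1 : ∀ x, ∃ α, f (slide κ hκ α x) = w x := fun x =>
    exists_slide_eq hfc (height_mem hw hfw x).1 (height_mem hw hfw x).2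
  have e2 : ∀ x, ∃ α, w (slide κ hκ α x) = f x := fun x =>
    exists_slide_eq hwc (height_mem hf (fun j => (hfw j).symm) x).1
      (height_mem hf (fun j => (hfw j).symm) x).2
  choose a ha using e1
  choose b hb using e2
  have inv1 : ∀ x, slide κ hκ (b (slide κ hκ (a x) x)) (slide κ hκ (a x) x) = x := by
    intro x
    by_cases hx : ∀ j, x ≠ stdSimplex.vertex j
    · obtain ⟨h0, h1⟩ := hf.interior_of_height hw hfw hx (ha x)
      have h2 := slide_symm (hκ := hκ) h0 h1 x
      refine Eq.trans (hw.slide_inj ?_) h2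
      rw [hb, h2, ha]
    · push Not at hx
      obtain ⟨k, rfl⟩ := hx
      simp only [slide_vertex]
  have inv2 : ∀ x, slide κ hκ (a (slide κ hκ (b x) x)) (slide κ hκ (b x) x) = x := by
    intro x
    by_cases hx : ∀ j, x ≠ stdSimplex.vertex j
    · obtain ⟨h0, h1⟩ := hw.interior_of_height hf (fun j => (hfw j).symm) hx (hb x)
      have h2 := slide_symm (hκ := hκ) h0 h1 x
      refine Eq.trans (hf.slide_inj ?_) h2
      rw [ha, h2, hb]
    · push Not at hx
      obtain ⟨k, rfl⟩ := hx
      simp only [slide_vertex]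
  have c1 : Continuous fun x => slide κ hκ (a x) x := by
    rw [← continuousOn_univ]
    exact hf.continuousOn_slide hfc continuousOn_id (fun x _ => ⟨a x, rfl⟩)
      (by simpa only [ha] using hwc.continuousOn)
  have c2 : Continuous fun x => slide κ hκ (b x) x := by
    rw [← continuousOn_univ]
    exact hw.continuousOn_slide hwc continuousOn_id (fun x _ => ⟨b x, rfl⟩)
      (by simpa only [hb] using hfc.continuousOn)
  refine ⟨⟨⟨fun x => slide κ hκ (a x) x, fun x => slide κ hκ (b x) x, inv1, inv2⟩, c1, c2⟩, ha,
    fun x j => ⟨fun h => ?_, fun h => slide_apply_eq_zero (hκ := hκ) h⟩⟩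
  rw [← inv1 x]
  exact slide_apply_eq_zero h

end Ascending

lemma simplex_map_apply {ι' : Type*} [Fintype ι'] {e : ι' → ι} (he : Function.Injective e)
    (z : stdSimplex ℝ ι') (k : ι') : stdSimplex.map e z (e k) = z k := by
  rw [stdSimplex.map_coe, FunOnFinite.linearMap_apply_apply, Finset.sum_eq_single k]
  · intro l hl hlk
    exact absurd (he (by simpa using hl)) hlk
  · simp

lemma simplex_map_apply_of_notMem {ι' : Type*} [Fintype ι'] {e : ι' → ι} (z : stdSimplex ℝ ι')
    {j : ι} (hj : j ∉ range e) : stdSimplex.map e z j = 0 := by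
  rw [stdSimplex.map_coe, FunOnFinite.linearMap_apply_apply]
  exact Finset.sum_eq_zero fun k hk => absurd ⟨k, by simpa using hk⟩ hj

/-- The flow is natural under inclusions of faces. -/
lemma slide_map {ι' : Type*} [Fintype ι'] {Γ' : Type*} [LinearOrder Γ'] {κ' : ι' → Γ'}
    {hκ' : Function.Injective κ'} {e : ι' → ι} (he : Function.Injective e)
    (hord : ∀ a b, κ (e a) ≤ κ (e b) ↔ κ' a ≤ κ' b) (α : unitInterval) (y : stdSimplex ℝ ι') :
    stdSimplex.map e (slide κ' hκ' α y) = slide κ hκ α (stdSimplex.map e y) := by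
  have hsum : ∀ (P : ι → Prop) [DecidablePred P],
      ∑ j with P j, stdSimplex.map e y j = ∑ k with P (e k), y k := by
    intro P _
    rw [Finset.sum_filter, Finset.sum_filter]
    rw [← Finset.sum_subset (Finset.subset_univ (Finset.univ.image e))]
    · rw [Finset.sum_image fun a _ b _ h => he h]
      simp only [simplex_map_apply he]
    · intro j _ hj
      have : j ∉ range e := by simpa using hj
      rw [simplex_map_apply_of_notMem y this, ite_self]
  apply stdSimplex.ext
  ext j
  by_cases hj : j ∈ range e
  · obtain ⟨k, rfl⟩ := hj
    rw [simplex_map_apply he, slide_apply, slide_apply]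
    have h1 : cumLe κ (stdSimplex.map e y) (e k) = cumLe κ' y k := by
      rw [cumLe, hsum]; simp only [hord]; rfl
    have h2 : cumLt κ (stdSimplex.map e y) (e k) = cumLt κ' y k := by
      rw [cumLt, hsum, cumLt]
      refine Finset.sum_congr (Finset.filter_congr fun a _ => ?_) fun _ _ => rfl
      rw [← not_le, hord, not_le]
    rw [h1, h2]
  · rw [simplex_map_apply_of_notMem _ hj, slide_apply_eq_zero (simplex_map_apply_of_notMem _ hj)]

end SlideMaps

/-! ### The canonical height function on a simplex -/

section Canonical

open Filter Topology

variable {ι : Type*} [Fintype ι] [DecidableEq ι] (b : ι → ℝ) (P : ι → (ℝ ≃o ℝ))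

/-- The weight of the vertex `l` above the level `t`. -/
noncomputable def upWeight (t : ℝ) (l : ι) : ℝ := max (-(P l t)) 0

/-- The mass below the level `t`, as seen from the vertex `l`. -/
noncomputable def downMass (x : ι → ℝ) (t : ℝ) (l : ι) : ℝ :=
  ∑ j, x j * max (P l t - P l (b j)) 0

/-- The point `x` lies below the level `t`. -/
def BelowLevel (x : stdSimplex ℝ ι) (t : ℝ) : Prop :=
  ∃ θ : ι → ℝ, (∀ l, 0 < θ l) ∧ ∑ l, θ l < 1 ∧ ∀ l, x l * upWeight P t l < θ l * downMass b P x t l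

/-- The point `x` lies above the level `t`. -/
def AboveLevel (x : stdSimplex ℝ ι) (t : ℝ) : Prop :=
  ∃ θ : ι → ℝ, 1 < ∑ l, θ l ∧
    ∀ l, θ l = 0 ∨ (0 ≤ θ l ∧ θ l * downMass b P x t l < x l * upWeight P t l)

/-- The point `x` lies on the level `t`. -/
def OnLevel (x : stdSimplex ℝ ι) (t : ℝ) : Prop :=
  (∃ k, x = stdSimplex.vertex k ∧ b k = t) ∨
    ((∃ j, x j ≠ 0 ∧ b j < t) ∧ ∑ l, x l * upWeight P t l / downMass b P x t l = 1)

/-- The height function on a simplex whose vertices have the heights `b`, and whose restriction to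
the edges with upper vertex `l` is linear in the coordinate `P l` of `ℝ`. -/
noncomputable def canonHeight (x : stdSimplex ℝ ι) : ℝ := sInf {t | BelowLevel b P x t}

variable {b P}

lemma upWeight_nonneg (t : ℝ) (l : ι) : 0 ≤ upWeight P t l := le_max_right _ _

lemma upWeight_pos (hP : ∀ l, P l (b l) = 0) {t : ℝ} {l : ι} (h : t < b l) :
    0 < upWeight P t l := by
  have := (P l).strictMono h
  rw [hP] at this
  exact lt_max_of_lt_left (by linarith)

lemma upWeight_eq_zero (hP : ∀ l, P l (b l) = 0) {t : ℝ} {l : ι} (h : b l ≤ t) :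
    upWeight P t l = 0 := by
  have := (P l).monotone h
  rw [hP] at this
  exact max_eq_right (by linarith)

lemma downMass_nonneg (x : stdSimplex ℝ ι) (t : ℝ) (l : ι) : 0 ≤ downMass b P x t l :=
  Finset.sum_nonneg fun j _ => mul_nonneg (x.2.1 j) (le_max_right _ _)

lemma downMass_pos {x : stdSimplex ℝ ι} {t : ℝ} (h : ∃ j, x j ≠ 0 ∧ b j < t) (l : ι) :
    0 < downMass b P x t l := by
  obtain ⟨j, hj, hjt⟩ := h
  refine Finset.sum_pos' (fun j _ => mul_nonneg (x.2.1 j) (le_max_right _ _))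
    ⟨j, Finset.mem_univ _, mul_pos (lt_of_le_of_ne (x.2.1 j) (Ne.symm hj)) ?_⟩
  exact lt_max_of_lt_left (sub_pos.2 ((P l).strictMono hjt))

lemma downMass_eq_zero {x : stdSimplex ℝ ι} {t : ℝ} (h : ¬ ∃ j, x j ≠ 0 ∧ b j < t) (l : ι) :
    downMass b P x t l = 0 := by
  push Not at h
  refine Finset.sum_eq_zero fun j _ => ?_
  by_cases hj : x j = 0
  · exact mul_eq_zero_of_left hj _
  · rw [max_eq_right (sub_nonpos.2 ((P l).monotone (h j hj))), mul_zero]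

/-- The weights θ turn a bound on a sum of quotients into inequalities between products. These are
open conditions in the point and the level, and they still make sense where the denominators vanish.
-/
lemma belowLevel_of_lt_one {x : stdSimplex ℝ ι} {t : ℝ} (h : ∃ j, x j ≠ 0 ∧ b j < t)
    (h1 : ∑ l, x l * upWeight P t l / downMass b P x t l < 1) : BelowLevel b P x t := by
  set φ := ∑ l, x l * upWeight P t l / downMass b P x t l
  have hc : (0 : ℝ) < Fintype.card ι + 1 := by positivity
  have hε : 0 < (1 - φ) / (Fintype.card ι + 1) := div_pos (by linarith) hc
  -- The slack 1 - φ is cut into one share more than there are vertices, so that the total stays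
  -- below 1.
  refine ⟨fun l => x l * upWeight P t l / downMass b P x t l + (1 - φ) / (Fintype.card ι + 1),
    fun l => ?_, ?_, fun l => ?_⟩
  · have := div_nonneg (mul_nonneg (x.2.1 l) (upWeight_nonneg (P := P) t l))
      (downMass_nonneg (b := b) (P := P) x t l)
    exact lt_of_lt_of_le hε (le_add_of_nonneg_left this)
  · rw [Finset.sum_add_distrib, Finset.sum_const, Finset.card_univ, nsmul_eq_mul]
    have : (Fintype.card ι : ℝ) * ((1 - φ) / (Fintype.card ι + 1)) < 1 - φ := by
      rw [mul_div_assoc', div_lt_iff₀ hc]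
      nlinarith
    linarith
  · have hd := downMass_pos (P := P) h l
    rw [add_mul, div_mul_cancel₀ _ hd.ne']
    have := mul_pos hε hd
    linarith

lemma aboveLevel_of_one_lt {x : stdSimplex ℝ ι} {t : ℝ} (h : ∃ j, x j ≠ 0 ∧ b j < t)
    (h1 : 1 < ∑ l, x l * upWeight P t l / downMass b P x t l) : AboveLevel b P x t := by
  set φ := ∑ l, x l * upWeight P t l / downMass b P x t l
  -- Scaling all summands by a number between 1/φ and 1 makes the inequalities strict while the sum
  -- stays above 1.
  obtain ⟨c, hc1, hc2⟩ := exists_between ((inv_lt_one₀ (by linarith)).2 h1)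
  have hc0 : 0 < c := lt_trans (inv_pos.2 (by linarith)) hc1
  refine ⟨fun l => c * (x l * upWeight P t l / downMass b P x t l), ?_, fun l => ?_⟩
  · rw [← Finset.mul_sum]
    rwa [inv_lt_iff_one_lt_mul₀ (by linarith)] at hc1
  · have hd := downMass_pos (P := P) h l
    rcases (mul_nonneg (x.2.1 l) (upWeight_nonneg (P := P) t l)).eq_or_lt with h0 | h0
    · left
      have h0 : x l * upWeight P t l = 0 := h0.symm
      simp [h0]
    · right
      refine ⟨mul_nonneg hc0.le (div_nonneg h0.le hd.le), ?_⟩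
      show c * (x l * upWeight P t l / downMass b P x t l) * downMass b P x t l <
        x l * upWeight P t l
      rw [mul_assoc, div_mul_cancel₀ _ hd.ne']
      exact mul_lt_of_lt_one_left h0 hc2

lemma eq_vertex_of_level (hb : Function.Injective b) {x : stdSimplex ℝ ι} {t : ℝ}
    (h : ∀ j, x j ≠ 0 → b j = t) : ∃ k, x = stdSimplex.vertex k ∧ b k = t := by
  obtain ⟨k, hk⟩ := support_nonempty x
  have hk : x k ≠ 0 := by simpa using hk
  refine ⟨k, eq_vertex_of_support fun l hl => ?_, h k hk⟩
  by_contra hl'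
  exact hl (hb ((h l hl').trans (h k hk).symm))

lemma onLevel_of_not (hP : ∀ l, P l (b l) = 0) (hb : Function.Injective b)
    {x : stdSimplex ℝ ι} {t : ℝ} (h1 : ¬ BelowLevel b P x t) (h2 : ¬ AboveLevel b P x t) :
    OnLevel b P x t := by
  by_cases h : ∃ j, x j ≠ 0 ∧ b j < t
  · refine Or.inr ⟨h, le_antisymm ?_ ?_⟩
    · by_contra hlt
      exact h2 (aboveLevel_of_one_lt h (not_le.1 hlt))
    · by_contra hlt
      exact h1 (belowLevel_of_lt_one h (not_le.1 hlt))
  · refine Or.inl (eq_vertex_of_level hb fun l hl => ?_)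
    have h' := h
    push Not at h'
    refine le_antisymm ?_ (h' l hl)
    by_contra hlt
    -- No mass lies below `t`, so the denominators vanish and a vertex above `t` admits any weight;
    -- 2 exceeds the bound 1.
    refine h2 ⟨fun k => if k = l then 2 else 0, by simp, fun k => ?_⟩
    by_cases hk : k = l
    · subst hk
      right
      simp only [if_true]
      rw [downMass_eq_zero h, mul_zero]
      exact ⟨by norm_num, mul_pos (lt_of_le_of_ne (x.2.1 k) (Ne.symm hl))
        (upWeight_pos hP (not_le.1 hlt))⟩
    · left; exact if_neg hk

lemma OnLevel.not_below (hP : ∀ l, P l (b l) = 0) {x : stdSimplex ℝ ι} {t : ℝ}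
    (h : OnLevel b P x t) : ¬ BelowLevel b P x t := by
  rintro ⟨θ, hθ, hs, hl⟩
  rcases h with ⟨k, rfl, hk⟩ | ⟨hB, h1⟩
  · have h0 : ¬ ∃ j, (stdSimplex.vertex k : stdSimplex ℝ ι) j ≠ 0 ∧ b j < t := by
      rintro ⟨j, hj, hjt⟩
      have : j = k := by by_contra hne; exact hj (vertex_apply_ne hne)
      rw [this, hk] at hjt
      exact lt_irrefl _ hjt
    have := hl k
    rw [downMass_eq_zero h0, mul_zero, upWeight_eq_zero hP hk.le, mul_zero] at this
    exact lt_irrefl _ this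
  · have : ∑ l, x l * upWeight P t l / downMass b P x t l ≤ ∑ l, θ l :=
      Finset.sum_le_sum fun l _ => (div_le_iff₀ (downMass_pos hB l)).2 (hl l).le
    linarith

lemma OnLevel.not_above (hP : ∀ l, P l (b l) = 0) {x : stdSimplex ℝ ι} {t : ℝ}
    (h : OnLevel b P x t) : ¬ AboveLevel b P x t := by
  rintro ⟨θ, hs, hl⟩
  rcases h with ⟨k, rfl, hk⟩ | ⟨hB, h1⟩
  · rw [Finset.sum_eq_zero fun l _ => ?_] at hs
    · linarith
    · rcases hl l with h | ⟨h0, h⟩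
      · exact h
      · exfalso
        have h3 : 0 ≤ θ l * downMass b P (stdSimplex.vertex k : stdSimplex ℝ ι) t l :=
          mul_nonneg h0 (downMass_nonneg _ _ _)
        by_cases hlk : l = k
        · subst hlk
          rw [upWeight_eq_zero hP hk.le, mul_zero] at h
          linarith
        · rw [vertex_apply_ne hlk, zero_mul] at h
          linarith
  · have : ∑ l, θ l ≤ ∑ l, x l * upWeight P t l / downMass b P x t l :=
      Finset.sum_le_sum fun l _ => by
        have hd := downMass_pos (P := P) hB l
        rcases hl l with h | ⟨_, h⟩
        · rw [h]
          exact div_nonneg (mul_nonneg (x.2.1 l) (upWeight_nonneg t l)) hd.le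
        · exact (le_div_iff₀ hd).2 h.le
    linarith

lemma downMass_mono {x : stdSimplex ℝ ι} {s t : ℝ} (h : s ≤ t) (l : ι) :
    downMass b P x s l ≤ downMass b P x t l :=
  Finset.sum_le_sum fun j _ => mul_le_mul_of_nonneg_left
    (max_le_max (sub_le_sub_right ((P l).monotone h) _) le_rfl) (x.2.1 j)

lemma upWeight_anti {s t : ℝ} (h : s ≤ t) (l : ι) : upWeight P t l ≤ upWeight P s l :=
  max_le_max (neg_le_neg ((P l).monotone h)) le_rfl

lemma BelowLevel.mono {x : stdSimplex ℝ ι} {s t : ℝ} (h : BelowLevel b P x s) (hst : s ≤ t) :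
    BelowLevel b P x t := by
  obtain ⟨θ, hθ, hs, hl⟩ := h
  exact ⟨θ, hθ, hs, fun l => (mul_le_mul_of_nonneg_left (upWeight_anti hst l) (x.2.1 l)).trans_lt
    ((hl l).trans_le (mul_le_mul_of_nonneg_left (downMass_mono hst l) (hθ l).le))⟩

/-- As the level rises the numerators decrease, strictly where they are positive, and the
denominators do not decrease. A sum equal to 1 has a positive term, so it drops below 1. -/
lemma OnLevel.below (hP : ∀ l, P l (b l) = 0) {x : stdSimplex ℝ ι} {s t : ℝ}
    (h : OnLevel b P x s) (hst : s < t) : BelowLevel b P x t := by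
  rcases h with ⟨k, rfl, hk⟩ | ⟨hB, h1⟩
  · have hB : ∃ j, (stdSimplex.vertex k : stdSimplex ℝ ι) j ≠ 0 ∧ b j < t :=
      ⟨k, by simp, hk ▸ hst⟩
    refine belowLevel_of_lt_one hB ?_
    rw [Finset.sum_eq_zero fun l _ => ?_]
    · exact one_pos
    · by_cases hlk : l = k
      · subst hlk
        rw [upWeight_eq_zero hP (hk.le.trans hst.le), mul_zero, zero_div]
      · rw [vertex_apply_ne hlk, zero_mul, zero_div]
  · have hB' : ∃ j, x j ≠ 0 ∧ b j < t := by
      obtain ⟨j, hj, hjs⟩ := hB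
      exact ⟨j, hj, hjs.trans hst⟩
    refine belowLevel_of_lt_one hB' (lt_of_lt_of_eq ?_ h1)
    have hle : ∀ l, x l * upWeight P t l / downMass b P x t l ≤
        x l * upWeight P s l / downMass b P x s l := fun l =>
      div_le_div₀ (mul_nonneg (x.2.1 l) (upWeight_nonneg _ _))
        (mul_le_mul_of_nonneg_left (upWeight_anti hst.le l) (x.2.1 l)) (downMass_pos hB l)
        (downMass_mono hst.le l)
    refine Finset.sum_lt_sum (fun l _ => hle l) ?_
    by_contra hne
    push Not at hne
    have : ∀ l, x l * upWeight P s l / downMass b P x s l = 0 := by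
      intro l
      by_contra h0
      have hpos : 0 < x l * upWeight P s l := by
        refine lt_of_le_of_ne (mul_nonneg (x.2.1 l) (upWeight_nonneg _ _)) fun h => h0 ?_
        rw [← h, zero_div]
      have hu : 0 < upWeight P s l := by
        refine lt_of_le_of_ne (upWeight_nonneg _ _) fun h => ?_
        rw [← h, mul_zero] at hpos
        exact lt_irrefl _ hpos
      have hx : 0 < x l := pos_of_mul_pos_left hpos (upWeight_nonneg _ _)
      have hlt : upWeight P t l < upWeight P s l := by
        have h3 : upWeight P s l = -(P l s) := by
          rw [upWeight] at hu ⊢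
          rcases max_choice (-(P l s)) 0 with h | h
          · exact h
          · rw [h] at hu; exact absurd hu (lt_irrefl _)
        rw [h3] at hu ⊢
        exact max_lt (neg_lt_neg ((P l).strictMono hst)) hu
      refine absurd (hne l (Finset.mem_univ _)) (not_le.2 ?_)
      exact div_lt_div₀ (mul_lt_mul_of_pos_left hlt hx) (downMass_mono hst.le l)
        (mul_nonneg hx.le (upWeight_nonneg _ _)) (downMass_pos hB l)
    rw [Finset.sum_eq_zero fun l _ => this l] at h1
    exact zero_ne_one h1

lemma not_below_and_above {x : stdSimplex ℝ ι} {t : ℝ} (h : BelowLevel b P x t) :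
    ¬ AboveLevel b P x t := by
  obtain ⟨θ, hθ, hs, hl⟩ := h
  rintro ⟨η, hη, hl'⟩
  have : ∑ l, η l ≤ ∑ l, θ l := Finset.sum_le_sum fun l _ => by
    rcases hl' l with h | ⟨_, h⟩
    · rw [h]; exact (hθ l).le
    · exact (lt_of_mul_lt_mul_right (h.trans (hl l)) (downMass_nonneg _ _ _)).le
  linarith

lemma continuous_upWeight (l : ι) : Continuous fun t => upWeight P t l :=
  ((P l).continuous.neg).max continuous_const

lemma continuous_downMass (l : ι) :
    Continuous fun q : stdSimplex ℝ ι × ℝ => downMass b P q.1 q.2 l :=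
  continuous_finsetSum _ fun j _ =>
    (((continuous_apply j).comp continuous_subtype_val).comp continuous_fst).mul
      (((((P l).continuous.comp continuous_snd).sub continuous_const)).max continuous_const)

lemma isOpen_belowLevel : IsOpen {q : stdSimplex ℝ ι × ℝ | BelowLevel b P q.1 q.2} := by
  simp only [BelowLevel, ofPred_exists, ofPred_and, ofPred_forall]
  refine isOpen_iUnion fun θ => (isOpen_iInter_of_finite fun l => isOpen_const).inter
    (isOpen_const.inter (isOpen_iInter_of_finite fun l => isOpen_lt ?_ ?_))
  · exact (((continuous_apply l).comp continuous_subtype_val).comp continuous_fst).mul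
      ((continuous_upWeight l).comp continuous_snd)
  · exact continuous_const.mul (continuous_downMass l)

lemma isOpen_aboveLevel : IsOpen {q : stdSimplex ℝ ι × ℝ | AboveLevel b P q.1 q.2} := by
  simp only [AboveLevel, ofPred_exists, ofPred_and, ofPred_forall, ofPred_or]
  refine isOpen_iUnion fun θ => isOpen_const.inter
    (isOpen_iInter_of_finite fun l => isOpen_const.union (isOpen_const.inter (isOpen_lt ?_ ?_)))
  · exact continuous_const.mul (continuous_downMass l)
  · exact (((continuous_apply l).comp continuous_subtype_val).comp continuous_fst).mul
      ((continuous_upWeight l).comp continuous_snd)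

lemma not_belowLevel_of_le {x : stdSimplex ℝ ι} {t : ℝ} (h : ∀ j, t ≤ b j) :
    ¬ BelowLevel b P x t := by
  rintro ⟨θ, hθ, hs, hl⟩
  obtain ⟨k, -⟩ := support_nonempty x
  have := hl k
  rw [downMass_eq_zero (by rintro ⟨j, -, hj⟩; exact absurd (h j) (not_le.2 hj)), mul_zero] at this
  exact absurd this (not_lt.2 (mul_nonneg (x.2.1 k) (upWeight_nonneg _ _)))

section
variable (hP : ∀ l, P l (b l) = 0) (hb : Function.Injective b)
include hP

lemma canonHeight_lt_iff {x : stdSimplex ℝ ι} {t : ℝ} :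
    canonHeight b P x < t ↔ BelowLevel b P x t := by
  obtain ⟨k, hk⟩ := support_nonempty x
  have hk : x k ≠ 0 := by simpa using hk
  have : Nonempty ι := ⟨k⟩
  have hbdd : BddBelow {t | BelowLevel b P x t} := by
    obtain ⟨j, hj⟩ := Finite.exists_min b
    refine ⟨b j, fun t ht => ?_⟩
    by_contra hlt
    exact not_belowLevel_of_le (fun i => (not_le.1 hlt).le.trans (hj i)) ht
  have hne : {t | BelowLevel b P x t}.Nonempty := by
    obtain ⟨j, hj⟩ := Finite.exists_max b
    have hlt : ∀ l, b l < b j + 1 := fun l => by linarith [hj l]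
    refine ⟨b j + 1, belowLevel_of_lt_one ⟨k, hk, hlt k⟩ ?_⟩
    rw [Finset.sum_eq_zero fun l _ => ?_]
    · exact one_pos
    · rw [upWeight_eq_zero hP (hlt l).le, mul_zero, zero_div]
  constructor
  · intro h
    obtain ⟨s, hs, hst⟩ := exists_lt_of_csInf_lt hne h
    exact BelowLevel.mono hs hst.le
  · intro h
    have ho : IsOpen {s | BelowLevel b P x s} :=
      isOpen_belowLevel.preimage (Continuous.prodMk_right x)
    obtain ⟨s, hst, hs⟩ := (mem_nhdsLE_iff_exists_Ioc_subset.1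
      (mem_nhdsWithin_of_mem_nhds (ho.mem_nhds h)))
    obtain ⟨r, hr1, hr2⟩ := exists_between (show s < t from hst)
    exact (csInf_le hbdd (hs ⟨hr1, hr2.le⟩)).trans_lt hr2

include hb

lemma lt_canonHeight_iff {x : stdSimplex ℝ ι} {t : ℝ} :
    t < canonHeight b P x ↔ AboveLevel b P x t := by
  constructor
  · intro h
    by_contra h2
    have h1 : ¬ BelowLevel b P x t := fun h1 => absurd ((canonHeight_lt_iff hP).2 h1) h.le.not_gt
    have hon := onLevel_of_not hP hb h1 h2
    obtain ⟨s, hs1, hs2⟩ := exists_between h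
    exact absurd ((canonHeight_lt_iff hP).2 (hon.below hP hs1)) hs2.le.not_gt
  · intro h
    have ho : IsOpen {s | AboveLevel b P x s} :=
      isOpen_aboveLevel.preimage (Continuous.prodMk_right x)
    obtain ⟨s, hst, hs⟩ := (mem_nhdsGE_iff_exists_Ico_subset.1
      (mem_nhdsWithin_of_mem_nhds (ho.mem_nhds h)))
    obtain ⟨r, hr1, hr2⟩ := exists_between (show t < s from hst)
    refine hr1.trans_le ?_
    by_contra hlt
    exact not_below_and_above ((canonHeight_lt_iff hP).1 (not_le.1 hlt)) (hs ⟨hr1.le, hr2⟩)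

/-- Away from the vertices the height `t` solves Σ_l x_l (-P_l t)⁺ / Σ_j x_j (P_l t - P_l b_j)⁺ = 1.
On an edge one summand survives, and the equation says that `P l t` is linear along the edge, `l`
being the upper end. The equation only sees vertices that carry mass, whence compatibility with
faces, and it is unchanged when a homeomorphism moves `t` and the `b j` while the `P l` are composed
with its inverse, whence equivariance. -/
lemma canonHeight_eq_iff {x : stdSimplex ℝ ι} {t : ℝ} :
    canonHeight b P x = t ↔ OnLevel b P x t := by
  constructor
  · intro h
    apply onLevel_of_not hP hb
    · rw [← canonHeight_lt_iff hP]; exact h.ge.not_gt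
    · rw [← lt_canonHeight_iff hP hb]; exact h.le.not_gt
  · intro h
    apply le_antisymm
    · rw [← not_lt, lt_canonHeight_iff hP hb]; exact h.not_above hP
    · rw [← not_lt, canonHeight_lt_iff hP]; exact h.not_below hP

lemma continuous_canonHeight : Continuous (canonHeight b P) := by
  rw [OrderTopology.continuous_iff]
  intro t
  constructor
  · have := (isOpen_aboveLevel (b := b) (P := P)).preimage (Continuous.prodMk_left t)
    convert this using 1
    ext x
    exact lt_canonHeight_iff hP hb
  · have := (isOpen_belowLevel (b := b) (P := P)).preimage (Continuous.prodMk_left t)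
    convert this using 1
    ext x
    exact canonHeight_lt_iff hP

lemma canonHeight_vertex (k : ι) : canonHeight b P (stdSimplex.vertex k) = b k :=
  (canonHeight_eq_iff hP hb).2 (Or.inl ⟨k, rfl, rfl⟩)

/-- At the level `t` of the earlier point, each positive summand has the mass of a vertex above `t`
in the numerator and only masses of vertices below `t` in the denominator. The flow increases these
ratios, so for the later point the sum at the same `t` exceeds 1. -/
lemma ascending_canonHeight {Γ : Type*} [LinearOrder Γ] {κ : ι → Γ} {hκ : Function.Injective κ}
    (hbκ : ∀ j l, b j < b l → κ j < κ l) : Ascending κ hκ (canonHeight b P) := by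
  refine ascending_of_interior (continuous_canonHeight hP hb) fun x hx α β h0 hαβ h1 => ?_
  set y := slide κ hκ α x with hy
  set y' := slide κ hκ β x with hy'
  have hsy : ∀ j, y j = 0 ↔ x j = 0 := fun j => slide_apply_eq_zero_iff h0 (hαβ.trans h1)
  have hsy' : ∀ j, y' j = 0 ↔ x j = 0 := fun j => slide_apply_eq_zero_iff (h0.trans hαβ) h1
  set t := canonHeight b P y with ht
  rw [lt_canonHeight_iff hP hb]
  rcases (canonHeight_eq_iff hP hb).1 ht.symm with ⟨k, hk, -⟩ | ⟨hB, hφ⟩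
  · exact absurd hk (slide_ne_vertex h0 (hαβ.trans h1) hx k)
  have hB' : ∃ j, y' j ≠ 0 ∧ b j < t := by
    obtain ⟨j, hj, hjt⟩ := hB
    exact ⟨j, by rwa [ne_eq, hsy', ← hsy], hjt⟩
  refine aboveLevel_of_one_lt hB' (lt_of_eq_of_lt hφ.symm ?_)
  have key : ∀ l, 0 < y l * upWeight P t l →
      y l * upWeight P t l / downMass b P y t l < y' l * upWeight P t l / downMass b P y' t l := by
    intro l hl
    have hu : 0 < upWeight P t l := pos_of_mul_pos_right hl (y.2.1 l)
    have hyl : y l ≠ 0 := fun h => by rw [h, zero_mul] at hl; exact lt_irrefl _ hl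
    have htl : t < b l := by
      by_contra hle
      rw [upWeight_eq_zero hP (not_lt.1 hle)] at hu
      exact lt_irrefl _ hu
    rw [div_lt_div_iff₀ (downMass_pos hB l) (downMass_pos hB' l)]
    suffices y l * downMass b P y' t l < y' l * downMass b P y t l by
      nlinarith
    rw [downMass, downMass, Finset.mul_sum, Finset.mul_sum]
    have hterm : ∀ j, x j ≠ 0 → b j < t → y l * y' j < y' l * y j := fun j hj hjt =>
      slide_ratio_lt h0 hαβ h1 hj (by rwa [ne_eq, ← hsy]) (hbκ _ _ (hjt.trans htl))
    refine Finset.sum_lt_sum (fun j _ => ?_) ?_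
    · by_cases hjt : b j < t
      · rw [← mul_assoc, ← mul_assoc]
        refine mul_le_mul_of_nonneg_right ?_ (le_max_right _ _)
        by_cases hj : x j = 0
        · rw [(hsy j).2 hj, (hsy' j).2 hj, mul_zero, mul_zero]
        · exact (hterm j hj hjt).le
      · rw [max_eq_right (sub_nonpos.2 ((P l).monotone (not_lt.1 hjt)))]
        simp
    · obtain ⟨j, hj, hjt⟩ := hB
      refine ⟨j, Finset.mem_univ _, ?_⟩
      rw [← mul_assoc, ← mul_assoc]
      exact mul_lt_mul_of_pos_right (hterm j (by rwa [ne_eq, ← hsy]) hjt)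
        (lt_max_of_lt_left (sub_pos.2 ((P l).strictMono hjt)))
  refine Finset.sum_lt_sum (fun l _ => ?_) ?_
  · rcases (mul_nonneg (y.2.1 l) (upWeight_nonneg (P := P) t l)).eq_or_lt with h | h
    · have h : y l * upWeight P t l = 0 := h.symm
      rw [h, zero_div]
      exact div_nonneg (mul_nonneg (y'.2.1 l) (upWeight_nonneg _ _)) (downMass_nonneg _ _ _)
    · exact (key l h).le
  · by_contra hne
    push Not at hne
    rw [Finset.sum_eq_zero fun l hl => ?_] at hφ
    · exact zero_ne_one hφ
    · rcases (mul_nonneg (y.2.1 l) (upWeight_nonneg (P := P) t l)).eq_or_lt with h | h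
      · have h : y l * upWeight P t l = 0 := h.symm
        rw [h, zero_div]
      · exact absurd (key l h) (not_lt.2 (hne l hl))

lemma canonHeight_edge {j k : ι} (hjk : ∀ l, l = j ∨ l = k) (hbj : b j = 0) (hbk : b k < 0)
    (hid : ∀ t, P j t = t) (x : stdSimplex ℝ ι) : canonHeight b P x = ∑ l, x l * b l := by
  have hne : j ≠ k := by rintro rfl; linarith
  have hsum : ∀ f : ι → ℝ, ∑ l, f l = f j + f k := by
    intro f
    have : (Finset.univ : Finset ι) = {j, k} := by
      ext l; simpa using hjk l
    rw [this, Finset.sum_pair hne]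
  have h1 : x j + x k = 1 := by rw [← hsum (fun l => x l)]; exact x.2.2
  rw [canonHeight_eq_iff hP hb, hsum, hbj, mul_zero, zero_add]
  by_cases hxj : x j = 0
  · refine Or.inl ⟨k, eq_vertex_of_support fun l hl => ?_, ?_⟩
    · rcases hjk l with rfl | rfl
      exacts [hxj, absurd rfl hl]
    · rw [hxj, zero_add] at h1
      rw [h1, one_mul]
  by_cases hxk : x k = 0
  · refine Or.inl ⟨j, eq_vertex_of_support fun l hl => ?_, ?_⟩
    · rcases hjk l with rfl | rfl
      exacts [absurd rfl hl, hxk]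
    · rw [hxk, zero_mul, hbj]
  have pj : 0 < x j := lt_of_le_of_ne (x.2.1 j) (Ne.symm hxj)
  have pk : 0 < x k := lt_of_le_of_ne (x.2.1 k) (Ne.symm hxk)
  have ht0 : x k * b k < 0 := mul_neg_of_pos_of_neg pk hbk
  have htk : b k < x k * b k := by nlinarith
  refine Or.inr ⟨⟨k, hxk, htk⟩, ?_⟩
  rw [hsum, upWeight_eq_zero hP htk.le, mul_zero, zero_div, add_zero, downMass, hsum, upWeight,
    hid, hid, hid, hbj, sub_zero, max_eq_right ht0.le, max_eq_left (by linarith),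
    max_eq_left (by linarith), mul_zero, zero_add, div_eq_one_iff_eq]
  · have : x j = 1 - x k := by linarith
    rw [this]; ring
  · have : x k * b k - b k ≠ 0 := by linarith
    exact mul_ne_zero hxk this

lemma canonHeight_map {ι' : Type*} [Fintype ι'] [DecidableEq ι'] {e : ι' → ι}
    (he : Function.Injective e) (y : stdSimplex ℝ ι') :
    canonHeight b P (stdSimplex.map e y) = canonHeight (b ∘ e) (P ∘ e) y := by
  have hP' : ∀ l, (P ∘ e) l ((b ∘ e) l) = 0 := fun l => hP (e l)
  have hsum : ∀ f : ι → ℝ → ℝ, (∀ l, f l 0 = 0) →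
      ∑ l, f l (stdSimplex.map e y l) = ∑ k, f (e k) (y k) := by
    intro f hf
    rw [← Finset.sum_subset (Finset.subset_univ (Finset.univ.image e))]
    · rw [Finset.sum_image fun a _ b _ h => he h]
      simp only [simplex_map_apply he]
    · intro j _ hj
      have : j ∉ range e := by simpa using hj
      rw [simplex_map_apply_of_notMem y this, hf]
  rw [canonHeight_eq_iff hP hb]
  rcases (canonHeight_eq_iff hP' (hb.comp he) (x := y)).1 rfl with ⟨k, hk, hbk⟩ | ⟨hB, hφ⟩
  · refine Or.inl ⟨e k, ?_, hbk⟩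
    rw [hk]
    exact stdSimplex.map_vertex e k
  · right
    set t := canonHeight (b ∘ e) (P ∘ e) y
    obtain ⟨j, hj, hjt⟩ := hB
    refine ⟨⟨e j, by rwa [simplex_map_apply he], hjt⟩, ?_⟩
    rw [← hφ, hsum (fun l z => z * upWeight P t l /
      downMass b P (stdSimplex.map e y) t l) (fun l => by simp)]
    refine Finset.sum_congr rfl fun k _ => ?_
    congr 1
    rw [downMass, hsum (fun l z => z * max (P (e k) t - P (e k) (b l)) 0) (fun l => by simp)]
    rfl

lemma canonHeight_equivariant {b' : ι → ℝ} {P' : ι → (ℝ ≃o ℝ)} (hP' : ∀ l, P' l (b' l) = 0)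
    (r : ℝ ≃o ℝ) (hbr : ∀ j, b' j = r (b j)) (hPr : ∀ l t, P' l (r t) = P l t)
    (x : stdSimplex ℝ ι) : canonHeight b' P' x = r (canonHeight b P x) := by
  have hb' : Function.Injective b' := fun j k h => hb (r.injective (by rw [← hbr, ← hbr, h]))
  rw [canonHeight_eq_iff hP' hb']
  set t := canonHeight b P x with ht
  rcases (canonHeight_eq_iff hP hb).1 ht.symm with ⟨k, hk, hbk⟩ | ⟨⟨j, hj, hjt⟩, hφ⟩
  · exact Or.inl ⟨k, hk, by rw [hbr, hbk]⟩
  · refine Or.inr ⟨⟨j, hj, by rw [hbr]; exact r.strictMono hjt⟩, ?_⟩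
    rw [← hφ]
    simp only [upWeight, downMass, hbr, hPr]

/-- In a simplex of dimension at most two the level sets are straight. -/
lemma convex_canonHeight (hcard : Fintype.card ι ≤ 3) (t : ℝ) :
    Convex ℝ ((Subtype.val : stdSimplex ℝ ι → ι → ℝ) '' {x | canonHeight b P x = t}) := by
  have hlin : ∀ c : ι → ℝ, (∀ x : stdSimplex ℝ ι, canonHeight b P x = t ↔ ∑ l, c l * x l = 0) →
      Convex ℝ ((Subtype.val : stdSimplex ℝ ι → ι → ℝ) '' {x | canonHeight b P x = t}) := by
    intro c hc
    have : (Subtype.val : stdSimplex ℝ ι → ι → ℝ) '' {x | canonHeight b P x = t} =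
        stdSimplex ℝ ι ∩ {x | ∑ l, c l * x l = 0} := by
      ext x
      constructor
      · rintro ⟨y, hy, rfl⟩
        exact ⟨y.2, (hc y).1 hy⟩
      · rintro ⟨hx, h⟩
        exact ⟨⟨x, hx⟩, (hc ⟨x, hx⟩).2 h, rfl⟩
    rw [this]
    refine (convex_stdSimplex ℝ ι).inter ?_
    intro x hx y hy u v _ _ _
    simp only [mem_ofPred] at *
    have : ∑ l, c l * (u • x + v • y) l = u * ∑ l, c l * x l + v * ∑ l, c l * y l := by
      rw [Finset.mul_sum, Finset.mul_sum, ← Finset.sum_add_distrib]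
      refine Finset.sum_congr rfl fun l _ => ?_
      simp; ring
    rw [this, hx, hy]; ring
  have hvert : (∀ x : stdSimplex ℝ ι, canonHeight b P x = t →
      ∃ k, x = stdSimplex.vertex k ∧ b k = t) →
      Convex ℝ ((Subtype.val : stdSimplex ℝ ι → ι → ℝ) '' {x | canonHeight b P x = t}) := by
    intro h
    refine Set.Subsingleton.convex ?_
    rintro _ ⟨x, hx, rfl⟩ _ ⟨y, hy, rfl⟩
    obtain ⟨k, rfl, hk⟩ := h x hx
    obtain ⟨l, rfl, hl⟩ := h y hy
    rw [hb (hk.trans hl.symm)]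
  have hneutral : ∀ x : stdSimplex ℝ ι, (¬ ∃ j, x j ≠ 0 ∧ b j < t) →
      (∀ l, x l * upWeight P t l = 0) → ∃ k, x = stdSimplex.vertex k ∧ b k = t := by
    intro x h1 h2
    push Not at h1
    refine eq_vertex_of_level hb fun j hj => le_antisymm ?_ (h1 j hj)
    by_contra hlt
    exact hj ((mul_eq_zero.1 (h2 j)).resolve_right (upWeight_pos hP (not_le.1 hlt)).ne')
  set B := Finset.univ.filter fun j => b j < t with hB
  set A := Finset.univ.filter fun j => t < b j with hA
  have hAB : A.card + B.card ≤ 3 := by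
    rw [← Finset.card_union_of_disjoint]
    · exact (Finset.card_le_univ _).trans hcard
    · rw [Finset.disjoint_left]
      intro j h1 h2
      simp [hA] at h1
      simp [hB] at h2
      linarith
  rcases Nat.eq_zero_or_pos B.card with h0 | hBpos
  · apply hvert
    intro x hx
    rcases (canonHeight_eq_iff hP hb).1 hx with h | ⟨⟨j, -, hj⟩, -⟩
    · exact h
    · rw [Finset.card_eq_zero, Finset.filter_eq_empty_iff] at h0
      exact absurd hj (h0 (Finset.mem_univ j))
  rcases Nat.eq_zero_or_pos A.card with h0 | hApos
  · apply hvert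
    intro x hx
    rcases (canonHeight_eq_iff hP hb).1 hx with h | ⟨-, hφ⟩
    · exact h
    · rw [Finset.card_eq_zero, Finset.filter_eq_empty_iff] at h0
      rw [Finset.sum_eq_zero fun l _ => ?_] at hφ
      · exact absurd hφ zero_ne_one
      · rw [upWeight_eq_zero hP (not_lt.1 (h0 (Finset.mem_univ l))), mul_zero, zero_div]
  -- With at most three vertices, one side of the level has a single vertex. A single vertex above
  -- leaves one summand; a single vertex below gives all denominators a common factor `x j`. Either
  -- way the equation becomes linear.
  rcases (show A.card = 1 ∨ B.card = 1 by omega) with h1 | h1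
  · obtain ⟨l, hl⟩ := Finset.card_eq_one.1 h1
    have hup : ∀ k, k ≠ l → upWeight P t k = 0 := by
      intro k hk
      refine upWeight_eq_zero hP ?_
      by_contra hlt
      have : k ∈ A := by simp [hA]; linarith
      rw [hl, Finset.mem_singleton] at this
      exact hk this
    refine hlin (fun k => (if k = l then upWeight P t l else 0) -
      max (P l t - P l (b k)) 0) fun x => ?_
    have hsum : ∑ k, ((if k = l then upWeight P t l else 0) - max (P l t - P l (b k)) 0) * x k =
        x l * upWeight P t l - downMass b P x t l := by
      simp only [sub_mul, Finset.sum_sub_distrib, ite_mul, zero_mul, Finset.sum_ite_eq',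
        Finset.mem_univ, if_true, downMass]
      rw [mul_comm]
      congr 1
      exact Finset.sum_congr rfl fun k _ => mul_comm _ _
    rw [hsum, canonHeight_eq_iff hP hb]
    by_cases hBx : ∃ j, x j ≠ 0 ∧ b j < t
    · have hd := downMass_pos (P := P) hBx l
      have hφ : ∑ k, x k * upWeight P t k / downMass b P x t k =
          x l * upWeight P t l / downMass b P x t l := by
        refine Finset.sum_eq_single l (fun k _ hk => ?_) (by simp)
        rw [hup k hk, mul_zero, zero_div]
      rw [OnLevel, hφ, div_eq_one_iff_eq hd.ne', sub_eq_zero]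
      constructor
      · rintro (⟨k, rfl, hk⟩ | ⟨-, h⟩)
        · obtain ⟨j, hj, hjt⟩ := hBx
          have : j = k := by by_contra h; exact hj (vertex_apply_ne h)
          rw [this, hk] at hjt
          exact absurd hjt (lt_irrefl _)
        · exact h
      · exact fun h => Or.inr ⟨hBx, h⟩
    · rw [downMass_eq_zero hBx, sub_zero]
      constructor
      · rintro (⟨k, rfl, hk⟩ | ⟨h, -⟩)
        · by_cases hlk : l = k
          · rw [upWeight_eq_zero hP (hlk ▸ hk.le), mul_zero]
          · rw [vertex_apply_ne hlk, zero_mul]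
        · exact absurd h hBx
      · intro h
        refine Or.inl (hneutral x hBx fun k => ?_)
        by_cases hk : k = l
        · rw [hk, h]
        · rw [hup k hk, mul_zero]
  · obtain ⟨j, hj⟩ := Finset.card_eq_one.1 h1
    have hjt : b j < t := by
      have : j ∈ B := by rw [hj]; simp
      simpa [hB] using this
    have hBj : ∀ k, b k < t → k = j := by
      intro k hk
      have : k ∈ B := by simpa [hB] using hk
      rw [hj, Finset.mem_singleton] at this
      exact this
    have hd : ∀ l, 0 < P l t - P l (b j) := fun l => sub_pos.2 ((P l).strictMono hjt)
    have hdown : ∀ (x : stdSimplex ℝ ι) l, downMass b P x t l = x j * (P l t - P l (b j)) := by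
      intro x l
      rw [downMass, Finset.sum_eq_single j, max_eq_left (hd l).le]
      · intro k _ hk
        rw [max_eq_right (sub_nonpos.2 ((P l).monotone (not_lt.1 fun h => hk (hBj k h)))), mul_zero]
      · simp
    refine hlin (fun l => upWeight P t l / (P l t - P l (b j)) - if l = j then 1 else 0)
      fun x => ?_
    have hsum : ∑ l, (upWeight P t l / (P l t - P l (b j)) - if l = j then 1 else 0) * x l =
        ∑ l, x l * (upWeight P t l / (P l t - P l (b j))) - x j := by
      simp only [sub_mul, Finset.sum_sub_distrib, ite_mul, one_mul, zero_mul, Finset.sum_ite_eq',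
        Finset.mem_univ, if_true]
      congr 1
      exact Finset.sum_congr rfl fun k _ => mul_comm _ _
    rw [hsum, canonHeight_eq_iff hP hb, sub_eq_zero]
    by_cases hxj : x j = 0
    · have hBx : ¬ ∃ j, x j ≠ 0 ∧ b j < t := by
        rintro ⟨k, hk, hkt⟩
        rw [hBj k hkt] at hk
        exact hk hxj
      rw [hxj]
      constructor
      · rintro (⟨k, rfl, hk⟩ | ⟨h, -⟩)
        · refine Finset.sum_eq_zero fun l _ => ?_
          by_cases hlk : l = k
          · rw [upWeight_eq_zero hP (hlk ▸ hk.le), zero_div, mul_zero]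
          · rw [vertex_apply_ne hlk, zero_mul]
        · exact absurd h hBx
      · intro h
        refine Or.inl (hneutral x hBx fun k => ?_)
        have := (Finset.sum_eq_zero_iff_of_nonneg fun l _ => mul_nonneg (x.2.1 l)
          (div_nonneg (upWeight_nonneg _ _) (hd l).le)).1 h k (Finset.mem_univ k)
        rw [mul_div_assoc', div_eq_zero_iff] at this
        exact this.resolve_right (hd k).ne'
    · have hφ : ∑ l, x l * upWeight P t l / downMass b P x t l =
          (∑ l, x l * (upWeight P t l / (P l t - P l (b j)))) / x j := by
        rw [Finset.sum_div]
        refine Finset.sum_congr rfl fun l _ => ?_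
        rw [hdown]
        have := (hd l).ne'
        field_simp
      rw [OnLevel, hφ, div_eq_one_iff_eq hxj]
      constructor
      · rintro (⟨k, rfl, hk⟩ | ⟨-, h⟩)
        · have : j = k := by by_contra h; exact hxj (vertex_apply_ne h)
          rw [← this] at hk
          exact absurd hk hjt.ne
        · exact h
      · exact fun h => Or.inr ⟨⟨j, hxj, hjt⟩, h⟩

end

/-- When the `P l` are the translations by `-b l`, all denominators agree and the level equation
reads Σ x_j (b_j - t) = 0. So the linear function is itself a canonical height. -/
lemma ascending_linear (hb : Function.Injective b) {Γ : Type*} [LinearOrder Γ] {κ : ι → Γ}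
    {hκ : Function.Injective κ} (hbκ : ∀ j l, b j < b l → κ j < κ l) :
    Ascending κ hκ fun x => ∑ j, b j * x j := by
  set P : ι → (ℝ ≃o ℝ) := fun l => OrderIso.addRight (-b l)
  have hPa : ∀ l t, P l t = t - b l := fun l t => by simp [P, sub_eq_add_neg]
  have hP : ∀ l, P l (b l) = 0 := fun l => by rw [hPa, sub_self]
  convert ascending_canonHeight hP hb hbκ (hκ := hκ) using 1
  ext x
  symm
  rw [canonHeight_eq_iff hP hb]
  set t := ∑ j, b j * x j with ht
  have h1 : ∑ j, x j = 1 := x.2.2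
  have hz : ∑ j, x j * (b j - t) = 0 := by
    simp only [mul_sub, Finset.sum_sub_distrib, ← Finset.sum_mul, h1, one_mul, ht]
    rw [sub_eq_zero]
    exact Finset.sum_congr rfl fun j _ => mul_comm _ _
  by_cases hB : ∃ j, x j ≠ 0 ∧ b j < t
  · refine Or.inr ⟨hB, ?_⟩
    have hdm : ∀ l, downMass b P x t l = ∑ j, x j * max (t - b j) 0 := by
      intro l
      simp only [downMass, hPa, sub_sub_sub_cancel_right]
    have hup : ∀ l, upWeight P t l = max (b l - t) 0 := fun l => by rw [upWeight, hPa, neg_sub]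
    obtain ⟨k, -⟩ := id hB
    have hd := downMass_pos (P := P) hB k
    rw [hdm] at hd
    simp only [hdm, hup, ← Finset.sum_div]
    rw [div_eq_one_iff_eq hd.ne', ← sub_eq_zero, ← Finset.sum_sub_distrib]
    refine Eq.trans ?_ hz
    refine Finset.sum_congr rfl fun j _ => ?_
    rw [← mul_sub]
    congr 1
    rcases le_total t (b j) with h | h
    · rw [max_eq_left (by linarith), max_eq_right (by linarith), sub_zero]
    · rw [max_eq_right (by linarith), max_eq_left (by linarith)]; ring
  · left
    push Not at hB
    refine eq_vertex_of_level hb fun j hj => ?_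
    have hnn : ∀ j ∈ Finset.univ, 0 ≤ x j * (b j - t) := fun j _ => by
      by_cases hj : x j = 0
      · rw [hj, zero_mul]
      · exact mul_nonneg (x.2.1 j) (sub_nonneg.2 (hB j hj))
    have := (Finset.sum_eq_zero_iff_of_nonneg hnn).1 hz j (Finset.mem_univ j)
    have := (mul_eq_zero.1 this).resolve_left hj
    linarith

end Canonical

/-! ### Tight realizations of a countable order in the line -/

section Realization

open Filter Topology

variable {A : Type*} [LinearOrder A]

/-- The open convex hull of the image of `i`. -/
def openHull (i : A → ℝ) : Set ℝ := {t | ∃ g h, i g < t ∧ t < i h}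

/-- Every gap of the image of `j` is a jump of the order. -/
def IsTight (j : A → ℝ) : Prop :=
  ∀ s t, s < t → (∃ g, s < j g ∧ j g < t) ∨ ∃ g h, g ⋖ h ∧ j g ≤ s ∧ t ≤ j h

/-- `ψ` extends the map `i g ↦ j g`, affinely over the jumps of the order. -/
structure IsExtension (i j : A → ℝ) (ψ : ℝ → ℝ) : Prop where
  mono : MonotoneOn ψ (openHull i)
  orbit : ∀ g, ψ (i g) = j g
  jump : ∀ g h, g ⋖ h → ∀ t ∈ Icc (i g) (i h),
    ψ t = j g + (j h - j g) * ((t - i g) / (i h - i g))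

/-- The values over which the supremum is taken in `extend`. -/
def extendSet (i j : A → ℝ) (t : ℝ) : Set ℝ :=
  {y | ∃ g, i g ≤ t ∧ (y = j g ∨ ∃ h, g ⋖ h ∧
    y = j g + (j h - j g) * min 1 ((t - i g) / (i h - i g)))}

/-- The extension of the map `i g ↦ j g`. -/
noncomputable def extend (i j : A → ℝ) (t : ℝ) : ℝ := sSup (extendSet i j t)

lemma isOpen_openHull (i : A → ℝ) : IsOpen (openHull i) := by
  have : openHull i = ⋃ g, ⋃ h, Ioo (i g) (i h) := by
    ext t; simp [openHull]
  rw [this]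
  exact isOpen_iUnion fun g => isOpen_iUnion fun h => isOpen_Ioo

lemma ordConnected_openHull (i : A → ℝ) : (openHull i).OrdConnected :=
  ⟨fun _ ⟨g, _, hg, _⟩ _ ⟨_, h, _, hh⟩ _ ht => ⟨g, h, hg.trans_le ht.1, ht.2.trans_lt hh⟩⟩

lemma mem_openHull [NoMinOrder A] [NoMaxOrder A] {i : A → ℝ} (hi : StrictMono i) (g : A) :
    i g ∈ openHull i := by
  obtain ⟨a, ha⟩ := exists_lt g
  obtain ⟨b, hb⟩ := exists_gt g
  exact ⟨a, b, hi ha, hi hb⟩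

variable {i j k : A → ℝ}

lemma extendSet_le (hi : StrictMono i) (hj : StrictMono j) {t : ℝ} {c : A} (htc : t ≤ i c) :
    ∀ y ∈ extendSet i j t, y ≤ j c := by
  rintro y ⟨g, hg, hy⟩
  have hgc : g ≤ c := hi.le_iff_le.1 (hg.trans htc)
  rcases hy with rfl | ⟨h, hgh, rfl⟩
  · exact hj.monotone hgc
  · have h1 : 0 < j h - j g := sub_pos.2 (hj hgh.lt)
    rcases hgc.eq_or_lt with rfl | hlt
    · have : t = i g := le_antisymm htc hg
      rw [this, sub_self, zero_div, min_eq_right zero_le_one, mul_zero, add_zero]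
    · have h2 : j h ≤ j c := hj.monotone (hgh.ge_of_gt hlt)
      have h3 := mul_le_mul_of_nonneg_left (min_le_left 1 ((t - i g) / (i h - i g))) h1.le
      linarith

/-- The values `j g` over orbit points to the left of `t` already give a monotone supremum; the
second kind of element interpolates over jumps, and its `min 1` keeps it at or below the value at
the far end of the jump. -/
lemma isExtension_extend (hi : StrictMono i) (hj : StrictMono j) :
    IsExtension i j (extend i j) := by
  have orbit : ∀ g, extend i j (i g) = j g := fun g =>
    IsGreatest.csSup_eq ⟨⟨g, le_rfl, Or.inl rfl⟩, extendSet_le hi hj le_rfl⟩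
  refine ⟨?_, orbit, ?_⟩
  · rintro s ⟨a, -, ha, -⟩ t ⟨-, b, -, hb⟩ hst
    refine csSup_le ⟨j a, a, ha.le, Or.inl rfl⟩ ?_
    have hbdd : BddAbove (extendSet i j t) := ⟨j b, extendSet_le hi hj hb.le⟩
    rintro y ⟨g, hg, rfl | ⟨h, hgh, rfl⟩⟩
    · exact le_csSup hbdd ⟨g, hg.trans hst, Or.inl rfl⟩
    · refine le_trans ?_ (le_csSup hbdd ⟨g, hg.trans hst, Or.inr ⟨h, hgh, rfl⟩⟩)
      have h1 : 0 < j h - j g := sub_pos.2 (hj hgh.lt)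
      have h2 : 0 < i h - i g := sub_pos.2 (hi hgh.lt)
      gcongr
  · intro g h hgh t ht
    have h1 : 0 < j h - j g := sub_pos.2 (hj hgh.lt)
    have h2 : 0 < i h - i g := sub_pos.2 (hi hgh.lt)
    rcases ht.2.eq_or_lt with rfl | hlt
    · rw [orbit, div_self h2.ne']; ring
    have h3 : min 1 ((t - i g) / (i h - i g)) = (t - i g) / (i h - i g) :=
      min_eq_right ((div_le_one h2).2 (by linarith))
    refine IsGreatest.csSup_eq ⟨⟨g, ht.1, Or.inr ⟨h, hgh, by rw [h3]⟩⟩, ?_⟩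
    have h4 : 0 ≤ (j h - j g) * ((t - i g) / (i h - i g)) :=
      mul_nonneg h1.le (div_nonneg (sub_nonneg.2 ht.1) h2.le)
    rintro y ⟨g', hg', hy⟩
    have hle : g' ≤ g := by
      by_contra hlt'
      exact absurd (hi.monotone (hgh.ge_of_gt (not_le.1 hlt'))) (not_le.2 (hg'.trans_lt hlt))
    rcases hle.eq_or_lt with rfl | hlt'
    · rcases hy with rfl | ⟨h', hgh', rfl⟩
      · linarith
      · rw [hgh'.unique_right hgh, h3]
    · have h5 := extendSet_le hi hj le_rfl (c := g) (j := j)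
      have : y ≤ j g := by
        rcases hy with rfl | ⟨h', hgh', rfl⟩
        · exact (hj hlt').le
        · have h6 : j h' ≤ j g := hj.monotone (hgh'.ge_of_gt hlt')
          have h7 : 0 < j h' - j g' := sub_pos.2 (hj hgh'.lt)
          have h8 := mul_le_mul_of_nonneg_left
            (min_le_left 1 ((t - i g') / (i h' - i g'))) h7.le
          linarith
      linarith

namespace IsExtension

variable {ψ χ : ℝ → ℝ}

lemma le_of_le [NoMinOrder A] [NoMaxOrder A] (hi : StrictMono i) (hψ : IsExtension i j ψ)
    {t : ℝ} (ht : t ∈ openHull i) {g : A} (h : i g ≤ t) : j g ≤ ψ t := by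
  rw [← hψ.orbit]
  exact hψ.mono (mem_openHull hi g) ht h

lemma ge_of_ge [NoMinOrder A] [NoMaxOrder A] (hi : StrictMono i) (hψ : IsExtension i j ψ)
    {t : ℝ} (ht : t ∈ openHull i) {g : A} (h : t ≤ i g) : ψ t ≤ j g := by
  rw [← hψ.orbit]
  exact hψ.mono ht (mem_openHull hi g) h

/-- If two extensions differed at a point, tightness would put between their values either some `j
g`, which contradicts monotonicity, or a piece of a jump, where both are given by the same formula.
-/
lemma eqOn [NoMinOrder A] [NoMaxOrder A] (hi : StrictMono i) (hj : IsTight j)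
    (hψ : IsExtension i j ψ) (hχ : IsExtension i j χ) : EqOn ψ χ (openHull i) := by
  have key : ∀ {ψ χ : ℝ → ℝ}, IsExtension i j ψ → IsExtension i j χ →
      ∀ t ∈ openHull i, ψ t ≤ χ t := by
    intro ψ χ hψ hχ t ht
    by_contra hlt
    push Not at hlt
    rcases hj _ _ hlt with ⟨g, h1, h2⟩ | ⟨g, h, hgh, h1, h2⟩
    · rcases le_total t (i g) with h | h
      · exact absurd (hψ.ge_of_ge hi ht h) (not_le.2 h2)
      · exact absurd (hχ.le_of_le hi ht h) (not_le.2 h1)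
    · rcases le_total t (i g) with h3 | h3
      · have := hψ.ge_of_ge hi ht h3
        linarith
      · rcases le_total (i h) t with h4 | h4
        · have := hχ.le_of_le hi ht h4
          linarith
        · rw [hψ.jump g h hgh t ⟨h3, h4⟩, hχ.jump g h hgh t ⟨h3, h4⟩] at hlt
          exact lt_irrefl _ hlt
  exact fun t ht => le_antisymm (key hψ hχ t ht) (key hχ hψ t ht)

/-- By tightness the values meet every open interval, and a monotone function with dense values is
continuous. -/
lemma continuousAt [NoMinOrder A] [NoMaxOrder A] (hi : StrictMono i) (hjm : StrictMono j)
    (hj : IsTight j) (hψ : IsExtension i j ψ) {t : ℝ} (ht : t ∈ openHull i) :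
    ContinuousAt ψ t := by
  have key : ∀ s r, s < r → ∃ c ∈ openHull i, ψ c ∈ Ioo s r := by
    intro s r hsr
    rcases hj s r hsr with ⟨g, h1, h2⟩ | ⟨g, h, hgh, h1, h2⟩
    · exact ⟨i g, mem_openHull hi g, by rw [hψ.orbit]; exact ⟨h1, h2⟩⟩
    · obtain ⟨m, hm1, hm2⟩ := exists_between hsr
      have hjp : 0 < j h - j g := sub_pos.2 (hjm hgh.lt)
      have hip : 0 < i h - i g := sub_pos.2 (hi hgh.lt)
      set u := (m - j g) / (j h - j g)
      have hu0 : 0 ≤ u := div_nonneg (by linarith) hjp.le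
      have hu1 : u ≤ 1 := (div_le_one hjp).2 (by linarith)
      have hc : i g + (i h - i g) * u ∈ Icc (i g) (i h) := by
        constructor
        · nlinarith
        · nlinarith
      refine ⟨_, (ordConnected_openHull i).out (mem_openHull hi g) (mem_openHull hi h) hc, ?_⟩
      rw [hψ.jump g h hgh _ hc, add_sub_cancel_left, mul_div_cancel_left₀ _ hip.ne',
        mul_div_cancel₀ _ hjp.ne', add_sub_cancel]
      exact ⟨hm1, hm2⟩
  exact continuousAt_of_monotoneOn_of_exists_between hψ.mono ((isOpen_openHull i).mem_nhds ht)
    (fun b hb => key b _ hb) fun b hb => key _ b hb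

lemma comp (hψ : IsExtension i j ψ) (hχ : IsExtension j k χ)
    (hi : StrictMono i) (hj : StrictMono j) (hmaps : MapsTo ψ (openHull i) (openHull j)) :
    IsExtension i k (χ ∘ ψ) := by
  refine ⟨fun s hs t ht hst => hχ.mono (hmaps hs) (hmaps ht) (hψ.mono hs ht hst),
    fun g => by rw [Function.comp_apply, hψ.orbit, hχ.orbit], fun g h hgh t ht => ?_⟩
  have hip : 0 < i h - i g := sub_pos.2 (hi hgh.lt)
  have hjp : 0 < j h - j g := sub_pos.2 (hj hgh.lt)
  have h0 : 0 ≤ (t - i g) / (i h - i g) := div_nonneg (sub_nonneg.2 ht.1) hip.le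
  have h1 : (t - i g) / (i h - i g) ≤ 1 := (div_le_one hip).2 (by linarith [ht.2])
  have e := hψ.jump g h hgh t ht
  have hmem : ψ t ∈ Icc (j g) (j h) := by
    rw [e]
    constructor <;> nlinarith
  rw [Function.comp_apply, hχ.jump g h hgh _ hmem, e, add_sub_cancel_left,
    mul_div_cancel_left₀ _ hjp.ne']

lemma reindex (σ : A ≃o A) (hψ : IsExtension i j ψ) : IsExtension (i ∘ σ) (j ∘ σ) ψ := by
  have hull : openHull (i ∘ σ) = openHull i := by
    ext t
    constructor
    · rintro ⟨g, h, h1, h2⟩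
      exact ⟨σ g, σ h, h1, h2⟩
    · rintro ⟨g, h, h1, h2⟩
      exact ⟨σ.symm g, σ.symm h, by simpa using h1, by simpa using h2⟩
  refine ⟨by rw [hull]; exact hψ.mono, fun g => hψ.orbit _, fun g h hgh t ht => ?_⟩
  exact hψ.jump _ _ ((apply_covBy_apply_iff σ).2 hgh) t ht

end IsExtension

/-- A dense-as-possible unbounded embedding of an order in the line. -/
structure IsTightRealization (j : A → ℝ) : Prop where
  strictMono : StrictMono j
  tight : IsTight j
  hull : openHull j = univ

lemma IsTightRealization.reindex {j : A → ℝ} (hj : IsTightRealization j) (σ : A ≃o A) :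
    IsTightRealization (j ∘ σ) := by
  refine ⟨hj.strictMono.comp σ.strictMono, fun s t hst => ?_, ?_⟩
  · rcases hj.tight s t hst with ⟨g, h1, h2⟩ | ⟨g, h, hgh, h1, h2⟩
    · exact Or.inl ⟨σ.symm g, by simpa using ⟨h1, h2⟩⟩
    · exact Or.inr ⟨σ.symm g, σ.symm h, (apply_covBy_apply_iff σ.symm).2 hgh,
        by simpa using h1, by simpa using h2⟩
  · rw [eq_univ_iff_forall]
    intro t
    obtain ⟨g, h, h1, h2⟩ := hj.hull ▸ mem_univ t
    exact ⟨σ.symm g, σ.symm h, by simpa using h1, by simpa using h2⟩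

/-- A countable order without endpoints, with rational intervals glued into its jumps. -/
def FilledOrder (A : Type*) [LinearOrder A] : Type _ :=
  {x : A ×ₗ ℚ // (0 ≤ (ofLex x).2 ∧ (ofLex x).2 < 1) ∧
    ((∀ h, ¬ (ofLex x).1 ⋖ h) → (ofLex x).2 = 0)}

noncomputable instance : LinearOrder (FilledOrder A) := by
  unfold FilledOrder; infer_instance

lemma FilledOrder.lt_iff (x y : FilledOrder A) :
    x < y ↔ (ofLex x.1).1 < (ofLex y.1).1 ∨
      (ofLex x.1).1 = (ofLex y.1).1 ∧ (ofLex x.1).2 < (ofLex y.1).2 := Prod.Lex.lt_iff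

/-- The inclusion of an order in the filled order. -/
def FilledOrder.incl (g : A) : FilledOrder A :=
  ⟨toLex (g, 0), ⟨le_rfl, one_pos⟩, fun _ => rfl⟩

/-- The filled order is countable, dense and without end points, hence isomorphic to ℚ, and the
original order is placed inside ℚ by this isomorphism. Nothing but the fillings of jumps is left
between its points. -/
lemma exists_isTightRealization (A : Type*) [LinearOrder A] [Countable A] [Nonempty A]
    [NoMinOrder A] [NoMaxOrder A] : ∃ j : A → ℝ, IsTightRealization j := by
  have : Countable (FilledOrder A) := by
    have : Countable (A ×ₗ ℚ) := inferInstanceAs (Countable (A × ℚ))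
    unfold FilledOrder; infer_instance
  have : Nonempty (FilledOrder A) := ‹Nonempty A›.map FilledOrder.incl
  have : NoMinOrder (FilledOrder A) := ⟨fun x => by
    obtain ⟨a, ha⟩ := exists_lt (ofLex x.1).1
    exact ⟨FilledOrder.incl a, (FilledOrder.lt_iff _ _).2 (Or.inl ha)⟩⟩
  have : NoMaxOrder (FilledOrder A) := ⟨fun x => by
    obtain ⟨a, ha⟩ := exists_gt (ofLex x.1).1
    exact ⟨FilledOrder.incl a, (FilledOrder.lt_iff _ _).2 (Or.inl ha)⟩⟩
  have : DenselyOrdered (FilledOrder A) := ⟨fun x y hxy => by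
    by_cases hx : ∃ h, (ofLex x.1).1 ⋖ h
    · rcases (FilledOrder.lt_iff x y).1 hxy with h | ⟨h1, h2⟩
      · refine ⟨⟨toLex ((ofLex x.1).1, ((ofLex x.1).2 + 1) / 2), ⟨?_, ?_⟩, ?_⟩, ?_, ?_⟩
        · have := x.2.1.1; simp only [ofLex_toLex]; linarith
        · have := x.2.1.2; simp only [ofLex_toLex]; linarith
        · intro h; obtain ⟨h', hh⟩ := hx; exact absurd hh (h h')
        · refine (FilledOrder.lt_iff _ _).2 (Or.inr ⟨rfl, ?_⟩)
          have := x.2.1.2; simp only [ofLex_toLex]; linarith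
        · exact (FilledOrder.lt_iff _ _).2 (Or.inl h)
      · refine ⟨⟨toLex ((ofLex x.1).1, ((ofLex x.1).2 + (ofLex y.1).2) / 2), ⟨?_, ?_⟩, ?_⟩, ?_, ?_⟩
        · have := x.2.1.1; simp only [ofLex_toLex]; linarith
        · have := y.2.1.2; simp only [ofLex_toLex]; linarith
        · intro h; obtain ⟨h', hh⟩ := hx; exact absurd hh (h h')
        · refine (FilledOrder.lt_iff _ _).2 (Or.inr ⟨rfl, ?_⟩)
          simp only [ofLex_toLex]; linarith
        · refine (FilledOrder.lt_iff _ _).2 (Or.inr ⟨h1, ?_⟩)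
          simp only [ofLex_toLex]; linarith
    · push Not at hx
      have hx2 := x.2.2 hx
      rcases (FilledOrder.lt_iff x y).1 hxy with h | ⟨h1, h2⟩
      · obtain ⟨m, hm1, hm2⟩ := (not_covBy_iff h).1 (hx _)
        exact ⟨FilledOrder.incl m, (FilledOrder.lt_iff _ _).2 (Or.inl hm1),
          (FilledOrder.lt_iff _ _).2 (Or.inl hm2)⟩
      · have := y.2.2 (h1 ▸ hx)
        linarith⟩
  obtain ⟨e⟩ := Order.iso_of_countable_dense (FilledOrder A) ℚ
  have hincl : ∀ (x : FilledOrder A), FilledOrder.incl (ofLex x.1).1 ≤ x := by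
    intro x
    rw [← not_lt, FilledOrder.lt_iff]
    rintro (h | ⟨-, h⟩)
    · exact lt_irrefl _ h
    · exact absurd x.2.1.1 (not_le.2 h)
  refine ⟨fun g => (e (FilledOrder.incl g) : ℝ), ⟨fun g h hgh => ?_, fun s t hst => ?_, ?_⟩⟩
  · have : e (FilledOrder.incl g) < e (FilledOrder.incl h) :=
      e.strictMono ((FilledOrder.lt_iff _ _).2 (Or.inl hgh))
    exact_mod_cast this
  · obtain ⟨r, hr1, hr2⟩ := exists_rat_btwn hst
    set x := e.symm r with hx
    have hex : e x = r := by rw [hx, e.apply_symm_apply]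
    set g := (ofLex x.1).1 with hg
    have hgx : (e (FilledOrder.incl g) : ℝ) ≤ r := by
      rw [← hex]; exact_mod_cast e.monotone (hincl x)
    by_cases h1 : s < (e (FilledOrder.incl g) : ℝ)
    · exact Or.inl ⟨g, h1, hgx.trans_lt hr2⟩
    · push Not at h1
      have hsucc : ∃ h, g ⋖ h := by
        by_contra hne
        push Not at hne
        have : x = FilledOrder.incl g :=
          Subtype.ext (congrArg toLex (Prod.ext rfl (x.2.2 hne)))
        rw [← this, hex] at h1
        exact absurd hr1 (not_lt.2 h1)
      obtain ⟨h, hgh⟩ := hsucc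
      by_cases h2 : (e (FilledOrder.incl h) : ℝ) < t
      · refine Or.inl ⟨h, hr1.trans ?_, h2⟩
        rw [← hex]
        exact_mod_cast e.strictMono ((FilledOrder.lt_iff _ _).2 (Or.inl hgh.lt))
      · exact Or.inr ⟨g, h, hgh, h1, not_lt.1 h2⟩
  · rw [eq_univ_iff_forall]
    intro t
    obtain ⟨q, hq⟩ := exists_rat_lt t
    obtain ⟨r, hr⟩ := exists_rat_gt t
    obtain ⟨a, ha⟩ := exists_lt (ofLex (e.symm q).1).1
    obtain ⟨b, hb⟩ := exists_gt (ofLex (e.symm r).1).1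
    refine ⟨a, b, lt_trans ?_ hq, hr.trans ?_⟩
    · have : e (FilledOrder.incl a) < e (e.symm q) :=
        e.strictMono ((FilledOrder.lt_iff _ _).2 (Or.inl ha))
      rw [e.apply_symm_apply] at this
      show ((e _ : ℚ) : ℝ) < ((q : ℚ) : ℝ)
      exact_mod_cast this
    · have : e (e.symm r) < e (FilledOrder.incl b) :=
        e.strictMono ((FilledOrder.lt_iff _ _).2 (Or.inl hb))
      rw [e.apply_symm_apply] at this
      show ((r : ℚ) : ℝ) < ((e _ : ℚ) : ℝ)
      exact_mod_cast this

end Realization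

/-! ### The tight action and the semiconjugacy to it -/

section InducedAction

variable {G : Type*} [Group G] [LinearOrder G]

/-- Left multiplication in a left-ordered group. -/
def leftMulOrderIso (hO : ∀ g a b : G, a < b → g * a < g * b) (g : G) : G ≃o G where
  toEquiv := Equiv.mulLeft g
  map_rel_iff' := by
    intro a b
    simp only [Equiv.coe_mulLeft]
    constructor
    · intro h
      by_contra hlt
      exact absurd (hO g b a (not_le.1 hlt)) (not_lt.2 h)
    · intro h
      rcases h.eq_or_lt with rfl | h
      exacts [le_rfl, (hO g a b h).le]

lemma noMaxOrder_of_leftOrdered [Nontrivial G] (hO : ∀ g a b : G, a < b → g * a < g * b) :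
    NoMaxOrder G := ⟨fun a => by
  obtain ⟨g, hg⟩ := exists_ne (1 : G)
  rcases lt_or_gt_of_ne hg with h | h
  · refine ⟨a * g⁻¹, ?_⟩
    have := hO (a * g⁻¹) g 1 h
    simpa using this
  · exact ⟨a * g, by simpa using hO a 1 g h⟩⟩

lemma noMinOrder_of_leftOrdered [Nontrivial G] (hO : ∀ g a b : G, a < b → g * a < g * b) :
    NoMinOrder G := ⟨fun a => by
  obtain ⟨g, hg⟩ := exists_ne (1 : G)
  rcases lt_or_gt_of_ne hg with h | h
  · exact ⟨a * g, by simpa using hO a g 1 h⟩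
  · refine ⟨a * g⁻¹, ?_⟩
    have := hO (a * g⁻¹) 1 g h
    simpa using this⟩

variable {j : G → ℝ}

/-- Between two consecutive orbit points `ρ g` is affine, and by continuity the formula persists at
both ends. -/
lemma IsInducedAction.isExtension {i : G → ℝ} {ρ : G →* (ℝ ≃o ℝ)} (hρ : IsInducedAction i ρ)
    (hi : StrictMono i) (hO : ∀ g a b : G, a < b → g * a < g * b) (g : G) :
    IsExtension i (i ∘ leftMulOrderIso hO g) (ρ g) := by
  refine ⟨(ρ g).monotone.monotoneOn _, fun h => hρ.map_orbit g h, fun a b hab t ht => ?_⟩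
  have hlt := hi hab.lt
  obtain ⟨m, c, hmc⟩ := hρ.affine_compl g (Ioo (i a) (i b)) ordConnected_Ioo (by
    rw [disjoint_left]
    rintro _ h ⟨r, rfl⟩
    exact hab.2 (hi.lt_iff_lt.1 h.1) (hi.lt_iff_lt.1 h.2))
  have hcl : EqOn (ρ g) (fun t => m * t + c) (Icc (i a) (i b)) := by
    rw [← closure_Ioo hlt.ne]
    exact EqOn.closure hmc (ρ g).continuous (by fun_prop)
  have ea := hcl (left_mem_Icc.2 hlt.le)
  have eb := hcl (right_mem_Icc.2 hlt.le)
  have et := hcl ht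
  simp only [hρ.map_orbit] at ea eb et
  have : i b - i a ≠ 0 := (sub_pos.2 hlt).ne'
  simp only [Function.comp, leftMulOrderIso, RelIso.coe_fn_mk, Equiv.coe_mulLeft]
  rw [ea, eb, et]
  field_simp
  ring

variable [NoMinOrder G] [NoMaxOrder G]

/-- Both sides extend the same map of orbits, and extensions into a tight realization are unique.
The remaining group laws and the semiconjugacy `extend_equivariant` follow from the same principle.
-/
lemma extend_leftMul_comp (hO : ∀ g a b : G, a < b → g * a < g * b) (hj : IsTightRealization j)
    (a b : G) (t : ℝ) : extend j (j ∘ leftMulOrderIso hO a) (extend j (j ∘ leftMulOrderIso hO b) t) =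
      extend j (j ∘ leftMulOrderIso hO (a * b)) t := by
  have h1 := isExtension_extend hj.strictMono (hj.reindex (leftMulOrderIso hO b)).strictMono
  have h2 := (isExtension_extend hj.strictMono
    (hj.reindex (leftMulOrderIso hO a)).strictMono).reindex (leftMulOrderIso hO b)
  have h3 := h1.comp h2 hj.strictMono (hj.reindex (leftMulOrderIso hO b)).strictMono
    (fun t _ => by rw [(hj.reindex (leftMulOrderIso hO b)).hull]; trivial)
  have h4 := isExtension_extend hj.strictMono (hj.reindex (leftMulOrderIso hO (a * b))).strictMono
  have h5 : (j ∘ leftMulOrderIso hO a) ∘ leftMulOrderIso hO b = j ∘ leftMulOrderIso hO (a * b) := by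
    ext g
    simp [leftMulOrderIso, mul_assoc]
  rw [h5] at h3
  exact h3.eqOn hj.strictMono (hj.reindex (leftMulOrderIso hO (a * b))).tight h4
    (by rw [hj.hull]; trivial)

lemma extend_leftMul_one (hO : ∀ g a b : G, a < b → g * a < g * b) (hj : IsTightRealization j)
    (t : ℝ) : extend j (j ∘ leftMulOrderIso hO 1) t = t := by
  have h1 := isExtension_extend hj.strictMono (hj.reindex (leftMulOrderIso hO 1)).strictMono
  have h2 : j ∘ leftMulOrderIso hO 1 = j := by ext g; simp [leftMulOrderIso]
  rw [h2] at h1 ⊢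
  refine h1.eqOn hj.strictMono hj.tight (χ := id) ⟨monotoneOn_id, fun g => rfl, ?_⟩
    (by rw [hj.hull]; trivial)
  intro g h hgh t _
  have : 0 < j h - j g := sub_pos.2 (hj.strictMono hgh.lt)
  rw [mul_div_cancel₀ _ this.ne']
  simp

/-- The action on the line determined by a tight realization of a left-ordered group. -/
noncomputable def tightAction (hO : ∀ g a b : G, a < b → g * a < g * b)
    (hj : IsTightRealization j) : G →* (ℝ ≃o ℝ) where
  toFun g :=
    { toFun := extend j (j ∘ leftMulOrderIso hO g)
      invFun := extend j (j ∘ leftMulOrderIso hO g⁻¹)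
      left_inv := fun t => by
        rw [extend_leftMul_comp hO hj, inv_mul_cancel, extend_leftMul_one hO hj]
      right_inv := fun t => by
        rw [extend_leftMul_comp hO hj, mul_inv_cancel, extend_leftMul_one hO hj]
      map_rel_iff' := by
        have hmono : ∀ g : G, Monotone (extend j (j ∘ leftMulOrderIso hO g)) := fun g s t hst =>
          (isExtension_extend hj.strictMono (hj.reindex (leftMulOrderIso hO g)).strictMono).mono
            (by rw [hj.hull]; trivial) (by rw [hj.hull]; trivial) hst
        intro s t
        refine ⟨fun h => ?_, fun h => hmono g h⟩
        have := hmono g⁻¹ h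
        simpa only [Equiv.coe_fn_mk, extend_leftMul_comp hO hj, inv_mul_cancel,
          extend_leftMul_one hO hj] using this }
  map_one' := by
    ext t
    exact extend_leftMul_one hO hj t
  map_mul' a b := by
    ext t
    exact (extend_leftMul_comp hO hj a b t).symm

lemma isExtension_tightAction (hO : ∀ g a b : G, a < b → g * a < g * b)
    (hj : IsTightRealization j) (g : G) :
    IsExtension j (j ∘ leftMulOrderIso hO g) (tightAction hO hj g) :=
  isExtension_extend hj.strictMono (hj.reindex (leftMulOrderIso hO g)).strictMono

lemma isInducedAction_tightAction (hO : ∀ g a b : G, a < b → g * a < g * b)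
    (hj : IsTightRealization j) : IsInducedAction j (tightAction hO hj) := by
  refine ⟨fun g h => (isExtension_tightAction hO hj g).orbit h, fun g J hJ hdisj => ?_⟩
  by_cases hsub : J.Subsingleton
  · rcases hsub.eq_empty_or_singleton with rfl | ⟨s, rfl⟩
    · exact ⟨0, 0, fun t ht => absurd ht (notMem_empty t)⟩
    · exact ⟨0, tightAction hO hj g s, fun t ht => by rw [mem_singleton_iff.1 ht]; ring⟩
  · have hno : ∀ a, j a ∉ J := fun a ha => disjoint_left.1 hdisj ha ⟨a, rfl⟩
    obtain ⟨s, hs, t, ht, hst⟩ : ∃ s ∈ J, ∃ t ∈ J, s < t := by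
      rw [not_subsingleton_iff] at hsub
      obtain ⟨s, hs, t, ht, hne⟩ := hsub
      rcases lt_or_gt_of_ne hne with h | h
      exacts [⟨s, hs, t, ht, h⟩, ⟨t, ht, s, hs, h⟩]
    -- By tightness an interval that misses the orbit lies over a single jump, where the action is
    -- affine by construction.
    rcases hj.tight s t hst with ⟨a, h1, h2⟩ | ⟨a, b, hab, h1, h2⟩
    · exact absurd (hJ.out hs ht ⟨h1.le, h2.le⟩) (hno a)
    · have hJsub : J ⊆ Icc (j a) (j b) := by
        intro r hr
        constructor
        · by_contra hlt
          exact hno a (hJ.out hr hs ⟨(not_le.1 hlt).le, h1⟩)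
        · by_contra hlt
          exact hno b (hJ.out ht hr ⟨h2, (not_le.1 hlt).le⟩)
      refine ⟨(j (g * b) - j (g * a)) / (j b - j a),
        j (g * a) - (j (g * b) - j (g * a)) / (j b - j a) * j a, fun r hr => ?_⟩
      rw [(isExtension_tightAction hO hj g).jump a b hab r (hJsub hr)]
      simp only [Function.comp, leftMulOrderIso, RelIso.coe_fn_mk, Equiv.coe_mulLeft]
      ring

/-- The semiconjugacy between induced actions. -/
lemma extend_equivariant {i : G → ℝ} {ρ : G →* (ℝ ≃o ℝ)} (hρ : IsInducedAction i ρ)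
    (hi : StrictMono i) (hO : ∀ g a b : G, a < b → g * a < g * b) (hj : IsTightRealization j)
    (g : G) {t : ℝ} (ht : t ∈ openHull i) :
    extend i j (ρ g t) = tightAction hO hj g (extend i j t) := by
  have hφ := isExtension_extend hi hj.strictMono
  have h1 := hφ.comp (isExtension_tightAction hO hj g) hi hj.strictMono
    (fun t _ => by rw [hj.hull]; trivial)
  have hiσ : StrictMono (i ∘ leftMulOrderIso hO g) := hi.comp (leftMulOrderIso hO g).strictMono
  have h2 := (hρ.isExtension hi hO g).comp (hφ.reindex (leftMulOrderIso hO g)) hi hiσ (by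
    rintro t ⟨a, b, ha, hb⟩
    refine ⟨a, b, ?_, ?_⟩
    · show i (g * a) < _
      rw [← hρ.map_orbit]; exact (ρ g).strictMono ha
    · show _ < i (g * b)
      rw [← hρ.map_orbit]; exact (ρ g).strictMono hb)
  exact h2.eqOn hi (hj.reindex (leftMulOrderIso hO g)).tight h1 ht

end InducedAction

/-! ### Straight segments in a simplex -/

section SimplexSegment

variable {ι : Type*} [Fintype ι]

/-- The straight segment between two points of a simplex. -/
def simplexSegment (t : unitInterval) (x y : stdSimplex ℝ ι) : stdSimplex ℝ ι :=
  ⟨fun j => (1 - t) * x j + t * y j,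
    fun j => add_nonneg (mul_nonneg (sub_nonneg.2 t.2.2) (x.2.1 j)) (mul_nonneg t.2.1 (y.2.1 j)), by
    have hx : ∑ j, x j = 1 := x.2.2
    have hy : ∑ j, y j = 1 := y.2.2
    rw [Finset.sum_add_distrib, ← Finset.mul_sum, ← Finset.mul_sum, hx, hy]; ring⟩

lemma simplexSegment_apply (t : unitInterval) (x y : stdSimplex ℝ ι) (j : ι) :
    simplexSegment t x y j = (1 - t) * x j + t * y j := rfl

lemma continuous_coord (j : ι) : Continuous fun x : stdSimplex ℝ ι => x j :=
  (continuous_apply j).comp continuous_subtype_val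

lemma continuous_simplexSegment :
    Continuous fun q : unitInterval × stdSimplex ℝ ι × stdSimplex ℝ ι =>
      simplexSegment q.1 q.2.1 q.2.2 := by
  refine Continuous.subtype_mk (continuous_pi fun j => ?_) _
  have h1 : Continuous fun q : unitInterval × stdSimplex ℝ ι × stdSimplex ℝ ι => q.2.1 j :=
    (continuous_coord j).comp (by fun_prop)
  have h2 : Continuous fun q : unitInterval × stdSimplex ℝ ι × stdSimplex ℝ ι => q.2.2 j :=
    (continuous_coord j).comp (by fun_prop)
  fun_prop

lemma simplexSegment_zero (x y : stdSimplex ℝ ι) : simplexSegment 0 x y = x := by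
  apply stdSimplex.ext; ext j; simp [simplexSegment_apply]

lemma simplexSegment_one (x y : stdSimplex ℝ ι) : simplexSegment 1 x y = y := by
  apply stdSimplex.ext; ext j; simp [simplexSegment_apply]

lemma simplexSegment_self (t : unitInterval) (x : stdSimplex ℝ ι) : simplexSegment t x x = x := by
  apply stdSimplex.ext; ext j; rw [simplexSegment_apply]; ring

lemma map_simplexSegment {ι' : Type*} [Fintype ι'] [DecidableEq ι'] {e : ι → ι'}
    (he : Function.Injective e) (t : unitInterval) (x y : stdSimplex ℝ ι) :
    stdSimplex.map e (simplexSegment t x y) =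
      simplexSegment t (stdSimplex.map e x) (stdSimplex.map e y) := by
  apply stdSimplex.ext; ext j
  rw [simplexSegment_apply]
  by_cases hj : j ∈ range e
  · obtain ⟨k, rfl⟩ := hj
    simp only [simplex_map_apply he, simplexSegment_apply]
  · simp only [simplex_map_apply_of_notMem _ hj]; ring

end SimplexSegment

/-! ### Deck transformations of the universal cover -/

section DeckGroup

variable {M : Type u} [TopologicalSpace M] {X : Type w} [TopologicalSpace X] {p : X → M}

lemma Deck.proj (g : Deck p) (x : X) : p ((g : X ≃ₜ X) x) = p x := g.2 x

lemma Deck.mul_apply (g h : Deck p) (x : X) :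
    ((g * h : Deck p) : X ≃ₜ X) x = (g : X ≃ₜ X) ((h : X ≃ₜ X) x) := rfl

lemma Deck.one_apply (x : X) : ((1 : Deck p) : X ≃ₜ X) x = x := rfl

lemma Deck.inv_apply_self (g : Deck p) (x : X) :
    ((g⁻¹ : Deck p) : X ≃ₜ X) ((g : X ≃ₜ X) x) = x := by
  rw [← Deck.mul_apply, inv_mul_cancel, Deck.one_apply]

lemma Deck.apply_inv_self (g : Deck p) (x : X) :
    (g : X ≃ₜ X) (((g⁻¹ : Deck p) : X ≃ₜ X) x) = x := by
  rw [← Deck.mul_apply, mul_inv_cancel, Deck.one_apply]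

lemma Deck.eq_of_apply_eq [PreconnectedSpace X] (hp : IsCoveringMap p) {g h : Deck p} {x : X}
    (hx : (g : X ≃ₜ X) x = (h : X ≃ₜ X) x) : g = h := by
  have : ((g : X ≃ₜ X) : X → X) = (h : X ≃ₜ X) :=
    hp.eq_of_comp_eq (g : X ≃ₜ X).continuous (h : X ≃ₜ X).continuous
      (by ext y; simp [Deck.proj]) x hx
  exact Subtype.ext (DFunLike.coe_injective this)

/-- As the cover is simply connected, `p` lifts through itself; the lift taking `x` to `y` and the
one taking `y` to `x` are mutually inverse by uniqueness of lifts. -/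
lemma Deck.exists_apply_eq [SimplyConnectedSpace X] [LocallyPathConnectedSpace X]
    (hp : IsCoveringMap p) {x y : X} (hxy : p x = p y) : ∃ g : Deck p, (g : X ≃ₜ X) x = y := by
  let P : C(X, M) := ⟨p, hp.continuous⟩
  obtain ⟨F, ⟨hF, hpF⟩, -⟩ := hp.existsUnique_continuousMap_lifts P x y hxy.symm
  obtain ⟨F', ⟨hF', hpF'⟩, -⟩ := hp.existsUnique_continuousMap_lifts P y x hxy
  have hpF1 : ∀ z, p (F z) = p z := fun z => congrFun hpF z
  have hpF1' : ∀ z, p (F' z) = p z := fun z => congrFun hpF' z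
  have h1 : F' ∘ F = id := hp.eq_of_comp_eq (F'.continuous.comp F.continuous) continuous_id
    (by ext z; simp [hpF1, hpF1']) x (by simp [hF, hF'])
  have h2 : F ∘ F' = id := hp.eq_of_comp_eq (F.continuous.comp F'.continuous) continuous_id
    (by ext z; simp [hpF1, hpF1']) y (by simp [hF, hF'])
  exact ⟨⟨⟨⟨F, F', congrFun h1, congrFun h2⟩, F.continuous, F'.continuous⟩, hpF1⟩, hF⟩

lemma IsCoveringMap.locallyPathConnectedSpace [LocallyPathConnectedSpace M]
    (hp : IsCoveringMap p) : LocallyPathConnectedSpace X := by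
  rw [locallyPathConnectedSpace_iff_pathComponentIn_mem_nhds]
  intro x U hU hx
  obtain ⟨e, hxe, rfl⟩ := hp.isLocalHomeomorph x
  set V := U ∩ e.source
  have hV : IsOpen V := hU.inter e.open_source
  have hloc : LocallyPathConnectedSpace V := by
    have h2 : Topology.IsOpenEmbedding (V.restrict e) :=
      e.isOpenEmbedding_restrict.comp
        (Topology.IsOpenEmbedding.inclusion (inter_subset_right : V ⊆ e.source)
          (hV.preimage continuous_subtype_val))
    exact h2.locallyPathConnectedSpace
  have hxV : x ∈ V := ⟨hx, hxe⟩
  have h3 : pathComponent (⟨x, hxV⟩ : V) ∈ nhds (⟨x, hxV⟩ : V) :=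
    (IsOpen.pathComponent _).mem_nhds (mem_pathComponent_self _)
  have h4 : Subtype.val '' pathComponent (⟨x, hxV⟩ : V) ∈ nhds x :=
    hV.isOpenMap_subtype_val.image_mem_nhds h3
  refine Filter.mem_of_superset h4 ?_
  have h5 : IsPathConnected (pathComponent (⟨x, hxV⟩ : V)) := isPathConnected_pathComponent
  have h6 := h5.image continuous_subtype_val
  refine h6.subset_pathComponentIn ⟨⟨x, hxV⟩, mem_pathComponent_self _, rfl⟩ ?_
  rintro _ ⟨y, -, rfl⟩
  exact y.2.1

end DeckGroup

/-! ### Simplices of the lifted triangulation -/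

section LiftedCells

open Filter Topology

variable {M : Type u} [TopologicalSpace M] {X : Type w} [TopologicalSpace X]

/-- A simplex of the lifted triangulation. -/
structure LiftedCell (T : OneVertexTriangulation M) (p : X → M) where
  cell : T.Cell
  map : C(Simplex (T.dim cell), X)
  lift : ∀ z, p (map z) = T.char cell z

namespace OneVertexTriangulation

/-- The cell `c'` is the face of `c` with vertices given by `e`. -/
def IsFaceMap (T : OneVertexTriangulation M) (c' c : T.Cell)
    (e : Fin (T.dim c' + 1) → Fin (T.dim c + 1)) : Prop :=
  Function.Injective e ∧ ∀ z, T.char c' z = T.char c (stdSimplex.map e z)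

variable {T : OneVertexTriangulation M}

lemma interior_unique {c c' : T.Cell} {y : Simplex (T.dim c)} {y' : Simplex (T.dim c')}
    (hy : ∀ j, 0 < y j) (hy' : ∀ j, 0 < y' j) (h : T.char c y = T.char c' y') :
    (⟨c, y⟩ : Σ c : T.Cell, Simplex (T.dim c)) = ⟨c', y'⟩ :=
  (T.existsUnique_open (T.char c' y')).unique ⟨hy, h⟩ ⟨hy', rfl⟩

lemma IsFaceMap.comp {c c' c'' : T.Cell} {e : Fin (T.dim c' + 1) → Fin (T.dim c + 1)}
    {e' : Fin (T.dim c'' + 1) → Fin (T.dim c' + 1)} (he : T.IsFaceMap c' c e)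
    (he' : T.IsFaceMap c'' c' e') : T.IsFaceMap c'' c (e ∘ e') :=
  ⟨he.1.comp he'.1, fun z => by rw [he'.2, he.2, stdSimplex.map_comp_apply]⟩

/-- The point of the simplex on `s` that is mapped to a point of a face. -/
def pullCoord {n m : ℕ} (e : Fin (m + 1) → Fin (n + 1)) (he : Function.Injective e)
    (z : Simplex n) (hz : ∀ j, j ∉ range e → z j = 0) : Simplex m :=
  ⟨fun k => z (e k), fun k => z.2.1 _, by
    have h1 : ∑ j, z j = 1 := z.2.2
    rw [← h1, ← Finset.sum_subset (Finset.subset_univ (Finset.univ.image e)),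
      Finset.sum_image fun a _ b _ h => he h]
    intro j _ hj
    exact hz j (by simpa using hj)⟩

lemma pullCoord_apply {n m : ℕ} (e : Fin (m + 1) → Fin (n + 1)) (he : Function.Injective e)
    (z : Simplex n) (hz : ∀ j, j ∉ range e → z j = 0) (k : Fin (m + 1)) :
    pullCoord e he z hz k = z (e k) := rfl

lemma map_pullCoord {n m : ℕ} (e : Fin (m + 1) → Fin (n + 1)) (he : Function.Injective e)
    (z : Simplex n) (hz : ∀ j, j ∉ range e → z j = 0) :
    stdSimplex.map e (pullCoord e he z hz) = z := by
  apply stdSimplex.ext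
  ext j
  by_cases hj : j ∈ range e
  · obtain ⟨k, rfl⟩ := hj
    rw [simplex_map_apply he, pullCoord_apply]
  · rw [simplex_map_apply_of_notMem _ hj, hz j hj]

lemma exists_isFaceMap (c : T.Cell) (s : Finset (Fin (T.dim c + 1))) (hs : s.Nonempty) :
    ∃ (c' : T.Cell) (e : Fin (T.dim c' + 1) → Fin (T.dim c + 1)),
      T.IsFaceMap c' c e ∧ range e = s := by
  obtain ⟨c', e, he⟩ := T.face c s hs
  refine ⟨c', fun j => e j, ⟨Subtype.val_injective.comp e.injective, he⟩, ?_⟩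
  ext j
  constructor
  · rintro ⟨k, rfl⟩
    exact (e k).2
  · exact fun hj => ⟨e.symm ⟨j, hj⟩, by simp⟩

lemma exists_face_interior (c : T.Cell) (z : Simplex (T.dim c)) :
    ∃ (c' : T.Cell) (e : Fin (T.dim c' + 1) → Fin (T.dim c + 1)) (y : Simplex (T.dim c')),
      T.IsFaceMap c' c e ∧ (∀ j, 0 < y j) ∧ stdSimplex.map e y = z := by
  obtain ⟨c', e, he, hr⟩ := exists_isFaceMap c _ (support_nonempty z)
  have hz : ∀ j, j ∉ range e → z j = 0 := by
    intro j hj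
    rw [hr] at hj
    by_contra h
    exact hj (by simpa using h)
  refine ⟨c', e, pullCoord e he.1 z hz, he, fun k => ?_, map_pullCoord e he.1 z hz⟩
  rw [pullCoord_apply]
  have : e k ∈ range e := ⟨k, rfl⟩
  rw [hr] at this
  have : z (e k) ≠ 0 := by simpa using this
  exact lt_of_le_of_ne (z.2.1 _) (Ne.symm this)

end OneVertexTriangulation

open OneVertexTriangulation

variable {T : OneVertexTriangulation M} {p : X → M}

/-- A face of a lifted simplex. -/
@[reducible] noncomputable def LiftedCell.face (τ : LiftedCell T p) (c' : T.Cell)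
    (e : Fin (T.dim c' + 1) → Fin (T.dim τ.cell + 1)) (he : T.IsFaceMap c' τ.cell e) :
    LiftedCell T p :=
  ⟨c', τ.map.comp ⟨stdSimplex.map e, stdSimplex.continuous_map e⟩, fun z => by
    rw [he.2]; exact τ.lift _⟩

lemma LiftedCell.face_map (τ : LiftedCell T p) (c' : T.Cell)
    (e : Fin (T.dim c' + 1) → Fin (T.dim τ.cell + 1)) (he : T.IsFaceMap c' τ.cell e)
    (y : Simplex (T.dim c')) : (τ.face c' e he).map y = τ.map (stdSimplex.map e y) := rfl

/-- The translate of a lifted simplex by a deck transformation. -/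
@[reducible] noncomputable def LiftedCell.translate (g : Deck p) (τ : LiftedCell T p) : LiftedCell T p :=
  ⟨τ.cell, ⟨fun z => (g : X ≃ₜ X) (τ.map z), (g : X ≃ₜ X).continuous.comp τ.map.continuous⟩,
    fun z => by
      show p ((g : X ≃ₜ X) (τ.map z)) = _
      exact (Deck.proj g _).trans (τ.lift z)⟩

lemma LiftedCell.translate_map (g : Deck p) (τ : LiftedCell T p) (z : Simplex (T.dim τ.cell)) :
    (τ.translate g).map z = (g : X ≃ₜ X) (τ.map z) := rfl

lemma IsCoveringMap.lift_unique (hp : IsCoveringMap p) {n : ℕ} {f f' : C(Simplex n, X)}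
    (h : ∀ z, p (f z) = p (f' z)) {z : Simplex n} (hz : f z = f' z) : f = f' :=
  DFunLike.coe_injective
    (hp.eq_of_comp_eq f.continuous f'.continuous (by ext z; exact h z) z hz)

lemma LiftedCell.interior_unique (hp : IsCoveringMap p) {τ τ' : LiftedCell T p}
    {y : Simplex (T.dim τ.cell)} {y' : Simplex (T.dim τ'.cell)} (hy : ∀ j, 0 < y j)
    (hy' : ∀ j, 0 < y' j) (h : τ.map y = τ'.map y') :
    (⟨τ, y⟩ : Σ τ : LiftedCell T p, Simplex (T.dim τ.cell)) = ⟨τ', y'⟩ := by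
  obtain ⟨c, f, hf⟩ := τ
  obtain ⟨c', f', hf'⟩ := τ'
  dsimp only at *
  have h1 := OneVertexTriangulation.interior_unique hy hy' (by rw [← hf, ← hf', h])
  cases h1
  have := hp.lift_unique (f := f) (f' := f') (fun z => by rw [hf, hf']) h
  subst this
  rfl

/-- The segments from `z₀` form a homotopy from a constant map to `f`, and homotopies lift. -/
lemma IsCoveringMap.exists_lift_simplex (hp : IsCoveringMap p) {n : ℕ} (f : C(Simplex n, M))
    (z₀ : Simplex n) (x₀ : X) (h : p x₀ = f z₀) :
    ∃ F : C(Simplex n, X), (∀ z, p (F z) = f z) ∧ F z₀ = x₀ := by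
  let H : C(unitInterval × Simplex n, M) :=
    ⟨fun q => f (simplexSegment q.1 z₀ q.2), f.continuous.comp
      (continuous_simplexSegment.comp (continuous_fst.prodMk
        (continuous_const.prodMk continuous_snd)))⟩
  have hH0 : ∀ z, H (0, z) = p ((ContinuousMap.const (Simplex n) x₀) z) := fun z => by
    show f (simplexSegment 0 z₀ z) = p x₀
    rw [simplexSegment_zero, h]
  let Γ := hp.liftHomotopy H (ContinuousMap.const _ x₀) hH0
  have hΓ : ∀ q, p (Γ q) = H q := fun q => congrFun (hp.liftHomotopy_lifts H _ hH0) q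
  refine ⟨⟨fun z => Γ (1, z), Γ.continuous.comp (Continuous.prodMk_right 1)⟩, fun z => ?_, ?_⟩
  · show p (Γ (1, z)) = f z
    rw [hΓ]
    show f (simplexSegment 1 z₀ z) = f z
    rw [simplexSegment_one]
  · show Γ (1, z₀) = x₀
    refine Eq.trans ?_ (hp.liftHomotopy_zero H (ContinuousMap.const _ x₀) hH0 z₀)
    -- The track of `z₀` under the lifted homotopy lies over a constant path, so it is constant.
    refine hp.const_of_comp (Γ.continuous.comp (Continuous.prodMk_left z₀)) (fun t s => ?_) 1 0
    simp only [Function.comp, hΓ]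
    show f (simplexSegment t z₀ z₀) = f (simplexSegment s z₀ z₀)
    rw [simplexSegment_self, simplexSegment_self]

variable [T2Space M]

lemma LiftedCell.exists_through (hp : IsCoveringMap p) {c : T.Cell} {z : Simplex (T.dim c)} {x : X}
    (h : p x = T.char c z) : ∃ f : C(Simplex (T.dim c), X), (∀ z, p (f z) = T.char c z) ∧ f z = x :=
  hp.exists_lift_simplex (T.char c) z x h

/-- Continuity can be checked on the lifted simplices. -/
lemma continuousOn_of_cells (hp : IsCoveringMap p) {Y W : Type*} [TopologicalSpace Y]
    [TopologicalSpace W] {F : X × Y → W} {A : Set (X × Y)}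
    (h : ∀ τ : LiftedCell T p, ContinuousOn
      (fun q : Simplex (T.dim τ.cell) × Y => F (τ.map q.1, q.2)) {q | (τ.map q.1, q.2) ∈ A}) :
    ContinuousOn F A := by
  classical
  intro a ha
  rw [ContinuousWithinAt, tendsto_iff_ultrafilter]
  intro U hU
  have hU1 : Tendsto (fun q : X × Y => q.1) U (𝓝 a.1) :=
    (continuous_fst.tendsto a).mono_left (hU.trans nhdsWithin_le_nhds)
  have hU2 : Tendsto (fun q : X × Y => q.2) U (𝓝 a.2) :=
    (continuous_snd.tendsto a).mono_left (hU.trans nhdsWithin_le_nhds)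
  have hA : ∀ᶠ q in (U : Filter (X × Y)), q ∈ A := hU self_mem_nhdsWithin
  choose k hk using fun x : X => (T.existsUnique_open (p x)).exists
  have := T.finite_cell
  -- There are finitely many compact simplices, so along an ultrafilter the cell carrying the
  -- projected point is eventually constant and the coordinates converge, possibly to a boundary
  -- point `s₀`.
  obtain ⟨⟨c, s₀⟩, -, hk0⟩ := isCompact_univ.ultrafilter_le_nhds (U.map fun q => k q.1) (by simp)
  have hk0 : Tendsto (fun q : X × Y => k q.1) U (𝓝 ⟨c, s₀⟩) := hk0
  rw [Sigma.nhds_mk] at hk0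
  let s : X → Simplex (T.dim c) := fun x => if h : ∃ s, k x = ⟨c, s⟩ then h.choose else s₀
  have hs : ∀ N ∈ 𝓝 s₀, ∀ᶠ q in (U : Filter (X × Y)), k q.1 = ⟨c, s q.1⟩ ∧ s q.1 ∈ N := by
    intro N hN
    filter_upwards [hk0 (image_mem_map hN)] with q hq
    obtain ⟨r, hrN, hr⟩ := hq
    have hex : ∃ s, k q.1 = ⟨c, s⟩ := ⟨r, hr.symm⟩
    have h1 : k q.1 = ⟨c, s q.1⟩ := by
      simp only [s, dif_pos hex]; exact hex.choose_spec
    refine ⟨h1, ?_⟩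
    have hr : (⟨c, r⟩ : Σ c : T.Cell, Simplex (T.dim c)) = k q.1 := hr
    rw [h1] at hr
    have : r = s q.1 := by simpa using hr
    exact this ▸ hrN
  have hst : Tendsto (fun q : X × Y => s q.1) U (𝓝 s₀) := by
    intro N hN
    have : ∀ᶠ q in (U : Filter (X × Y)), s q.1 ∈ N := (hs N hN).mono fun q hq => hq.2
    exact this
  have hkc : ∀ᶠ q in (U : Filter (X × Y)), T.char c (s q.1) = p q.1 := by
    filter_upwards [hs univ univ_mem] with q hq
    have := (hk q.1).2
    rw [hq.1] at this
    exact this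
  have hp0 : p a.1 = T.char c s₀ := by
    refine tendsto_nhds_unique ((hp.continuous.tendsto _).comp hU1)
      ((((T.char c).continuous.tendsto s₀).comp hst).congr' ?_)
    filter_upwards [hkc] with q hq using hq
  obtain ⟨f, hf, hf0⟩ := LiftedCell.exists_through hp hp0
  obtain ⟨e, hae, rfl⟩ := hp.isLocalHomeomorph a.1
  have hfs : Tendsto (fun q : X × Y => f (s q.1)) U (𝓝 a.1) := by
    rw [← hf0]; exact (f.continuous.tendsto s₀).comp hst
  -- Both points lie over the same point of `M` and near `a.1`, where the projection is injective.
  -- So the nearby points lie on a single lifted simplex through `a.1`.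
  have heq : ∀ᶠ q in (U : Filter (X × Y)), f (s q.1) = q.1 := by
    filter_upwards [hkc, hfs (e.open_source.mem_nhds hae), hU1 (e.open_source.mem_nhds hae)]
      with q h1 h2 h3
    exact e.injOn h2 h3 (by rw [hf, h1])
  have hcont := h ⟨c, f, hf⟩ (s₀, a.2) (by show (f s₀, a.2) ∈ A; rw [hf0]; exact ha)
  have hlim : Tendsto (fun q : X × Y => (s q.1, q.2)) U
      (𝓝[{q : Simplex (T.dim c) × Y | (f q.1, q.2) ∈ A}] (s₀, a.2)) := by
    refine tendsto_nhdsWithin_iff.2 ⟨hst.prodMk_nhds hU2, ?_⟩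
    filter_upwards [heq, hA] with q h1 h2
    show (f (s q.1), q.2) ∈ A
    rw [h1]; exact h2
  have hfin := Tendsto.comp hcont hlim
  have e1 : (fun q : Simplex (T.dim c) × Y => F (f q.1, q.2)) (s₀, a.2) = F a := by
    show F (f s₀, a.2) = F a
    rw [hf0]
  have hfin' : Tendsto ((fun q : Simplex (T.dim c) × Y => F (f q.1, q.2)) ∘
      fun q : X × Y => (s q.1, q.2)) U (𝓝 (F a)) := e1 ▸ hfin
  refine hfin'.congr' ?_
  filter_upwards [heq] with q hq
  show F (f (s q.1), q.2) = F q
  rw [hq]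

lemma continuous_of_cells (hp : IsCoveringMap p) {W : Type*} [TopologicalSpace W] {F : X → W}
    (h : ∀ τ : LiftedCell T p, Continuous fun z => F (τ.map z)) : Continuous F := by
  have h1 : ContinuousOn (fun q : X × Unit => F q.1) univ :=
    continuousOn_of_cells (T := T) hp fun τ =>
      ((h τ).comp continuous_fst).continuousOn
  exact (continuousOn_univ.1 h1).comp (Continuous.prodMk_left ())

end LiftedCells

/-! ### Labelling the vertices of the cover by the deck group -/

section Cover

open Filter Topology OneVertexTriangulation

variable {M : Type u} [TopologicalSpace M] {X : Type w} [TopologicalSpace X]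

/-- The universal cover of an essentially triangulated space. -/
structure IsTriangulatedCover (T : OneVertexTriangulation M) (p : X → M) (v₀ : X) : Prop where
  cov : IsCoveringMap p
  surj : Function.Surjective p
  vertex : T.IsVertex (p v₀)
  essential : T.IsEssential
  t2 : T2Space M
  simplyConnected : SimplyConnectedSpace X
  locPath : LocallyPathConnectedSpace X

variable {T : OneVertexTriangulation M} {p : X → M} {v₀ : X} (S : IsTriangulatedCover T p v₀)

namespace IsTriangulatedCover
include S

lemma char_vertex (c : T.Cell) (j : Fin (T.dim c + 1)) :
    T.char c (stdSimplex.vertex j) = p v₀ := by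
  obtain ⟨c₀, hc₀, z₀, hz₀⟩ := S.vertex
  obtain ⟨c', e, he, hr⟩ := exists_isFaceMap c {j} (Finset.singleton_nonempty j)
  have hrj : ∀ k, e k = j := fun k => by
    have : e k ∈ range e := ⟨k, rfl⟩
    rw [hr] at this
    simpa using this
  have hdim : T.dim c' = 0 := by
    by_contra hne
    have : (⟨0, by omega⟩ : Fin (T.dim c' + 1)) = ⟨1, by omega⟩ :=
      he.1 ((hrj _).trans (hrj _).symm)
    simp at this
  obtain rfl : c' = c₀ := T.existsUnique_vertex.unique hdim hc₀
  rw [← hz₀, he.2]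
  congr 1
  symm
  apply eq_vertex_of_support
  intro k hk
  apply simplex_map_apply_of_notMem
  rw [hr]; simpa using hk

lemma exists_key (τ : LiftedCell T p) (j : Fin (T.dim τ.cell + 1)) :
    ∃ g : Deck p, (g : X ≃ₜ X) v₀ = τ.map (stdSimplex.vertex j) := by
  have := S.simplyConnected
  have := S.locPath
  refine Deck.exists_apply_eq S.cov ?_
  rw [τ.lift, S.char_vertex]

lemma exists_carrier (x : X) : ∃ q : Σ τ : LiftedCell T p, Simplex (T.dim τ.cell),
    (∀ j, 0 < q.2 j) ∧ q.1.map q.2 = x := by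
  have := S.t2
  obtain ⟨⟨c, y⟩, hy, hyx⟩ := (T.existsUnique_open (p x)).exists
  obtain ⟨f, hf, hfy⟩ := LiftedCell.exists_through S.cov (c := c) (z := y) (x := x) hyx.symm
  exact ⟨⟨⟨c, f, hf⟩, y⟩, hy, hfy⟩

/-- The deck transformation moving the base vertex to the `j`-th vertex of a lifted simplex. -/
noncomputable def key (τ : LiftedCell T p) (j : Fin (T.dim τ.cell + 1)) : Deck p :=
  (S.exists_key τ j).choose

lemma key_spec (τ : LiftedCell T p) (j : Fin (T.dim τ.cell + 1)) :
    (S.key τ j : X ≃ₜ X) v₀ = τ.map (stdSimplex.vertex j) := (S.exists_key τ j).choose_spec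

lemma key_eq {τ : LiftedCell T p} {j : Fin (T.dim τ.cell + 1)} {g : Deck p}
    (h : (g : X ≃ₜ X) v₀ = τ.map (stdSimplex.vertex j)) : S.key τ j = g := by
  have := S.simplyConnected
  exact Deck.eq_of_apply_eq S.cov ((S.key_spec τ j).trans h.symm)

lemma key_face (τ : LiftedCell T p) {c' : T.Cell}
    {e : Fin (T.dim c' + 1) → Fin (T.dim τ.cell + 1)} (he : T.IsFaceMap c' τ.cell e)
    (k : Fin (T.dim c' + 1)) : S.key (τ.face c' e he) k = S.key τ (e k) := by
  apply S.key_eq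
  rw [LiftedCell.face_map, stdSimplex.map_vertex]
  exact S.key_spec τ (e k)

lemma key_translate (g : Deck p) (τ : LiftedCell T p) (j : Fin (T.dim τ.cell + 1)) :
    S.key (τ.translate g) j = g * S.key τ j := by
  apply S.key_eq
  rw [Deck.mul_apply, S.key_spec, LiftedCell.translate_map]

/-- The simplex carrying a point of the cover, with the coordinates of the point. -/
noncomputable def carrier (x : X) : Σ τ : LiftedCell T p, Simplex (T.dim τ.cell) :=
  (S.exists_carrier x).choose

lemma carrier_pos (x : X) (j) : 0 < (S.carrier x).2 j := (S.exists_carrier x).choose_spec.1 j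

lemma carrier_map (x : X) : (S.carrier x).1.map (S.carrier x).2 = x :=
  (S.exists_carrier x).choose_spec.2

lemma carrier_eq {τ : LiftedCell T p} {y : Simplex (T.dim τ.cell)} (hy : ∀ j, 0 < y j) :
    S.carrier (τ.map y) = ⟨τ, y⟩ :=
  LiftedCell.interior_unique S.cov (S.carrier_pos _) hy (S.carrier_map _)

/-- The function on the cover that is given by a compatible family of functions on the lifted
simplices. -/
noncomputable def glue {W : Type*} (f : ∀ τ : LiftedCell T p, Simplex (T.dim τ.cell) → W)
    (x : X) : W := f (S.carrier x).1 (S.carrier x).2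

/-- Each point is interior to a unique lifted simplex, and this is a face of every lifted simplex
containing the point. So compatibility with faces is all that gluing requires. -/
lemma glue_apply {W : Type*} {f : ∀ τ : LiftedCell T p, Simplex (T.dim τ.cell) → W}
    (hf : ∀ (τ : LiftedCell T p) (c' : T.Cell) (e : Fin (T.dim c' + 1) → Fin (T.dim τ.cell + 1))
      (he : T.IsFaceMap c' τ.cell e) (y : Simplex (T.dim c')),
      f (τ.face c' e he) y = f τ (stdSimplex.map e y))
    (τ : LiftedCell T p) (z : Simplex (T.dim τ.cell)) : S.glue f (τ.map z) = f τ z := by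
  obtain ⟨c', e, y, he, hy, rfl⟩ := exists_face_interior τ.cell z
  have h1 : S.carrier (τ.map (stdSimplex.map e y)) = ⟨τ.face c' e he, y⟩ :=
    S.carrier_eq (τ := τ.face c' e he) hy
  rw [glue, h1, ← hf τ c' e he]

/-- This is where essentiality enters. If two vertices of a lifted simplex coincided, the edge
between them would be a loop in the simply connected cover, and its contraction would project to a
null-homotopy of an edge loop of `M` relative to its end points. -/
lemma key_injective (τ : LiftedCell T p) : Function.Injective (S.key τ) := by
  have := S.simplyConnected
  intro j k hjk
  by_contra hne
  have hv : τ.map (stdSimplex.vertex j) = τ.map (stdSimplex.vertex k) := by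
    rw [← S.key_spec, ← S.key_spec, hjk]
  obtain ⟨c', e, he, hr⟩ := exists_isFaceMap τ.cell {j, k} ⟨j, by simp⟩
  have hdim : T.dim c' = 1 := by
    have h1 : Fintype.card (Fin (T.dim c' + 1)) = Fintype.card ({j, k} : Finset _) := by
      refine Fintype.card_congr ((Equiv.ofInjective e he.1).trans (Equiv.setCongr ?_))
      exact hr
    rw [Fintype.card_coe, Finset.card_pair hne, Fintype.card_fin] at h1
    exact Nat.succ_injective h1
  have hconst : ∀ a, (τ.face c' e he).map (stdSimplex.vertex a) = τ.map (stdSimplex.vertex j) := by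
    intro a
    rw [LiftedCell.face_map, stdSimplex.map_vertex]
    have : e a ∈ range e := ⟨a, rfl⟩
    rw [hr] at this
    have : e a = j ∨ e a = k := by simpa using this
    rcases this with h | h
    · rw [h]
    · rw [h, hv]
  refine S.essential c' hdim (p v₀) ?_
  have hlift := (τ.face c' e he).lift
  have aux : ∀ (n : ℕ) (f : C(Simplex n, X)) (F : C(Simplex n, M)) (x : X) (m : M), n = 1 → p x = m →
      (∀ z, p (f z) = F z) → (∀ a, f (stdSimplex.vertex a) = x) →
      F.HomotopicRel (ContinuousMap.const _ m) (range fun j => stdSimplex.vertex j) := by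
    rintro n f F x m rfl hxm hf hx
    let φ := stdSimplexHomeomorphUnitInterval
    have hφ0 : φ (stdSimplex.vertex 0) = 0 := stdSimplexHomeomorphUnitInterval_zero
    have hφ1 : φ (stdSimplex.vertex 1) = 1 := stdSimplexHomeomorphUnitInterval_one
    have hs0 : φ.symm 0 = stdSimplex.vertex 0 := by rw [← hφ0, φ.symm_apply_apply]
    have hs1 : φ.symm 1 = stdSimplex.vertex 1 := by rw [← hφ1, φ.symm_apply_apply]
    let γ : Path x x := ⟨⟨fun t => f (φ.symm t), f.continuous.comp φ.symm.continuous⟩,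
      by show f (φ.symm 0) = x; rw [hs0, hx], by show f (φ.symm 1) = x; rw [hs1, hx]⟩
    obtain ⟨K⟩ := SimplyConnectedSpace.paths_homotopic γ (Path.refl x)
    refine ⟨⟨⟨⟨fun q => p (K (q.1, φ q.2)), ?_⟩, fun z => ?_, fun z => ?_⟩, ?_⟩⟩
    · exact S.cov.continuous.comp (K.continuous.comp
        (continuous_fst.prodMk (φ.continuous.comp continuous_snd)))
    · show p (K (0, φ z)) = F z
      rw [K.apply_zero]
      show p (f (φ.symm (φ z))) = F z
      rw [φ.symm_apply_apply, hf]
    · show p (K (1, φ z)) = m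
      rw [K.apply_one]
      exact hxm
    · rintro t _ ⟨a, rfl⟩
      show p (K (t, φ (stdSimplex.vertex a))) = F (stdSimplex.vertex a)
      rw [← hf, hx]
      have : a = 0 ∨ a = 1 := by fin_cases a <;> simp
      rcases this with rfl | rfl
      · rw [hφ0, K.source]
      · rw [hφ1, K.target]
  refine aux _ (τ.face c' e he).map _ _ _ hdim ?_ hlift hconst
  rw [τ.lift, S.char_vertex]

end IsTriangulatedCover

end Cover

/-! ### The canonical defining function, and the flow on the cover -/

section CanonicalFunction

open Filter Topology OneVertexTriangulation

variable {M : Type u} [TopologicalSpace M] {X : Type w} [TopologicalSpace X]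
  {T : OneVertexTriangulation M} {p : X → M} {v₀ : X} (S : IsTriangulatedCover T p v₀)

namespace IsTriangulatedCover

include S

/-- The base vertex is the vertex of a lifted simplex. -/
lemma exists_vertex_cell : ∃ (τ : LiftedCell T p) (j : Fin (T.dim τ.cell + 1)),
    T.dim τ.cell = 0 ∧ τ.map (stdSimplex.vertex j) = v₀ := by
  have := S.t2
  obtain ⟨c, hc, z, hz⟩ := S.vertex
  obtain ⟨f, hf, hfz⟩ := LiftedCell.exists_through S.cov hz.symm
  have hz0 : z = stdSimplex.vertex 0 := by
    apply eq_vertex_of_support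
    intro k hk
    exact absurd (Fin.ext (by have := k.2; simp; omega)) hk
  exact ⟨⟨c, f, hf⟩, 0, hc, by rw [← hz0]; exact hfz⟩

variable {i : Deck p → ℝ} {ρ : Deck p →* (ℝ ≃o ℝ)}

/-- The canonical function on the cover that is determined by an action on the line. -/
noncomputable def canonF (i : Deck p → ℝ) (ρ : Deck p →* (ℝ ≃o ℝ)) : X → ℝ :=
  S.glue fun τ z => canonHeight (fun j => i (S.key τ j)) (fun l => ρ (S.key τ l)⁻¹) z

/-- The coordinate of the line attached to the vertex labelled `g` is `ρ g⁻¹`, which moves the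
height of that vertex to 0. Linearity of an edge in the coordinate of its upper end is what
equivariance makes of linearity below the base vertex. -/
lemma base_zero (hi1 : i 1 = 0) (hρ : ∀ g h, ρ g (i h) = i (g * h)) (τ : LiftedCell T p)
    (l : Fin (T.dim τ.cell + 1)) : ρ (S.key τ l)⁻¹ (i (S.key τ l)) = 0 := by
  rw [hρ, inv_mul_cancel, hi1]

lemma base_injective (hi : Function.Injective i) (τ : LiftedCell T p) :
    Function.Injective fun j => i (S.key τ j) := hi.comp (S.key_injective τ)

lemma canonF_map (hi : Function.Injective i) (hi1 : i 1 = 0)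
    (hρ : ∀ g h, ρ g (i h) = i (g * h)) (τ : LiftedCell T p) (z : Simplex (T.dim τ.cell)) :
    S.canonF i ρ (τ.map z) =
      canonHeight (fun j => i (S.key τ j)) (fun l => ρ (S.key τ l)⁻¹) z := by
  refine S.glue_apply ?_ τ z
  intro τ c' e he y
  rw [canonHeight_map (S.base_zero hi1 hρ τ) (S.base_injective hi τ) he.1]
  congr 1
  · ext j; simp only [Function.comp, S.key_face τ he]
  · ext j; simp only [Function.comp, S.key_face τ he]

lemma continuous_canonF (hi : Function.Injective i) (hi1 : i 1 = 0)
    (hρ : ∀ g h, ρ g (i h) = i (g * h)) : Continuous (S.canonF i ρ) := by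
  have := S.t2
  refine continuous_of_cells (T := T) S.cov fun τ => ?_
  simp only [S.canonF_map hi hi1 hρ]
  exact continuous_canonHeight (S.base_zero hi1 hρ τ) (S.base_injective hi τ)

lemma canonF_vertex (hi : Function.Injective i) (hi1 : i 1 = 0)
    (hρ : ∀ g h, ρ g (i h) = i (g * h)) (τ : LiftedCell T p) (j : Fin (T.dim τ.cell + 1)) :
    S.canonF i ρ (τ.map (stdSimplex.vertex j)) = i (S.key τ j) := by
  rw [S.canonF_map hi hi1 hρ,
    canonHeight_vertex (S.base_zero hi1 hρ τ) (S.base_injective hi τ)]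

lemma canonF_deck (hi : Function.Injective i) (hi1 : i 1 = 0)
    (hρ : ∀ g h, ρ g (i h) = i (g * h)) (g : Deck p) (x : X) :
    S.canonF i ρ ((g : X ≃ₜ X) x) = ρ g (S.canonF i ρ x) := by
  obtain ⟨⟨τ, z⟩, -, rfl⟩ := S.exists_carrier x
  dsimp only
  rw [← LiftedCell.translate_map, S.canonF_map hi hi1 hρ, S.canonF_map hi hi1 hρ]
  refine canonHeight_equivariant (S.base_zero hi1 hρ τ) (S.base_injective hi τ)
    (S.base_zero hi1 hρ (τ.translate g)) _ (fun j => ?_) (fun l t => ?_) z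
  · exact (congrArg i (S.key_translate g τ j)).trans (hρ _ _).symm
  · rw [S.key_translate g τ l, mul_inv_rev, map_mul, RelIso.mul_apply, ← RelIso.mul_apply _ (ρ g),
      ← map_mul, inv_mul_cancel, map_one, RelIso.one_apply]

lemma canonF_base (hi : Function.Injective i) (hi1 : i 1 = 0)
    (hρ : ∀ g h, ρ g (i h) = i (g * h)) : S.canonF i ρ v₀ = 0 := by
  obtain ⟨τ, j, -, hj⟩ := S.exists_vertex_cell
  have hk : S.key τ j = 1 := S.key_eq hj.symm
  rw [← congrArg (S.canonF i ρ) hj, S.canonF_vertex hi hi1 hρ, hk, hi1]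

variable [LinearOrder (Deck p)]

lemma ascending_canonF (hi : StrictMono i) (hi1 : i 1 = 0)
    (hρ : ∀ g h, ρ g (i h) = i (g * h)) (τ : LiftedCell T p) :
    Ascending (S.key τ) (S.key_injective τ) fun z => S.canonF i ρ (τ.map z) := by
  simp only [S.canonF_map hi.injective hi1 hρ]
  exact ascending_canonHeight (S.base_zero hi1 hρ τ) (S.base_injective hi.injective τ)
    fun j l h => hi.lt_iff_lt.1 h

theorem isDefiningFunction_canonF (hi : StrictMono i) (hi1 : i 1 = 0)
    (hρ : ∀ g h, ρ g (i h) = i (g * h)) : IsDefiningFunction T p v₀ ρ (S.canonF i ρ) where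
  continuous := S.continuous_canonF hi.injective hi1 hρ
  map_base := S.canonF_base hi.injective hi1 hρ
  map_deck := S.canonF_deck hi.injective hi1 hρ
  linear_edge := by
    intro c hc f hf j hj hk x
    let τ : LiftedCell T p := ⟨c, f, hf⟩
    have hv : ∀ k, S.canonF i ρ (f (stdSimplex.vertex k)) = i (S.key τ k) :=
      S.canonF_vertex hi.injective hi1 hρ τ
    have hj1 : S.key τ j = 1 := S.key_eq hj.symm
    simp only [hv]
    refine (S.canonF_map hi.injective hi1 hρ τ x).trans ?_
    obtain ⟨k, hkj⟩ : ∃ k : Fin (T.dim c + 1), k ≠ j := by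
      by_contra! h
      have h1 := h ⟨0, by omega⟩
      have h2 := h ⟨1, by omega⟩
      rw [← h2] at h1
      simp at h1
    refine canonHeight_edge (S.base_zero hi1 hρ τ) (S.base_injective hi.injective τ) (j := j)
      (k := k) (fun l => ?_) ?_ ?_ ?_ x
    · have h1 := l.2; have h2 := j.2; have h3 := k.2
      have h4 : k.1 ≠ j.1 := fun h => hkj (Fin.ext h)
      change l.1 < T.dim c + 1 at h1
      have : l.1 = j.1 ∨ l.1 = k.1 := by omega
      exact this.imp Fin.ext Fin.ext
    · show i (S.key τ j) = 0
      rw [hj1, hi1]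
    · have := hk k hkj
      rw [hv, S.canonF_base hi.injective hi1 hρ] at this
      exact this
    · intro t
      rw [hj1, inv_one, map_one, RelIso.one_apply]
  convex_level := by
    intro c hc f hf t
    let τ : LiftedCell T p := ⟨c, f, hf⟩
    have h := convex_canonHeight (S.base_zero hi1 hρ τ) (S.base_injective hi.injective τ)
      (by rw [Fintype.card_fin]; exact Nat.succ_le_succ hc) t
    have h2 : ∀ x, S.canonF i ρ (f x) = _ := S.canonF_map hi.injective hi1 hρ τ
    simp only [h2]
    exact h
  polytope_level := by
    intro c f hf
    let τ : LiftedCell T p := ⟨c, f, hf⟩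
    -- The linear function with the same vertex values also increases along the flow, so sliding
    -- along flow lines straightens the levels.
    obtain ⟨h, hh, h0⟩ := (S.ascending_canonF hi hi1 hρ τ).exists_homeomorph
      ((S.continuous_canonF hi.injective hi1 hρ).comp τ.map.continuous)
      (ascending_linear (b := fun j => i (S.key τ j)) (S.base_injective hi.injective τ)
        fun j l h => hi.lt_iff_lt.1 h)
      (continuous_finsetSum _ fun j _ => continuous_const.mul (continuous_coord j)) (fun j => by
        rw [S.canonF_vertex hi.injective hi1 hρ, Finset.sum_eq_single j]
        · rw [vertex_apply_self, mul_one]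
        · intro k _ hk
          rw [vertex_apply_ne hk, mul_zero]
        · simp)
    have hh' : ∀ x, S.canonF i ρ (f (h x)) = _ := hh
    exact ⟨h, fun j => i (S.key τ j), h0, fun x y => by rw [hh', hh']⟩

/-- The sliding flow on the cover. -/
noncomputable def slideX (α : unitInterval) : X → X :=
  S.glue fun τ z => τ.map (slide (S.key τ) (S.key_injective τ) α z)

lemma slideX_map (α : unitInterval) (τ : LiftedCell T p) (z : Simplex (T.dim τ.cell)) :
    S.slideX α (τ.map z) = τ.map (slide (S.key τ) (S.key_injective τ) α z) := by
  refine S.glue_apply ?_ τ z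
  intro τ c' e he y
  rw [LiftedCell.face_map]
  congr 1
  exact slide_map he.1 (fun a b => by rw [S.key_face τ he, S.key_face τ he]) α y

/-- A deck transformation multiplies all labels on the left, which preserves their order, and the
flow depends on nothing else. -/
lemma slideX_deck (hO : ∀ g a b : Deck p, a < b → g * a < g * b) (α : unitInterval) (g : Deck p)
    (x : X) : S.slideX α ((g : X ≃ₜ X) x) = (g : X ≃ₜ X) (S.slideX α x) := by
  obtain ⟨⟨τ, z⟩, -, rfl⟩ := S.exists_carrier x
  dsimp only
  rw [← LiftedCell.translate_map, S.slideX_map, S.slideX_map, LiftedCell.translate_map]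
  have hlt : StrictMono fun a => g * a := fun a b h => hO g a b h
  have := slide_map (κ := S.key (τ.translate g)) (hκ := S.key_injective (τ.translate g))
    (κ' := S.key τ) (hκ' := S.key_injective τ) (e := id) Function.injective_id
    (fun a b => by
      have h1 : S.key (τ.translate g) a = g * S.key τ a := S.key_translate g τ a
      have h2 : S.key (τ.translate g) b = g * S.key τ b := S.key_translate g τ b
      simp only [id, h1, h2, hlt.le_iff_le]) α z
  rw [stdSimplex.map_id_apply, stdSimplex.map_id_apply] at this
  rw [this]

end IsTriangulatedCover

end CanonicalFunction

/-! ### Countability of the deck group -/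

section DeckCountable

open Filter Topology OneVertexTriangulation

variable {M : Type u} [TopologicalSpace M] {X : Type w} [TopologicalSpace X]
  {T : OneVertexTriangulation M} {p : X → M} {v₀ : X} (S : IsTriangulatedCover T p v₀)

namespace IsTriangulatedCover

include S

lemma exists_translate (c : T.Cell) (f f' : C(Simplex (T.dim c), X))
    (hf : ∀ z, p (f z) = T.char c z) (hf' : ∀ z, p (f' z) = T.char c z) :
    ∃ g : Deck p, ∀ z, f' z = (g : X ≃ₜ X) (f z) := by
  have := S.simplyConnected
  have := S.locPath
  obtain ⟨g, hg⟩ := Deck.exists_apply_eq S.cov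
    (x := f (stdSimplex.vertex 0)) (y := f' (stdSimplex.vertex 0)) (by rw [hf, hf'])
  have h := S.cov.lift_unique (f := f')
    (f' := (LiftedCell.translate g ⟨c, f, hf⟩ : LiftedCell T p).map)
    (z := stdSimplex.vertex 0)
    (fun z => by rw [hf']; exact ((LiftedCell.translate g ⟨c, f, hf⟩ : LiftedCell T p).lift z).symm)
    hg.symm
  exact ⟨g, fun z => DFunLike.congr_fun h z⟩

/-- Two lifts of a cell differ by a deck transformation, and this cancels in the ratio of two
labels. So the finitely many cells of `M` account for all ratios. -/
lemma finite_ratio : {r : Deck p | ∃ (τ : LiftedCell T p) (j k : Fin (T.dim τ.cell + 1)),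
    (S.key τ j)⁻¹ * S.key τ k = r}.Finite := by
  have := S.t2
  have := T.finite_cell
  have hex : ∀ c : T.Cell, ∃ f : C(Simplex (T.dim c), X), ∀ z, p (f z) = T.char c z := by
    intro c
    obtain ⟨x, hx⟩ := S.surj (T.char c (stdSimplex.vertex 0))
    obtain ⟨f, hf, -⟩ := LiftedCell.exists_through S.cov hx
    exact ⟨f, hf⟩
  choose f hf using hex
  refine (finite_range fun q : Σ c : T.Cell, Fin (T.dim c + 1) × Fin (T.dim c + 1) =>
    (S.key ⟨q.1, f q.1, hf q.1⟩ q.2.1)⁻¹ * S.key ⟨q.1, f q.1, hf q.1⟩ q.2.2).subset ?_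
  rintro _ ⟨⟨c, f', hf'⟩, j, k, rfl⟩
  refine ⟨⟨c, j, k⟩, ?_⟩
  dsimp only
  obtain ⟨g, hg⟩ := S.exists_translate c (f c) f' (hf c) hf'
  have hk : ∀ j, S.key ⟨c, f', hf'⟩ j = g * S.key ⟨c, f c, hf c⟩ j := by
    intro j
    apply S.key_eq
    rw [Deck.mul_apply, S.key_spec]
    exact (hg _).symm
  rw [hk, hk]
  group

/-- A function on the lifted simplices that is compatible with faces is constant. -/
lemma glue_const {W : Type*} {f : LiftedCell T p → W}
    (hf : ∀ (τ : LiftedCell T p) (c' : T.Cell) (e : Fin (T.dim c' + 1) → Fin (T.dim τ.cell + 1))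
      (he : T.IsFaceMap c' τ.cell e), f (τ.face c' e he) = f τ) (τ τ' : LiftedCell T p) :
    f τ = f τ' := by
  have := S.t2
  have := S.simplyConnected
  letI : TopologicalSpace W := ⊥
  have : DiscreteTopology W := ⟨rfl⟩
  have hg : ∀ (τ : LiftedCell T p) z, S.glue (fun τ _ => f τ) (τ.map z) = f τ :=
    fun τ z => S.glue_apply (fun τ c' e he _ => hf τ c' e he) τ z
  have hc : Continuous (S.glue fun τ _ => f τ) :=
    continuous_of_cells (T := T) S.cov fun τ => by simp only [hg]; exact continuous_const
  rw [← hg τ (stdSimplex.vertex 0), ← hg τ' (stdSimplex.vertex 0)]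
  exact PreconnectedSpace.constant inferInstance hc

lemma key_translate_base (g : Deck p) : ∃ (τ : LiftedCell T p) (j : Fin (T.dim τ.cell + 1)),
    S.key τ j = g := by
  obtain ⟨τ, j, -, hj⟩ := S.exists_vertex_cell
  refine ⟨τ.translate g, j, ?_⟩
  rw [S.key_translate g τ j, S.key_eq (g := 1) hj.symm, mul_one]

/-- Modulo the subgroup generated by the ratios, all vertices of a lifted simplex have the same
label. This common coset is unchanged by passing to faces, hence constant on the connected cover,
and every element is a label; so the finitely many ratios generate the group. Countability is
required for Cantor's theorem. -/
lemma countable_deck : Countable (Deck p) := by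
  let H : Subgroup (Deck p) := Subgroup.closure {r : Deck p |
    ∃ (τ : LiftedCell T p) (j k : Fin (T.dim τ.cell + 1)), (S.key τ j)⁻¹ * S.key τ k = r}
  have hH : ∀ (τ : LiftedCell T p) (j k : Fin (T.dim τ.cell + 1)),
      (S.key τ j)⁻¹ * S.key τ k ∈ H := fun τ j k => Subgroup.subset_closure ⟨τ, j, k, rfl⟩
  have hconst := S.glue_const (f := fun τ => (S.key τ 0 : Deck p ⧸ H)) (by
    intro τ c' e he
    rw [S.key_face τ he]
    exact QuotientGroup.eq.2 (hH τ _ _))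
  have hcos : ∀ g g' : Deck p, (g : Deck p ⧸ H) = g' := by
    intro g g'
    obtain ⟨τ, j, rfl⟩ := S.key_translate_base g
    obtain ⟨τ', j', rfl⟩ := S.key_translate_base g'
    exact (QuotientGroup.eq.2 (hH τ j 0)).trans
      ((hconst τ τ').trans (QuotientGroup.eq.2 (hH τ' 0 j')))
  have hfin := S.finite_ratio
  have : Finite {r : Deck p |
    ∃ (τ : LiftedCell T p) (j k : Fin (T.dim τ.cell + 1)), (S.key τ j)⁻¹ * S.key τ k = r} := hfin
  have hc : Countable H := by
    have : Countable (FreeGroup {r : Deck p |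
        ∃ (τ : LiftedCell T p) (j k : Fin (T.dim τ.cell + 1)), (S.key τ j)⁻¹ * S.key τ k = r}) :=
      Quot.mk_surjective.countable
    have h1 : H = _ := FreeGroup.closure_eq_range (s := {r : Deck p |
        ∃ (τ : LiftedCell T p) (j k : Fin (T.dim τ.cell + 1)), (S.key τ j)⁻¹ * S.key τ k = r})
    show Countable H
    rw [h1]
    exact (MonoidHom.rangeRestrict_surjective _).countable
  have htop : H = ⊤ := by
    rw [eq_top_iff]
    intro g _
    have := QuotientGroup.eq.1 (hcos 1 g)
    simpa using this
  have : Countable (⊤ : Subgroup (Deck p)) := htop ▸ hc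
  exact (Subgroup.topEquiv (G := Deck p)).toEquiv.countable_iff.1 this

end IsTriangulatedCover

end DeckCountable

/-! ### An Alexander trick on all levels of a linear function -/

section LevelExtension

variable {ι : Type*} [Fintype ι] [DecidableEq ι]

/-- The boundary of a simplex. -/
def simplexBoundary (ι : Type*) [Fintype ι] : Set (stdSimplex ℝ ι) := {x | ∃ j, x j = 0}

lemma isClosed_simplexBoundary : IsClosed (simplexBoundary ι) := by
  have : simplexBoundary ι = ⋃ j, {x : stdSimplex ℝ ι | x j = 0} := by
    ext x; simp [simplexBoundary]
  rw [this]
  exact isClosed_iUnion_of_finite fun j => isClosed_eq (continuous_coord j) continuous_const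

lemma sum_mul_vertex (b : ι → ℝ) (k : ι) :
    ∑ j, b j * (stdSimplex.vertex k : stdSimplex ℝ ι) j = b k := by
  rw [Finset.sum_eq_single k]
  · rw [vertex_apply_self, mul_one]
  · intro j _ hj
    rw [vertex_apply_ne hj, mul_zero]
  · simp

lemma continuous_linearHeight (b : ι → ℝ) :
    Continuous fun x : stdSimplex ℝ ι => ∑ j, b j * x j :=
  continuous_finsetSum _ fun j _ => continuous_const.mul (continuous_coord j)

/-- The centre of a level is its intersection with the flow line of the barycentre. This line joins
the lowest and the highest vertex through the interior, so a centre is interior unless its level is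
one of these two vertices. -/
lemma exists_centers (b : ι → ℝ) (hb : Function.Injective b) [Nonempty ι] :
    ∃ m : stdSimplex ℝ ι → stdSimplex ℝ ι, Continuous m ∧
      (∀ x, ∑ j, b j * m x j = ∑ j, b j * x j) ∧
      (∀ x y, ∑ j, b j * x j = ∑ j, b j * y j → m x = m y) ∧
      ∀ x, (∃ k, x = stdSimplex.vertex k ∧ m x = x) ∨ ∀ j, 0 < m x j := by
  classical
  have hw : Ascending b hb fun x => ∑ j, b j * x j := ascending_linear hb fun j l h => h
  have hwc := continuous_linearHeight b
  let β : stdSimplex ℝ ι := stdSimplex.barycenter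
  have hβ : ∀ j, 0 < β j := fun j => by
    show (0 : ℝ) < (Fintype.card ι : ℝ)⁻¹
    exact inv_pos.2 (Nat.cast_pos.2 Fintype.card_pos)
  obtain ⟨jl, hjl⟩ := exists_isLowest b β
  obtain ⟨jh, hjh⟩ := exists_isHighest b β
  have hlow : ∀ k, b jl ≤ b k := fun k => hjl.2 k (hβ k).ne'
  have hhigh : ∀ k, b k ≤ b jh := fun k => hjh.2 k (hβ k).ne'
  have hex : ∀ x : stdSimplex ℝ ι, ∃ α, ∑ j, b j * slide b hb α β j = ∑ j, b j * x j := by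
    intro x
    obtain ⟨kl, hkl⟩ := exists_isLowest b x
    obtain ⟨kh, hkh⟩ := exists_isHighest b x
    refine exists_slide_eq (f := fun x : stdSimplex ℝ ι => ∑ j, b j * x j) hwc ?_ ?_
    · have := hw.lowest_le hkl
      rw [sum_mul_vertex] at this
      rw [slide_zero hjl, sum_mul_vertex]
      exact (hlow kl).trans this
    · have := hw.le_highest hkh
      rw [sum_mul_vertex] at this
      rw [slide_one hjh, sum_mul_vertex]
      exact this.trans (hhigh kh)
  choose α hα using hex
  refine ⟨fun x => slide b hb (α x) β, ?_, hα, fun x y hxy => ?_, fun x => ?_⟩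
  · rw [← continuousOn_univ]
    exact hw.continuousOn_slide hwc (x := fun _ => β) continuousOn_const
      (fun y _ => ⟨α y, rfl⟩) (by simp only [hα]; exact hwc.continuousOn)
  · exact hw.slide_inj (by simp only [hα, hxy])
  · rcases eq_or_lt_of_le (α x).2.1 with h0 | h0
    · have h0' : α x = 0 := Subtype.ext h0.symm
      left
      have hx := hα x
      rw [h0', slide_zero hjl, sum_mul_vertex] at hx
      obtain ⟨k, rfl⟩ : ∃ k, x = stdSimplex.vertex k := by
        by_contra! hne
        obtain ⟨kl, hkl⟩ := exists_isLowest b x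
        have := hw.lowest_lt hne hkl
        rw [sum_mul_vertex, ← hx] at this
        exact absurd (hlow kl) (not_le.2 this)
      refine ⟨k, rfl, ?_⟩
      rw [sum_mul_vertex] at hx
      dsimp only
      rw [h0', slide_zero hjl, hb hx]
    · rcases eq_or_lt_of_le (α x).2.2 with h1 | h1
      · have h1' : α x = 1 := Subtype.ext h1
        left
        have hx := hα x
        rw [h1', slide_one hjh, sum_mul_vertex] at hx
        obtain ⟨k, rfl⟩ : ∃ k, x = stdSimplex.vertex k := by
          by_contra! hne
          obtain ⟨kh, hkh⟩ := exists_isHighest b x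
          have := hw.lt_highest hne hkh
          rw [sum_mul_vertex, ← hx] at this
          exact absurd (hhigh kh) (not_le.2 this)
        refine ⟨k, rfl, ?_⟩
        rw [sum_mul_vertex] at hx
        dsimp only
        rw [h1', slide_one hjh, hb hx]
      · right
        intro j
        refine lt_of_le_of_ne ((slide b hb (α x) β).2.1 j) (Ne.symm ?_)
        show slide b hb (α x) β j ≠ 0
        rw [Ne, slide_apply_eq_zero_iff (α := α x) h0 h1]
        exact (hβ j).ne'

/-- A point other than the centre lies on a unique segment from the centre to the boundary. -/
lemma exists_segment_boundary [Nontrivial ι] {m x : stdSimplex ℝ ι} (h : m = x ∨ ∀ j, 0 < m j) :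
    ∃ (s : unitInterval) (y : stdSimplex ℝ ι), y ∈ simplexBoundary ι ∧ x = simplexSegment s m y := by
  by_cases hx : m = x
  · obtain ⟨j, k, hjk⟩ := exists_pair_ne ι
    exact ⟨0, stdSimplex.vertex j, ⟨k, vertex_apply_ne hjk.symm⟩, by
      rw [simplexSegment_zero, hx]⟩
  have hm := h.resolve_left hx
  -- The ray from `m` through `x` leaves the simplex where the coordinate with the least ratio `x j
  -- / m j` vanishes.
  obtain ⟨l, -, hl⟩ := Finset.exists_min_image Finset.univ (fun j => x j / m j)
    ⟨Classical.arbitrary ι, Finset.mem_univ _⟩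
  have hxs : ∑ j, x j = 1 := x.2.2
  have hms : ∑ j, m j = 1 := m.2.2
  set μ := x l / m l with hμ
  have hμ0 : 0 ≤ μ := div_nonneg (x.2.1 l) (hm l).le
  have hle : ∀ j, μ * m j ≤ x j := fun j => (le_div_iff₀ (hm j)).1 (hl j (Finset.mem_univ j))
  have hμ1 : μ < 1 := by
    by_contra! h1
    apply hx
    have hle' : ∀ j ∈ Finset.univ, m j ≤ x j := fun j _ =>
      (le_mul_of_one_le_left (hm j).le h1).trans (hle j)
    have := (Finset.sum_eq_sum_iff_of_le hle').1 (hms.trans hxs.symm)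
    exact stdSimplex.ext (funext fun j => this j (Finset.mem_univ j))
  have hs : 0 < 1 - μ := sub_pos.2 hμ1
  refine ⟨⟨1 - μ, hs.le, by linarith⟩, ⟨fun j => (x j - μ * m j) / (1 - μ),
    fun j => div_nonneg (sub_nonneg.2 (hle j)) hs.le, ?_⟩, ⟨l, ?_⟩, ?_⟩
  · rw [← Finset.sum_div, Finset.sum_sub_distrib, ← Finset.mul_sum, hxs, hms, mul_one,
      div_self hs.ne']
  · show (x l - μ * m l) / (1 - μ) = 0
    rw [hμ, div_mul_cancel₀ _ (hm l).ne', sub_self, zero_div]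
  · apply stdSimplex.ext
    funext j
    rw [simplexSegment_apply]
    show x j = (1 - (1 - μ)) * m j + (1 - μ) * ((x j - μ * m j) / (1 - μ))
    field_simp
    ring

lemma segment_boundary_unique {m y y' : stdSimplex ℝ ι} {s s' : unitInterval} (hm : ∀ j, 0 < m j)
    (hy : y ∈ simplexBoundary ι) (hy' : y' ∈ simplexBoundary ι)
    (h : simplexSegment s m y = simplexSegment s' m y') : s = s' ∧ (s = 0 ∨ y = y') := by
  have hle : ∀ {y y' : stdSimplex ℝ ι} {s s' : unitInterval}, y ∈ simplexBoundary ι →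
      simplexSegment s m y = simplexSegment s' m y' → (s : ℝ) ≤ s' := by
    intro y y' s s' ⟨j, hj⟩ h
    have h1 : simplexSegment s m y j = simplexSegment s' m y' j := by rw [h]
    rw [simplexSegment_apply, simplexSegment_apply, hj, mul_zero, add_zero] at h1
    have h2 : (0 : ℝ) ≤ s' * y' j := mul_nonneg s'.2.1 (y'.2.1 j)
    have h3 : (1 - s' : ℝ) * m j ≤ (1 - s) * m j := by linarith
    have := le_of_mul_le_mul_right h3 (hm j)
    linarith
  have hs : s = s' := Subtype.ext (le_antisymm (hle hy h) (hle hy' h.symm))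
  refine ⟨hs, or_iff_not_imp_left.2 fun h0 => ?_⟩
  subst hs
  have hs0 : (s : ℝ) ≠ 0 := fun h => h0 (Subtype.ext h)
  apply stdSimplex.ext
  funext j
  have h1 : simplexSegment s m y j = simplexSegment s m y' j := by rw [h]
  rw [simplexSegment_apply, simplexSegment_apply] at h1
  exact mul_left_cancel₀ hs0 (add_left_cancel h1)

/-- A level preserving self-map of the boundary that preserves the faces. -/
structure IsBoundaryMap (b : ι → ℝ) (k : stdSimplex ℝ ι → stdSimplex ℝ ι) : Prop where
  cont : ContinuousOn k (simplexBoundary ι)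
  support : ∀ x ∈ simplexBoundary ι, ∀ j, k x j = 0 ↔ x j = 0
  level : ∀ x ∈ simplexBoundary ι, ∑ j, b j * k x j = ∑ j, b j * x j

lemma sum_mul_simplexSegment (b : ι → ℝ) (s : unitInterval) (x y : stdSimplex ℝ ι) :
    ∑ j, b j * simplexSegment s x y j =
      (1 - s) * ∑ j, b j * x j + s * ∑ j, b j * y j := by
  rw [Finset.mul_sum, Finset.mul_sum, ← Finset.sum_add_distrib]
  exact Finset.sum_congr rfl fun j _ => by rw [simplexSegment_apply]; ring

lemma vertex_of_support {y : stdSimplex ℝ ι} {j : ι}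
    (h : ∀ l, y l = 0 ↔ (stdSimplex.vertex j : stdSimplex ℝ ι) l = 0) : y = stdSimplex.vertex j :=
  eq_vertex_of_support fun l hl => (h l).2 (vertex_apply_ne hl)

/-- The boundary map is coned off over the moving centres. The representation of `x` by a boundary
point and a parameter is ambiguous only if `x` is its own centre, and the coned value does not
depend on it; by compactness this makes the value continuous even though the representation need not
be. -/
lemma IsBoundaryMap.exists_map [Nontrivial ι] {b : ι → ℝ} {k m : stdSimplex ℝ ι → stdSimplex ℝ ι}
    (hk : IsBoundaryMap b k) (hmc : Continuous m)
    (hm : ∀ x, (∃ k, x = stdSimplex.vertex k ∧ m x = x) ∨ ∀ j, 0 < m x j) :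
    ∃ K : stdSimplex ℝ ι → stdSimplex ℝ ι, Continuous K ∧ ∀ x s y, y ∈ simplexBoundary ι →
      x = simplexSegment s (m x) y → K x = simplexSegment s (m x) (k y) := by
  have hex : ∀ x, ∃ (s : unitInterval) (y : stdSimplex ℝ ι), y ∈ simplexBoundary ι ∧
      x = simplexSegment s (m x) y := fun x =>
    exists_segment_boundary ((hm x).imp_left fun ⟨k, _, h⟩ => h)
  choose s y hy hxs using hex
  have huniq : ∀ x s' y', y' ∈ simplexBoundary ι → x = simplexSegment s' (m x) y' →
      simplexSegment (s x) (m x) (k (y x)) = simplexSegment s' (m x) (k y') := by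
    intro x s' y' hy' hx'
    rcases hm x with ⟨l, rfl, hl⟩ | hpos
    · have aux : ∀ (s' : unitInterval) y', y' ∈ simplexBoundary ι →
          stdSimplex.vertex l = simplexSegment s' (m (stdSimplex.vertex l)) y' →
          simplexSegment s' (m (stdSimplex.vertex l)) (k y') = stdSimplex.vertex l := by
        intro s' y' hy' h
        rw [hl] at h ⊢
        by_cases h0 : s' = 0
        · rw [h0, simplexSegment_zero]
        · have hs0 : (s' : ℝ) ≠ 0 := fun h => h0 (Subtype.ext h)
          have : y' = stdSimplex.vertex l := by
            apply eq_vertex_of_support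
            intro j hj
            have h1 : (stdSimplex.vertex l : stdSimplex ℝ ι) j =
              simplexSegment s' (stdSimplex.vertex l) y' j := by rw [← h]
            rw [simplexSegment_apply, vertex_apply_ne hj, mul_zero, zero_add] at h1
            exact (mul_eq_zero.1 h1.symm).resolve_left hs0
          subst this
          have : k (stdSimplex.vertex l) = stdSimplex.vertex l :=
            vertex_of_support (hk.support _ hy')
          rw [this, simplexSegment_self]
      rw [aux _ _ (hy _) (hxs _), aux _ _ hy' hx']
    · obtain ⟨h1, h2⟩ := segment_boundary_unique hpos (hy x) hy' ((hxs x).symm.trans hx')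
      rcases h2 with h2 | h2
      · rw [← h1, h2, simplexSegment_zero, simplexSegment_zero]
      · rw [← h1, h2]
  refine ⟨fun x => simplexSegment (s x) (m x) (k (y x)), ?_, huniq⟩
  rw [continuous_iff_continuousAt]
  intro a
  rw [ContinuousAt, Filter.tendsto_iff_ultrafilter]
  intro U hU
  obtain ⟨s₀, -, hs₀⟩ := isCompact_univ.ultrafilter_le_nhds (U.map s) (by simp)
  obtain ⟨y₀, hy₀, hyl⟩ := (isClosed_simplexBoundary (ι := ι)).isCompact.ultrafilter_le_nhds
    (U.map y) (by
      rw [Filter.le_principal_iff]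
      exact Filter.Eventually.of_forall (f := (U : Filter _)) hy)
  have hs₀ : Filter.Tendsto s U (nhds s₀) := hs₀
  have hyl : Filter.Tendsto y U (nhds y₀) := hyl
  have hml : Filter.Tendsto m U (nhds (m a)) := (hmc.tendsto a).comp hU
  have hkl : Filter.Tendsto (fun x => k (y x)) U (nhds (k y₀)) :=
    (hk.cont y₀ hy₀).tendsto.comp (tendsto_nhdsWithin_iff.2
      ⟨hyl, Filter.Eventually.of_forall hy⟩)
  have ha : a = simplexSegment s₀ (m a) y₀ := by
    refine tendsto_nhds_unique hU (((continuous_simplexSegment.tendsto (s₀, m a, y₀)).comp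
      (hs₀.prodMk_nhds (hml.prodMk_nhds hyl))).congr fun x => (hxs x).symm)
  rw [huniq a s₀ y₀ hy₀ ha]
  exact (continuous_simplexSegment.tendsto (s₀, m a, k y₀)).comp
    (hs₀.prodMk_nhds (hml.prodMk_nhds hkl))

/-- The Alexander trick, performed on all level sets of a linear function simultaneously. -/
theorem exists_level_extension [Nontrivial ι] {b : ι → ℝ} (hb : Function.Injective b)
    {k k' : stdSimplex ℝ ι → stdSimplex ℝ ι} (hk : IsBoundaryMap b k) (hk' : IsBoundaryMap b k')
    (hkk' : ∀ x ∈ simplexBoundary ι, k' (k x) = x) (hk'k : ∀ x ∈ simplexBoundary ι, k (k' x) = x) :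
    ∃ K : stdSimplex ℝ ι ≃ₜ stdSimplex ℝ ι, (∀ x ∈ simplexBoundary ι, K x = k x) ∧
      (∀ x j, K x j = 0 ↔ x j = 0) ∧ ∀ x, ∑ j, b j * K x j = ∑ j, b j * x j := by
  obtain ⟨m, hmc, hmw, hmx, hm⟩ := exists_centers b hb
  obtain ⟨K, hKc, hK⟩ := hk.exists_map hmc hm
  obtain ⟨K', hKc', hK'⟩ := hk'.exists_map hmc hm
  have hex : ∀ x, ∃ (s : unitInterval) (y : stdSimplex ℝ ι), y ∈ simplexBoundary ι ∧
      x = simplexSegment s (m x) y := fun x =>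
    exists_segment_boundary ((hm x).imp_left fun ⟨k, _, h⟩ => h)
  have hmem : ∀ {k : stdSimplex ℝ ι → stdSimplex ℝ ι}, IsBoundaryMap b k →
      ∀ y ∈ simplexBoundary ι, k y ∈ simplexBoundary ι := by
    intro k hk y hy
    obtain ⟨j, hj⟩ := hy
    exact ⟨j, (hk.support y ⟨j, hj⟩ j).2 hj⟩
  have hlev : ∀ {k K : stdSimplex ℝ ι → stdSimplex ℝ ι}, IsBoundaryMap b k →
      (∀ x s y, y ∈ simplexBoundary ι → x = simplexSegment s (m x) y →
        K x = simplexSegment s (m x) (k y)) → ∀ x, ∑ j, b j * K x j = ∑ j, b j * x j := by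
    intro k K hk hK x
    obtain ⟨s, y, hy, hx⟩ := hex x
    rw [hK x s y hy hx, sum_mul_simplexSegment, hk.level y hy, ← sum_mul_simplexSegment, ← hx]
  have hinv : ∀ {k k' K K' : stdSimplex ℝ ι → stdSimplex ℝ ι}, IsBoundaryMap b k →
      (∀ x ∈ simplexBoundary ι, k' (k x) = x) →
      (∀ x s y, y ∈ simplexBoundary ι → x = simplexSegment s (m x) y →
        K x = simplexSegment s (m x) (k y)) →
      (∀ x s y, y ∈ simplexBoundary ι → x = simplexSegment s (m x) y →
        K' x = simplexSegment s (m x) (k' y)) → ∀ x, K' (K x) = x := by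
    intro k k' K K' hk hkk' hK hK' x
    obtain ⟨s, y, hy, hx⟩ := hex x
    have h1 := hK x s y hy hx
    -- The centre depends only on the level, which `K` preserves, so the two cones have the same
    -- apex and the inverse can be computed on the boundary.
    have h2 : m (K x) = m x := hmx _ _ (hlev hk hK x)
    rw [hK' (K x) s (k y) (hmem hk y hy) (by rw [h2, ← h1]), h2, hkk' y hy, ← hx]
  have hbd : ∀ {k K : stdSimplex ℝ ι → stdSimplex ℝ ι},
      (∀ x s y, y ∈ simplexBoundary ι → x = simplexSegment s (m x) y →
        K x = simplexSegment s (m x) (k y)) → ∀ x ∈ simplexBoundary ι, K x = k x := by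
    intro k K hK x hx
    rw [hK x 1 x hx (simplexSegment_one _ _).symm, simplexSegment_one]
  refine ⟨⟨⟨K, K', hinv hk hkk' hK hK', hinv hk' hk'k hK' hK⟩, hKc, hKc'⟩, hbd hK,
    fun x j => ?_, hlev hk hK⟩
  show K x j = 0 ↔ x j = 0
  constructor
  · intro h
    have hb' : K x ∈ simplexBoundary ι := ⟨j, h⟩
    have h1 := hbd hK' _ hb'
    rw [hinv hk hkk' hK hK'] at h1
    rw [h1]
    exact (hk'.support _ hb' j).2 h
  · intro h
    have hb' : x ∈ simplexBoundary ι := ⟨j, h⟩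
    rw [hbd hK x hb']
    exact (hk.support _ hb' j).2 h

end LevelExtension

/-! ### Compatible self-maps of the simplices -/

section FaceSystems

open Filter Topology OneVertexTriangulation

variable {M : Type u} [TopologicalSpace M] {X : Type w} [TopologicalSpace X]
  {T : OneVertexTriangulation M} {p : X → M} {v₀ : X} (S : IsTriangulatedCover T p v₀)

namespace OneVertexTriangulation

lemma support_range {n m : ℕ} {e : Fin (m + 1) → Fin (n + 1)} (he : Function.Injective e)
    {y : Simplex m} (hy : ∀ j, 0 < y j) (j : Fin (n + 1)) :
    j ∈ range e ↔ stdSimplex.map e y j ≠ 0 := by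
  constructor
  · rintro ⟨k, rfl⟩
    rw [simplex_map_apply he]
    exact (hy k).ne'
  · intro h
    by_contra hj
    exact h (simplex_map_apply_of_notMem _ hj)

/-- A relabelling of the vertices of a simplex under which the characteristic map is invariant
is trivial. -/
lemma relabel_eq_id {c : T.Cell} {σ : Fin (T.dim c + 1) → Fin (T.dim c + 1)}
    (hσ : Function.Injective σ) (h : ∀ z, T.char c z = T.char c (stdSimplex.map σ z))
    (k : Fin (T.dim c + 1)) : σ k = k := by
  by_contra hk
  have hsurj := Finite.surjective_of_injective hσ
  let t : unitInterval := ⟨1 / 2, by norm_num, by norm_num⟩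
  let β : Simplex (T.dim c) := stdSimplex.barycenter
  have hβ : ∀ j, β j = (Fintype.card (Fin (T.dim c + 1)) : ℝ)⁻¹ := fun j => rfl
  have hβ0 : (0 : ℝ) < (Fintype.card (Fin (T.dim c + 1)) : ℝ)⁻¹ :=
    inv_pos.2 (Nat.cast_pos.2 Fintype.card_pos)
  -- An interior point whose `k`-th coordinate differs from all others. Since open simplices are
  -- embedded, the relabelling fixes this point, and so fixes `k`.
  let z : Simplex (T.dim c) := simplexSegment t β (stdSimplex.vertex k)
  have hzj : ∀ j, z j = (1 - 1 / 2) * β j + 1 / 2 * (stdSimplex.vertex k : Simplex _) j :=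
    fun j => rfl
  have hz : ∀ j, 0 < z j := by
    intro j
    rw [hzj, hβ]
    have : (0 : ℝ) ≤ (stdSimplex.vertex k : Simplex _) j :=
      (stdSimplex.vertex k : Simplex (T.dim c)).2.1 j
    linarith
  have hz' : ∀ j, 0 < stdSimplex.map σ z j := by
    intro j
    obtain ⟨l, rfl⟩ := hsurj j
    rw [simplex_map_apply hσ]
    exact hz l
  have h1 := interior_unique hz hz' (h z)
  have h2 : z = stdSimplex.map σ z := by simpa using h1
  have h3 : z (σ k) = z k := by
    conv_lhs => rw [h2]
    rw [simplex_map_apply hσ]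
  rw [hzj, hzj, hβ, hβ, vertex_apply_self, vertex_apply_ne hk] at h3
  linarith

/-- Embeddedness of the open simplices determines the cell and its coordinates. The two inclusions
then differ by a relabelling that leaves a characteristic map invariant, and such a relabelling is
trivial. -/
lemma face_unique {c c' c'' : T.Cell} {e : Fin (T.dim c' + 1) → Fin (T.dim c + 1)}
    {e' : Fin (T.dim c'' + 1) → Fin (T.dim c + 1)} (he : T.IsFaceMap c' c e)
    (he' : T.IsFaceMap c'' c e') {y : Simplex (T.dim c')} {y' : Simplex (T.dim c'')}
    (hy : ∀ j, 0 < y j) (hy' : ∀ j, 0 < y' j) (h : stdSimplex.map e y = stdSimplex.map e' y') :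
    (⟨c', e, y⟩ : Σ c' : T.Cell, (Fin (T.dim c' + 1) → Fin (T.dim c + 1)) × Simplex (T.dim c')) =
      ⟨c'', e', y'⟩ := by
  have h1 := interior_unique hy hy' (by rw [he.2, he'.2, h])
  cases h1
  have hex : ∀ k, ∃ l, e' l = e k := by
    intro k
    have : e k ∈ range e' := by
      rw [support_range he'.1 hy, ← h, ← support_range he.1 hy]
      exact ⟨k, rfl⟩
    exact this
  choose σ hσ using hex
  have hσi : Function.Injective σ := by
    intro a b hab
    apply he.1
    rw [← hσ, ← hσ, hab]
  have hcomp : e' ∘ σ = e := funext hσ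
  have hid := relabel_eq_id hσi fun z => by
    rw [he.2, ← hcomp, ← stdSimplex.map_comp_apply, ← he'.2]
  have : e = e' := by
    rw [← hcomp]
    funext k
    simp [hid]
  rw [this]

lemma IsFaceMap.dim_le {c c' : T.Cell} {e : Fin (T.dim c' + 1) → Fin (T.dim c + 1)}
    (he : T.IsFaceMap c' c e) : T.dim c' ≤ T.dim c := by
  have := Fintype.card_le_of_injective e he.1
  simp only [Fintype.card_fin] at this
  omega

lemma barycenter_pos {n : ℕ} (j : Fin (n + 1)) : 0 < (stdSimplex.barycenter : Simplex n) j := by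
  show (0 : ℝ) < (Fintype.card (Fin (n + 1)) : ℝ)⁻¹
  exact inv_pos.2 (Nat.cast_pos.2 Fintype.card_pos)

lemma IsFaceMap.refl (c : T.Cell) : T.IsFaceMap c c id :=
  ⟨Function.injective_id, fun z => by rw [stdSimplex.map_id_apply]⟩

lemma IsFaceMap.eq_of_surjective {c c' : T.Cell} {e : Fin (T.dim c' + 1) → Fin (T.dim c + 1)}
    (he : T.IsFaceMap c' c e) (hs : Function.Surjective e) :
    (⟨c', e⟩ : Σ c' : T.Cell, (Fin (T.dim c' + 1) → Fin (T.dim c + 1))) = ⟨c, id⟩ := by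
  have hpos : ∀ j, 0 < stdSimplex.map e (stdSimplex.barycenter : Simplex (T.dim c')) j := by
    intro j
    obtain ⟨k, rfl⟩ := hs j
    rw [simplex_map_apply he.1]
    exact barycenter_pos k
  have := face_unique he (IsFaceMap.refl c) barycenter_pos hpos
    (by rw [stdSimplex.map_id_apply])
  exact congrArg (fun q : Σ c' : T.Cell, (Fin (T.dim c' + 1) → Fin (T.dim c + 1)) ×
    Simplex (T.dim c') => (⟨q.1, q.2.1⟩ : Σ c' : T.Cell,
      (Fin (T.dim c' + 1) → Fin (T.dim c + 1)))) this

lemma IsFaceMap.surjective_of_dim_eq {c c' : T.Cell} {e : Fin (T.dim c' + 1) → Fin (T.dim c + 1)}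
    (he : T.IsFaceMap c' c e) (h : T.dim c' = T.dim c) : Function.Surjective e :=
  ((Fintype.bijective_iff_injective_and_card e).2 ⟨he.1, by simp [h]⟩).2

lemma exists_carrier_face (c : T.Cell) (x : Simplex (T.dim c)) :
    ∃ q : Σ c' : T.Cell, (Fin (T.dim c' + 1) → Fin (T.dim c + 1)) × Simplex (T.dim c'),
      T.IsFaceMap q.1 c q.2.1 ∧ (∀ j, 0 < q.2.2 j) ∧ stdSimplex.map q.2.1 q.2.2 = x := by
  obtain ⟨c', e, y, h⟩ := exists_face_interior c x
  exact ⟨⟨c', e, y⟩, h⟩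

/-- The face of a simplex that carries a given point, with the coordinates of the point. -/
noncomputable def carrierFace (c : T.Cell) (x : Simplex (T.dim c)) :
    Σ c' : T.Cell, (Fin (T.dim c' + 1) → Fin (T.dim c + 1)) × Simplex (T.dim c') :=
  (exists_carrier_face c x).choose

lemma carrierFace_map {c c' : T.Cell} {e : Fin (T.dim c' + 1) → Fin (T.dim c + 1)}
    (he : T.IsFaceMap c' c e) {y : Simplex (T.dim c')} (hy : ∀ j, 0 < y j) :
    carrierFace c (stdSimplex.map e y) = ⟨c', e, y⟩ := by
  have hs := (exists_carrier_face c (stdSimplex.map e y)).choose_spec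
  exact face_unique hs.1 he hs.2.1 hy hs.2.2

/-- The extension to all of a simplex of self-maps of its faces. -/
noncomputable def faceGlue (κ : ∀ c : T.Cell, Simplex (T.dim c) → Simplex (T.dim c)) (c : T.Cell)
    (x : Simplex (T.dim c)) : Simplex (T.dim c) :=
  stdSimplex.map (carrierFace c x).2.1 (κ _ (carrierFace c x).2.2)

/-- Self-maps of the simplices of dimension at most `n` that are compatible with the faces and
carry the levels of `F₂` to those of `F₁`. -/
structure IsFaceSystem (T : OneVertexTriangulation M) (p : X → M) (n : ℕ) (F₁ F₂ : X → ℝ)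
    (κ : ∀ c : T.Cell, Simplex (T.dim c) → Simplex (T.dim c)) : Prop where
  cont : ∀ c, T.dim c ≤ n → Continuous (κ c)
  support : ∀ c, T.dim c ≤ n → ∀ x j, κ c x j = 0 ↔ x j = 0
  face : ∀ c, T.dim c ≤ n → ∀ c' e, T.IsFaceMap c' c e → ∀ y,
    κ c (stdSimplex.map e y) = stdSimplex.map e (κ c' y)
  height : ∀ τ : LiftedCell T p, T.dim τ.cell ≤ n → ∀ z, F₁ (τ.map (κ τ.cell z)) = F₂ (τ.map z)

variable {κ : ∀ c : T.Cell, Simplex (T.dim c) → Simplex (T.dim c)} {n : ℕ} {F₁ F₂ : X → ℝ}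

lemma faceGlue_map (hκ : IsFaceSystem T p n F₁ F₂ κ) {c c' : T.Cell}
    {e : Fin (T.dim c' + 1) → Fin (T.dim c + 1)} (he : T.IsFaceMap c' c e) (hn : T.dim c' ≤ n)
    (y : Simplex (T.dim c')) : faceGlue κ c (stdSimplex.map e y) = stdSimplex.map e (κ c' y) := by
  obtain ⟨c'', e', y', he', hy', rfl⟩ := exists_face_interior c' y
  rw [hκ.face c' hn c'' e' he', stdSimplex.map_comp_apply, stdSimplex.map_comp_apply, faceGlue,
    carrierFace_map (he.comp he') hy']

lemma isClosedEmbedding_simplex_map {n m : ℕ} {e : Fin (m + 1) → Fin (n + 1)}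
    (he : Function.Injective e) :
    IsClosedEmbedding (stdSimplex.map e : Simplex m → Simplex n) := by
  refine (stdSimplex.continuous_map e).isClosedEmbedding fun x y h => ?_
  apply stdSimplex.ext
  funext k
  have : stdSimplex.map e x (e k) = stdSimplex.map e y (e k) := by rw [h]
  rwa [simplex_map_apply he, simplex_map_apply he] at this

lemma exists_boundary_face {c : T.Cell} (hc : T.dim c = n + 1) (j : Fin (T.dim c + 1)) :
    ∃ (c' : T.Cell) (e : Fin (T.dim c' + 1) → Fin (T.dim c + 1)), T.IsFaceMap c' c e ∧
      T.dim c' ≤ n ∧ ∀ x : Simplex (T.dim c), x j = 0 → x ∈ range (stdSimplex.map e) := by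
  obtain ⟨k, hk⟩ : ∃ k : Fin (T.dim c + 1), k ≠ j := by
    by_contra! h
    have h1 := (h ⟨0, by omega⟩).trans (h ⟨1, by omega⟩).symm
    simp at h1
  obtain ⟨c', e, he, hr⟩ := exists_isFaceMap c (Finset.univ.erase j) ⟨k, by simp [hk]⟩
  have hmem : ∀ l, l ∈ range e ↔ l ≠ j := fun l => by rw [hr]; simp
  refine ⟨c', e, he, ?_, fun x hx => ?_⟩
  · by_contra! hlt
    have heq : T.dim c' = T.dim c := le_antisymm he.dim_le (by omega)
    exact (hmem j).1 (he.surjective_of_dim_eq heq j) rfl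
  · have hz : ∀ l, l ∉ range e → x l = 0 := by
      intro l hl
      rw [hmem, not_not] at hl
      rw [hl, hx]
    exact ⟨pullCoord e he.1 x hz, map_pullCoord e he.1 x hz⟩

lemma continuousOn_faceGlue (hκ : IsFaceSystem T p n F₁ F₂ κ) {c : T.Cell}
    (hc : T.dim c = n + 1) :
    ContinuousOn (faceGlue κ c) (simplexBoundary (Fin (T.dim c + 1))) := by
  have hb : simplexBoundary (Fin (T.dim c + 1)) = ⋃ j, {x : Simplex (T.dim c) | x j = 0} := by
    ext x; simp [simplexBoundary]
  rw [hb]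
  refine (locallyFinite_of_finite _).continuousOn_iUnion
    (fun j => isClosed_eq (continuous_coord j) continuous_const) fun j => ?_
  obtain ⟨c', e, he, hn, hx⟩ := exists_boundary_face hc j
  have h1 : ContinuousOn (faceGlue κ c) (range (stdSimplex.map e)) := by
    rw [← image_univ]
    refine (isClosedEmbedding_simplex_map he.1).isInducing.continuousOn_image_iff.2
      (Continuous.continuousOn ?_)
    have : faceGlue κ c ∘ stdSimplex.map e = fun y => stdSimplex.map e (κ c' y) :=
      funext fun y => faceGlue_map hκ he hn y
    rw [this]
    exact (stdSimplex.continuous_map e).comp (hκ.cont c' hn)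
  exact h1.mono hx

lemma faceGlue_support (hκ : IsFaceSystem T p n F₁ F₂ κ) {c : T.Cell}
    (hc : T.dim c = n + 1) {x : Simplex (T.dim c)}
    (hx : x ∈ simplexBoundary (Fin (T.dim c + 1))) (j) : faceGlue κ c x j = 0 ↔ x j = 0 := by
  obtain ⟨l, hl⟩ := hx
  obtain ⟨c', e, he, hn, hx⟩ := exists_boundary_face hc l
  obtain ⟨y, rfl⟩ := hx x hl
  rw [faceGlue_map hκ he hn]
  by_cases hj : j ∈ range e
  · obtain ⟨k, rfl⟩ := hj
    rw [simplex_map_apply he.1, simplex_map_apply he.1, hκ.support c' hn]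
  · rw [simplex_map_apply_of_notMem _ hj, simplex_map_apply_of_notMem _ hj]

lemma faceGlue_height (hκ : IsFaceSystem T p n F₁ F₂ κ) (τ : LiftedCell T p)
    (hc : T.dim τ.cell = n + 1) {x : Simplex (T.dim τ.cell)}
    (hx : x ∈ simplexBoundary (Fin (T.dim τ.cell + 1))) :
    F₁ (τ.map (faceGlue κ τ.cell x)) = F₂ (τ.map x) := by
  obtain ⟨l, hl⟩ := hx
  obtain ⟨c', e, he, hn, hx⟩ := exists_boundary_face hc l
  obtain ⟨y, rfl⟩ := hx x hl
  rw [faceGlue_map hκ he hn]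
  exact hκ.height (τ.face c' e he) hn y

lemma faceGlue_inverse {κ' : ∀ c : T.Cell, Simplex (T.dim c) → Simplex (T.dim c)}
    {F₃ F₄ : X → ℝ} (hκ : IsFaceSystem T p n F₁ F₂ κ) (hκ' : IsFaceSystem T p n F₃ F₄ κ')
    (h : ∀ c y, κ' c (κ c y) = y) {c : T.Cell} (hc : T.dim c = n + 1) {x : Simplex (T.dim c)}
    (hx : x ∈ simplexBoundary (Fin (T.dim c + 1))) : faceGlue κ' c (faceGlue κ c x) = x := by
  obtain ⟨l, hl⟩ := hx
  obtain ⟨c', e, he, hn, hx⟩ := exists_boundary_face hc l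
  obtain ⟨y, rfl⟩ := hx x hl
  rw [faceGlue_map hκ he hn, faceGlue_map hκ' he hn, h]

end OneVertexTriangulation

end FaceSystems

/-! ### Comparing two defining functions of one action -/

section LinearModel

open Filter Topology OneVertexTriangulation

/-- A continuous function whose levels are those of a linear function is strictly monotone along
that linear function. -/
lemma monotone_of_same_levels {ι : Type*} [Fintype ι] {f : stdSimplex ℝ ι → ℝ} (hf : Continuous f)
    {a : ι → ℝ} (h : ∀ x y, f x = f y ↔ ∑ j, a j * x j = ∑ j, a j * y j) :
    (∀ x y, ∑ j, a j * x j < ∑ j, a j * y j → f x < f y) ∨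
      ∀ x y, ∑ j, a j * x j < ∑ j, a j * y j → f y < f x := by
  set A : Set (stdSimplex ℝ ι × stdSimplex ℝ ι) :=
    {q | ∑ j, a j * q.1 j < ∑ j, a j * q.2 j} with hA
  -- The pairs in `A` form a convex set, on which the difference of the values of `f` has no zero;
  -- so its sign is constant.
  have hpre : IsPreconnected A := by
    refine isPreconnected_of_forall_pair fun q hq q' hq' => ?_
    have hc : Continuous fun t : unitInterval =>
        (simplexSegment t q.1 q'.1, simplexSegment t q.2 q'.2) :=
      (continuous_simplexSegment.comp
        (continuous_id.prodMk (continuous_const (y := (q.1, q'.1))))).prodMk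
        (continuous_simplexSegment.comp
          (continuous_id.prodMk (continuous_const (y := (q.2, q'.2)))))
    refine ⟨range fun t : unitInterval => (simplexSegment t q.1 q'.1, simplexSegment t q.2 q'.2),
      ?_, ⟨0, ?_⟩, ⟨1, ?_⟩, isPreconnected_range hc⟩
    · rintro _ ⟨t, rfl⟩
      have h1 : ∑ j, a j * q.1 j < ∑ j, a j * q.2 j := hq
      have h2 : ∑ j, a j * q'.1 j < ∑ j, a j * q'.2 j := hq'
      show ∑ j, a j * simplexSegment t q.1 q'.1 j < ∑ j, a j * simplexSegment t q.2 q'.2 j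
      classical
      rw [sum_mul_simplexSegment, sum_mul_simplexSegment]
      have t0 : (0 : ℝ) ≤ t := t.2.1
      rcases eq_or_lt_of_le t.2.2 with ht | ht
      · rw [ht]; linarith
      · have := mul_lt_mul_of_pos_left h1 (sub_pos.2 ht)
        have := mul_le_mul_of_nonneg_left h2.le t0
        linarith
    · simp only [simplexSegment_zero]
    · simp only [simplexSegment_one]
  have hφ : ContinuousOn (fun q : stdSimplex ℝ ι × stdSimplex ℝ ι => f q.1 - f q.2) A :=
    ((hf.comp continuous_fst).sub (hf.comp continuous_snd)).continuousOn
  by_contra! hcon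
  obtain ⟨⟨x, y, hxy, h1⟩, x', y', hxy', h2⟩ := hcon
  obtain ⟨q, hq, h0⟩ := hpre.intermediate_value (show (x', y') ∈ A from hxy')
    (show (x, y) ∈ A from hxy) hφ (show (0 : ℝ) ∈ Icc _ _ from
      ⟨sub_nonpos.2 h2, sub_nonneg.2 h1⟩)
  exact hq.ne ((h _ _).1 (sub_eq_zero.1 h0))

variable {M : Type u} [TopologicalSpace M] {X : Type w} [TopologicalSpace X]
  {T : OneVertexTriangulation M} {p : X → M} {v₀ : X} (S : IsTriangulatedCover T p v₀)

variable {i : Deck p → ℝ} {ρ : Deck p →* (ℝ ≃o ℝ)} {F : X → ℝ}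

lemma IsDefiningFunction.orbit (hF : IsDefiningFunction T p v₀ ρ F) (hi1 : i 1 = 0)
    (hρ : ∀ g h, ρ g (i h) = i (g * h)) (g : Deck p) : F ((g : X ≃ₜ X) v₀) = i g := by
  rw [hF.map_deck, hF.map_base, ← hi1, hρ, mul_one]

namespace IsTriangulatedCover

include S

lemma defining_vertex (hF : IsDefiningFunction T p v₀ ρ F) (hi1 : i 1 = 0)
    (hρ : ∀ g h, ρ g (i h) = i (g * h)) (τ : LiftedCell T p) (j : Fin (T.dim τ.cell + 1)) :
    F (τ.map (stdSimplex.vertex j)) = i (S.key τ j) := by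
  rw [← S.key_spec, hF.orbit hi1 hρ]

/-- In each simplex, a defining function is linear up to a homeomorphism preserving the faces. -/
lemma exists_linear_model (hF : IsDefiningFunction T p v₀ ρ F) (hi : Function.Injective i)
    (hi1 : i 1 = 0) (hρ : ∀ g h, ρ g (i h) = i (g * h)) (τ : LiftedCell T p) :
    ∃ q : Simplex (T.dim τ.cell) ≃ₜ Simplex (T.dim τ.cell), (∀ x j, q x j = 0 ↔ x j = 0) ∧
      ∀ x, F (τ.map (q x)) = ∑ j, i (S.key τ j) * x j := by
  obtain ⟨h, a, h0, hl⟩ := hF.polytope_level τ.cell τ.map τ.lift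
  have hfc : Continuous fun x => F (τ.map (h x)) :=
    hF.continuous.comp (τ.map.continuous.comp h.continuous)
  have hv : ∀ j, F (τ.map (h (stdSimplex.vertex j))) = i (S.key τ j) := by
    intro j
    rw [vertex_of_support (y := h (stdSimplex.vertex j)) fun l => h0 _ l,
      S.defining_vertex hF hi1 hρ]
  obtain ⟨a', ha'⟩ : ∃ a' : Fin (T.dim τ.cell + 1) → ℝ,
      (∀ x y, F (τ.map (h x)) = F (τ.map (h y)) ↔ ∑ j, a' j * x j = ∑ j, a' j * y j) ∧
      ∀ x y, ∑ j, a' j * x j < ∑ j, a' j * y j → F (τ.map (h x)) < F (τ.map (h y)) := by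
    rcases monotone_of_same_levels hfc hl with hm | hm
    · exact ⟨a, hl, hm⟩
    · refine ⟨fun j => -a j, fun x y => ?_, fun x y hxy => ?_⟩
      · rw [hl]
        simp only [neg_mul, Finset.sum_neg_distrib, neg_inj]
      · simp only [neg_mul, Finset.sum_neg_distrib, neg_lt_neg_iff] at hxy
        exact hm _ _ hxy
  obtain ⟨hl', hm'⟩ := ha'
  have hb := S.base_injective hi τ
  have hab : ∀ j l, a' j < a' l → i (S.key τ j) < i (S.key τ l) := by
    intro j l hjl
    rw [← hv, ← hv]
    apply hm'
    rwa [sum_mul_vertex, sum_mul_vertex]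
  have ha : Function.Injective a' := by
    intro j l hjl
    apply hb
    show i (S.key τ j) = i (S.key τ l)
    rw [← hv, ← hv, hl', sum_mul_vertex, sum_mul_vertex, hjl]
  -- The coefficients `a'` and the vertex heights order the vertices alike, so the flow belonging to
  -- the heights raises the linear function of `a'`, and with it the given function.
  have hasc : Ascending (fun j => i (S.key τ j)) hb fun x => F (τ.map (h x)) := by
    intro x hx α β hαβ
    exact hm' _ _ (ascending_linear (hκ := hb) ha hab x hx hαβ)
  obtain ⟨h2, hh2, h02⟩ := hasc.exists_homeomorph hfc
    (ascending_linear (b := fun j => i (S.key τ j)) (hκ := hb) hb fun j l h => h)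
    (continuous_linearHeight _) (fun j => by rw [sum_mul_vertex]; exact hv j)
  exact ⟨h2.trans h, fun x j => (h0 _ j).trans (h02 x j), hh2⟩

variable {F₁ F₂ : X → ℝ} {n : ℕ}

/-- In the linear models of the two functions the map glued on the boundary preserves the levels of
one and the same linear function, so the Alexander trick extends it. It is enough to treat one lift
of the cell, because both functions are equivariant for the same action. -/
lemma exists_extend_cell (hF₁ : IsDefiningFunction T p v₀ ρ F₁)
    (hF₂ : IsDefiningFunction T p v₀ ρ F₂) (hi : Function.Injective i)
    (hi1 : i 1 = 0) (hρ : ∀ g h, ρ g (i h) = i (g * h))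
    {κ : ∀ c : T.Cell, Simplex (T.dim c) ≃ₜ Simplex (T.dim c)}
    (hκ : T.IsFaceSystem p n F₁ F₂ fun c => κ c)
    (hκ' : T.IsFaceSystem p n F₂ F₁ fun c => (κ c).symm) (c : T.Cell) (hc : T.dim c = n + 1) :
    ∃ K : Simplex (T.dim c) ≃ₜ Simplex (T.dim c), (∀ x j, K x j = 0 ↔ x j = 0) ∧
      (∀ x ∈ simplexBoundary (Fin (T.dim c + 1)), K x = faceGlue (fun c => κ c) c x) ∧
      ∀ (f : C(Simplex (T.dim c), X)), (∀ z, p (f z) = T.char c z) → ∀ z, F₁ (f (K z)) = F₂ (f z) := by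
  have := S.t2
  have : Nontrivial (Fin (T.dim c + 1)) := Fin.nontrivial_iff_two_le.2 (by omega)
  obtain ⟨x₀, hx₀⟩ := S.surj (T.char c (stdSimplex.vertex 0))
  obtain ⟨f, hf, -⟩ := LiftedCell.exists_through S.cov hx₀
  let τ : LiftedCell T p := ⟨c, f, hf⟩
  obtain ⟨q₁, hq₁, hw₁⟩ := S.exists_linear_model hF₁ hi hi1 hρ τ
  obtain ⟨q₂, hq₂, hw₂⟩ := S.exists_linear_model hF₂ hi hi1 hρ τ
  have hbd : ∀ (q : Simplex (T.dim c) → Simplex (T.dim c)), (∀ x j, q x j = 0 ↔ x j = 0) →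
      ∀ x ∈ simplexBoundary (Fin (T.dim c + 1)), q x ∈ simplexBoundary (Fin (T.dim c + 1)) :=
    fun q hq x ⟨j, hj⟩ => ⟨j, (hq x j).2 hj⟩
  have hsymm : ∀ (q : Simplex (T.dim c) ≃ₜ Simplex (T.dim c)), (∀ x j, q x j = 0 ↔ x j = 0) →
      ∀ x j, q.symm x j = 0 ↔ x j = 0 := by
    intro q hq x j
    rw [← hq, q.apply_symm_apply]
  have key : ∀ (κ : ∀ c : T.Cell, Simplex (T.dim c) → Simplex (T.dim c)) (F₁ F₂ : X → ℝ)
      (q₁ q₂ : Simplex (T.dim c) ≃ₜ Simplex (T.dim c)), T.IsFaceSystem p n F₁ F₂ κ →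
      (∀ x j, q₁ x j = 0 ↔ x j = 0) → (∀ x j, q₂ x j = 0 ↔ x j = 0) →
      (∀ x, F₁ (τ.map (q₁ x)) = ∑ j, i (S.key τ j) * x j) →
      (∀ x, F₂ (τ.map (q₂ x)) = ∑ j, i (S.key τ j) * x j) →
      IsBoundaryMap (fun j => i (S.key τ j)) fun x => q₁.symm (faceGlue κ c (q₂ x)) := by
    intro κ F₁ F₂ q₁ q₂ hκ hq₁ hq₂ hw₁ hw₂
    refine ⟨?_, fun x hx j => ?_, fun x hx => ?_⟩
    · exact q₁.symm.continuous.comp_continuousOn ((continuousOn_faceGlue hκ hc).comp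
        q₂.continuous.continuousOn (hbd q₂ hq₂))
    · rw [hsymm q₁ hq₁, faceGlue_support hκ hc (hbd q₂ hq₂ x hx), hq₂]
    · have h1 := faceGlue_height hκ τ hc (hbd q₂ hq₂ x hx)
      rw [hw₂] at h1
      have h2 := hw₁ (q₁.symm (faceGlue κ c (q₂ x)))
      rw [q₁.apply_symm_apply] at h2
      exact h2.symm.trans h1
  have hB := key _ F₁ F₂ q₁ q₂ hκ hq₁ hq₂ hw₁ hw₂
  have hB' := key _ F₂ F₁ q₂ q₁ hκ' hq₂ hq₁ hw₂ hw₁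
  obtain ⟨K, hKb, hK0, hKw⟩ := exists_level_extension (S.base_injective hi τ) hB hB'
    (fun x hx => by
      simp only [Homeomorph.apply_symm_apply]
      rw [faceGlue_inverse hκ hκ' (fun c y => (κ c).symm_apply_apply y) hc (hbd q₂ hq₂ x hx),
        Homeomorph.symm_apply_apply])
    (fun x hx => by
      simp only [Homeomorph.apply_symm_apply]
      rw [faceGlue_inverse hκ' hκ (fun c y => (κ c).apply_symm_apply y) hc (hbd q₁ hq₁ x hx),
        Homeomorph.symm_apply_apply])
  have hfin : ∀ z, F₁ (f (q₁ (K (q₂.symm z)))) = F₂ (f z) := by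
    intro z
    have h1 := hw₁ (K (q₂.symm z))
    have h2 := hw₂ (q₂.symm z)
    rw [q₂.apply_symm_apply] at h2
    exact h1.trans ((hKw _).trans h2.symm)
  refine ⟨q₂.symm.trans (K.trans q₁), fun x j => ?_, fun x hx => ?_, fun f' hf' z => ?_⟩
  · show q₁ (K (q₂.symm x)) j = 0 ↔ x j = 0
    rw [hq₁, hK0, hsymm q₂ hq₂]
  · show q₁ (K (q₂.symm x)) = _
    rw [hKb _ (hbd _ (hsymm q₂ hq₂) x hx), q₁.apply_symm_apply, q₂.apply_symm_apply]
  · obtain ⟨g, hg⟩ := S.exists_translate c f f' hf hf'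
    rw [hg, hg, hF₁.map_deck, hF₂.map_deck]
    exact congrArg (ρ g) (hfin z)

/-- Induction over the skeleta. At the vertices the two functions agree, as both are given by `i`.
The maps live on the cells of `M` rather than on their lifts, so that the result commutes with deck
transformations. -/
lemma exists_faceSystem (hF₁ : IsDefiningFunction T p v₀ ρ F₁)
    (hF₂ : IsDefiningFunction T p v₀ ρ F₂) (hi : Function.Injective i)
    (hi1 : i 1 = 0) (hρ : ∀ g h, ρ g (i h) = i (g * h)) (n : ℕ) :
    ∃ κ : ∀ c : T.Cell, Simplex (T.dim c) ≃ₜ Simplex (T.dim c),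
      T.IsFaceSystem p n F₁ F₂ (fun c => κ c) ∧ T.IsFaceSystem p n F₂ F₁ fun c => (κ c).symm := by
  have hinv : ∀ (n : ℕ) (κ : ∀ c : T.Cell, Simplex (T.dim c) ≃ₜ Simplex (T.dim c)),
      T.IsFaceSystem p n F₁ F₂ (fun c => κ c) → T.IsFaceSystem p n F₂ F₁ fun c => (κ c).symm := by
    intro n κ hκ
    refine ⟨fun c _ => (κ c).symm.continuous, fun c hc x j => ?_, fun c hc c' e he y => ?_,
      fun τ hτ z => ?_⟩
    · rw [← hκ.support c hc, (κ c).apply_symm_apply]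
    · rw [(κ c).symm_apply_eq, hκ.face c hc c' e he, (κ c').apply_symm_apply]
    · rw [← hκ.height τ hτ, (κ τ.cell).apply_symm_apply]
  suffices h : ∃ κ : ∀ c : T.Cell, Simplex (T.dim c) ≃ₜ Simplex (T.dim c),
      T.IsFaceSystem p n F₁ F₂ (fun c => κ c) by
    obtain ⟨κ, hκ⟩ := h
    exact ⟨κ, hκ, hinv n κ hκ⟩
  induction n with
  | zero =>
    refine ⟨fun c => Homeomorph.refl _, fun c _ => continuous_id, fun c _ x j => Iff.rfl,
      fun c _ c' e _ y => rfl, fun τ hτ z => ?_⟩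
    have hz : z = stdSimplex.vertex 0 := by
      apply eq_vertex_of_support
      intro k hk
      exact absurd (Fin.ext (by have := k.2; simp; omega)) hk
    show F₁ (τ.map z) = F₂ (τ.map z)
    rw [hz, S.defining_vertex hF₁ hi1 hρ, S.defining_vertex hF₂ hi1 hρ]
  | succ n ih =>
    classical
    obtain ⟨κ, hκ⟩ := ih
    choose K hK0 hKb hKw using
      fun c hc => S.exists_extend_cell hF₁ hF₂ hi hi1 hρ hκ (hinv n κ hκ) c hc
    let κ' : ∀ c : T.Cell, Simplex (T.dim c) ≃ₜ Simplex (T.dim c) := fun c =>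
      if h : T.dim c = n + 1 then K c h else κ c
    have hnew : ∀ c (h : T.dim c = n + 1), κ' c = K c h := fun c h => dif_pos h
    have hold : ∀ c, T.dim c ≤ n → κ' c = κ c := fun c h => dif_neg (by omega)
    refine ⟨κ', fun c _ => (κ' c).continuous, fun c hc x j => ?_, fun c hc c' e he y => ?_,
      fun τ hτ z => ?_⟩
    · rcases Nat.le_succ_iff.1 hc with h | h
      · rw [hold c h]; exact hκ.support c h x j
      · rw [hnew c h]; exact hK0 c h x j
    · rcases Nat.le_succ_iff.1 hc with h | h
      · rw [hold c h, hold c' (he.dim_le.trans h)]; exact hκ.face c h c' e he y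
      · by_cases hs : Function.Surjective e
        · have := he.eq_of_surjective hs
          cases this
          rw [stdSimplex.map_id_apply, stdSimplex.map_id_apply]
        · have hlt : T.dim c' ≤ n := by
            by_contra! hlt
            exact hs (he.surjective_of_dim_eq (le_antisymm he.dim_le (by omega)))
          have hmem : stdSimplex.map e y ∈ simplexBoundary (Fin (T.dim c + 1)) := by
            simp only [Function.Surjective, not_forall] at hs
            obtain ⟨j, hj⟩ := hs
            exact ⟨j, simplex_map_apply_of_notMem _ hj⟩
          rw [hnew c h, hKb c h _ hmem, hold c' hlt, faceGlue_map hκ he hlt]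
    · rcases Nat.le_succ_iff.1 hτ with h | h
      · rw [hold _ h]; exact hκ.height τ h z
      · rw [hnew _ h]; exact hKw _ h τ.map τ.lift z

end IsTriangulatedCover

end LinearModel

/-! ### Simplexwise maps of the cover and their descent to `M` -/

section CellMaps

open Filter Topology OneVertexTriangulation

variable {M : Type u} [TopologicalSpace M] {X : Type w} [TopologicalSpace X]
  {T : OneVertexTriangulation M} {p : X → M} {v₀ : X} (S : IsTriangulatedCover T p v₀)

/-- Self-maps of the lifted simplices that are compatible with faces and deck transformations. -/
structure IsCellMap (T : OneVertexTriangulation M) (p : X → M)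
    (R : ∀ τ : LiftedCell T p, Simplex (T.dim τ.cell) → Simplex (T.dim τ.cell)) : Prop where
  cont : ∀ τ, Continuous (R τ)
  face : ∀ (τ : LiftedCell T p) c' e (he : T.IsFaceMap c' τ.cell e) y,
    R τ (stdSimplex.map e y) = stdSimplex.map e (R (τ.face c' e he) y)
  deck : ∀ (g : Deck p) (τ : LiftedCell T p) z, R (τ.translate g) z = R τ z

variable {R R' : ∀ τ : LiftedCell T p, Simplex (T.dim τ.cell) → Simplex (T.dim τ.cell)}

lemma IsCellMap.vertex (hR : IsCellMap T p R) (τ : LiftedCell T p) (j : Fin (T.dim τ.cell + 1)) :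
    R τ (stdSimplex.vertex j) = stdSimplex.vertex j := by
  obtain ⟨c', e, he, hr⟩ := exists_isFaceMap τ.cell {j} (Finset.singleton_nonempty j)
  have hej : e 0 = j := by
    have : e 0 ∈ range e := ⟨0, rfl⟩
    rw [hr] at this
    simpa using this
  have h1 := hR.face τ c' e he (stdSimplex.vertex 0)
  rw [stdSimplex.map_vertex, hej] at h1
  rw [h1]
  apply eq_vertex_of_support
  intro k hk
  apply simplex_map_apply_of_notMem
  rw [hr]
  simpa using hk

lemma IsCellMap.segment (hR : IsCellMap T p R) (t : unitInterval) :
    IsCellMap T p fun τ z => simplexSegment t (R τ z) z := by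
  refine ⟨fun τ => ?_, fun τ c' e he y => ?_, fun g τ z => ?_⟩
  · exact continuous_simplexSegment.comp
      (continuous_const.prodMk ((hR.cont τ).prodMk continuous_id))
  · rw [hR.face τ c' e he, map_simplexSegment he.1]
  · rw [hR.deck]

namespace IsTriangulatedCover

/-- The self-map of the cover that is given by self-maps of the simplices. -/
noncomputable def cellMap
    (R : ∀ τ : LiftedCell T p, Simplex (T.dim τ.cell) → Simplex (T.dim τ.cell)) : X → X :=
  S.glue fun τ z => τ.map (R τ z)

lemma cellMap_map (hR : IsCellMap T p R) (τ : LiftedCell T p) (z : Simplex (T.dim τ.cell)) :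
    S.cellMap R (τ.map z) = τ.map (R τ z) := by
  refine S.glue_apply (fun τ c' e he y => ?_) τ z
  rw [hR.face τ c' e he, LiftedCell.face_map]

lemma continuous_cellMap (hR : IsCellMap T p R) : Continuous (S.cellMap R) := by
  have := S.t2
  refine continuous_of_cells (T := T) S.cov fun τ => ?_
  simp only [S.cellMap_map hR]
  exact τ.map.continuous.comp (hR.cont τ)

lemma cellMap_deck (hR : IsCellMap T p R) (g : Deck p) (x : X) :
    S.cellMap R ((g : X ≃ₜ X) x) = (g : X ≃ₜ X) (S.cellMap R x) := by
  obtain ⟨⟨τ, z⟩, -, rfl⟩ := S.exists_carrier x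
  dsimp only
  rw [← LiftedCell.translate_map, S.cellMap_map hR, S.cellMap_map hR, hR.deck,
    LiftedCell.translate_map]

lemma cellMap_base (hR : IsCellMap T p R) : S.cellMap R v₀ = v₀ := by
  obtain ⟨τ, j, -, hj⟩ := S.exists_vertex_cell
  rw [← congrArg (S.cellMap R) hj, S.cellMap_map hR, hR.vertex]
  exact hj

include S

lemma isOpenQuotientMap : IsOpenQuotientMap p :=
  ⟨S.surj, S.cov.continuous, S.cov.isLocalHomeomorph.isOpenMap⟩

/-- Equivariant families of self-maps of the cover descend. -/
lemma exists_descent {Y : Type*} [TopologicalSpace Y] {f : X × Y → X} (hf : Continuous f)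
    (hd : ∀ (g : Deck p) x y, f ((g : X ≃ₜ X) x, y) = (g : X ≃ₜ X) (f (x, y))) :
    ∃ fb : C(M × Y, M), ∀ x y, fb (p x, y) = p (f (x, y)) := by
  have := S.simplyConnected
  have := S.locPath
  have hq : IsOpenQuotientMap (Prod.map p (id : Y → Y)) :=
    S.isOpenQuotientMap.prodMap IsOpenQuotientMap.id
  have hfac : ∀ x y, p (f (Function.surjInv S.surj (p x), y)) = p (f (x, y)) := by
    intro x y
    obtain ⟨g, hg⟩ := Deck.exists_apply_eq S.cov (Function.surjInv_eq S.surj (p x)).symm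
    rw [← hg, hd]
    exact Deck.proj g _
  refine ⟨⟨fun q => p (f (Function.surjInv S.surj q.1, q.2)), ?_⟩, hfac⟩
  rw [← hq.continuous_comp_iff]
  exact (S.cov.continuous.comp hf).congr fun q => (hfac q.1 q.2).symm

lemma continuous_cellHomotopy (hR : IsCellMap T p R) :
    Continuous fun q : X × unitInterval =>
      S.cellMap (fun τ z => simplexSegment q.2 (R τ z) z) q.1 := by
  have := S.t2
  rw [← continuousOn_univ]
  refine continuousOn_of_cells (T := T) S.cov fun τ => Continuous.continuousOn ?_
  simp only [S.cellMap_map (hR.segment _)]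
  exact τ.map.continuous.comp (continuous_simplexSegment.comp
    (continuous_snd.prodMk (((hR.cont τ).comp continuous_fst).prodMk continuous_fst)))

/-- A cellwise map of the cover descends to a map homotopic to the identity. -/
theorem exists_cellMap_descent (hR : IsCellMap T p R) :
    ∃ c : C(M, M), (∀ x, c (p x) = p (S.cellMap R x)) ∧
      c.HomotopicRel (ContinuousMap.id M) {p v₀} := by
  -- Straight segments inside the simplices form an equivariant homotopy from the cellwise map, at
  -- time 0, to the identity, at time 1.
  obtain ⟨f, hf⟩ := S.exists_descent (S.continuous_cellHomotopy hR)
    fun g x t => S.cellMap_deck (hR.segment t) g x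
  have h0 : ∀ x, f (p x, 0) = p (S.cellMap R x) := by
    intro x
    rw [hf]
    simp only [simplexSegment_zero]
  have h1 : ∀ x, f (p x, 1) = p x := by
    intro x
    obtain ⟨⟨τ, z⟩, -, rfl⟩ := S.exists_carrier x
    rw [hf, S.cellMap_map (hR.segment 1), simplexSegment_one]
  refine ⟨⟨fun m => f (m, 0), f.continuous.comp (Continuous.prodMk_left 0)⟩, h0,
    ⟨⟨⟨⟨fun q => f (q.2, q.1), f.continuous.comp continuous_swap⟩, fun m => rfl, fun m => ?_⟩,
      ?_⟩⟩⟩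
  · obtain ⟨x, rfl⟩ := S.surj m
    exact h1 x
  · rintro t _ rfl
    show f (p v₀, t) = f (p v₀, 0)
    rw [hf, hf, S.cellMap_base (hR.segment t),
      S.cellMap_base (hR.segment 0)]

variable {i : Deck p → ℝ} {ρ : Deck p →* (ℝ ≃o ℝ)} {F₁ F₂ : X → ℝ}

/-- Any two defining functions of the same action agree up to an isotopy of the base. -/
theorem exists_homeomorph_of_defining (hF₁ : IsDefiningFunction T p v₀ ρ F₁)
    (hF₂ : IsDefiningFunction T p v₀ ρ F₂) (hi : Function.Injective i)
    (hi1 : i 1 = 0) (hρ : ∀ g h, ρ g (i h) = i (g * h)) :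
    ∃ (H : X ≃ₜ X) (η : M ≃ₜ M), (∀ x, F₁ (H x) = F₂ x) ∧ (∀ x, p (H x) = η (p x)) ∧
      η (p v₀) = p v₀ ∧ (η.symm : C(M, M)).HomotopicRel (ContinuousMap.id M) {p v₀} := by
  have := T.finite_cell
  have := Fintype.ofFinite T.Cell
  obtain ⟨κ, hκ, hκ'⟩ := S.exists_faceSystem hF₁ hF₂ hi hi1 hρ (Finset.univ.sup T.dim)
  have hle : ∀ c, T.dim c ≤ Finset.univ.sup T.dim := fun c =>
    Finset.le_sup (f := T.dim) (Finset.mem_univ c)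
  have hR : ∀ {F₁ F₂ : X → ℝ} {κ : ∀ c : T.Cell, Simplex (T.dim c) → Simplex (T.dim c)},
      T.IsFaceSystem p (Finset.univ.sup T.dim) F₁ F₂ κ →
      IsCellMap T p fun τ z => κ τ.cell z := fun hκ =>
    ⟨fun τ => hκ.cont _ (hle _), fun τ c' e he y => hκ.face _ (hle _) c' e he y,
      fun g τ z => rfl⟩
  have h1 := hR hκ
  have h2 := hR hκ'
  have hinv : ∀ x, S.cellMap (fun τ z => (κ τ.cell).symm z) (S.cellMap (fun τ z => κ τ.cell z) x)
      = x := by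
    intro x
    obtain ⟨⟨τ, z⟩, -, rfl⟩ := S.exists_carrier x
    rw [S.cellMap_map h1, S.cellMap_map h2, Homeomorph.symm_apply_apply]
  have hinv' : ∀ x, S.cellMap (fun τ z => κ τ.cell z)
      (S.cellMap (fun τ z => (κ τ.cell).symm z) x) = x := by
    intro x
    obtain ⟨⟨τ, z⟩, -, rfl⟩ := S.exists_carrier x
    rw [S.cellMap_map h2, S.cellMap_map h1, Homeomorph.apply_symm_apply]
  obtain ⟨c, hc, -⟩ := S.exists_cellMap_descent h1
  obtain ⟨c', hc', hhom⟩ := S.exists_cellMap_descent h2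
  refine ⟨⟨⟨_, _, hinv, hinv'⟩, S.continuous_cellMap h1, S.continuous_cellMap h2⟩,
    ⟨⟨c, c', fun m => ?_, fun m => ?_⟩, c.continuous, c'.continuous⟩, fun x => ?_,
    fun x => (hc x).symm, ?_, hhom⟩
  · obtain ⟨x, rfl⟩ := S.surj m
    rw [hc, hc', hinv]
  · obtain ⟨x, rfl⟩ := S.surj m
    rw [hc', hc, hinv']
  · obtain ⟨⟨τ, z⟩, -, rfl⟩ := S.exists_carrier x
    show F₁ (S.cellMap (fun τ z => κ τ.cell z) (τ.map z)) = F₂ (τ.map z)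
    rw [S.cellMap_map h1]
    exact hκ.height τ (hle _) z
  · show c (p v₀) = p v₀
    rw [hc, S.cellMap_base h1]

end IsTriangulatedCover

end CellMaps

/-! ### Transport of leaves and strips by a homeomorphism -/

section Transport

open Filter Topology

variable {M : Type u} [TopologicalSpace M] {X : Type w} [TopologicalSpace X]

lemma leaves_image {p : X → M} {F F' : X → ℝ} (H : X ≃ₜ X) (η : M → M) (hF : ∀ x, F (H x) = F' x)
    (hp : ∀ x, p (H x) = η (p x)) : leaves p F = (fun l => η '' l) '' leaves p F' := by
  have key : ∀ x, p '' connectedComponentIn (F ⁻¹' {F (H x)}) (H x) =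
      η '' (p '' connectedComponentIn (F' ⁻¹' {F' x}) x) := by
    intro x
    have h1 : F ⁻¹' {F (H x)} = H '' (F' ⁻¹' {F' x}) := by
      ext y
      constructor
      · intro hy
        refine ⟨H.symm y, ?_, H.apply_symm_apply y⟩
        show F' (H.symm y) = F' x
        rw [← hF, ← hF, H.apply_symm_apply]
        exact hy
      · rintro ⟨z, hz, rfl⟩
        show F (H z) = F (H x)
        rw [hF, hF]
        exact hz
    rw [h1, ← H.image_connectedComponentIn (show x ∈ F' ⁻¹' {F' x} from rfl), image_image,
      image_image]
    exact image_congr fun y _ => hp y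
  ext l
  constructor
  · rintro ⟨x, rfl⟩
    refine ⟨_, ⟨H.symm x, rfl⟩, ?_⟩
    dsimp only
    rw [← key, H.apply_symm_apply]
  · rintro ⟨_, ⟨x, rfl⟩, rfl⟩
    exact ⟨H x, key x⟩

/-- The strips are carried along by a homeomorphism isotopic to the identity. -/
lemma IsStripInsertion.transport {v : M} {𝓖 𝓕 : Set (Set M)} (h : IsStripInsertion v 𝓖 𝓕)
    (η : M ≃ₜ M) (hv : η v = v) (hη : (η.symm : C(M, M)).HomotopicRel (ContinuousMap.id M) {v}) :
    IsStripInsertion v 𝓖 ((fun l => η '' l) '' 𝓕) := by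
  obtain ⟨S, c, hc, hhom, hfib, hleaf⟩ := h
  let S' : StripFamily v ((fun l => η '' l) '' 𝓕) :=
    { ι := S.ι
      L := S.L
      top := S.top
      chart := fun k q => η (S.chart k q)
      isOpenEmbedding := fun k =>
        letI := S.top k
        η.isOpenEmbedding.comp (S.isOpenEmbedding k)
      disjoint := fun k l hkl => by
        rw [show (fun q => η (S.chart k q)) = η ∘ S.chart k from rfl,
          show (fun q => η (S.chart l q)) = η ∘ S.chart l from rfl, range_comp, range_comp]
        exact (disjoint_image_iff η.injective).2 (S.disjoint k l hkl)
      leaf_mem := fun k s => ⟨_, S.leaf_mem k s, by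
        dsimp only
        rw [← range_comp]; rfl⟩
      notMem := fun k => by
        rintro ⟨q, hq⟩
        exact S.notMem k ⟨q, η.injective (hq.trans hv.symm)⟩ }
  have harc : ∀ x y, S'.SameArc x y ↔ S.SameArc (η.symm x) (η.symm y) := by
    intro x y
    have hcl : ∀ k q, closure (range fun s : Ioo (0 : ℝ) 1 => S'.chart k (q, s)) =
        η '' closure (range fun s : Ioo (0 : ℝ) 1 => S.chart k (q, s)) := by
      intro k q
      rw [η.image_closure, ← range_comp]; rfl
    have hmem : ∀ (A : Set M) z, z ∈ η '' A ↔ η.symm z ∈ A := by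
      intro A z
      constructor
      · rintro ⟨w, hw, rfl⟩
        rwa [η.symm_apply_apply]
      · exact fun hz => ⟨_, hz, η.apply_symm_apply z⟩
    refine exists_congr fun k => exists_congr fun q => ?_
    rw [hcl, hmem, hmem]
  have hsame : ∀ x y, SameLeaf ((fun l => η '' l) '' 𝓕) x y ↔
      SameLeaf 𝓕 (η.symm x) (η.symm y) := by
    intro x y
    constructor
    · rintro ⟨_, ⟨l, hl, rfl⟩, ⟨a, ha, rfl⟩, b, hb, rfl⟩
      exact ⟨l, hl, by rwa [η.symm_apply_apply], by rwa [η.symm_apply_apply]⟩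
    · rintro ⟨l, hl, hx, hy⟩
      exact ⟨_, ⟨l, hl, rfl⟩, ⟨_, hx, η.apply_symm_apply x⟩, _, hy, η.apply_symm_apply y⟩
  have hgen : ∀ (r r' : M → M → Prop), (∀ x y, r' x y ↔ r (η.symm x) (η.symm y)) →
      ∀ x y, Relation.EqvGen r (η.symm x) (η.symm y) ↔ Relation.EqvGen r' x y := by
    intro r r' hr x y
    constructor
    · have aux : ∀ a b, Relation.EqvGen r a b → Relation.EqvGen r' (η a) (η b) := by
        intro a b h
        induction h with
        | rel a b h => exact .rel _ _ ((hr _ _).2 (by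
            rwa [η.symm_apply_apply, η.symm_apply_apply]))
        | refl a => exact .refl _
        | symm a b _ ih => exact .symm _ _ ih
        | trans a b c _ _ ih1 ih2 => exact .trans _ _ _ ih1 ih2
      intro h
      have := aux _ _ h
      rwa [η.apply_symm_apply, η.apply_symm_apply] at this
    · intro h
      induction h with
      | rel a b h => exact .rel _ _ ((hr _ _).1 h)
      | refl a => exact .refl _
      | symm a b _ ih => exact .symm _ _ ih
      | trans a b c _ _ ih1 ih2 => exact .trans _ _ _ ih1 ih2
  refine ⟨S', c.comp (η.symm : C(M, M)), hc.comp η.symm.surjective, ?_, fun x y => ?_,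
    fun x y => ?_⟩
  · obtain ⟨K⟩ := hhom
    refine ContinuousMap.HomotopicRel.trans ?_ hη
    have hv' : η.symm v = v := by rw [η.symm_apply_eq, hv]
    refine ⟨⟨⟨⟨fun q => K (q.1, η.symm q.2), K.continuous.comp
      (continuous_fst.prodMk (η.symm.continuous.comp continuous_snd))⟩, fun x => ?_, fun x => ?_⟩,
      ?_⟩⟩
    · exact K.apply_zero _
    · exact K.apply_one _
    · rintro t y (hy : y = v)
      show K (t, η.symm y) = c (η.symm y)
      rw [hy, hv']
      exact K.eq_fst t rfl
  · exact (hfib _ _).trans (hgen _ _ harc x y)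
  · exact (hleaf _ _).trans (hgen _ _ (fun a b => or_congr (hsame a b) (harc a b)) x y)

end Transport

/-! ### Composition of slides -/

section SlideComposition

variable {ι : Type*} [Fintype ι] [DecidableEq ι] {Γ : Type*} [LinearOrder Γ] {κ : ι → Γ}
  {hκ : Function.Injective κ}

/-- `slideCoord α` multiplies the odds T / (1 - T) by (1 - α) / α, and γ is the parameter whose
factor is the product of the two. -/
lemma slideCoord_comp {α β γ T : ℝ} (hα : α ∈ Ioo (0 : ℝ) 1) (hβ : β ∈ Ioo (0 : ℝ) 1)
    (hγ : γ = α * β / (α * β + (1 - α) * (1 - β))) (hT : T ∈ Icc (0 : ℝ) 1) :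
    slideCoord β (slideCoord α T) = slideCoord γ T := by
  have h1 : 0 < α * β := mul_pos hα.1 hβ.1
  have h2 : 0 < (1 - α) * (1 - β) := mul_pos (sub_pos.2 hα.2) (sub_pos.2 hβ.2)
  have hD : 0 < α * β + (1 - α) * (1 - β) := add_pos h1 h2
  have hγm : γ ∈ Ioo (0 : ℝ) 1 := by
    rw [hγ]
    exact ⟨div_pos h1 hD, (div_lt_one hD).2 (by linarith)⟩
  have hE := slideCoord_den_pos' hα hT
  rw [slideCoord_eq hβ, slideCoord_eq hγm, slideCoord_eq hα]
  have h1γ : 1 - γ = (1 - α) * (1 - β) / (α * β + (1 - α) * (1 - β)) := by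
    rw [hγ]; field_simp; ring
  have h1T : 1 - (1 - α) * T / ((1 - α) * T + α * (1 - T)) =
      α * (1 - T) / ((1 - α) * T + α * (1 - T)) := by
    field_simp; ring
  rw [h1γ, hγ, h1T]
  set E := (1 - α) * T + α * (1 - T)
  set D := α * β + (1 - α) * (1 - β)
  have e1 : (1 - β) * ((1 - α) * T / E) = (1 - α) * (1 - β) * T / E := by ring
  have e2 : β * (α * (1 - T) / E) = α * β * (1 - T) / E := by ring
  have e3 : (1 - α) * (1 - β) / D * T = (1 - α) * (1 - β) * T / D := by ring
  have e4 : α * β / D * (1 - T) = α * β * (1 - T) / D := by ring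
  rw [e1, e2, e3, e4, ← add_div, ← add_div, div_div_div_cancel_right₀ hE.ne',
    div_div_div_cancel_right₀ hD.ne']

/-- The slide paths compose. -/
lemma exists_slide_slide (α β : unitInterval) (x : stdSimplex ℝ ι) :
    ∃ γ, slide κ hκ β (slide κ hκ α x) = slide κ hκ γ x ∧
      (0 < α → α < 1 → 0 < β → β < 1 → 0 < γ ∧ γ < 1) := by
  obtain ⟨jl, hjl⟩ := exists_isLowest κ x
  obtain ⟨jh, hjh⟩ := exists_isHighest κ x
  rcases eq_or_lt_of_le α.2.1 with h0 | h0
  · have h0' : α = 0 := Subtype.ext h0.symm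
    refine ⟨α, ?_, fun h => absurd h0' h.ne'⟩
    rw [h0', slide_zero hjl, slide_vertex]
  rcases eq_or_lt_of_le α.2.2 with h1 | h1
  · have h1' : α = 1 := Subtype.ext h1
    refine ⟨α, ?_, fun _ h => absurd h1' h.ne⟩
    rw [h1', slide_one hjh, slide_vertex]
  have h0α : 0 < α := h0
  have h1α : α < 1 := h1
  rcases eq_or_lt_of_le β.2.1 with b0 | b0
  · have b0' : β = 0 := Subtype.ext b0.symm
    refine ⟨0, ?_, fun _ _ h => absurd b0' h.ne'⟩
    rw [b0', slide_zero ((isLowest_slide h0α h1α).2 hjl), slide_zero hjl]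
  rcases eq_or_lt_of_le β.2.2 with b1 | b1
  · have b1' : β = 1 := Subtype.ext b1
    refine ⟨1, ?_, fun _ _ _ h => absurd b1' h.ne⟩
    rw [b1', slide_one ((isHighest_slide h0α h1α).2 hjh), slide_one hjh]
  have hab : (0 : ℝ) < α * β := mul_pos h0 b0
  have hab' : (0 : ℝ) < (1 - α) * (1 - β) := mul_pos (sub_pos.2 h1) (sub_pos.2 b1)
  have hD := add_pos hab hab'
  have hγ0 : (0 : ℝ) < α * β / (α * β + (1 - α) * (1 - β)) := div_pos hab hD
  have hγ1 : (α * β / (α * β + (1 - α) * (1 - β)) : ℝ) < 1 := (div_lt_one hD).2 (by linarith)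
  refine ⟨⟨_, hγ0.le, hγ1.le⟩, ?_, fun _ _ _ _ => ⟨hγ0, hγ1⟩⟩
  refine stdSimplex.ext (eq_of_cumLe_eq hκ fun j => ?_)
  erw [cumLe_slide, cumLe_slide, cumLe_slide]
  exact slideCoord_comp ⟨h0, h1⟩ ⟨b0, b1⟩ rfl (cumLe_mem x j)

end SlideComposition

/-! ### Gaps: the intervals collapsed by a monotone map -/

section Gaps

variable {A : Type*} [LinearOrder A]

/-- The interval `(a, b)` is a maximal interval between points of the orbit on which `φ` is
constant. -/
structure IsGap (i : A → ℝ) (φ : ℝ → ℝ) (a b : ℝ) : Prop where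
  lt : a < b
  subset : Icc a b ⊆ openHull i
  disj : ∀ t ∈ Ioo a b, t ∉ range i
  eq : φ a = φ b
  maximal : ∀ a' b', a' ≤ a → b ≤ b' → Icc a' b' ⊆ openHull i → (∀ t ∈ Ioo a' b', t ∉ range i) →
    φ a' = φ b' → a' = a ∧ b' = b

variable {i : A → ℝ} {φ : ℝ → ℝ}

lemma MonotoneOn.eq_of_mem_Icc {s : Set ℝ} (hφ : MonotoneOn φ s) {a b t : ℝ} (hs : Icc a b ⊆ s)
    (h : φ a = φ b) (ht : t ∈ Icc a b) : φ t = φ a := by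
  have hab := ht.1.trans ht.2
  refine le_antisymm ?_ (hφ (hs ⟨le_rfl, hab⟩) (hs ht) ht.1)
  rw [h]
  exact hφ (hs ht) (hs ⟨hab, le_rfl⟩) ht.2

lemma Icc_subset_openHull {a b : ℝ} (ha : a ∈ openHull i) (hb : b ∈ openHull i) :
    Icc a b ⊆ openHull i := (ordConnected_openHull i).out ha hb

lemma IsGap.eq_of_mem {a b t : ℝ} (h : IsGap i φ a b) (hφ : MonotoneOn φ (openHull i))
    (ht : t ∈ Icc a b) : φ t = φ a := hφ.eq_of_mem_Icc h.subset h.eq ht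

/-- The union of two overlapping gaps again misses the orbit in its interior and is collapsed, so
both gaps equal it by maximality. Gaps on the two sides of an orbit point may still share that end
point. -/
lemma IsGap.eq_of_inter {a b a' b' t : ℝ} (h : IsGap i φ a b) (h' : IsGap i φ a' b')
    (hφ : MonotoneOn φ (openHull i)) (ht : t ∈ Ioo a b) (ht' : t ∈ Ioo a' b') :
    a = a' ∧ b = b' := by
  have e := h.eq_of_mem hφ (Ioo_subset_Icc_self ht)
  have e' := h'.eq_of_mem hφ (Ioo_subset_Icc_self ht')
  have hee : φ a = φ a' := e.symm.trans e'
  have hA : φ (min a a') = φ a := by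
    rcases min_choice a a' with hm | hm <;> rw [hm]
    exact hee.symm
  have hB : φ (max b b') = φ a := by
    rcases max_choice b b' with hm | hm <;> rw [hm]
    · exact h.eq.symm
    · rw [hee]; exact h'.eq.symm
  have ha : a ∈ openHull i := h.subset (left_mem_Icc.2 h.lt.le)
  have hb : b ∈ openHull i := h.subset (right_mem_Icc.2 h.lt.le)
  have ha' : a' ∈ openHull i := h'.subset (left_mem_Icc.2 h'.lt.le)
  have hb' : b' ∈ openHull i := h'.subset (right_mem_Icc.2 h'.lt.le)
  have hsub : Icc (min a a') (max b b') ⊆ openHull i := by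
    apply Icc_subset_openHull
    · rcases min_choice a a' with hm | hm <;> rw [hm] <;> assumption
    · rcases max_choice b b' with hm | hm <;> rw [hm] <;> assumption
  have hdisj : ∀ y ∈ Ioo (min a a') (max b b'), y ∉ range i := by
    rintro y ⟨h1, h2⟩
    rcases min_lt_iff.1 h1 with h1 | h1 <;> rcases lt_max_iff.1 h2 with h2 | h2
    · exact h.disj y ⟨h1, h2⟩
    · rcases le_total y t with hy | hy
      · exact h.disj y ⟨h1, hy.trans_lt ht.2⟩
      · exact h'.disj y ⟨ht'.1.trans_le hy, h2⟩
    · rcases le_total y t with hy | hy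
      · exact h'.disj y ⟨h1, hy.trans_lt ht'.2⟩
      · exact h.disj y ⟨ht.1.trans_le hy, h2⟩
    · exact h'.disj y ⟨h1, h2⟩
  obtain ⟨m1, m2⟩ := h.maximal _ _ (min_le_left _ _) (le_max_left _ _) hsub hdisj (hA.trans hB.symm)
  obtain ⟨m3, m4⟩ := h'.maximal _ _ (min_le_right _ _) (le_max_right _ _) hsub hdisj
    (hA.trans hB.symm)
  exact ⟨m1.symm.trans m3, m2.symm.trans m4⟩

lemma MonotoneOn.eq_of_mem_closure {s : Set ℝ} (hc : ContinuousOn φ s) {V : Set ℝ} {a c : ℝ}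
    (hcl : a ∈ closure V) (ha : a ∈ s) (hV : V ⊆ s) (hVc : ∀ u ∈ V, φ u = c) : φ a = c := by
  have h2 := ((hc a ha).mono hV).mem_closure_image hcl
  have h3 : φ '' V ⊆ {c} := by
    rintro _ ⟨u, hu, rfl⟩
    exact hVc u hu
  have h4 := closure_mono h3 h2
  rwa [closure_singleton] at h4

/-- The left end is pushed out to an infimum, then the right end to a supremum. Orbit points on
either side bound the search, and continuity keeps the value of φ at the limits. -/
lemma exists_isGap [NoMinOrder A] [NoMaxOrder A] (hi : StrictMono i)
    (hφ : MonotoneOn φ (openHull i)) (hc : ContinuousOn φ (openHull i))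
    {s t : ℝ} (hst : s < t) (hs : s ∈ openHull i) (ht : t ∈ openHull i) (heq : φ s = φ t)
    (hd : ∀ y ∈ Ioo s t, y ∉ range i) : ∃ a b, IsGap i φ a b ∧ a ≤ s ∧ t ≤ b := by
  obtain ⟨g, g', hg, hg'⟩ := id hs
  obtain ⟨k, k', hk, hk'⟩ := id ht
  set U : Set ℝ := {u | u ≤ s ∧ u ∈ openHull i ∧ φ u = φ s ∧ ∀ y ∈ Ioo u t, y ∉ range i} with hU
  have hsU : s ∈ U := ⟨le_rfl, hs, rfl, hd⟩
  have hUg : ∀ u ∈ U, i g ≤ u := by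
    intro u hu
    by_contra! h
    exact hu.2.2.2 (i g) ⟨h, hg.trans hst⟩ ⟨g, rfl⟩
  have hUb : BddBelow U := ⟨i g, hUg⟩
  obtain ⟨a, ha⟩ : ∃ a, a = sInf U := ⟨_, rfl⟩
  have has : a ≤ s := ha ▸ csInf_le hUb hsU
  have hga : i g ≤ a := ha ▸ le_csInf ⟨s, hsU⟩ hUg
  have hah : a ∈ openHull i := Icc_subset_openHull (mem_openHull hi g) hs ⟨hga, has⟩
  have haφ : φ a = φ s := MonotoneOn.eq_of_mem_closure hc (ha ▸ csInf_mem_closure ⟨s, hsU⟩ hUb)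
    hah (fun u hu => hu.2.1) fun u hu => hu.2.2.1
  have had : ∀ y ∈ Ioo a t, y ∉ range i := by
    intro y hy
    obtain ⟨u, hu, huy⟩ := exists_lt_of_csInf_lt ⟨s, hsU⟩ (ha ▸ hy.1)
    exact hu.2.2.2 y ⟨huy, hy.2⟩
  set V : Set ℝ := {u | t ≤ u ∧ u ∈ openHull i ∧ φ u = φ s ∧ ∀ y ∈ Ioo a u, y ∉ range i} with hV
  have htV : t ∈ V := ⟨le_rfl, ht, heq.symm, had⟩
  have hVk : ∀ u ∈ V, u ≤ i k' := by
    intro u hu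
    by_contra! h
    exact hu.2.2.2 (i k') ⟨(has.trans_lt hst).trans hk', h⟩ ⟨k', rfl⟩
  have hVb : BddAbove V := ⟨i k', hVk⟩
  obtain ⟨b, hb⟩ : ∃ b, b = sSup V := ⟨_, rfl⟩
  have htb : t ≤ b := hb ▸ le_csSup hVb htV
  have hkb : b ≤ i k' := hb ▸ csSup_le ⟨t, htV⟩ hVk
  have hbh : b ∈ openHull i := Icc_subset_openHull ht (mem_openHull hi k') ⟨htb, hkb⟩
  have hbφ : φ b = φ s := MonotoneOn.eq_of_mem_closure hc (hb ▸ csSup_mem_closure ⟨t, htV⟩ hVb)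
    hbh (fun u hu => hu.2.1) fun u hu => hu.2.2.1
  have hbd : ∀ y ∈ Ioo a b, y ∉ range i := by
    intro y hy
    obtain ⟨u, hu, huy⟩ := exists_lt_of_lt_csSup ⟨t, htV⟩ (hb ▸ hy.2)
    exact hu.2.2.2 y ⟨hy.1, huy⟩
  refine ⟨a, b, ⟨has.trans_lt (hst.trans_le htb), Icc_subset_openHull hah hbh, hbd,
    haφ.trans hbφ.symm, fun a' b' ha' hb' hsub hdisj hφab => ?_⟩, has, htb⟩
  have hle : a' ≤ b' := ha'.trans (has.trans (hst.le.trans (htb.trans hb')))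
  have hsm : s ∈ Icc a' b' := ⟨ha'.trans has, hst.le.trans (htb.trans hb')⟩
  have hφa' : φ a' = φ s := (hφ.eq_of_mem_Icc hsub hφab hsm).symm
  have haU : a' ∈ U := ⟨ha'.trans has, hsub (left_mem_Icc.2 hle), hφa', fun y hy =>
    hdisj y ⟨hy.1, hy.2.trans_le (htb.trans hb')⟩⟩
  have hbV : b' ∈ V := ⟨htb.trans hb', hsub (right_mem_Icc.2 hle), hφab ▸ hφa', fun y hy =>
    hdisj y ⟨ha'.trans_lt hy.1, hy.2⟩⟩
  exact ⟨le_antisymm ha' (ha ▸ csInf_le hUb haU), le_antisymm (hb ▸ le_csSup hVb hbV) hb'⟩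

end Gaps

/-! ### Equivariant collapses of an action on the line -/

section CollapseOrbits

variable {G : Type*} [Group G] [LinearOrder G]

/-- A monotone map `φ` carrying the orbit map `i` to the orbit map `j`, equivariantly. -/
structure IsCollapse (i j : G → ℝ) (ρ ρ' : G →* (ℝ ≃o ℝ)) (φ : ℝ → ℝ) : Prop where
  left : ∀ g a b : G, a < b → g * a < g * b
  noMin : NoMinOrder G
  noMax : NoMaxOrder G
  monoI : StrictMono i
  monoJ : StrictMono j
  one_i : i 1 = 0
  one_j : j 1 = 0
  actI : IsInducedAction i ρ
  actJ : ∀ g h, ρ' g (j h) = j (g * h)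
  mono : MonotoneOn φ (openHull i)
  cont : ContinuousOn φ (openHull i)
  orbit : ∀ g, φ (i g) = j g
  equiv : ∀ g, ∀ t ∈ openHull i, φ (ρ g t) = ρ' g (φ t)

namespace IsCollapse

variable {i j : G → ℝ} {ρ ρ' : G →* (ℝ ≃o ℝ)} {φ : ℝ → ℝ} (D : IsCollapse i j ρ ρ' φ)
include D

lemma orbit_mem (g : G) : i g ∈ openHull i := by
  have := D.noMin
  have := D.noMax
  exact mem_openHull D.monoI g

omit D in
lemma act_inv (ρ : G →* (ℝ ≃o ℝ)) (g : G) (t : ℝ) : ρ g⁻¹ (ρ g t) = t := by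
  rw [← RelIso.mul_apply, ← map_mul, inv_mul_cancel, map_one, RelIso.one_apply]

omit D in
lemma act_inv' (ρ : G →* (ℝ ≃o ℝ)) (g : G) (t : ℝ) : ρ g (ρ g⁻¹ t) = t := by
  rw [← RelIso.mul_apply, ← map_mul, mul_inv_cancel, map_one, RelIso.one_apply]

lemma act_hull (g : G) {t : ℝ} (ht : t ∈ openHull i) : ρ g t ∈ openHull i := by
  obtain ⟨a, b, ha, hb⟩ := ht
  refine ⟨g * a, g * b, ?_, ?_⟩
  · rw [← D.actI.map_orbit]; exact (ρ g).strictMono ha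
  · rw [← D.actI.map_orbit]; exact (ρ g).strictMono hb

lemma act_range (g : G) {t : ℝ} (ht : ρ g t ∈ range i) : t ∈ range i := by
  obtain ⟨h, hh⟩ := ht
  exact ⟨g⁻¹ * h, by rw [← D.actI.map_orbit, hh, act_inv]⟩

omit D in
lemma act_lt_iff (g : G) (s t : ℝ) : ρ g s < t ↔ s < ρ g⁻¹ t := by
  rw [← (ρ g).lt_iff_lt (y := ρ g⁻¹ t), act_inv']

omit D in
lemma lt_act_iff (g : G) (s t : ℝ) : t < ρ g s ↔ ρ g⁻¹ t < s := by
  rw [← (ρ g).lt_iff_lt (x := ρ g⁻¹ t), act_inv']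

lemma gap_act (g : G) {a b : ℝ} (h : IsGap i φ a b) : IsGap i φ (ρ g a) (ρ g b) := by
  have hbase : ∀ (g : G) {a b : ℝ}, Icc a b ⊆ openHull i → Icc (ρ g a) (ρ g b) ⊆ openHull i := by
    intro g a b hs t ht
    have h1 : ρ g⁻¹ t ∈ Icc a b := by
      constructor
      · rw [← (ρ g).le_iff_le, act_inv']; exact ht.1
      · rw [← (ρ g).le_iff_le, act_inv']; exact ht.2
    have := D.act_hull g (hs h1)
    rwa [act_inv'] at this
  have hdis : ∀ (g : G) {a b : ℝ}, (∀ t ∈ Ioo a b, t ∉ range i) →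
      ∀ t ∈ Ioo (ρ g a) (ρ g b), t ∉ range i := by
    intro g a b hs t ht htr
    refine hs (ρ g⁻¹ t) ⟨(lt_act_iff g⁻¹ t a).2 (by rw [inv_inv]; exact ht.1),
      (act_lt_iff g⁻¹ t b).2 (by rw [inv_inv]; exact ht.2)⟩ (D.act_range g ?_)
    rwa [act_inv']
  have ha := h.subset (left_mem_Icc.2 h.lt.le)
  have hb := h.subset (right_mem_Icc.2 h.lt.le)
  refine ⟨(ρ g).strictMono h.lt, hbase g h.subset, hdis g h.disj, ?_,
    fun a' b' ha' hb' hs hd he => ?_⟩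
  · rw [D.equiv g a ha, D.equiv g b hb, h.eq]
  · have hle : a' ≤ b' := ha'.trans (((ρ g).monotone h.lt.le).trans hb')
    obtain ⟨e1, e2⟩ := h.maximal (ρ g⁻¹ a') (ρ g⁻¹ b')
      (by rw [← (ρ g).le_iff_le, act_inv']; exact ha')
      (by rw [← (ρ g).le_iff_le, act_inv']; exact hb')
      (hbase g⁻¹ hs) (hdis g⁻¹ hd)
      (by rw [D.equiv _ _ (hs (left_mem_Icc.2 hle)), D.equiv _ _ (hs (right_mem_Icc.2 hle)), he])
    rw [← e1, ← e2, act_inv', act_inv']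
    exact ⟨rfl, rfl⟩

/-- A gap misses the orbit in its interior, so the action is affine there and, by continuity, up to
the ends. This makes affine coordinates in gaps invariant under the group, so that they are defined
on strips in `M`. -/
lemma act_affine (g : G) {a b : ℝ} (h : IsGap i φ a b) {s : ℝ} (hs : s ∈ Icc (0 : ℝ) 1) :
    ρ g (a + s * (b - a)) = ρ g a + s * (ρ g b - ρ g a) := by
  obtain ⟨m, c, hmc⟩ := D.actI.affine_compl g (Ioo a b) ordConnected_Ioo
    (disjoint_left.2 h.disj)
  have hIcc : EqOn (ρ g) (fun t => m * t + c) (Icc a b) := by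
    rw [← closure_Ioo h.lt.ne]
    exact EqOn.closure hmc (ρ g).continuous (by fun_prop)
  have hmem : a + s * (b - a) ∈ Icc a b := by
    have := h.lt
    constructor
    · nlinarith [hs.1]
    · nlinarith [hs.2]
  rw [hIcc hmem, hIcc (left_mem_Icc.2 h.lt.le), hIcc (right_mem_Icc.2 h.lt.le)]
  ring

end IsCollapse

end CollapseOrbits

/-! ### Slide paths on the cover -/

section SlidePaths

open Filter Topology OneVertexTriangulation

variable {M : Type u} [TopologicalSpace M] {X : Type w} [TopologicalSpace X]
  {T : OneVertexTriangulation M} {p : X → M} {v₀ : X} (S : IsTriangulatedCover T p v₀)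

/-- An order preserving orbit map of an action on the line. -/
structure IsOrbitMap {G : Type*} [Group G] [LinearOrder G] (i : G → ℝ) (ρ : G →* (ℝ ≃o ℝ)) :
    Prop where
  mono : StrictMono i
  one : i 1 = 0
  act : ∀ g h, ρ g (i h) = i (g * h)

lemma IsCollapse.orbI {G : Type*} [Group G] [LinearOrder G] {i j : G → ℝ} {ρ ρ' : G →* (ℝ ≃o ℝ)}
    {φ : ℝ → ℝ} (D : IsCollapse i j ρ ρ' φ) : IsOrbitMap i ρ := ⟨D.monoI, D.one_i, D.actI.map_orbit⟩

lemma IsCollapse.orbJ {G : Type*} [Group G] [LinearOrder G] {i j : G → ℝ} {ρ ρ' : G →* (ℝ ≃o ℝ)}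
    {φ : ℝ → ℝ} (D : IsCollapse i j ρ ρ' φ) : IsOrbitMap j ρ' := ⟨D.monoJ, D.one_j, D.actJ⟩

namespace IsTriangulatedCover

variable [LinearOrder (Deck p)]

/-- `y` lies on the slide path of `x`. -/
def OnPath (x y : X) : Prop := ∃ α, y = S.slideX α x

variable {S}

lemma OnPath.refl (x : X) : S.OnPath x x := by
  obtain ⟨⟨τ, z⟩, -, rfl⟩ := S.exists_carrier x
  exact ⟨_, by rw [S.slideX_map, slide_half]⟩

lemma OnPath.trans {x y z : X} (h : S.OnPath x y) (h' : S.OnPath y z) : S.OnPath x z := by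
  obtain ⟨α, rfl⟩ := h
  obtain ⟨β, rfl⟩ := h'
  obtain ⟨⟨τ, z⟩, -, rfl⟩ := S.exists_carrier x
  obtain ⟨γ, hγ, -⟩ := exists_slide_slide (κ := S.key τ) (hκ := S.key_injective τ) α β z
  exact ⟨γ, by rw [S.slideX_map, S.slideX_map, S.slideX_map, hγ]⟩

lemma exists_slideX_zero (x : X) : ∃ g : Deck p, S.slideX 0 x = (g : X ≃ₜ X) v₀ := by
  obtain ⟨⟨τ, z⟩, -, rfl⟩ := S.exists_carrier x
  obtain ⟨j, hj⟩ := exists_isLowest (S.key τ) z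
  exact ⟨S.key τ j, by rw [S.slideX_map, slide_zero hj, S.key_spec]⟩

lemma exists_slideX_one (x : X) : ∃ g : Deck p, S.slideX 1 x = (g : X ≃ₜ X) v₀ := by
  obtain ⟨⟨τ, z⟩, -, rfl⟩ := S.exists_carrier x
  obtain ⟨j, hj⟩ := exists_isHighest (S.key τ) z
  exact ⟨S.key τ j, by rw [S.slideX_map, slide_one hj, S.key_spec]⟩

/-- Slides by interior times are invertible. At times 0 and 1 a vertex has been reached, from which
the path cannot be recovered. -/
lemma OnPath.symm_or {x y : X} (h : S.OnPath x y) :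
    S.OnPath y x ∨ ∃ g : Deck p, y = (g : X ≃ₜ X) v₀ := by
  obtain ⟨α, rfl⟩ := h
  rcases eq_or_lt_of_le α.2.1 with h0 | h0
  · have : α = 0 := Subtype.ext h0.symm
    rw [this]
    exact Or.inr (exists_slideX_zero x)
  rcases eq_or_lt_of_le α.2.2 with h1 | h1
  · have : α = 1 := Subtype.ext h1
    rw [this]
    exact Or.inr (exists_slideX_one x)
  left
  obtain ⟨⟨τ, z⟩, -, rfl⟩ := S.exists_carrier x
  exact ⟨unitInterval.symm α, by rw [S.slideX_map, S.slideX_map, slide_symm (α := α) h0 h1]⟩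

lemma OnPath.deck (hO : ∀ g a b : Deck p, a < b → g * a < g * b) {x y : X} (h : S.OnPath x y)
    (g : Deck p) : S.OnPath ((g : X ≃ₜ X) x) ((g : X ≃ₜ X) y) := by
  obtain ⟨α, rfl⟩ := h
  exact ⟨α, (S.slideX_deck hO α g x).symm⟩

variable (S)

lemma slide_translate (hO : ∀ g a b : Deck p, a < b → g * a < g * b) (α : unitInterval)
    (g : Deck p) (τ : LiftedCell T p) (z : Simplex (T.dim τ.cell)) :
    slide (S.key (τ.translate g)) (S.key_injective (τ.translate g)) α z =
      slide (S.key τ) (S.key_injective τ) α z := by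
  have hlt : StrictMono fun a => g * a := fun a b h => hO g a b h
  have := slide_map (κ := S.key (τ.translate g)) (hκ := S.key_injective (τ.translate g))
    (κ' := S.key τ) (hκ' := S.key_injective τ) (e := id) Function.injective_id
    (fun a b => by
      have h1 : S.key (τ.translate g) a = g * S.key τ a := S.key_translate g τ a
      have h2 : S.key (τ.translate g) b = g * S.key τ b := S.key_translate g τ b
      simp only [id, h1, h2, hlt.le_iff_le]) α z
  rw [stdSimplex.map_id_apply, stdSimplex.map_id_apply] at this
  exact this.symm

variable {i : Deck p → ℝ} {ρ : Deck p →* (ℝ ≃o ℝ)} (hI : IsOrbitMap i ρ)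

include hI

lemma canonF_continuous : Continuous (S.canonF i ρ) :=
  S.continuous_canonF hI.mono.injective hI.one hI.act

lemma canonF_apply_deck (g : Deck p) (x : X) :
    S.canonF i ρ ((g : X ≃ₜ X) x) = ρ g (S.canonF i ρ x) :=
  S.canonF_deck hI.mono.injective hI.one hI.act g x

lemma canonF_orbit (g : Deck p) : S.canonF i ρ ((g : X ≃ₜ X) v₀) = i g := by
  rw [S.canonF_apply_deck hI, S.canonF_base hI.mono.injective hI.one hI.act, ← hI.one, hI.act,
    mul_one]

lemma canonF_ascending (τ : LiftedCell T p) :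
    Ascending (S.key τ) (S.key_injective τ) fun z => S.canonF i ρ (τ.map z) :=
  S.ascending_canonF hI.mono hI.one hI.act τ

variable {S}

lemma OnPath.eq_of_height {x y y' : X} (h : S.OnPath x y) (h' : S.OnPath x y')
    (he : S.canonF i ρ y = S.canonF i ρ y') : y = y' := by
  obtain ⟨α, rfl⟩ := h
  obtain ⟨β, rfl⟩ := h'
  obtain ⟨⟨τ, z⟩, -, rfl⟩ := S.exists_carrier x
  rw [S.slideX_map, S.slideX_map] at he ⊢
  rw [(S.canonF_ascending hI τ).slide_inj he]

lemma OnPath.height_mem {x y : X} (h : S.OnPath x y) : S.canonF i ρ y ∈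
    Icc (S.canonF i ρ (S.slideX 0 x)) (S.canonF i ρ (S.slideX 1 x)) := by
  obtain ⟨α, rfl⟩ := h
  obtain ⟨⟨τ, z⟩, -, rfl⟩ := S.exists_carrier x
  rw [S.slideX_map, S.slideX_map, S.slideX_map]
  exact ⟨(S.canonF_ascending hI τ).slide_zero_le α z, (S.canonF_ascending hI τ).le_slide_one α z⟩

lemma exists_onPath {x : X} {t : ℝ} (ht : t ∈
    Icc (S.canonF i ρ (S.slideX 0 x)) (S.canonF i ρ (S.slideX 1 x))) :
    ∃ α, S.canonF i ρ (S.slideX α x) = t := by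
  obtain ⟨⟨τ, z⟩, -, rfl⟩ := S.exists_carrier x
  simp only [S.slideX_map] at ht ⊢
  exact exists_slide_eq ((S.canonF_continuous hI).comp τ.map.continuous) ht.1 ht.2

lemma bottom_orbit (x : X) : ∃ g, S.canonF i ρ (S.slideX 0 x) = i g := by
  obtain ⟨g, hg⟩ := exists_slideX_zero (S := S) x
  exact ⟨g, by rw [hg, S.canonF_orbit hI]⟩

lemma top_orbit (x : X) : ∃ g, S.canonF i ρ (S.slideX 1 x) = i g := by
  obtain ⟨g, hg⟩ := exists_slideX_one (S := S) x
  exact ⟨g, by rw [hg, S.canonF_orbit hI]⟩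

omit hI
variable (S)

open Classical in
/-- The parameter at which the slide path of `x` reaches the height `t`. -/
noncomputable def levelParam (F : X → ℝ) (t : ℝ) (x : X) : unitInterval :=
  if h : ∃ α, F (S.slideX α x) = t then h.choose else ⟨1 / 2, by norm_num, by norm_num⟩

/-- The point of height `t` on the slide path of `x`. -/
noncomputable def lev (F : X → ℝ) (t : ℝ) (x : X) : X := S.slideX (S.levelParam F t x) x

lemma onPath_lev (F : X → ℝ) (t : ℝ) (x : X) : S.OnPath x (S.lev F t x) := ⟨_, rfl⟩

include hI

lemma canonF_lev {x : X} {t : ℝ} (ht : t ∈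
    Icc (S.canonF i ρ (S.slideX 0 x)) (S.canonF i ρ (S.slideX 1 x))) :
    S.canonF i ρ (S.lev (S.canonF i ρ) t x) = t := by
  have h := exists_onPath hI ht
  rw [lev, levelParam, dif_pos h]
  exact h.choose_spec

lemma continuousOn_lev : ContinuousOn (fun q : X × ℝ => S.lev (S.canonF i ρ) q.2 q.1)
    {q | q.2 ∈ Icc (S.canonF i ρ (S.slideX 0 q.1)) (S.canonF i ρ (S.slideX 1 q.1))} := by
  have := S.t2
  refine continuousOn_of_cells (T := T) S.cov fun τ => ?_
  have h1 : ∀ q : Simplex (T.dim τ.cell) × ℝ, S.lev (S.canonF i ρ) q.2 (τ.map q.1) =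
      τ.map (slide (S.key τ) (S.key_injective τ)
        (S.levelParam (S.canonF i ρ) q.2 (τ.map q.1)) q.1) := fun q => S.slideX_map _ τ q.1
  simp only [h1]
  refine τ.map.continuous.comp_continuousOn ((S.canonF_ascending hI τ).continuousOn_slide
    ((S.canonF_continuous hI).comp τ.map.continuous) (x := fun q => q.1) continuousOn_fst
    (fun q _ => ⟨_, rfl⟩) ?_)
  refine continuousOn_snd.congr fun q hq => ?_
  rw [← h1, S.canonF_lev hI hq]

end IsTriangulatedCover

end SlidePaths

/-! ### Sliding the levels of one canonical function to those of another -/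

section Collapse

open Filter Topology OneVertexTriangulation

variable {M : Type u} [TopologicalSpace M] {X : Type w} [TopologicalSpace X]
  {T : OneVertexTriangulation M} {p : X → M} {v₀ : X} (S : IsTriangulatedCover T p v₀)
  [LinearOrder (Deck p)] {i j : Deck p → ℝ} {ρ ρ' : Deck p →* (ℝ ≃o ℝ)} {φ : ℝ → ℝ}

namespace IsTriangulatedCover

/-- The map of the cover that slides the levels of one canonical function to those of another. -/
noncomputable def collapse (i j : Deck p → ℝ) (ρ ρ' : Deck p →* (ℝ ≃o ℝ)) (φ : ℝ → ℝ) (x : X) : X :=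
  S.lev (S.canonF j ρ') (φ (S.canonF i ρ x)) x

/-- The sliding map on a lifted simplex. -/
noncomputable def collapseCell (i j : Deck p → ℝ) (ρ ρ' : Deck p →* (ℝ ≃o ℝ)) (φ : ℝ → ℝ)
    (τ : LiftedCell T p) (z : Simplex (T.dim τ.cell)) : Simplex (T.dim τ.cell) :=
  slide (S.key τ) (S.key_injective τ)
    (S.levelParam (S.canonF j ρ') (φ (S.canonF i ρ (τ.map z))) (τ.map z)) z

lemma collapse_map (τ : LiftedCell T p) (z : Simplex (T.dim τ.cell)) :
    S.collapse i j ρ ρ' φ (τ.map z) = τ.map (S.collapseCell i j ρ ρ' φ τ z) :=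
  S.slideX_map _ τ z

variable (D : IsCollapse i j ρ ρ' φ)

lemma onPath_collapse (x : X) : S.OnPath x (S.collapse i j ρ ρ' φ x) := S.onPath_lev _ _ _

include D

lemma canonF_mem_hull (x : X) : S.canonF i ρ x ∈ openHull i := by
  have h := (OnPath.refl (S := S) x).height_mem D.orbI
  obtain ⟨g, hg⟩ := bottom_orbit (S := S) D.orbI x
  obtain ⟨g', hg'⟩ := top_orbit (S := S) D.orbI x
  rw [hg, hg'] at h
  exact Icc_subset_openHull (D.orbit_mem g) (D.orbit_mem g') h

/-- A slide path ends at vertices, where φ takes one canonical function to the other. By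
monotonicity the required height lies between the heights of the two ends. -/
lemma collapse_height_mem (x : X) : φ (S.canonF i ρ x) ∈
    Icc (S.canonF j ρ' (S.slideX 0 x)) (S.canonF j ρ' (S.slideX 1 x)) := by
  have h := (OnPath.refl (S := S) x).height_mem D.orbI
  obtain ⟨g, hg⟩ := exists_slideX_zero (S := S) x
  obtain ⟨g', hg'⟩ := exists_slideX_one (S := S) x
  rw [hg, hg', S.canonF_orbit D.orbI, S.canonF_orbit D.orbI] at h
  rw [hg, hg', S.canonF_orbit D.orbJ, S.canonF_orbit D.orbJ, ← D.orbit, ← D.orbit]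
  have hx := S.canonF_mem_hull D x
  exact ⟨D.mono (D.orbit_mem g) hx h.1, D.mono hx (D.orbit_mem g') h.2⟩

lemma canonF_collapse (x : X) :
    S.canonF j ρ' (S.collapse i j ρ ρ' φ x) = φ (S.canonF i ρ x) :=
  S.canonF_lev D.orbJ (S.collapse_height_mem D x)

lemma eq_collapse {x y : X} (h : S.OnPath x y) (hy : S.canonF j ρ' y = φ (S.canonF i ρ x)) :
    y = S.collapse i j ρ ρ' φ x :=
  h.eq_of_height D.orbJ (S.onPath_collapse x) (by rw [hy, S.canonF_collapse D])

lemma collapse_deck (g : Deck p) (x : X) : S.collapse i j ρ ρ' φ ((g : X ≃ₜ X) x) =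
    (g : X ≃ₜ X) (S.collapse i j ρ ρ' φ x) := by
  symm
  apply S.eq_collapse D ((S.onPath_collapse x).deck D.left g)
  rw [S.canonF_apply_deck D.orbJ, S.canonF_collapse D, S.canonF_apply_deck D.orbI,
    D.equiv g _ (S.canonF_mem_hull D x)]

lemma collapse_eq_of_onPath {x y : X} (h : S.OnPath x y)
    (he : φ (S.canonF i ρ x) = φ (S.canonF i ρ y)) :
    S.collapse i j ρ ρ' φ y = S.collapse i j ρ ρ' φ x :=
  S.eq_collapse D (h.trans (S.onPath_collapse y)) (by rw [S.canonF_collapse D, he])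

lemma isCellMap_collapseCell : IsCellMap T p (S.collapseCell i j ρ ρ' φ) := by
  refine ⟨fun τ => ?_, fun τ c' e he y => ?_, fun g τ z => ?_⟩
  · rw [← continuousOn_univ]
    refine (S.canonF_ascending D.orbJ τ).continuousOn_slide
      ((S.canonF_continuous D.orbJ).comp τ.map.continuous) (x := fun z => z) continuousOn_id
      (fun z _ => ⟨_, rfl⟩) ?_
    have h1 : ∀ z, S.canonF j ρ' (τ.map (S.collapseCell i j ρ ρ' φ τ z)) =
        φ (S.canonF i ρ (τ.map z)) := fun z => by
      rw [← S.collapse_map, S.canonF_collapse D]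
    simp only [h1]
    exact D.cont.comp ((S.canonF_continuous D.orbI).comp τ.map.continuous).continuousOn
      fun z _ => S.canonF_mem_hull D _
  · exact (slide_map he.1 (fun a b => by rw [S.key_face τ he, S.key_face τ he]) _ y).symm
  · have h1 := S.collapse_deck D g (τ.map z)
    have h2 := S.collapse_map (i := i) (j := j) (ρ := ρ) (ρ' := ρ') (φ := φ) (τ.translate g) z
    rw [S.collapse_map] at h1
    have h3 : S.canonF j ρ' ((τ.translate g).map (S.collapseCell i j ρ ρ' φ (τ.translate g) z)) =
        S.canonF j ρ' ((τ.translate g).map (S.collapseCell i j ρ ρ' φ τ z)) :=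
      congrArg (S.canonF j ρ') (h2.symm.trans h1)
    have h4 : S.collapseCell i j ρ ρ' φ τ z =
        slide (S.key (τ.translate g)) (S.key_injective (τ.translate g))
          (S.levelParam (S.canonF j ρ') (φ (S.canonF i ρ (τ.map z))) (τ.map z)) z :=
      (S.slide_translate D.left _ g τ z).symm
    rw [h4] at h3 ⊢
    exact (S.canonF_ascending D.orbJ (τ.translate g)).slide_inj h3

lemma cellMap_collapseCell (x : X) :
    S.cellMap (S.collapseCell i j ρ ρ' φ) x = S.collapse i j ρ ρ' φ x := by
  obtain ⟨⟨τ, z⟩, -, rfl⟩ := S.exists_carrier x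
  rw [S.cellMap_map (S.isCellMap_collapseCell D), S.collapse_map]

lemma continuous_collapse : Continuous (S.collapse i j ρ ρ' φ) :=
  (S.continuous_cellMap (S.isCellMap_collapseCell D)).congr fun x => S.cellMap_collapseCell D x

/-- By the intermediate value theorem φ takes on every height of the path of `y`; this gives
surjectivity of the collapse, with a preimage on the path itself. -/
lemma exists_onPath_collapse {y : X} {t : ℝ} (ht : S.canonF j ρ' y = t) :
    ∃ x, S.OnPath y x ∧ φ (S.canonF i ρ x) = t ∧ S.collapse i j ρ ρ' φ x = y := by
  obtain ⟨g, hg⟩ := exists_slideX_zero (S := S) y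
  obtain ⟨g', hg'⟩ := exists_slideX_one (S := S) y
  have h := (OnPath.refl (S := S) y).height_mem D.orbJ
  rw [hg, hg', S.canonF_orbit D.orbJ, S.canonF_orbit D.orbJ, ht] at h
  have hle : i g ≤ i g' := D.monoI.le_iff_le.2 (D.monoJ.le_iff_le.1 (h.1.trans h.2))
  obtain ⟨s, hs, hst⟩ := intermediate_value_Icc hle
    (D.cont.mono (Icc_subset_openHull (D.orbit_mem g) (D.orbit_mem g')))
    (show t ∈ Icc (φ (i g)) (φ (i g')) by rw [D.orbit, D.orbit]; exact h)
  obtain ⟨α, hα⟩ := exists_onPath (S := S) D.orbI (x := y) (t := s)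
    (by rw [hg, hg', S.canonF_orbit D.orbI, S.canonF_orbit D.orbI]; exact hs)
  have hp : S.OnPath y (S.slideX α y) := ⟨α, rfl⟩
  refine ⟨S.slideX α y, hp, by rw [hα, hst], ?_⟩
  symm
  rcases hp.symm_or with h' | ⟨k, hk⟩
  · exact S.eq_collapse D h' (by rw [hα, hst, ht])
  · have hyx : y = S.slideX α y := by
      refine (OnPath.refl (S := S) y).eq_of_height D.orbJ hp ?_
      rw [ht, hk, S.canonF_orbit D.orbJ, ← D.orbit, ← S.canonF_orbit D.orbI, ← hk, hα, hst]
    refine S.eq_collapse D ?_ (by rw [hα, hst, ht])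
    rw [← hyx]
    exact OnPath.refl y

end IsTriangulatedCover

end Collapse

/-! ### Leaves of an equivariant function -/

section LeavesOfEquivariant

open Filter Topology

variable {M : Type u} [TopologicalSpace M] {X : Type w} [TopologicalSpace X] {p : X → M}
  {F : X → ℝ} {r : Deck p → ℝ → ℝ}

lemma image_component_deck (hF : ∀ (g : Deck p) x, F ((g : X ≃ₜ X) x) = r g (F x))
    (g : Deck p) (x : X) :
    p '' connectedComponentIn (F ⁻¹' {F ((g : X ≃ₜ X) x)}) ((g : X ≃ₜ X) x) =
      p '' connectedComponentIn (F ⁻¹' {F x}) x := by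
  have h1 : F ⁻¹' {F ((g : X ≃ₜ X) x)} = (g : X ≃ₜ X) '' (F ⁻¹' {F x}) := by
    ext y
    constructor
    · intro hy
      refine ⟨((g⁻¹ : Deck p) : X ≃ₜ X) y, ?_, Deck.apply_inv_self g y⟩
      have hy' : F y = F ((g : X ≃ₜ X) x) := hy
      show F (((g⁻¹ : Deck p) : X ≃ₜ X) y) = F x
      rw [hF, hy', ← hF, Deck.inv_apply_self]
    · rintro ⟨z, hz, rfl⟩
      have hz' : F z = F x := hz
      show F ((g : X ≃ₜ X) z) = F ((g : X ≃ₜ X) x)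
      rw [hF, hF, hz']
  rw [h1, ← (g : X ≃ₜ X).image_connectedComponentIn (show x ∈ F ⁻¹' {F x} from rfl), image_image]
  exact image_congr fun y _ => Deck.proj g y

lemma mem_component_self (x : X) : x ∈ connectedComponentIn (F ⁻¹' {F x}) x :=
  mem_connectedComponentIn rfl

lemma height_of_mem_component {x y : X} (h : y ∈ connectedComponentIn (F ⁻¹' {F x}) x) :
    F y = F x := by
  have h1 : y ∈ F ⁻¹' {F x} := connectedComponentIn_subset _ _ h
  exact h1

lemma component_eq {x y : X} (h : y ∈ connectedComponentIn (F ⁻¹' {F x}) x) :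
    connectedComponentIn (F ⁻¹' {F y}) y = connectedComponentIn (F ⁻¹' {F x}) x := by
  rw [height_of_mem_component h, connectedComponentIn_eq h]

lemma SameLeaf.symm {𝓕 : Set (Set M)} {x y : M} (h : SameLeaf 𝓕 x y) : SameLeaf 𝓕 y x := by
  obtain ⟨l, hl, hx, hy⟩ := h
  exact ⟨l, hl, hy, hx⟩

lemma SameLeaf.refl_leaves (hps : Function.Surjective p) (a : M) :
    SameLeaf (leaves p F) a a := by
  obtain ⟨x, rfl⟩ := hps a
  exact ⟨_, ⟨x, rfl⟩, ⟨x, mem_component_self x, rfl⟩, ⟨x, mem_component_self x, rfl⟩⟩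

variable [SimplyConnectedSpace X] [LocallyPathConnectedSpace X]

/-- A leaf is determined by any of its points. -/
lemma leaf_eq (hp : IsCoveringMap p) (hF : ∀ (g : Deck p) x, F ((g : X ≃ₜ X) x) = r g (F x))
    {l : Set M} (hl : l ∈ leaves p F) {x : X} (hx : p x ∈ l) :
    l = p '' connectedComponentIn (F ⁻¹' {F x}) x := by
  obtain ⟨y, rfl⟩ := hl
  obtain ⟨z, hz, hzx⟩ := hx
  obtain ⟨g, rfl⟩ := Deck.exists_apply_eq hp hzx
  rw [image_component_deck hF, component_eq hz]

lemma sameLeaf_iff (hp : IsCoveringMap p)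
    (hF : ∀ (g : Deck p) x, F ((g : X ≃ₜ X) x) = r g (F x)) (x y : X) :
    SameLeaf (leaves p F) (p x) (p y) ↔
      ∃ g : Deck p, (g : X ≃ₜ X) y ∈ connectedComponentIn (F ⁻¹' {F x}) x := by
  constructor
  · rintro ⟨l, hl, hx, hy⟩
    rw [leaf_eq hp hF hl hx] at hy
    obtain ⟨z, hz, hzy⟩ := hy
    obtain ⟨g, rfl⟩ := Deck.exists_apply_eq hp hzy.symm
    exact ⟨g, hz⟩
  · rintro ⟨g, hg⟩
    exact ⟨_, ⟨x, rfl⟩, ⟨x, mem_component_self x, rfl⟩, ⟨_, hg, Deck.proj g y⟩⟩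

lemma SameLeaf.trans_leaves (hp : IsCoveringMap p) (hps : Function.Surjective p)
    (hF : ∀ (g : Deck p) x, F ((g : X ≃ₜ X) x) = r g (F x)) {a b c : M}
    (h : SameLeaf (leaves p F) a b) (h' : SameLeaf (leaves p F) b c) :
    SameLeaf (leaves p F) a c := by
  obtain ⟨x, rfl⟩ := hps b
  obtain ⟨l, hl, ha, hb⟩ := h
  obtain ⟨l', hl', hb', hc⟩ := h'
  refine ⟨l, hl, ha, ?_⟩
  rw [leaf_eq hp hF hl hb, ← leaf_eq hp hF hl' hb']
  exact hc

end LeavesOfEquivariant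

/-! ### Affine coordinates in the gaps -/

section GapCoordinates

variable {A : Type*} [LinearOrder A] {i : A → ℝ} {φ : ℝ → ℝ}

/-- `t` lies in the interior of a gap. -/
def InGap (i : A → ℝ) (φ : ℝ → ℝ) (t : ℝ) : Prop := ∃ a b, IsGap i φ a b ∧ t ∈ Ioo a b

open Classical in
/-- The end points of the gap containing `t`. -/
noncomputable def gapEnds (i : A → ℝ) (φ : ℝ → ℝ) (t : ℝ) : ℝ × ℝ :=
  if h : InGap i φ t then (h.choose, h.choose_spec.choose) else (0, 0)

/-- The point with affine coordinate `s` in the gap containing `t`. -/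
noncomputable def gapPoint (i : A → ℝ) (φ : ℝ → ℝ) (s t : ℝ) : ℝ :=
  (gapEnds i φ t).1 + s * ((gapEnds i φ t).2 - (gapEnds i φ t).1)

/-- The affine coordinate of `t` in its gap. -/
noncomputable def gapCoord (i : A → ℝ) (φ : ℝ → ℝ) (t : ℝ) : ℝ :=
  (t - (gapEnds i φ t).1) / ((gapEnds i φ t).2 - (gapEnds i φ t).1)

variable {a b s t : ℝ}

namespace IsGap

lemma ends_eq (h : IsGap i φ a b) (hφ : MonotoneOn φ (openHull i)) (ht : t ∈ Ioo a b) :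
    gapEnds i φ t = (a, b) := by
  have hg : InGap i φ t := ⟨a, b, h, ht⟩
  rw [gapEnds, dif_pos hg]
  have h1 := hg.choose_spec.choose_spec
  obtain ⟨e1, e2⟩ := h1.1.eq_of_inter h hφ h1.2 ht
  exact Prod.ext e1 e2

lemma point_eq (h : IsGap i φ a b) (hφ : MonotoneOn φ (openHull i)) (ht : t ∈ Ioo a b) (s : ℝ) :
    gapPoint i φ s t = a + s * (b - a) := by rw [gapPoint, h.ends_eq hφ ht]

lemma coord_eq (h : IsGap i φ a b) (hφ : MonotoneOn φ (openHull i)) (ht : t ∈ Ioo a b) :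
    gapCoord i φ t = (t - a) / (b - a) := by rw [gapCoord, h.ends_eq hφ ht]

lemma mem_Icc (h : IsGap i φ a b) (hs : s ∈ Icc (0 : ℝ) 1) : a + s * (b - a) ∈ Icc a b := by
  have h1 := sub_pos.2 h.lt
  have h2 := mul_nonneg hs.1 h1.le
  have h3 := mul_le_mul_of_nonneg_right hs.2 h1.le
  constructor <;> linarith

lemma mem_Ioo (h : IsGap i φ a b) (hs : s ∈ Ioo (0 : ℝ) 1) : a + s * (b - a) ∈ Ioo a b := by
  have h1 := sub_pos.2 h.lt
  have h2 := mul_pos hs.1 h1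
  have h3 := mul_lt_mul_of_pos_right hs.2 h1
  constructor <;> linarith

lemma coord_mem (h : IsGap i φ a b) (hφ : MonotoneOn φ (openHull i)) (ht : t ∈ Ioo a b) :
    gapCoord i φ t ∈ Ioo (0 : ℝ) 1 := by
  have h1 := sub_pos.2 h.lt
  rw [h.coord_eq hφ ht]
  exact ⟨div_pos (sub_pos.2 ht.1) h1, (div_lt_one h1).2 (by linarith [ht.2])⟩

lemma point_coord (h : IsGap i φ a b) (hφ : MonotoneOn φ (openHull i)) (ht : t ∈ Ioo a b) :
    gapPoint i φ (gapCoord i φ t) t = t := by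
  have h1 := sub_pos.2 h.lt
  rw [h.point_eq hφ ht, h.coord_eq hφ ht, div_mul_cancel₀ _ h1.ne']
  ring

lemma coord_point (h : IsGap i φ a b) (hφ : MonotoneOn φ (openHull i)) (ht : t ∈ Ioo a b)
    (hs : s ∈ Ioo (0 : ℝ) 1) : gapCoord i φ (gapPoint i φ s t) = s := by
  have h1 := sub_pos.2 h.lt
  rw [h.point_eq hφ ht, h.coord_eq hφ (h.mem_Ioo hs), add_sub_cancel_left,
    mul_div_cancel_right₀ _ h1.ne']

lemma point_point (h : IsGap i φ a b) (hφ : MonotoneOn φ (openHull i)) (ht : t ∈ Ioo a b)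
    (hs : s ∈ Ioo (0 : ℝ) 1) (s' : ℝ) :
    gapPoint i φ s' (gapPoint i φ s t) = gapPoint i φ s' t := by
  rw [h.point_eq hφ ht, h.point_eq hφ ht, h.point_eq hφ (h.mem_Ioo hs)]

end IsGap

lemma isOpen_inGap : IsOpen {t | InGap i φ t} := by
  rw [isOpen_iff_mem_nhds]
  rintro t ⟨a, b, h, ht⟩
  filter_upwards [Ioo_mem_nhds ht.1 ht.2] with s hs
  exact ⟨a, b, h, hs⟩

lemma continuousAt_gapPoint (hφ : MonotoneOn φ (openHull i)) (ht : InGap i φ t) (s : ℝ) :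
    ContinuousAt (fun q : ℝ × ℝ => gapPoint i φ q.1 q.2) (s, t) := by
  obtain ⟨a, b, h, ht⟩ := ht
  have h1 : ContinuousAt (fun q : ℝ × ℝ => a + q.1 * (b - a)) (s, t) := by fun_prop
  refine h1.congr ?_
  have h2 : ∀ᶠ q : ℝ × ℝ in nhds (s, t), q.2 ∈ Ioo a b :=
    continuousAt_snd.eventually (Ioo_mem_nhds ht.1 ht.2)
  filter_upwards [h2] with q hq
  exact (h.point_eq hφ hq q.1).symm

lemma continuousAt_gapCoord (hφ : MonotoneOn φ (openHull i)) (ht : InGap i φ t) :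
    ContinuousAt (gapCoord i φ) t := by
  obtain ⟨a, b, h, ht⟩ := ht
  have h1 : ContinuousAt (fun t : ℝ => (t - a) / (b - a)) t := by fun_prop
  refine h1.congr ?_
  filter_upwards [Ioo_mem_nhds ht.1 ht.2] with q hq
  exact (h.coord_eq hφ hq).symm

namespace IsCollapse

variable {G : Type*} [Group G] [LinearOrder G]
  {i j : G → ℝ} {ρ ρ' : G →* (ℝ ≃o ℝ)} {φ : ℝ → ℝ} (D : IsCollapse i j ρ ρ' φ)
include D

lemma inGap_act (g : G) {t : ℝ} (ht : InGap i φ t) : InGap i φ (ρ g t) := by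
  obtain ⟨a, b, h, ht⟩ := ht
  exact ⟨_, _, D.gap_act g h, (ρ g).strictMono ht.1, (ρ g).strictMono ht.2⟩

lemma act_gapPoint (g : G) {s t : ℝ} (ht : InGap i φ t) (hs : s ∈ Icc (0 : ℝ) 1) :
    ρ g (gapPoint i φ s t) = gapPoint i φ s (ρ g t) := by
  obtain ⟨a, b, h, ht⟩ := ht
  rw [h.point_eq D.mono ht, (D.gap_act g h).point_eq D.mono
    ⟨(ρ g).strictMono ht.1, (ρ g).strictMono ht.2⟩, D.act_affine g h hs]

lemma gapCoord_act (g : G) {t : ℝ} (ht : InGap i φ t) :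
    gapCoord i φ (ρ g t) = gapCoord i φ t := by
  obtain ⟨a, b, h, ht⟩ := id ht
  have hc := h.coord_mem D.mono ht
  conv_lhs => rw [← h.point_coord D.mono ht]
  rw [D.act_gapPoint g ⟨a, b, h, ht⟩ ⟨hc.1.le, hc.2.le⟩]
  exact (D.gap_act g h).coord_point D.mono ⟨(ρ g).strictMono ht.1, (ρ g).strictMono ht.2⟩ hc

end IsCollapse

end GapCoordinates

/-! ### Pushing points across a gap along slide paths -/

section Push

open Filter Topology OneVertexTriangulation

variable {M : Type u} [TopologicalSpace M] {X : Type w} [TopologicalSpace X]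
  {T : OneVertexTriangulation M} {p : X → M} {v₀ : X} (S : IsTriangulatedCover T p v₀)
  [LinearOrder (Deck p)] {i j : Deck p → ℝ} {ρ ρ' : Deck p →* (ℝ ≃o ℝ)} {φ : ℝ → ℝ}

namespace IsTriangulatedCover

/-- The level sets of a canonical function in a lifted simplex are connected. -/
lemma isPreconnected_level (hI : IsOrbitMap i ρ) (τ : LiftedCell T p) (t : ℝ) :
    IsPreconnected {z | S.canonF i ρ (τ.map z) = t} := by
  -- A linear model turns the level into a convex slice of the simplex.
  obtain ⟨q, -, hq⟩ := S.exists_linear_model (S.isDefiningFunction_canonF hI.mono hI.one hI.act)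
    hI.mono.injective hI.one hI.act τ
  have h1 : {z | S.canonF i ρ (τ.map z) = t} =
      q '' {x | ∑ j, i (S.key τ j) * x j = t} := by
    ext z
    constructor
    · intro hz
      refine ⟨q.symm z, ?_, q.apply_symm_apply z⟩
      show ∑ j, i (S.key τ j) * q.symm z j = t
      rw [← hq, q.apply_symm_apply]
      exact hz
    · rintro ⟨x, hx, rfl⟩
      exact (hq x).trans hx
  rw [h1]
  refine IsPreconnected.image ?_ _ q.continuous.continuousOn
  refine isPreconnected_of_forall_pair fun x hx y hy => ?_
  have hc : Continuous fun s : unitInterval => simplexSegment s x y :=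
    continuous_simplexSegment.comp (continuous_id.prodMk (continuous_const (y := (x, y))))
  refine ⟨range fun s : unitInterval => simplexSegment s x y, ?_, ⟨0, simplexSegment_zero x y⟩,
    ⟨1, simplexSegment_one x y⟩, isPreconnected_range hc⟩
  rintro _ ⟨s, rfl⟩
  have hx' : ∑ j, i (S.key τ j) * x j = t := hx
  have hy' : ∑ j, i (S.key τ j) * y j = t := hy
  show ∑ j, i (S.key τ j) * simplexSegment s x y j = t
  rw [sum_mul_simplexSegment, hx', hy']
  ring

/-- Points of a simplex at the same height are on the same component of a level set. -/
lemma mem_component_of_height_eq (hI : IsOrbitMap i ρ) (τ : LiftedCell T p)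
    {z z' : Simplex (T.dim τ.cell)}
    (h : S.canonF i ρ (τ.map z') = S.canonF i ρ (τ.map z)) :
    τ.map z' ∈ connectedComponentIn (S.canonF i ρ ⁻¹' {S.canonF i ρ (τ.map z)}) (τ.map z) := by
  have h1 := (S.isPreconnected_level hI τ (S.canonF i ρ (τ.map z))).image τ.map
    τ.map.continuous.continuousOn
  refine h1.subset_connectedComponentIn ⟨z, rfl, rfl⟩ ?_ ⟨z', h, rfl⟩
  rintro _ ⟨y, hy, rfl⟩
  exact hy

/-- The point with coordinate `s` in its gap on the slide path of `x`. -/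
noncomputable def push (i : Deck p → ℝ) (ρ : Deck p →* (ℝ ≃o ℝ)) (φ : ℝ → ℝ) (s : ℝ) (x : X) : X :=
  S.lev (S.canonF i ρ) (gapPoint i φ s (S.canonF i ρ x)) x

variable (D : IsCollapse i j ρ ρ' φ)

lemma onPath_push (s : ℝ) (x : X) : S.OnPath x (S.push i ρ φ s x) := S.onPath_lev _ _ _

include D

/-- Both ends of a slide path have orbit heights, and the interior of a gap contains none. So a path
that enters a gap crosses all of it. -/
lemma gap_subset {a b : ℝ} (h : IsGap i φ a b) {x : X} (hx : S.canonF i ρ x ∈ Ioo a b) :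
    Icc a b ⊆ Icc (S.canonF i ρ (S.slideX 0 x)) (S.canonF i ρ (S.slideX 1 x)) := by
  have hm := (OnPath.refl (S := S) x).height_mem D.orbI
  obtain ⟨g, hg⟩ := bottom_orbit (S := S) D.orbI x
  obtain ⟨g', hg'⟩ := top_orbit (S := S) D.orbI x
  rw [hg, hg'] at hm ⊢
  refine Icc_subset_Icc ?_ ?_
  · by_contra! hlt
    exact h.disj _ ⟨hlt, hm.1.trans_lt hx.2⟩ ⟨g, rfl⟩
  · by_contra! hlt
    exact h.disj _ ⟨hx.1.trans_le hm.2, hlt⟩ ⟨g', rfl⟩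

lemma gapPoint_mem {x : X} (hx : InGap i φ (S.canonF i ρ x)) {s : ℝ} (hs : s ∈ Icc (0 : ℝ) 1) :
    gapPoint i φ s (S.canonF i ρ x) ∈
      Icc (S.canonF i ρ (S.slideX 0 x)) (S.canonF i ρ (S.slideX 1 x)) := by
  obtain ⟨a, b, h, hx⟩ := hx
  rw [h.point_eq D.mono hx]
  exact S.gap_subset D h hx (h.mem_Icc hs)

lemma canonF_push {x : X} (hx : InGap i φ (S.canonF i ρ x)) {s : ℝ} (hs : s ∈ Icc (0 : ℝ) 1) :
    S.canonF i ρ (S.push i ρ φ s x) = gapPoint i φ s (S.canonF i ρ x) :=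
  S.canonF_lev D.orbI (S.gapPoint_mem D hx hs)

lemma inGap_push {x : X} (hx : InGap i φ (S.canonF i ρ x)) {s : ℝ} (hs : s ∈ Ioo (0 : ℝ) 1) :
    InGap i φ (S.canonF i ρ (S.push i ρ φ s x)) := by
  rw [S.canonF_push D hx (Ioo_subset_Icc_self hs)]
  obtain ⟨a, b, h, hx⟩ := hx
  rw [h.point_eq D.mono hx]
  exact ⟨a, b, h, h.mem_Ioo hs⟩

lemma eq_push {x y : X} (hx : InGap i φ (S.canonF i ρ x)) {s : ℝ} (hs : s ∈ Icc (0 : ℝ) 1)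
    (h : S.OnPath x y) (hy : S.canonF i ρ y = gapPoint i φ s (S.canonF i ρ x)) :
    y = S.push i ρ φ s x :=
  h.eq_of_height D.orbI (S.onPath_push s x) (by rw [hy, S.canonF_push D hx hs])

lemma push_deck (g : Deck p) {x : X} (hx : InGap i φ (S.canonF i ρ x)) {s : ℝ}
    (hs : s ∈ Icc (0 : ℝ) 1) :
    S.push i ρ φ s ((g : X ≃ₜ X) x) = (g : X ≃ₜ X) (S.push i ρ φ s x) := by
  symm
  refine S.eq_push D ?_ hs ((S.onPath_push s x).deck D.left g) ?_
  · rw [S.canonF_apply_deck D.orbI]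
    exact D.inGap_act g hx
  · rw [S.canonF_apply_deck D.orbI, S.canonF_apply_deck D.orbI, S.canonF_push D hx hs,
      D.act_gapPoint g hx hs]

lemma push_push {x : X} (hx : InGap i φ (S.canonF i ρ x)) {s s' : ℝ} (hs : s ∈ Ioo (0 : ℝ) 1)
    (hs' : s' ∈ Icc (0 : ℝ) 1) :
    S.push i ρ φ s' (S.push i ρ φ s x) = S.push i ρ φ s' x := by
  refine S.eq_push D hx hs' ((S.onPath_push s x).trans (S.onPath_push s' _)) ?_
  rw [S.canonF_push D (S.inGap_push D hx hs) hs', S.canonF_push D hx (Ioo_subset_Icc_self hs)]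
  obtain ⟨a, b, h, hx⟩ := hx
  exact h.point_point D.mono hx hs s'

lemma push_coord {x : X} (hx : InGap i φ (S.canonF i ρ x)) :
    S.push i ρ φ (gapCoord i φ (S.canonF i ρ x)) x = x := by
  obtain ⟨a, b, h, hab⟩ := id hx
  have hc := h.coord_mem D.mono hab
  exact (S.eq_push D hx (Ioo_subset_Icc_self hc) (OnPath.refl x)
    (h.point_coord D.mono hab).symm).symm

lemma continuousOn_push : ContinuousOn (fun q : X × ℝ => S.push i ρ φ q.2 q.1)
    {q | InGap i φ (S.canonF i ρ q.1) ∧ q.2 ∈ Icc (0 : ℝ) 1} := by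
  have h0 : ∀ q : X × ℝ, InGap i φ (S.canonF i ρ q.1) →
      ContinuousAt (fun q : X × ℝ => gapPoint i φ q.2 (S.canonF i ρ q.1)) q := by
    intro q hq
    have h3 : Tendsto (fun q : X × ℝ => (q.2, S.canonF i ρ q.1)) (𝓝 q)
        (𝓝 (q.2, S.canonF i ρ q.1)) :=
      Continuous.tendsto
        (continuous_snd.prodMk ((S.canonF_continuous D.orbI).comp continuous_fst)) q
    exact (continuousAt_gapPoint D.mono hq q.2).tendsto.comp h3
  have h1 : ContinuousOn (fun q : X × ℝ => (q.1, gapPoint i φ q.2 (S.canonF i ρ q.1)))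
      {q | InGap i φ (S.canonF i ρ q.1) ∧ q.2 ∈ Icc (0 : ℝ) 1} :=
    ContinuousOn.prodMk continuousOn_fst fun q hq => (h0 q hq.1).continuousWithinAt
  have h2 : MapsTo (fun q : X × ℝ => (q.1, gapPoint i φ q.2 (S.canonF i ρ q.1)))
      {q | InGap i φ (S.canonF i ρ q.1) ∧ q.2 ∈ Icc (0 : ℝ) 1}
      {q | q.2 ∈ Icc (S.canonF i ρ (S.slideX 0 q.1)) (S.canonF i ρ (S.slideX 1 q.1))} :=
    fun q hq => S.gapPoint_mem D hq.1 hq.2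
  have h5 := ContinuousOn.comp (S.continuousOn_lev D.orbI) h1 h2
  refine ContinuousOn.congr h5 fun q _ => ?_
  rw [push, Function.comp_apply]

lemma isOpen_gapRegion : IsOpen {x | InGap i φ (S.canonF i ρ x)} :=
  isOpen_inGap.preimage (S.canonF_continuous D.orbI)

lemma continuousAt_push {x : X} (hx : InGap i φ (S.canonF i ρ x)) {s : ℝ}
    (hs : s ∈ Ioo (0 : ℝ) 1) : ContinuousAt (fun q : X × ℝ => S.push i ρ φ q.2 q.1) (x, s) := by
  refine (S.continuousOn_push D).continuousAt ?_
  have h1 : {q : X × ℝ | InGap i φ (S.canonF i ρ q.1)} ∈ nhds (x, s) :=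
    ((S.isOpen_gapRegion D).preimage continuous_fst).mem_nhds hx
  have h2 : {q : X × ℝ | q.2 ∈ Icc (0 : ℝ) 1} ∈ nhds (x, s) :=
    continuousAt_snd.preimage_mem_nhds (Icc_mem_nhds hs.1 hs.2)
  filter_upwards [h1, h2] with q h1 h2 using ⟨h1, h2⟩

lemma push_mem_component {x y : X} (hx : InGap i φ (S.canonF i ρ x)) {s : ℝ}
    (hs : s ∈ Ioo (0 : ℝ) 1) (hy : y ∈ connectedComponentIn (S.canonF i ρ ⁻¹' {S.canonF i ρ x}) x) :
    S.push i ρ φ s y ∈ connectedComponentIn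
      (S.canonF i ρ ⁻¹' {S.canonF i ρ (S.push i ρ φ s x)}) (S.push i ρ φ s x) := by
  have hs' := Ioo_subset_Icc_self hs
  have hlev : ∀ z ∈ connectedComponentIn (S.canonF i ρ ⁻¹' {S.canonF i ρ x}) x,
      S.canonF i ρ z = S.canonF i ρ x := fun z hz => height_of_mem_component hz
  have hcont : ContinuousOn (S.push i ρ φ s)
      (connectedComponentIn (S.canonF i ρ ⁻¹' {S.canonF i ρ x}) x) :=
    (S.continuousOn_push D).comp (f := fun z : X => (z, s))
      (Continuous.prodMk_left s).continuousOn fun z hz => ⟨by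
        show InGap i φ (S.canonF i ρ z)
        rw [hlev z hz]; exact hx, hs'⟩
  refine (isPreconnected_connectedComponentIn.image _ hcont).subset_connectedComponentIn
    ⟨x, mem_component_self x, rfl⟩ ?_ ⟨y, hy, rfl⟩
  rintro _ ⟨z, hz, rfl⟩
  have hz' := hlev z hz
  show S.canonF i ρ (S.push i ρ φ s z) = S.canonF i ρ (S.push i ρ φ s x)
  rw [S.canonF_push D (by rw [hz']; exact hx) hs', S.canonF_push D hx hs', hz']

/-- Pushing along the gap carries leaves to leaves. -/
lemma push_image_component {x : X} (hx : InGap i φ (S.canonF i ρ x)) {s : ℝ}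
    (hs : s ∈ Ioo (0 : ℝ) 1) :
    S.push i ρ φ s '' connectedComponentIn (S.canonF i ρ ⁻¹' {S.canonF i ρ x}) x =
      connectedComponentIn
        (S.canonF i ρ ⁻¹' {S.canonF i ρ (S.push i ρ φ s x)}) (S.push i ρ φ s x) := by
  apply Subset.antisymm
  · rintro _ ⟨y, hy, rfl⟩
    exact S.push_mem_component D hx hs hy
  · intro y hy
    have hsx := S.inGap_push D hx hs
    have hy' : InGap i φ (S.canonF i ρ y) := by
      rw [height_of_mem_component hy]; exact hsx
    obtain ⟨a, b, h, hab⟩ := id hx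
    have hc := h.coord_mem D.mono hab
    -- Pushing back to the coordinate of `x` inverts the push, so the first inclusion, applied to
    -- the reverse push, gives the second.
    have h1 := S.push_mem_component D hsx hc hy
    rw [S.push_push D hx hs (Ioo_subset_Icc_self hc), S.push_coord D hx] at h1
    refine ⟨_, h1, ?_⟩
    rw [S.push_push D hy' hc (Ioo_subset_Icc_self hs)]
    have h2 : s = gapCoord i φ (S.canonF i ρ y) := by
      rw [height_of_mem_component hy, S.canonF_push D hx (Ioo_subset_Icc_self hs)]
      exact (h.coord_point D.mono hab hs).symm
    rw [h2]
    exact S.push_coord D hy'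

end IsTriangulatedCover

end Push

/-! ### The strips in `M` -/

section Strips

open Filter Topology OneVertexTriangulation

variable {M : Type u} [TopologicalSpace M] {X : Type w} [TopologicalSpace X]
  {T : OneVertexTriangulation M} {p : X → M} {v₀ : X} (S : IsTriangulatedCover T p v₀)
  [LinearOrder (Deck p)] {i j : Deck p → ℝ} {ρ ρ' : Deck p →* (ℝ ≃o ℝ)} {φ : ℝ → ℝ}

namespace IsTriangulatedCover

lemma exists_deck_surjInv (x : X) :
    ∃ g : Deck p, Function.surjInv S.surj (p x) = (g : X ≃ₜ X) x := by
  have := S.simplyConnected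
  have := S.locPath
  obtain ⟨g, hg⟩ := Deck.exists_apply_eq S.cov (Function.surjInv_eq S.surj (p x)).symm
  exact ⟨g, hg.symm⟩

/-- The points of `M` in the interiors of the strips. -/
def strips (i : Deck p → ℝ) (ρ : Deck p →* (ℝ ≃o ℝ)) (φ : ℝ → ℝ) : Set M :=
  {m | InGap i φ (S.canonF i ρ (Function.surjInv S.surj m))}

/-- The point with coordinate `s` on the transverse arc through a point of a strip. -/
noncomputable def stripPush (i : Deck p → ℝ) (ρ : Deck p →* (ℝ ≃o ℝ)) (φ : ℝ → ℝ) (s : ℝ) (m : M) :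
    M := p (S.push i ρ φ s (Function.surjInv S.surj m))

/-- The transverse coordinate in a strip. -/
noncomputable def stripCoord (i : Deck p → ℝ) (ρ : Deck p →* (ℝ ≃o ℝ)) (φ : ℝ → ℝ) (m : M) : ℝ :=
  gapCoord i φ (S.canonF i ρ (Function.surjInv S.surj m))

/-- `x` lies on the central level of a gap. -/
def IsCentral (i : Deck p → ℝ) (ρ : Deck p →* (ℝ ≃o ℝ)) (φ : ℝ → ℝ) (x : X) : Prop :=
  InGap i φ (S.canonF i ρ x) ∧ S.push i ρ φ (1 / 2) x = x

variable (D : IsCollapse i j ρ ρ' φ)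

lemma half_mem : (1 / 2 : ℝ) ∈ Ioo (0 : ℝ) 1 := by constructor <;> norm_num

include D

lemma inGap_deck (g : Deck p) {x : X} (hx : InGap i φ (S.canonF i ρ x)) :
    InGap i φ (S.canonF i ρ ((g : X ≃ₜ X) x)) := by
  rw [S.canonF_apply_deck D.orbI]
  exact D.inGap_act g hx

lemma mem_strips {x : X} : p x ∈ S.strips i ρ φ ↔ InGap i φ (S.canonF i ρ x) := by
  obtain ⟨g, hg⟩ := S.exists_deck_surjInv x
  rw [strips, mem_ofPred, hg]
  refine ⟨fun h => ?_, S.inGap_deck D g⟩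
  have := S.inGap_deck D g⁻¹ h
  rwa [Deck.inv_apply_self] at this

/-- Pushing commutes with deck transformations, so the lift chosen in the definition does not
matter. -/
lemma stripPush_apply {x : X} (hx : InGap i φ (S.canonF i ρ x)) {s : ℝ} (hs : s ∈ Icc (0 : ℝ) 1) :
    S.stripPush i ρ φ s (p x) = p (S.push i ρ φ s x) := by
  obtain ⟨g, hg⟩ := S.exists_deck_surjInv x
  rw [stripPush, hg, S.push_deck D g hx hs]
  exact Deck.proj g _

lemma stripCoord_apply {x : X} (hx : InGap i φ (S.canonF i ρ x)) :
    S.stripCoord i ρ φ (p x) = gapCoord i φ (S.canonF i ρ x) := by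
  obtain ⟨g, hg⟩ := S.exists_deck_surjInv x
  rw [stripCoord, hg, S.canonF_apply_deck D.orbI, D.gapCoord_act g hx]

lemma continuousAt_stripPush {x : X} (hx : InGap i φ (S.canonF i ρ x)) {s : ℝ}
    (hs : s ∈ Ioo (0 : ℝ) 1) :
    ContinuousAt (fun q : M × ℝ => S.stripPush i ρ φ q.2 q.1) (p x, s) := by
  have hq : IsOpenQuotientMap (Prod.map p (id : ℝ → ℝ)) :=
    S.isOpenQuotientMap.prodMap IsOpenQuotientMap.id
  have h1 : ContinuousAt ((fun q : M × ℝ => S.stripPush i ρ φ q.2 q.1) ∘ Prod.map p id) (x, s) := by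
    refine ContinuousAt.congr (f := fun q : X × ℝ => p (S.push i ρ φ q.2 q.1))
      (S.cov.continuous.continuousAt.comp (S.continuousAt_push D hx hs)) ?_
    have h1 : {q : X × ℝ | InGap i φ (S.canonF i ρ q.1)} ∈ nhds (x, s) :=
      ((S.isOpen_gapRegion D).preimage continuous_fst).mem_nhds hx
    have h2 : {q : X × ℝ | q.2 ∈ Icc (0 : ℝ) 1} ∈ nhds (x, s) :=
      continuousAt_snd.preimage_mem_nhds (Icc_mem_nhds hs.1 hs.2)
    filter_upwards [h1, h2] with q h1 h2
    exact (S.stripPush_apply D h1 h2).symm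
  exact hq.continuousAt_comp_iff.1 h1

lemma continuousAt_stripCoord {x : X} (hx : InGap i φ (S.canonF i ρ x)) :
    ContinuousAt (S.stripCoord i ρ φ) (p x) := by
  rw [← S.isOpenQuotientMap.continuousAt_comp_iff]
  refine ContinuousAt.congr (f := fun x : X => gapCoord i φ (S.canonF i ρ x))
    (ContinuousAt.comp (continuousAt_gapCoord D.mono hx)
      (S.canonF_continuous D.orbI).continuousAt) ?_
  filter_upwards [(S.isOpen_gapRegion D).mem_nhds hx] with y hy
  exact (S.stripCoord_apply D hy).symm

lemma isCentral_push {x : X} (hx : InGap i φ (S.canonF i ρ x)) :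
    S.IsCentral i ρ φ (S.push i ρ φ (1 / 2) x) :=
  ⟨S.inGap_push D hx half_mem, S.push_push D hx half_mem (Ioo_subset_Icc_self half_mem)⟩

lemma isCentral_of_height_eq {x y : X} (hx : S.IsCentral i ρ φ x)
    (h : S.canonF i ρ y = S.canonF i ρ x) : S.IsCentral i ρ φ y := by
  have hy : InGap i φ (S.canonF i ρ y) := by rw [h]; exact hx.1
  refine ⟨hy, (S.eq_push D hy (Ioo_subset_Icc_self half_mem) (OnPath.refl y) ?_).symm⟩
  rw [h, ← S.canonF_push D hx.1 (Ioo_subset_Icc_self half_mem), hx.2]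

lemma mem_leaf_iff {l : Set M} (hl : l ∈ leaves p (S.canonF i ρ)) {x y : X}
    (h : y ∈ connectedComponentIn (S.canonF i ρ ⁻¹' {S.canonF i ρ x}) x) : p x ∈ l ↔ p y ∈ l := by
  have := S.simplyConnected
  have := S.locPath
  have hF := S.canonF_apply_deck D.orbI
  constructor
  · intro hx
    rw [leaf_eq S.cov hF hl hx]
    exact ⟨y, h, rfl⟩
  · intro hy
    rw [leaf_eq S.cov hF hl hy, component_eq h]
    exact ⟨x, mem_component_self x, rfl⟩

/-- Membership in a given leaf is locally constant on the central levels. -/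
lemma isOpen_strip {l : Set M} (hl : l ∈ leaves p (S.canonF i ρ)) :
    IsOpen {m | m ∈ S.strips i ρ φ ∧ S.stripPush i ρ φ (1 / 2) m ∈ l} := by
  classical
  have := S.t2
  have hmid := Ioo_subset_Icc_self (half_mem)
  -- Membership in `l`, as a map to a discrete space. On the central levels its continuity, that is,
  -- its local constancy, can be tested simplex by simplex.
  let χ : X × Unit → Bool := fun x => decide (p x.1 ∈ l)
  have hχ : ContinuousOn χ {q | S.IsCentral i ρ φ q.1} := by
    refine continuousOn_of_cells (T := T) S.cov fun τ => ?_
    rintro ⟨z, u⟩ hz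
    have hz' : S.IsCentral i ρ φ (τ.map z) := hz
    obtain ⟨a, b, hab, ht⟩ := hz'.1
    have hev : ∀ᶠ q : Simplex (T.dim τ.cell) × Unit in
        𝓝[{q | S.IsCentral i ρ φ (τ.map q.1)}] (z, u), χ (τ.map q.1, q.2) = χ (τ.map z, u) := by
      have hc : Continuous fun q : Simplex (T.dim τ.cell) × Unit => S.canonF i ρ (τ.map q.1) :=
        (S.canonF_continuous D.orbI).comp (τ.map.continuous.comp continuous_fst)
      have h1 : ∀ᶠ q : Simplex (T.dim τ.cell) × Unit in
          𝓝[{q | S.IsCentral i ρ φ (τ.map q.1)}] (z, u),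
            S.canonF i ρ (τ.map q.1) ∈ Ioo a b :=
        (hc.tendsto (z, u)).eventually (Ioo_mem_nhds ht.1 ht.2) |>.filter_mono nhdsWithin_le_nhds
      filter_upwards [h1, self_mem_nhdsWithin] with q hq hqc
      have hqc : S.IsCentral i ρ φ (τ.map q.1) := hqc
      have hh : ∀ x, S.IsCentral i ρ φ x → S.canonF i ρ x ∈ Ioo a b →
          S.canonF i ρ x = a + 1 / 2 * (b - a) := by
        intro x hx hxab
        rw [← hab.point_eq D.mono hxab, ← S.canonF_push D hx.1 hmid, hx.2]
      -- Central points in the same gap all have the height of its midpoint, so within a simplex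
      -- they share a connected level, hence a leaf.
      have he : S.canonF i ρ (τ.map q.1) = S.canonF i ρ (τ.map z) :=
        (hh _ hqc hq).trans (hh _ hz' ht).symm
      have := S.mem_leaf_iff D hl (S.mem_component_of_height_eq D.orbI τ he)
      simp only [χ, decide_eq_decide]
      exact this.symm
    exact (tendsto_const_nhds.congr' (hev.mono fun q hq => hq.symm))
  have hopen : IsOpen ({x | InGap i φ (S.canonF i ρ x)} ∩
      (fun x => χ (S.push i ρ φ (1 / 2) x, ())) ⁻¹' {true}) := by
    refine ContinuousOn.isOpen_inter_preimage ?_ (S.isOpen_gapRegion D) (isOpen_discrete _)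
    refine hχ.comp (f := fun x : X => (S.push i ρ φ (1 / 2) x, ())) ?_
      fun x hx => S.isCentral_push D hx
    refine ContinuousOn.prodMk ?_ continuousOn_const
    exact (S.continuousOn_push D).comp (f := fun z : X => (z, (1 / 2 : ℝ)))
      (Continuous.prodMk_left _).continuousOn fun z hz => ⟨hz, hmid⟩
  rw [← S.isOpenQuotientMap.isQuotientMap.isOpen_preimage]
  convert hopen using 1
  ext x
  simp only [mem_preimage, mem_ofPred, mem_inter_iff, S.mem_strips D, mem_singleton_iff, χ,
    decide_eq_true_eq]
  refine and_congr_right fun hx => ?_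
  rw [S.stripPush_apply D hx hmid]

end IsTriangulatedCover

end Strips

/-! ### The family of strips, one for each central leaf -/

section StripFamilies

open Filter Topology OneVertexTriangulation

/-- Here `P s` pushes a point to the transverse coordinate `s` and `κ` reads this coordinate. The
inverse of the chart is then m ↦ (P (1/2) m, κ m), which is continuous on the open set `V`. -/
lemma isOpenEmbedding_of_transverse {M : Type u} [TopologicalSpace M] (P : ℝ → M → M) (κ : M → ℝ)
    {l V : Set M} (hVo : IsOpen V)
    (hP : ∀ q ∈ l, ∀ s ∈ Ioo (0 : ℝ) 1, ContinuousAt (fun q : M × ℝ => P q.2 q.1) (q, s))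
    (hP' : ∀ m ∈ V, ContinuousAt (fun q : M × ℝ => P q.2 q.1) (m, 1 / 2))
    (hκ : ∀ m ∈ V, ContinuousAt κ m)
    (hl : ∀ q ∈ l, ∀ s ∈ Ioo (0 : ℝ) 1, P (1 / 2) (P s q) = q ∧ κ (P s q) = s ∧ P s q ∈ V)
    (hV : ∀ m ∈ V, P (1 / 2) m ∈ l ∧ κ m ∈ Ioo (0 : ℝ) 1 ∧ P (κ m) (P (1 / 2) m) = m) :
    IsOpenEmbedding fun q : l × Ioo (0 : ℝ) 1 => P q.2 q.1 := by
  refine IsOpenEmbedding.of_continuous_injective_isOpenMap ?_ ?_ ?_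
  · rw [continuous_iff_continuousAt]
    rintro ⟨q, s⟩
    exact ContinuousAt.comp (f := fun q : l × Ioo (0 : ℝ) 1 => ((q.1 : M), (q.2 : ℝ)))
      (x := (q, s)) (hP q q.2 s s.2) (by fun_prop)
  · intro q q' h
    have h : P q.2 q.1 = P q'.2 q'.1 := h
    obtain ⟨h1, h2, -⟩ := hl q.1 q.1.2 q.2 q.2.2
    obtain ⟨h1', h2', -⟩ := hl q'.1 q'.1.2 q'.2 q'.2.2
    exact Prod.ext (Subtype.ext (by rw [← h1, ← h1', h])) (Subtype.ext (by rw [← h2, ← h2', h]))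
  · intro U hU
    let inv : V → l × Ioo (0 : ℝ) 1 := fun m =>
      (⟨P (1 / 2) m, (hV m m.2).1⟩, ⟨κ m, (hV m m.2).2.1⟩)
    have hinv : Continuous inv := by
      refine Continuous.prodMk (Continuous.subtype_mk ?_ _) (Continuous.subtype_mk ?_ _)
      · rw [continuous_iff_continuousAt]
        intro m
        exact ContinuousAt.comp (f := fun m : V => ((m : M), (1 / 2 : ℝ)))
          (x := m) (hP' m m.2) (by fun_prop)
      · rw [continuous_iff_continuousAt]
        exact fun m => (hκ m m.2).comp continuous_subtype_val.continuousAt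
    have himg : (fun q : l × Ioo (0 : ℝ) 1 => P q.2 q.1) '' U = Subtype.val '' (inv ⁻¹' U) := by
      ext m
      constructor
      · rintro ⟨q, hq, rfl⟩
        obtain ⟨h1, h2, h3⟩ := hl q.1 q.1.2 q.2 q.2.2
        refine ⟨⟨_, h3⟩, ?_, rfl⟩
        have : inv ⟨_, h3⟩ = q := Prod.ext (Subtype.ext h1) (Subtype.ext h2)
        rw [mem_preimage, this]
        exact hq
      · rintro ⟨⟨m, hm⟩, hmU, rfl⟩
        exact ⟨_, hmU, (hV m hm).2.2⟩
    rw [himg]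
    exact hVo.isOpenMap_subtype_val _ (hU.preimage hinv)

variable {M : Type u} [TopologicalSpace M] {X : Type w} [TopologicalSpace X]
  {T : OneVertexTriangulation M} {p : X → M} {v₀ : X} (S : IsTriangulatedCover T p v₀)
  [LinearOrder (Deck p)] {i j : Deck p → ℝ} {ρ ρ' : Deck p →* (ℝ ≃o ℝ)} {φ : ℝ → ℝ}

namespace IsTriangulatedCover

/-- The leaves on the central levels of the gaps. -/
def CentralLeaf (i : Deck p → ℝ) (ρ : Deck p →* (ℝ ≃o ℝ)) (φ : ℝ → ℝ) : Type u :=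
  {l : Set M // ∃ x, S.IsCentral i ρ φ x ∧
    l = p '' connectedComponentIn (S.canonF i ρ ⁻¹' {S.canonF i ρ x}) x}

variable {S}

lemma CentralLeaf.mem_leaves (l : S.CentralLeaf i ρ φ) : l.1 ∈ leaves p (S.canonF i ρ) := by
  obtain ⟨x, -, hl⟩ := l.2
  exact ⟨x, hl.symm⟩

variable (D : IsCollapse i j ρ ρ' φ)
include D

lemma CentralLeaf.exists_central (l : S.CentralLeaf i ρ φ) {q : M} (hq : q ∈ l.1) :
    ∃ x, S.IsCentral i ρ φ x ∧ p x = q ∧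
      l.1 = p '' connectedComponentIn (S.canonF i ρ ⁻¹' {S.canonF i ρ x}) x := by
  obtain ⟨x, hx, hl⟩ := l.2
  rw [hl] at hq ⊢
  obtain ⟨y, hy, rfl⟩ := hq
  exact ⟨y, S.isCentral_of_height_eq D hx (height_of_mem_component hy), rfl, by rw [component_eq hy]⟩

variable (S)

lemma stripPush_stripPush {x : X} (hx : InGap i φ (S.canonF i ρ x)) {s s' : ℝ}
    (hs : s ∈ Ioo (0 : ℝ) 1) (hs' : s' ∈ Icc (0 : ℝ) 1) :
    S.stripPush i ρ φ s' (S.stripPush i ρ φ s (p x)) = S.stripPush i ρ φ s' (p x) := by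
  rw [S.stripPush_apply D hx (Ioo_subset_Icc_self hs), S.stripPush_apply D hx hs',
    S.stripPush_apply D (S.inGap_push D hx hs) hs', S.push_push D hx hs hs']

lemma stripCoord_stripPush {x : X} (hx : InGap i φ (S.canonF i ρ x)) {s : ℝ}
    (hs : s ∈ Ioo (0 : ℝ) 1) : S.stripCoord i ρ φ (S.stripPush i ρ φ s (p x)) = s := by
  rw [S.stripPush_apply D hx (Ioo_subset_Icc_self hs),
    S.stripCoord_apply D (S.inGap_push D hx hs), S.canonF_push D hx (Ioo_subset_Icc_self hs)]
  obtain ⟨a, b, h, hab⟩ := hx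
  exact h.coord_point D.mono hab hs

lemma stripPush_stripCoord {x : X} (hx : InGap i φ (S.canonF i ρ x)) :
    S.stripPush i ρ φ (S.stripCoord i ρ φ (p x)) (p x) = p x := by
  obtain ⟨a, b, h, hab⟩ := id hx
  rw [S.stripCoord_apply D hx, S.stripPush_apply D hx (Ioo_subset_Icc_self (h.coord_mem D.mono hab)),
    S.push_coord D hx]

lemma stripCoord_mem {x : X} (hx : InGap i φ (S.canonF i ρ x)) :
    S.stripCoord i ρ φ (p x) ∈ Ioo (0 : ℝ) 1 := by
  obtain ⟨a, b, h, hab⟩ := id hx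
  rw [S.stripCoord_apply D hx]
  exact h.coord_mem D.mono hab

lemma stripPush_half {x : X} (hx : S.IsCentral i ρ φ x) :
    S.stripPush i ρ φ (1 / 2) (p x) = p x := by
  rw [S.stripPush_apply D hx.1 (Ioo_subset_Icc_self half_mem), hx.2]

lemma mem_strips_stripPush {x : X} (hx : InGap i φ (S.canonF i ρ x)) {s : ℝ}
    (hs : s ∈ Ioo (0 : ℝ) 1) : S.stripPush i ρ φ s (p x) ∈ S.strips i ρ φ := by
  rw [S.stripPush_apply D hx (Ioo_subset_Icc_self hs), S.mem_strips D]
  exact S.inGap_push D hx hs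

lemma isOpenEmbedding_stripPush (l : S.CentralLeaf i ρ φ) :
    IsOpenEmbedding fun q : l.1 × Ioo (0 : ℝ) 1 => S.stripPush i ρ φ q.2 q.1 := by
  refine isOpenEmbedding_of_transverse (S.stripPush i ρ φ) (S.stripCoord i ρ φ)
    (S.isOpen_strip D l.mem_leaves) ?_ ?_ ?_ ?_ ?_
  · intro q hq s hs
    obtain ⟨x, hx, rfl, -⟩ := CentralLeaf.exists_central D l hq
    exact S.continuousAt_stripPush D hx.1 hs
  · intro m hm
    obtain ⟨x, rfl⟩ := S.surj m
    exact S.continuousAt_stripPush D ((S.mem_strips D).1 hm.1) half_mem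
  · intro m hm
    obtain ⟨x, rfl⟩ := S.surj m
    exact S.continuousAt_stripCoord D ((S.mem_strips D).1 hm.1)
  · intro q hq s hs
    obtain ⟨x, hx, rfl, -⟩ := CentralLeaf.exists_central D l hq
    have h1 := S.stripPush_stripPush D hx.1 hs (Ioo_subset_Icc_self half_mem)
    rw [S.stripPush_half D hx] at h1
    exact ⟨h1, S.stripCoord_stripPush D hx.1 hs, S.mem_strips_stripPush D hx.1 hs,
      by rw [h1]; exact hq⟩
  · intro m hm
    obtain ⟨x, rfl⟩ := S.surj m
    have hx := (S.mem_strips D).1 hm.1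
    refine ⟨hm.2, S.stripCoord_mem D hx, ?_⟩
    rw [S.stripPush_stripPush D hx half_mem (Ioo_subset_Icc_self (S.stripCoord_mem D hx)),
      S.stripPush_stripCoord D hx]

/-- The strips of a canonical function over the intervals on which `φ` is constant. -/
noncomputable def stripFamily : StripFamily (p v₀) (leaves p (S.canonF i ρ)) where
  ι := S.CentralLeaf i ρ φ
  L := fun l => l.1
  top := fun l => inferInstance
  chart := fun l q => S.stripPush i ρ φ q.2 q.1
  isOpenEmbedding := fun l => S.isOpenEmbedding_stripPush D l
  disjoint := fun l l' hne => by
    rw [disjoint_left]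
    rintro _ ⟨⟨q, s⟩, rfl⟩ ⟨⟨q', s'⟩, hq⟩
    have hq : S.stripPush i ρ φ s' q' = S.stripPush i ρ φ s q := hq
    obtain ⟨x, hx, hxq, hl⟩ := CentralLeaf.exists_central D l q.2
    obtain ⟨x', hx', hxq', hl'⟩ := CentralLeaf.exists_central D l' q'.2
    rw [← hxq, ← hxq'] at hq
    have h1 := congrArg (S.stripPush i ρ φ (1 / 2)) hq
    rw [S.stripPush_stripPush D hx.1 s.2 (Ioo_subset_Icc_self half_mem),
      S.stripPush_stripPush D hx'.1 s'.2 (Ioo_subset_Icc_self half_mem), S.stripPush_half D hx,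
      S.stripPush_half D hx'] at h1
    apply hne
    apply Subtype.ext
    have := S.simplyConnected
    have := S.locPath
    have hmem : p x' ∈ l.1 := by
      rw [h1, hl]
      exact ⟨x, mem_component_self x, rfl⟩
    rw [hl', leaf_eq S.cov (S.canonF_apply_deck D.orbI) l.mem_leaves hmem]
  leaf_mem := fun l s => by
    obtain ⟨x, hx, hl⟩ := l.2
    refine ⟨S.push i ρ φ s x, ?_⟩
    dsimp only
    rw [← S.push_image_component D hx.1 s.2]
    ext m
    constructor
    · rintro ⟨_, ⟨y, hy, rfl⟩, rfl⟩
      have hy' := S.isCentral_of_height_eq D hx (height_of_mem_component hy)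
      exact ⟨⟨p y, by rw [hl]; exact ⟨y, hy, rfl⟩⟩,
        S.stripPush_apply D hy'.1 (Ioo_subset_Icc_self s.2)⟩
    · rintro ⟨⟨q, hq⟩, rfl⟩
      have hq' := hq
      rw [hl] at hq'
      obtain ⟨y, hy, rfl⟩ := hq'
      have hy' := S.isCentral_of_height_eq D hx (height_of_mem_component hy)
      exact ⟨_, ⟨y, hy, rfl⟩, (S.stripPush_apply D hy'.1 (Ioo_subset_Icc_self s.2)).symm⟩
  notMem := fun l => by
    rintro ⟨⟨q, s⟩, hq⟩
    have hq : S.stripPush i ρ φ s q = p v₀ := hq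
    obtain ⟨x, hx, hxq, -⟩ := CentralLeaf.exists_central D l q.2
    have h1 := S.mem_strips_stripPush D hx.1 s.2
    rw [hxq, hq, S.mem_strips D, S.canonF_base D.monoI.injective D.one_i D.actI.map_orbit] at h1
    obtain ⟨a, b, h, hab⟩ := h1
    exact h.disj 0 hab ⟨1, D.one_i⟩

/-- The closed transverse arcs. -/
lemma sameArc_iff {m m' : M} : (S.stripFamily D).SameArc m m' ↔
    ∃ x, S.IsCentral i ρ φ x ∧ ∃ s ∈ Icc (0 : ℝ) 1, ∃ s' ∈ Icc (0 : ℝ) 1,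
      m = p (S.push i ρ φ s x) ∧ m' = p (S.push i ρ φ s' x) := by
  have := S.t2
  -- The arc with its two ends is compact, hence closed in the Hausdorff space `M`, and the open arc
  -- is dense in it.
  have hcl : ∀ x, S.IsCentral i ρ φ x →
      closure (range fun s : Ioo (0 : ℝ) 1 => S.stripPush i ρ φ s (p x)) =
        (fun s => p (S.push i ρ φ s x)) '' Icc (0 : ℝ) 1 := by
    intro x hx
    have hc : ContinuousOn (fun s => p (S.push i ρ φ s x)) (Icc (0 : ℝ) 1) :=
      S.cov.continuous.comp_continuousOn ((S.continuousOn_push D).comp (f := fun s : ℝ => (x, s))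
        (Continuous.prodMk_right x).continuousOn fun s hs => ⟨hx.1, hs⟩)
    have hr : (range fun s : Ioo (0 : ℝ) 1 => S.stripPush i ρ φ s (p x)) =
        (fun s => p (S.push i ρ φ s x)) '' Ioo (0 : ℝ) 1 := by
      ext m
      constructor
      · rintro ⟨s, rfl⟩
        exact ⟨s, s.2, (S.stripPush_apply D hx.1 (Ioo_subset_Icc_self s.2)).symm⟩
      · rintro ⟨s, hs, rfl⟩
        exact ⟨⟨s, hs⟩, S.stripPush_apply D hx.1 (Ioo_subset_Icc_self hs)⟩
    rw [hr]
    apply Subset.antisymm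
    · exact closure_minimal (image_mono Ioo_subset_Icc_self)
        (isCompact_Icc.image_of_continuousOn hc).isClosed
    · rw [← closure_Ioo (zero_ne_one' ℝ)] at hc ⊢
      exact hc.image_closure
  constructor
  · rintro ⟨(l : S.CentralLeaf i ρ φ), (q : l.1), h, h'⟩
    obtain ⟨x, hx, hxq, -⟩ := CentralLeaf.exists_central D l q.2
    have h : m ∈ closure (range fun s : Ioo (0 : ℝ) 1 => S.stripPush i ρ φ s q) := h
    have h' : m' ∈ closure (range fun s : Ioo (0 : ℝ) 1 => S.stripPush i ρ φ s q) := h'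
    rw [← hxq, hcl x hx] at h h'
    obtain ⟨s, hs, rfl⟩ := h
    obtain ⟨s', hs', rfl⟩ := h'
    exact ⟨x, hx, s, hs, s', hs', rfl, rfl⟩
  · rintro ⟨x, hx, s, hs, s', hs', rfl, rfl⟩
    let l : S.CentralLeaf i ρ φ := ⟨_, x, hx, rfl⟩
    let q : l.1 := ⟨p x, x, mem_component_self x, rfl⟩
    refine ⟨l, q, ?_, ?_⟩
    · show _ ∈ closure (range fun s : Ioo (0 : ℝ) 1 => S.stripPush i ρ φ s (p x))
      rw [hcl x hx]
      exact ⟨s, hs, rfl⟩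
    · show _ ∈ closure (range fun s : Ioo (0 : ℝ) 1 => S.stripPush i ρ φ s (p x))
      rw [hcl x hx]
      exact ⟨s', hs', rfl⟩

end IsTriangulatedCover

end StripFamilies

/-! ### Fibres of the collapse, and insertion of strips -/

section StripInsertion

open Filter Topology OneVertexTriangulation Relation

variable {M : Type u} [TopologicalSpace M] {X : Type w} [TopologicalSpace X]
  {T : OneVertexTriangulation M} {p : X → M} {v₀ : X} (S : IsTriangulatedCover T p v₀)
  [LinearOrder (Deck p)] {i j : Deck p → ℝ} {ρ ρ' : Deck p →* (ℝ ≃o ℝ)} {φ : ℝ → ℝ}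

namespace IsTriangulatedCover

variable (D : IsCollapse i j ρ ρ' φ)
include D

lemma eq_of_height_mem {x y : X} {t : ℝ} (he : φ (S.canonF i ρ x) = φ (S.canonF i ρ y))
    (ht : t ∈ Icc (S.canonF i ρ x) (S.canonF i ρ y)) : φ t = φ (S.canonF i ρ x) :=
  D.mono.eq_of_mem_Icc (Icc_subset_openHull (S.canonF_mem_hull D x) (S.canonF_mem_hull D y)) he
    ht

/-- The interval between the two heights lies in a single gap. The point of the path at the mean
height is interior to this gap, and pushing it to the centre yields the arc that contains both
points. -/
lemma sameArc_of_onPath {z u v : X} (hu : S.OnPath z u) (hv : S.OnPath z v)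
    (hlt : S.canonF i ρ u < S.canonF i ρ v) (he : φ (S.canonF i ρ u) = φ (S.canonF i ρ v))
    (hd : ∀ y ∈ Ioo (S.canonF i ρ u) (S.canonF i ρ v), y ∉ range i) :
    (S.stripFamily D).SameArc (p u) (p v) := by
  have := D.noMin
  have := D.noMax
  obtain ⟨a, b, h, ha, hb⟩ := exists_isGap D.monoI D.mono D.cont hlt (S.canonF_mem_hull D u)
    (S.canonF_mem_hull D v) he hd
  have hb0 := sub_pos.2 h.lt
  have hum := hu.height_mem D.orbI
  have hvm := hv.height_mem D.orbI
  obtain ⟨α, hα⟩ := exists_onPath (S := S) D.orbI (x := z)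
    (t := (S.canonF i ρ u + S.canonF i ρ v) / 2)
    ⟨by linarith [hum.1, hvm.1], by linarith [hum.2, hvm.2]⟩
  have hw : S.canonF i ρ (S.slideX α z) ∈ Ioo a b := by
    rw [hα]; constructor <;> linarith
  have hwg : InGap i φ (S.canonF i ρ (S.slideX α z)) := ⟨a, b, h, hw⟩
  set x := S.push i ρ φ (1 / 2) (S.slideX α z) with hx
  have hxc : S.IsCentral i ρ φ x := S.isCentral_push D hwg
  have hxf : S.canonF i ρ x ∈ Ioo a b := by
    rw [hx, S.canonF_push D hwg (Ioo_subset_Icc_self half_mem), h.point_eq D.mono hw]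
    exact h.mem_Ioo half_mem
  have hzx : S.OnPath z x := OnPath.trans ⟨α, rfl⟩ (S.onPath_push _ _)
  -- The arc is described from its central point `x`, so the path of `x` has to lead back to `z`. It
  -- does, because `x` has a height inside a gap and so is not a vertex.
  have hxz : S.OnPath x z := by
    rcases hzx.symm_or with h' | ⟨k, hk⟩
    · exact h'
    · rw [hk, S.canonF_orbit D.orbI] at hxf
      exact absurd ⟨k, rfl⟩ (h.disj _ hxf)
  have key : ∀ y, S.OnPath z y → S.canonF i ρ y ∈ Icc a b →
      ∃ s ∈ Icc (0 : ℝ) 1, p y = p (S.push i ρ φ s x) := by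
    intro y hy hyab
    have hs : (S.canonF i ρ y - a) / (b - a) ∈ Icc (0 : ℝ) 1 :=
      ⟨div_nonneg (by linarith [hyab.1]) hb0.le, (div_le_one hb0).2 (by linarith [hyab.2])⟩
    refine ⟨_, hs, congrArg p (S.eq_push D hxc.1 hs (hxz.trans hy) ?_)⟩
    rw [h.point_eq D.mono hxf, div_mul_cancel₀ _ hb0.ne']
    ring
  obtain ⟨s, hs, hsu⟩ := key u hu ⟨ha, hlt.le.trans hb⟩
  obtain ⟨s', hs', hsv⟩ := key v hv ⟨ha.trans hlt.le, hb⟩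
  exact (S.sameArc_iff D).2 ⟨x, hxc, s, hs, s', hs', hsu, hsv⟩

/-- Points of a slide path with the same collapsed height are joined by arcs of strips. -/
lemma eqvGen_of_onPath {z u v : X} (hu : S.OnPath z u) (hv : S.OnPath z v)
    (he : φ (S.canonF i ρ u) = φ (S.canonF i ρ v)) :
    EqvGen (S.stripFamily D).SameArc (p u) (p v) := by
  wlog hle : S.canonF i ρ u ≤ S.canonF i ρ v generalizing u v
  · exact (this hv hu he.symm (not_le.1 hle).le).symm
  rcases hle.eq_or_lt with heq | hlt
  · rw [hu.eq_of_height D.orbI hv heq]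
    exact EqvGen.refl _
  by_cases hd : ∀ y ∈ Ioo (S.canonF i ρ u) (S.canonF i ρ v), y ∉ range i
  · exact EqvGen.rel _ _ (S.sameArc_of_onPath D hu hv hlt he hd)
  push Not at hd
  obtain ⟨_, hg, g, rfl⟩ := hd
  obtain ⟨α, hα⟩ := exists_onPath (S := S) D.orbI (x := z) (t := i g)
    ⟨(hu.height_mem D.orbI).1.trans hg.1.le, hg.2.le.trans (hv.height_mem D.orbI).2⟩
  have hφ := fun t ht => S.eq_of_height_mem D (t := t) he ht
  -- φ is injective on the orbit, so between the two heights there is only one orbit height. At that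
  -- height the arcs on either side are joined, which is why an equivalence has to be generated.
  have hone : ∀ k, i k ∈ Icc (S.canonF i ρ u) (S.canonF i ρ v) → k = g := by
    intro k hk
    have h1 := (hφ _ hk).trans (hφ _ (Ioo_subset_Icc_self hg)).symm
    rw [D.orbit, D.orbit] at h1
    exact D.monoJ.injective h1
  refine (EqvGen.rel _ (p (S.slideX α z)) ?_).trans _ _ _ (EqvGen.rel _ _ ?_)
  · refine S.sameArc_of_onPath D hu ⟨α, rfl⟩ (by rw [hα]; exact hg.1)
      (by rw [hα, hφ _ (Ioo_subset_Icc_self hg)]) ?_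
    rintro _ hy ⟨k, rfl⟩
    rw [hα] at hy
    have := hone k ⟨hy.1.le, hy.2.le.trans hg.2.le⟩
    rw [this] at hy
    exact lt_irrefl _ hy.2
  · refine S.sameArc_of_onPath D ⟨α, rfl⟩ hv (by rw [hα]; exact hg.2)
      (by rw [hα, hφ _ (Ioo_subset_Icc_self hg), he]) ?_
    rintro _ hy ⟨k, rfl⟩
    rw [hα] at hy
    have := hone k ⟨hg.1.le.trans hy.1.le, hy.2.le⟩
    rw [this] at hy
    exact lt_irrefl _ hy.1

/-- If the common image is not a vertex, both points lie on its slide path. If it is a vertex, each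
point is joined to it by arcs along its own path, since at a vertex φ relates the heights for the
two functions. -/
lemma eqvGen_of_collapse_eq {x y : X}
    (h : S.collapse i j ρ ρ' φ x = S.collapse i j ρ ρ' φ y) :
    EqvGen (S.stripFamily D).SameArc (p x) (p y) := by
  have hvert : ∀ x, (∃ g : Deck p, S.collapse i j ρ ρ' φ x = (g : X ≃ₜ X) v₀) →
      EqvGen (S.stripFamily D).SameArc (p x) (p (S.collapse i j ρ ρ' φ x)) := by
    rintro x ⟨g, hg⟩
    refine S.eqvGen_of_onPath D (OnPath.refl x) (S.onPath_collapse x) ?_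
    rw [← S.canonF_collapse D, hg, S.canonF_orbit D.orbI, S.canonF_orbit D.orbJ, D.orbit]
  rcases (S.onPath_collapse (i := i) (j := j) (ρ := ρ) (ρ' := ρ') (φ := φ) x).symm_or with hx | hx
  · rcases (S.onPath_collapse (i := i) (j := j) (ρ := ρ) (ρ' := ρ') (φ := φ) y).symm_or with hy | hy
    · rw [← h] at hy
      refine S.eqvGen_of_onPath D hx hy ?_
      rw [← S.canonF_collapse D, h, S.canonF_collapse D]
    · have h1 := hvert x (by rw [h]; exact hy)
      rw [h] at h1
      exact h1.trans _ _ _ (hvert y hy).symm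
  · have h1 := hvert y (by rw [← h]; exact hx)
    rw [← h] at h1
    exact (hvert x hx).trans _ _ _ h1.symm

lemma collapse_push {x : X} (hx : InGap i φ (S.canonF i ρ x)) {s : ℝ} (hs : s ∈ Icc (0 : ℝ) 1) :
    S.collapse i j ρ ρ' φ (S.push i ρ φ s x) = S.collapse i j ρ ρ' φ x := by
  refine S.collapse_eq_of_onPath D (S.onPath_push s x) ?_
  rw [S.canonF_push D hx hs]
  obtain ⟨a, b, h, hab⟩ := hx
  rw [h.point_eq D.mono hab, h.eq_of_mem D.mono (Ioo_subset_Icc_self hab),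
    h.eq_of_mem D.mono (h.mem_Icc hs)]

/-- Points on the same leaf, or on the same arc of a strip. -/
def LeafOrArc (a b : M) : Prop :=
  SameLeaf (leaves p (S.canonF i ρ)) a b ∨ (S.stripFamily D).SameArc a b

lemma eqvGen_leafOrArc {a b : M} (h : EqvGen (S.stripFamily D).SameArc a b) :
    EqvGen (S.LeafOrArc D) a b := h.mono fun _ _ h => Or.inr h

/-- Preimages of the two points are moved along arcs to a common height for `i`, where the level in
the simplex is connected and hence lies in one leaf. If no height were common to the two slide
paths, the top of one and the bottom of the other would be distinct orbit heights with the same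
image under φ. -/
lemma eqvGen_of_cell (τ : LiftedCell T p) {z z' : Simplex (T.dim τ.cell)}
    (h : S.canonF j ρ' (τ.map z) = S.canonF j ρ' (τ.map z')) {x x' : X}
    (hx : S.collapse i j ρ ρ' φ x = τ.map z) (hx' : S.collapse i j ρ ρ' φ x' = τ.map z') :
    EqvGen (S.LeafOrArc D) (p x) (p x') := by
  obtain ⟨y, hy, hyt, hyc⟩ := S.exists_onPath_collapse D h
  obtain ⟨y', hy', hyt', hyc'⟩ := S.exists_onPath_collapse D (y := τ.map z') rfl
  refine ((S.eqvGen_leafOrArc D (S.eqvGen_of_collapse_eq D (hx.trans hyc.symm))).trans _ (p y) _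
    (EqvGen.trans _ (p y') _ ?_
      (S.eqvGen_leafOrArc D (S.eqvGen_of_collapse_eq D (hyc'.trans hx'.symm)))))
  clear hx hx' hyc hyc'
  have he := hyt.trans hyt'.symm
  clear hyt hyt' h
  wlog hle : S.canonF i ρ y ≤ S.canonF i ρ y' generalizing y y' z z'
  · exact (this y' hy' y hy he.symm (not_le.1 hle).le).symm
  have hφ := fun t ht => S.eq_of_height_mem D (t := t) he ht
  have hm := hy.height_mem D.orbI
  have hm' := hy'.height_mem D.orbI
  obtain ⟨l, hl⟩ := bottom_orbit (S := S) D.orbI (τ.map z')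
  obtain ⟨m, hmt⟩ := top_orbit (S := S) D.orbI (τ.map z)
  have hlm : S.canonF i ρ (S.slideX 0 (τ.map z')) ≤ S.canonF i ρ (S.slideX 1 (τ.map z)) := by
    by_contra hlt
    have hlt := not_le.1 hlt
    have h1 := (hφ _ ⟨hm.2, hlt.le.trans hm'.1⟩).trans (hφ _ ⟨hm.2.trans hlt.le, hm'.1⟩).symm
    rw [hl, hmt, D.orbit, D.orbit] at h1
    rw [hl, hmt, D.monoJ.injective h1] at hlt
    exact lt_irrefl _ hlt
  -- The lowest height, starting from that of `y`, that both slide paths reach.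
  set t := max (S.canonF i ρ y) (S.canonF i ρ (S.slideX 0 (τ.map z'))) with ht
  have ht1 : t ∈ Icc (S.canonF i ρ y) (S.canonF i ρ y') := ⟨le_max_left _ _, max_le hle hm'.1⟩
  obtain ⟨α, hα⟩ := exists_onPath (S := S) D.orbI (x := τ.map z) (t := t)
    ⟨hm.1.trans ht1.1, max_le hm.2 hlm⟩
  obtain ⟨β, hβ⟩ := exists_onPath (S := S) D.orbI (x := τ.map z') (t := t)
    ⟨le_max_right _ _, ht1.2.trans hm'.2⟩
  have e1 := S.eqvGen_leafOrArc D (S.eqvGen_of_onPath D hy ⟨α, rfl⟩ (by rw [hα, hφ t ht1]))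
  have e2 := S.eqvGen_leafOrArc D (S.eqvGen_of_onPath D ⟨β, rfl⟩ hy' (by rw [hβ, hφ t ht1, he]))
  refine e1.trans _ _ _ (EqvGen.trans _ _ _ (EqvGen.rel _ _ (Or.inl ?_)) e2)
  refine ⟨_, ⟨S.slideX α (τ.map z), rfl⟩, ⟨_, mem_component_self _, rfl⟩, ⟨_, ?_, rfl⟩⟩
  have h0 := hβ.trans hα.symm
  rw [S.slideX_map, S.slideX_map] at h0 ⊢
  exact S.mem_component_of_height_eq D.orbI τ h0

/-- Choosing a preimage under the collapse and taking the class of its projection is independent of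
the choice. On a level for `j` the resulting map to the discrete quotient is constant in each
simplex, hence continuous, hence constant on connected components. -/
lemma eqvGen_of_mem_component {x y : X} (h : S.collapse i j ρ ρ' φ y ∈ connectedComponentIn
    (S.canonF j ρ' ⁻¹' {S.canonF j ρ' (S.collapse i j ρ ρ' φ x)}) (S.collapse i j ρ ρ' φ x)) :
    EqvGen (S.LeafOrArc D) (p x) (p y) := by
  have := S.t2
  let _ : TopologicalSpace (Quot (S.LeafOrArc D)) := ⊥
  have : DiscreteTopology (Quot (S.LeafOrArc D)) := ⟨rfl⟩
  have hsurj : ∀ w : X, ∃ x, S.collapse i j ρ ρ' φ x = w := fun w => by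
    obtain ⟨x, -, -, hx⟩ := S.exists_onPath_collapse D (y := w) rfl
    exact ⟨x, hx⟩
  choose q hq using hsurj
  let Ψ : X × Unit → Quot (S.LeafOrArc D) := fun w => Quot.mk _ (p (q w.1))
  have hΨ : ∀ x, Ψ (S.collapse i j ρ ρ' φ x, ()) = Quot.mk _ (p x) := fun x =>
    Quot.eqvGen_sound (S.eqvGen_leafOrArc D (S.eqvGen_of_collapse_eq D (hq _)))
  set t := S.canonF j ρ' (S.collapse i j ρ ρ' φ x) with ht
  have hc : ContinuousOn Ψ {w | S.canonF j ρ' w.1 = t} := by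
    refine continuousOn_of_cells (T := T) S.cov fun τ => ?_
    rintro ⟨z, u⟩ hz
    refine tendsto_const_nhds.congr' ?_
    filter_upwards [self_mem_nhdsWithin] with w hw
    have hz : S.canonF j ρ' (τ.map z) = t := hz
    have hw : S.canonF j ρ' (τ.map w.1) = t := hw
    exact Quot.eqvGen_sound (S.eqvGen_of_cell D τ (hz.trans hw.symm) (hq _) (hq _))
  have hc' : ContinuousOn (fun w => Ψ (w, ())) (S.canonF j ρ' ⁻¹' {t}) :=
    hc.comp (Continuous.prodMk_left ()).continuousOn fun w hw => hw
  have h1 := isPreconnected_connectedComponentIn.constant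
    (hc'.mono (connectedComponentIn_subset _ _)) h (mem_component_self (F := S.canonF j ρ') _)
  rw [hΨ, hΨ] at h1
  exact (Quot.eqvGen_exact h1).symm

lemma collapse_mem_component {x y : X}
    (h : y ∈ connectedComponentIn (S.canonF i ρ ⁻¹' {S.canonF i ρ x}) x) :
    S.collapse i j ρ ρ' φ y ∈ connectedComponentIn
      (S.canonF j ρ' ⁻¹' {S.canonF j ρ' (S.collapse i j ρ ρ' φ x)}) (S.collapse i j ρ ρ' φ x) := by
  have h1 := (isPreconnected_connectedComponentIn (F := S.canonF i ρ ⁻¹' {S.canonF i ρ x})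
    (x := x)).image _ (S.continuous_collapse D).continuousOn
  refine h1.subset_connectedComponentIn ⟨x, mem_component_self x, rfl⟩ ?_ ⟨y, h, rfl⟩
  rintro _ ⟨z, hz, rfl⟩
  rw [mem_preimage, mem_singleton_iff, S.canonF_collapse D, S.canonF_collapse D,
    height_of_mem_component hz]

/-- Collapsing the gaps of an orbit map removes strips from the foliation. -/
theorem isStripInsertion_canonF :
    IsStripInsertion (p v₀) (leaves p (S.canonF j ρ')) (leaves p (S.canonF i ρ)) := by
  have := S.simplyConnected
  have := S.locPath
  obtain ⟨c, hc, hhom⟩ := S.exists_cellMap_descent (S.isCellMap_collapseCell D)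
  simp only [S.cellMap_collapseCell D] at hc
  have harc : ∀ a b, (S.stripFamily D).SameArc a b → c a = c b := by
    intro a b h
    obtain ⟨x, hx, s, hs, s', hs', rfl, rfl⟩ := (S.sameArc_iff D).1 h
    rw [hc, hc, S.collapse_push D hx.1 hs, S.collapse_push D hx.1 hs']
  have hJ := S.canonF_apply_deck D.orbJ
  refine ⟨S.stripFamily D, c, fun m => ?_, hhom, fun m m' => ⟨fun h => ?_, fun h => ?_⟩,
    fun m m' => ⟨fun h => ?_, fun h => ?_⟩⟩
  · obtain ⟨w, rfl⟩ := S.surj m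
    obtain ⟨x, -, -, rfl⟩ := S.exists_onPath_collapse D (y := w) rfl
    exact ⟨p x, hc x⟩
  · obtain ⟨x, rfl⟩ := S.surj m
    obtain ⟨y, rfl⟩ := S.surj m'
    rw [hc, hc] at h
    obtain ⟨g, hg⟩ := Deck.exists_apply_eq S.cov h
    rw [← S.collapse_deck D] at hg
    have h1 := S.eqvGen_of_collapse_eq D hg
    have h2 : p ((g : X ≃ₜ X) x) = p x := Deck.proj g _
    rwa [h2] at h1
  · induction h with
    | rel a b h => exact harc a b h
    | refl a => rfl
    | symm a b _ h => exact h.symm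
    | trans a b d _ _ h h' => exact h.trans h'
  · obtain ⟨x, rfl⟩ := S.surj m
    obtain ⟨y, rfl⟩ := S.surj m'
    rw [hc, hc, sameLeaf_iff S.cov hJ] at h
    obtain ⟨g, hg⟩ := h
    rw [← S.collapse_deck D] at hg
    have h1 := S.eqvGen_of_mem_component D hg
    have h2 : p ((g : X ≃ₜ X) y) = p y := Deck.proj g _
    rwa [h2] at h1
  · induction h with
    | rel a b h =>
      rcases h with h | h
      · obtain ⟨x, rfl⟩ := S.surj a
        obtain ⟨y, rfl⟩ := S.surj b
        rw [sameLeaf_iff S.cov (S.canonF_apply_deck D.orbI)] at h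
        obtain ⟨g, hg⟩ := h
        rw [hc, hc, sameLeaf_iff S.cov hJ]
        exact ⟨g, by rw [← S.collapse_deck D]; exact S.collapse_mem_component D hg⟩
      · rw [harc a b h]
        exact SameLeaf.refl_leaves S.surj _
    | refl a => exact SameLeaf.refl_leaves S.surj _
    | symm a b _ h => exact h.symm
    | trans a b d _ _ h h' => exact h.trans_leaves S.cov S.surj hJ h'

end IsTriangulatedCover

end StripInsertion

/-! ### Normalizing the tight realization at the identity -/

section Realization

open Topology OneVertexTriangulation

lemma IsTightRealization.sub_const {A : Type*} [LinearOrder A] {j : A → ℝ}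
    (hj : IsTightRealization j) (r : ℝ) : IsTightRealization fun g => j g - r := by
  refine ⟨fun a b h => sub_lt_sub_right (hj.strictMono h) r, fun s t hst => ?_, ?_⟩
  · rcases hj.tight (s + r) (t + r) (by linarith) with ⟨g, h1, h2⟩ | ⟨g, h, hgh, h1, h2⟩
    · exact Or.inl ⟨g, by linarith, by linarith⟩
    · exact Or.inr ⟨g, h, hgh, by linarith, by linarith⟩
  · refine eq_univ_of_forall fun t => ?_
    have ht : t + r ∈ openHull j := by rw [hj.hull]; trivial
    obtain ⟨g, h, h1, h2⟩ := ht
    exact ⟨g, h, by linarith, by linarith⟩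

lemma isCollapse_extend {G : Type*} [Group G] [LinearOrder G] [NoMinOrder G] [NoMaxOrder G] {i j : G → ℝ}
    {ρ : G →* (ℝ ≃o ℝ)} (hO : ∀ g a b : G, a < b → g * a < g * b) (hi : StrictMono i)
    (hi1 : i 1 = 0) (hρ : IsInducedAction i ρ) (hj : IsTightRealization j) (hj1 : j 1 = 0) :
    IsCollapse i j ρ (tightAction hO hj) (extend i j) := by
  have hE := isExtension_extend hi hj.strictMono
  exact ⟨hO, inferInstance, inferInstance, hi, hj.strictMono, hi1, hj1, hρ,
    (isInducedAction_tightAction hO hj).map_orbit, hE.mono,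
    fun t ht => (hE.continuousAt hi hj.strictMono hj.tight ht).continuousWithinAt, hE.orbit,
    fun g t ht => extend_equivariant hρ hi hO hj g ht⟩

end Realization

/-! ### Arbitrary defining functions, and the trivial group -/

section DefiningFunctions

open OneVertexTriangulation

variable {M : Type u} [TopologicalSpace M] {X : Type w} [TopologicalSpace X]
  {T : OneVertexTriangulation M} {p : X → M} {v₀ : X} (S : IsTriangulatedCover T p v₀)
include S

namespace IsTriangulatedCover

/-- The vertices of a lifted simplex have distinct labels. With only one label available, every
lifted simplex is a single point, namely the base vertex. -/
lemma subsingleton_of_subsingleton_deck [Subsingleton (Deck p)] : Subsingleton X := by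
  refine subsingleton_of_forall_eq v₀ fun x => ?_
  obtain ⟨⟨τ, z⟩, -, rfl⟩ := S.exists_carrier x
  have h1 : Subsingleton (Fin (T.dim τ.cell + 1)) := (S.key_injective τ).subsingleton
  have h2 : z = stdSimplex.vertex 0 := by
    ext j
    have hj : j = 0 := Subsingleton.elim _ _
    have hs : ∑ k, z k = 1 := z.2.2
    rw [Fintype.sum_subsingleton _ j] at hs
    rw [hs, hj]
    simp [stdSimplex.vertex]
  rw [h2, ← S.key_spec, Subsingleton.elim (S.key τ 0) 1]
  rfl

/-- The foliation of any defining function for `i` is obtained by inserting strips. -/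
theorem isStripInsertion_of_isCollapse [LinearOrder (Deck p)] {i j : Deck p → ℝ}
    {ρ ρ' : Deck p →* (ℝ ≃o ℝ)} {φ : ℝ → ℝ} (D : IsCollapse i j ρ ρ' φ) {F : X → ℝ}
    (hF : IsDefiningFunction T p v₀ ρ F) :
    IsStripInsertion (p v₀) (leaves p (S.canonF j ρ')) (leaves p F) := by
  obtain ⟨H, η, hH, hη, hv, hhom⟩ := S.exists_homeomorph_of_defining hF
    (S.isDefiningFunction_canonF D.monoI D.one_i D.actI.map_orbit) D.monoI.injective D.one_i
    D.actI.map_orbit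
  rw [leaves_image H η hH hη]
  exact (S.isStripInsertion_canonF D).transport η hv hhom

end IsTriangulatedCover

omit S

lemma isStripInsertion_of_subsingleton [Subsingleton M] (hps : Function.Surjective p) (v : M)
    (F F' : X → ℝ) : IsStripInsertion v (leaves p F) (leaves p F') := by
  let S : StripFamily v (leaves p F') :=
    { ι := PEmpty
      L := fun k => k.elim
      top := fun k => k.elim
      chart := fun k => k.elim
      isOpenEmbedding := fun k => k.elim
      disjoint := fun k => k.elim
      leaf_mem := fun k => k.elim
      notMem := fun k => k.elim }
  refine ⟨S, ContinuousMap.id M, Function.surjective_id, ContinuousMap.HomotopicRel.refl _,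
    fun x y => ?_, fun x y => ?_⟩
  · rw [Subsingleton.elim x y]
    exact ⟨fun _ => Relation.EqvGen.refl _, fun _ => rfl⟩
  · rw [Subsingleton.elim x y]
    exact ⟨fun _ => Relation.EqvGen.refl _, fun _ => SameLeaf.refl_leaves hps _⟩

end DefiningFunctions

theorem mainTheorem10 {d : ℕ} {M : Type u} [TopologicalSpace M] [T2Space M]
    [SecondCountableTopology M] [ChartedSpace (EuclideanSpace ℝ (Fin d)) M]
    (T : OneVertexTriangulation M) (hT : T.IsEssential)
    {X : Type w} [TopologicalSpace X] [SimplyConnectedSpace X]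
    (p : X → M) (hp : IsCoveringMap p) (hps : Function.Surjective p)
    (v₀ : X) (hv₀ : T.IsVertex (p v₀))
    [LinearOrder (Deck p)] (hO : ∀ g a b : Deck p, a < b → g * a < g * b)
    (i i' : Deck p → ℝ) (hi : StrictMono i) (hi' : StrictMono i') (hi1 : i 1 = 0) (hi1' : i' 1 = 0)
    (ρ ρ' : Deck p →* (ℝ ≃o ℝ)) (hρ : IsInducedAction i ρ) (hρ' : IsInducedAction i' ρ') :
    (∃ F : X → ℝ, IsDefiningFunction T p v₀ ρ F) ∧
    (∃ F' : X → ℝ, IsDefiningFunction T p v₀ ρ' F') ∧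
    ∀ F F' : X → ℝ, IsDefiningFunction T p v₀ ρ F → IsDefiningFunction T p v₀ ρ' F' →
      ∃ (i₀ : Deck p → ℝ) (ρ₀ : Deck p →* (ℝ ≃o ℝ)) (F₀ : X → ℝ),
        StrictMono i₀ ∧ i₀ 1 = 0 ∧ IsInducedAction i₀ ρ₀ ∧ IsDefiningFunction T p v₀ ρ₀ F₀ ∧
        IsStripInsertion (p v₀) (leaves p F₀) (leaves p F) ∧
        IsStripInsertion (p v₀) (leaves p F₀) (leaves p F') := by
  have hM : LocallyPathConnectedSpace M :=
    ChartedSpace.locallyPathConnectedSpace (EuclideanSpace ℝ (Fin d)) M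
  have S : IsTriangulatedCover T p v₀ :=
    ⟨hp, hps, hv₀, hT, inferInstance, inferInstance, hp.locallyPathConnectedSpace⟩
  refine ⟨⟨_, S.isDefiningFunction_canonF hi hi1 hρ.map_orbit⟩,
    ⟨_, S.isDefiningFunction_canonF hi' hi1' hρ'.map_orbit⟩, fun F F' hF hF' => ?_⟩
  -- A tight realization is unbounded on both sides, which excludes the trivial group; in that case
  -- `M` is a point and no strips are inserted.
  rcases subsingleton_or_nontrivial (Deck p) with hG | hG
  · have := S.subsingleton_of_subsingleton_deck
    have : Subsingleton M := hps.subsingleton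
    exact ⟨i, ρ, F, hi, hi1, hρ, hF, isStripInsertion_of_subsingleton hps _ _ _,
      isStripInsertion_of_subsingleton hps _ _ _⟩
  have := S.countable_deck
  have := noMinOrder_of_leftOrdered hO
  have := noMaxOrder_of_leftOrdered hO
  -- Only the order enters here, so the same realization serves for `i` and for `i'`.
  obtain ⟨j₀, hj₀⟩ := exists_isTightRealization (Deck p)
  have hj := hj₀.sub_const (j₀ 1)
  have hj1 := sub_self (j₀ 1)
  have hact := isInducedAction_tightAction hO hj
  exact ⟨_, tightAction hO hj, _, hj.strictMono, hj1, hact,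
    S.isDefiningFunction_canonF hj.strictMono hj1 hact.map_orbit,
    S.isStripInsertion_of_isCollapse (isCollapse_extend hO hi hi1 hρ hj hj1) hF,
    S.isStripInsertion_of_isCollapse (isCollapse_extend hO hi' hi1' hρ' hj hj1) hF'⟩
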